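/- **Theorem.** Let $p\in[1,\infty)$ be real. Let the following public parameters be functions of a security parameter $\lambda$: set sizes $m$ (sender) and $n$ (receiver), dimension $d$, integer threshold $\delta\ge 0$, coordinate universe $U=\{0,\dots,u-1\}$, bit length $\ell$ of the field $\mathbb F=\mathbb F_{2^\ell}$ (whose addition is XOR of $\ell$-bit strings), key length $\kappa$, and an integer $N\ge 1$; $m,n,d,\delta,\log u,\ell,\kappa$ are polynomially bounded in $\lambda$. Put $c_t=\lfloor N t^p\rfloor$ for $0\le t\le\delta$ (so $c_t=t^p$ if $p$ is an integer and $N=1$). Assume for every $\lambda$ that $2^\ell\ge m^2 2^\lambda$, $2^\ell\ge n^2 2^\lambda$, $2^\ell\ge m\,c_\delta 2^\lambda$ and $d\,c_\delta<2^\ell$, and that the fixed-point values $c_t$ are precise enough: for all integers $t_1,\dots,t_d\in[0,\delta]$, $\sum_k c_{t_k}\le c_\delta$ iff $\sum_k t_k^p\le\delta^p$ (automatic if $p$ is an integer and $N=1$). Let $F:\{0,1\}^\kappa\times\mathbb F\to\mathbb F$ be pseudorandom (a PRF) against non-uniform probabilistic polynomial-time (PPT) adversaries. Inputs are $Q=(q_j)_{j\in[m]}$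 of the sender $\mathcal S$ and $W=(w_i)_{i\in[n]}$ of the receiver $\mathcal R$, with points in $U^d$, each satisfying the *disjoint projection assumption*: for every element $x$ there is a dimension $k$ such that the interval $[x_k-\delta,x_k+\delta]$ is disjoint from $[y_k-\delta,y_k+\delta]$ for all other elements $y$ of the same set. The functionality $\mathcal F_{\mathsf{FPSI}}$ gives $Z=\{q_j : \exists i,\ (\sum_k|q_{j,k}-w_{i,k}|^p)^{1/p}\le\delta\}$ to $\mathcal R$ and nothing to $\mathcal S$. *Ideal functionalities.* * $\mathcal F_{\mathsf{so\text{-}OPPRF}}$: the sender inputs a list $L$ of key-value pairs, the receiver inputs queries $x_i$. A random function $F'$ with values in $\mathbb F$ is drawn such that $F'(y)=z$ for $(y,z)\in L$; the sender gets oracle access to $F'$, and the two parties get fresh random shares of $F'(x_i)$ for each $i$. * $\mathcal F_{\mathsf{si\text{-}OPRF}}$: from shares of a key $k$ and of inputs $x_i$, the receiver gets $F_k(x_i)$. * $\mathcal F_{\mathsf{B2A}}$: turns XOR shares of an $\ell$-bit number into fresh additive shares modulo $2^\ell$. * $\mathcal F_{\mathsf{Interval}}$: tells $\mathcal R$ whether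 the number in $[0,2^\ell)$ shared additively modulo $2^\ell$ is at most $c_\delta$. * $\mathcal F_{\mathsf{OT}}$: $1$-out-of-$2$ oblivious transfer. *Local mapping* of $X=(x_j)$: in each dimension $k$, process $j=1,2,\dots$ in turn: sample $r_{j,k}\leftarrow\mathbb F$, and replace $[x_{j,k}-\delta,x_{j,k}+\delta]$ and all stored intervals that meet it by their union, labelled $r_{j,k}$. Let $\mathsf{pid}_{x_j}$ be the sum over $k$ of the label of the interval containing $x_{j,k}$, and let $\mathsf{List}$ map $k\|y$ to the label of the interval of dimension $k$ containing $y$, padded with dummy items to size $|X|\,d(2\delta+1)$. *Protocol $\Pi^{L_p}_{\mathsf{FPSI}}$.* 1. $\mathcal S$ indexes its points in uniformly random order. 2. Fuzzy mapping for $L_\infty$: both parties run local mapping and sample shares of a PRF key $k^*$. By so-OPPRF ($\mathcal S$ as sender with its $\mathsf{List}$, $\mathcal R$ querying $k\|w_{i,k}$) they get shares of values whose sum over $k$ is $h_i$; by si-OPRF $\mathcal R$ gets $\mathsf{ID}_{w_i}=F_{k^*}(h_i+\mathsf{pid}_{w_i})$. Symmetrically with the roles exchanged, $\mathcal S$ gets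 $\mathsf{ID}_{q_j}$. 3. By so-OPPRF, with $\mathcal R$ as sender programming $\mathsf{ID}_{w_i}\|k\|(w_{i,k}+t)\mapsto c_{|t|}$ for $t\in[-\delta,\delta]$ and with queries $\mathsf{ID}_{q_j}\|k\|q_{j,k}$ of $\mathcal S$, they get shares of one value for each $(j,k)$. 4. B2A is applied to these shares; each party sums its arithmetic shares over $k$. 5. By the interval test $\mathcal R$ gets $b_j$, which is $1$ iff the shared sum is at most $c_\delta$. 6. By OT with messages $(\bot,q_j)$ and choice bit $b_j$, $\mathcal R$ gets $z_j$, and it outputs $\{z_j : b_j=1\}$. *Claim.* In the hybrid model with these functionalities, $\Pi^{L_p}_{\mathsf{FPSI}}$ securely computes $\mathcal F_{\mathsf{FPSI}}$ for the $L_p$ distance against static semi-honest adversaries: there are (uniform) PPT simulators $\mathsf{Sim}_{\mathcal S},\mathsf{Sim}_{\mathcal R}$, given $1^\lambda$ and the public parameters (with the table of the $c_t$), such that for all inputs $Q,W$ as above $$\{\mathsf{view}_{\mathcal S}(Q,W),\mathsf{out}(Q,W)\}\approx_c\{\mathsf{Sim}_{\mathcal S}(Q,\bot),\mathcal F_{\mathsf{FPSI}}(Q,W)\},$$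 $$\{\mathsf{view}_{\mathcal R}(Q,W),\mathsf{out}(Q,W)\}\approx_c\{\mathsf{Sim}_{\mathcal R}(W,Z),\mathcal F_{\mathsf{FPSI}}(Q,W)\}.$$ Here a view contains the party's input, its random coins, everything it receives from the functionalities, and oracle access to the functions $F'$ of the so-OPPRFs in which it is the sender (the simulator answers these queries). $\approx_c$ means that every non-uniform PPT distinguisher has advantage at most $\mu(\lambda)$ for a negligible $\mu$ that does not depend on $Q,W$. -/

import Mathlib

namespace FPSI

open Filter

/-! ### Machine model: probabilistic oracle programs with a step count -/

/-- The data handled by programs: binary trees with natural numbers at the leaves. -/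
inductive Data where
  | num (n : ℕ) : Data
  | pair (a b : Data) : Data

namespace Data

/-- Length of a datum in bits, up to a constant factor. -/
def size : Data → ℕ
  | num n => Nat.size n + 1
  | pair a b => a.size + b.size + 1

/-- First component (a number has dummy components). -/
def fst : Data → Data
  | num _ => num 0
  | pair a _ => a

/-- Second component. -/
def snd : Data → Data
  | num _ => num 0
  | pair _ b => b

/-- `1` for a pair and `0` for a number. -/
def isPair : Data → Data
  | num _ => num 0
  | pair _ _ => num 1

/-- A binary operation on natural numbers, as an operation on data. -/
def arith (op : ℕ → ℕ → ℕ) : Data → Data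
  | pair (num a) (num b) => num (op a b)
  | _ => num 0

/-- The number stored in a leaf (`0` for a pair). -/
def toNat : Data → ℕ
  | num n => n
  | pair _ _ => 0

end Data

/-- Programs. Every program maps a datum to a datum. -/
inductive Prog where
  | id : Prog
  | const (c : Data) : Prog
  | comp (f g : Prog) : Prog
  | pair (f g : Prog) : Prog
  | fst : Prog
  | snd : Prog
  | isPair : Prog
  | size : Prog
  | add : Prog
  | sub : Prog
  | mul : Prog
  | div : Prog
  | mod : Prog
  | xor : Prog
  | ite (c f g : Prog) : Prog
  | loop (f : Prog) : Prog
  | rand : Prog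
  | query : Prog

/-- A step that turns `x` into `y` costs `size x + size y + 1`. -/
def step (x y : Data) : Data × ℕ := (y, x.size + y.size + 1)

/-- Execution of a program on an input. The result is the output together with the number of
steps. `tape` is the random tape, of which the program reads a word (`rand`) by giving its address,
and `O` is the oracle, to which it submits data (`query`). `comp f g` runs `g` and then `f`;
`loop f` on input `(n, x)` applies `f` to `x` for `n` times. -/
def Prog.run (tape : ℕ → ℕ) (O : Data → Data) : Prog → Data → Data × ℕ
  | .id, x => step x x
  | .const c, x => step x c
  | .comp f g, x =>
      let y := g.run tape O x
      let z := f.run tape O y.1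
      (z.1, y.2 + z.2 + 1)
  | .pair f g, x =>
      let y := f.run tape O x
      let z := g.run tape O x
      (.pair y.1 z.1, y.2 + z.2 + 1)
  | .fst, x => step x x.fst
  | .snd, x => step x x.snd
  | .isPair, x => step x x.isPair
  | .size, x => step x (.num x.size)
  | .add, x => step x (x.arith (· + ·))
  | .sub, x => step x (x.arith (· - ·))
  | .mul, x => step x (x.arith (· * ·))
  | .div, x => step x (x.arith (· / ·))
  | .mod, x => step x (x.arith (· % ·))
  | .xor, x => step x (x.arith Nat.xor)
  | .ite c f g, x =>
      let b := c.run tape O x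
      let y := if b.1.toNat ≠ 0 then f.run tape O x else g.run tape O x
      (y.1, b.2 + y.2 + 1)
  | .loop f, x =>
      (fun st : Data × ℕ => let y := f.run tape O st.1; (y.1, st.2 + y.2 + 1))^[x.fst.toNat]
        (step x x.snd)
  | .rand, x => step x (.num (tape x.toNat))
  | .query, x => step x (O x)

/-- Polynomial running time: on every input, for all random tapes and oracles, the number of steps
is at most a polynomial in any bound `s` on the sizes of the input, of the words of the random tape
and of the answers of the oracle. -/
def Prog.PolyTime (A : Prog) : Prop :=
  ∃ q : Polynomial ℕ, ∀ (tape : ℕ → ℕ) (O : Data → Data) (x : Data) (s : ℕ),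
    x.size ≤ s → (∀ a, (Data.num (tape a)).size ≤ s) → (∀ y, (O y).size ≤ s) →
      (A.run tape O x).2 ≤ q.eval s

/-- A random tape with `2 ^ T` independent uniform words of `T` bits (addresses have `T` bits);
the word at an address outside the tape is `0`. -/
def tapeOf {T : ℕ} (ω : Fin (2 ^ T) → Fin (2 ^ T)) (a : ℕ) : ℕ :=
  if h : a < 2 ^ T then (ω ⟨a, h⟩ : ℕ) else 0

/-- Polynomially bounded in the security parameter. -/
def PolyBounded (f : ℕ → ℕ) : Prop := ∃ q : Polynomial ℕ, ∀ s, f s ≤ q.eval s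

/-- Negligible functions of the security parameter. -/
def Negligible (μ : ℕ → ℝ) : Prop :=
  Asymptotics.SuperpolynomialDecay atTop (fun s : ℕ => (s : ℝ)) μ

/-- The security parameter in unary. -/
def unary (s : ℕ) : Data := .num (2 ^ s)

/-- A non-uniform probabilistic polynomial-time algorithm: one polynomial-time program, an advice
datum of polynomial size for every security parameter, and a polynomial that fixes the dimensions
of the random tape. -/
structure Adversary where
  prog : Prog
  polyTime : prog.PolyTime
  advice : ℕ → Data
  advice_poly : PolyBounded fun s => (advice s).size
  tapeLen : Polynomial ℕ

/-- What an algorithm is given: a datum and access to an oracle. -/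
abbrev View := Data × (Data → Data)

/-- The probability that `D` outputs `1` at security parameter `s`, given a sample of `X` (its
datum as input and its oracle for queries). -/
noncomputable def acceptProb (D : Adversary) (s : ℕ) (X : PMF View) : ℝ :=
  ((do
    let v ← X
    let ω ← PMF.uniformOfFintype
      (Fin (2 ^ D.tapeLen.eval s) → Fin (2 ^ D.tapeLen.eval s))
    pure (D.prog.run (tapeOf ω) v.2 (.pair (unary s) (.pair (D.advice s) v.1))).1 : PMF Data)
      (.num 1)).toReal

/-- Computational indistinguishability of two ensembles indexed by the security parameter `s` and
by the elements of a set that depends on `s`. -/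
def CompIndist {ι : ℕ → Type} (X Y : ∀ s, ι s → PMF View) : Prop :=
  ∀ D : Adversary, ∃ μ : ℕ → ℝ, Negligible μ ∧
    ∀ s (i : ι s), |acceptProb D s (X s i) - acceptProb D s (Y s i)| ≤ μ s

/-! ### Semi-honest security of two-party protocols -/

/-- A simulator: a uniform probabilistic polynomial-time algorithm that outputs a datum and
afterwards answers the queries to the oracles in the view, using the same random tape. -/
structure Simulator where
  view : Prog
  view_polyTime : view.PolyTime
  answer : Prog
  answer_polyTime : answer.PolyTime
  tapeLen : Polynomial ℕ

/-- The view produced by a simulator on input `x`. -/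
noncomputable def Simulator.sample (S : Simulator) (s : ℕ) (x : Data) : PMF View := do
  let ω ← PMF.uniformOfFintype (Fin (2 ^ S.tapeLen.eval s) → Fin (2 ^ S.tapeLen.eval s))
  pure ((S.view.run (tapeOf ω) (fun _ => .num 0) x).1,
    fun y => (S.answer.run (tapeOf ω) (fun _ => .num 0) (.pair x y)).1)

/-- Append the outputs of both parties to a view. -/
def View.withOutput (v : View) (out : Data × Data) : View := (.pair v.1 (.pair out.1 out.2), v.2)

/-- One execution of a two-party protocol: the views and the outputs of sender and receiver. -/
structure Execution where
  viewS : View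
  viewR : View
  out : Data × Data

/-- The protocol `Π` securely computes the deterministic functionality `f` (with the outputs of
sender and receiver as components) against static semi-honest adversaries, for all pairs of inputs
that satisfy `valid`. A simulator gets the security parameter in unary, the public parameters, the
input of the corrupted party and its output. -/
def SecurelyComputes {X Y : ℕ → Type} (encX : ∀ s, X s → Data) (encY : ∀ s, Y s → Data)
    (pub : ℕ → Data) (valid : ∀ s, X s → Y s → Prop) (f : ∀ s, X s → Y s → Data × Data)
    (protocol : ∀ s, X s → Y s → PMF Execution) : Prop :=
  ∃ SimS SimR : Simulator,
    CompIndist (ι := fun s => {i : X s × Y s // valid s i.1 i.2})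
      (fun s i => (fun e => e.viewS.withOutput e.out) <$> protocol s i.1.1 i.1.2)
      (fun s i => (fun v => View.withOutput v (f s i.1.1 i.1.2)) <$>
        SimS.sample s (.pair (unary s) (.pair (pub s)
          (.pair (encX s i.1.1) (f s i.1.1 i.1.2).1)))) ∧
    CompIndist (ι := fun s => {i : X s × Y s // valid s i.1 i.2})
      (fun s i => (fun e => e.viewR.withOutput e.out) <$> protocol s i.1.1 i.1.2)
      (fun s i => (fun v => View.withOutput v (f s i.1.1 i.1.2)) <$>
        SimR.sample s (.pair (unary s) (.pair (pub s)
          (.pair (encY s i.1.2) (f s i.1.1 i.1.2).2))))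

/-! ### The binary field, encodings of values as data -/

/-- The additive group of the field with `2 ^ ℓ` elements: bit strings of length `ℓ` with XOR. -/
abbrev BF (ℓ : ℕ) := Fin ℓ → ZMod 2

/-- The number with a given binary representation. -/
def BF.toNat {ℓ : ℕ} (x : BF ℓ) : ℕ := ∑ i, (x i).val * 2 ^ (i : ℕ)

/-- The `ℓ` low bits of a number. -/
def BF.ofNat (ℓ : ℕ) (v : ℕ) : BF ℓ := fun i => ((v / 2 ^ (i : ℕ) : ℕ) : ZMod 2)

def encList {α : Type} (e : α → Data) : List α → Data
  | [] => .num 0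
  | a :: l => .pair (e a) (encList e l)

def encVec {α : Type} {n : ℕ} (e : α → Data) (x : Fin n → α) : Data := encList e (List.ofFn x)

def encBF {ℓ : ℕ} (x : BF ℓ) : Data := .num x.toNat

def encFin {n : ℕ} (x : Fin n) : Data := .num x

def encZMod {N : ℕ} (x : ZMod N) : Data := .num x.val

def encBool (b : Bool) : Data := .num b.toNat

def encOption {α : Type} (e : α → Data) : Option α → Data
  | none => .num 0
  | some a => .pair (.num 1) (e a)

open Classical in
/-- Oracle access to a function with values in `BF ℓ`; queries that do not encode an argument are
answered by `0`. -/
noncomputable def oracleOf {α : Type} {ℓ : ℕ} (e : α → Data) (f : α → BF ℓ) (y : Data) : Data :=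
  if h : ∃ a, e a = y then encBF (f h.choose) else .num 0

/-- A keyed family of functions from `BF ℓ` to `BF ℓ` with keys in `BF κ` is pseudorandom (a PRF):
for a uniform key it is computationally indistinguishable, by oracle access, from a uniform
function. -/
def Pseudorandom {κ ℓ : ℕ → ℕ} (F : ∀ s, BF (κ s) → BF (ℓ s) → BF (ℓ s)) : Prop :=
  CompIndist (ι := fun _ => Unit)
    (fun s _ => (fun k => (Data.num 0, oracleOf encBF (F s k))) <$>
      PMF.uniformOfFintype (BF (κ s)))
    (fun s _ => (fun G => (Data.num 0, oracleOf encBF G)) <$>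
      PMF.uniformOfFintype (BF (ℓ s) → BF (ℓ s)))

/-! ### Ideal functionalities of the hybrid model -/

open Classical in
/-- The function that takes the programmed value at the keys that occur in the list `L` of
key-value pairs, and agrees with `g` elsewhere. -/
noncomputable def programmed {Key : Type} {ℓ : ℕ} (L : Finset (Key × BF ℓ)) (g : Key → BF ℓ)
    (x : Key) : BF ℓ :=
  if h : ∃ z, (x, z) ∈ L then h.choose else g x

/-- Outputs of the functionality of OPPRF with shared outputs: the function to which the sender
gets oracle access, the shares of the sender and the shares of the receiver. -/
structure SoOPPRFOut (Key ι : Type) (ℓ : ℕ) where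
  oracle : Key → BF ℓ
  shareS : ι → BF ℓ
  shareR : ι → BF ℓ

/-- OPPRF with shared outputs: the sender inputs the list `L`, the receiver the queries `X`. -/
noncomputable def soOPPRF {Key ι : Type} [Fintype Key] [DecidableEq Key] [Fintype ι]
    [DecidableEq ι] {ℓ : ℕ} (L : Finset (Key × BF ℓ)) (X : ι → Key) :
    PMF (SoOPPRFOut Key ι ℓ) := do
  let g ← PMF.uniformOfFintype (Key → BF ℓ)
  let y ← PMF.uniformOfFintype (ι → BF ℓ)
  pure ⟨programmed L g, y, fun i => programmed L g (X i) - y i⟩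

/-- OPRF with shared key and shared inputs; the output goes to the receiver. -/
def siOPRF {ι : Type} {κ ℓ : ℕ} (F : BF κ → BF ℓ → BF ℓ) (kS kR : BF κ) (xS xR : ι → BF ℓ) :
    ι → BF ℓ :=
  fun i => F (kS + kR) (xS i + xR i)

/-- Conversion of Boolean (XOR) shares into fresh arithmetic shares modulo `2 ^ ℓ`. -/
noncomputable def b2a {ι : Type} [Fintype ι] [DecidableEq ι] {ℓ : ℕ} (xS xR : ι → BF ℓ) :
    PMF ((ι → ZMod (2 ^ ℓ)) × (ι → ZMod (2 ^ ℓ))) := do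
  let y ← PMF.uniformOfFintype (ι → ZMod (2 ^ ℓ))
  pure (y, fun i => ((xS i + xR i).toNat : ZMod (2 ^ ℓ)) - y i)

/-- Private interval test on arithmetic shares; the output goes to the receiver. -/
def intervalTest {N : ℕ} (threshold : ℕ) (xS xR : ZMod N) : Bool :=
  decide ((xS + xR).val ≤ threshold)

/-- Oblivious transfer: the sender inputs two messages, the receiver a bit. -/
def oblTransfer {α : Type} (msgs : α × α) (b : Bool) : α := if b then msgs.2 else msgs.1

/-! ### Parameters, fuzzy PSI -/

/-- Public parameters: set sizes `m` (sender) and `n` (receiver), dimension `d`, threshold `δ`, the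
size `u` of the universe `{0, …, u - 1}` of coordinates, bit length `ℓ` of field elements, bit
length `κ` of PRF keys, and the scale of the fixed-point representation of `|t| ^ p`. -/
structure Params where
  m : ℕ
  n : ℕ
  d : ℕ
  δ : ℕ
  u : ℕ
  ℓ : ℕ
  κ : ℕ
  scale : ℕ

variable (P : Params)

/-- Points. -/
abbrev Point := Fin P.d → Fin P.u

/-- The integers within distance `δ` of the universe of coordinates. -/
abbrev Coord := ↥(Finset.Icc (-(P.δ : ℤ)) (P.u - 1 + P.δ))

/-- The fixed-point representation of `t ^ p`. For integral `p` and `scale = 1` it is `t ^ p`. -/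
noncomputable def powVal (p : ℝ) (t : ℕ) : ℕ := ⌊(P.scale : ℝ) * (t : ℝ) ^ p⌋₊

variable {P}

/-- The `L_p` distance. -/
noncomputable def distLp (p : ℝ) (x y : Point P) : ℝ :=
  (∑ k, |((x k : ℕ) : ℝ) - ((y k : ℕ) : ℝ)| ^ p) ^ (1 / p)

/-- The disjoint projection assumption. -/
def DisjointProjection {n : ℕ} (w : Fin n → Point P) : Prop :=
  ∀ i, ∃ k, ∀ j, j ≠ i →
    Set.Icc (((w i k : ℕ) : ℤ) - P.δ) (((w i k : ℕ) : ℤ) + P.δ) ∩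
      Set.Icc (((w j k : ℕ) : ℤ) - P.δ) (((w j k : ℕ) : ℤ) + P.δ) = ∅

open Classical in
/-- The output of the fuzzy PSI functionality for the `L_p` distance. -/
noncomputable def fuzzyPSI (p : ℝ) (q : Fin P.m → Point P) (w : Fin P.n → Point P) :
    Finset (Point P) :=
  (Finset.univ.filter fun j => ∃ i, distLp p (q j) (w i) ≤ P.δ).image q

/-- The constraints on the parameters, which are functions of the security parameter `s`. -/
structure Admissible (p : ℝ) (P : ℕ → Params) : Prop where
  poly_m : PolyBounded fun s => (P s).m
  poly_n : PolyBounded fun s => (P s).n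
  poly_d : PolyBounded fun s => (P s).d
  poly_δ : PolyBounded fun s => (P s).δ
  poly_u : PolyBounded fun s => Nat.size (P s).u
  poly_ℓ : PolyBounded fun s => (P s).ℓ
  poly_κ : PolyBounded fun s => (P s).κ
  /-- the field is large enough to avoid collisions of identifiers -/
  field_m : ∀ s, (P s).m ^ 2 * 2 ^ s ≤ 2 ^ (P s).ℓ
  field_n : ∀ s, (P s).n ^ 2 * 2 ^ s ≤ 2 ^ (P s).ℓ
  /-- the field is large enough to avoid false positives -/
  field_δ : ∀ s, (P s).m * powVal (P s) p (P s).δ * 2 ^ s ≤ 2 ^ (P s).ℓ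
  /-- sums of `d` programmed values do not overflow -/
  no_overflow : ∀ s, (P s).d * powVal (P s) p (P s).δ < 2 ^ (P s).ℓ
  scale_pos : ∀ s, 0 < (P s).scale
  /-- the precision suffices to decide whether a vector of coordinate distances, each at most `δ`,
  has norm at most `δ` -/
  exact_repr : ∀ s (t : Fin (P s).d → ℕ), (∀ k, t k ≤ (P s).δ) →
    (∑ k, powVal (P s) p (t k) ≤ powVal (P s) p (P s).δ ↔
      ∑ k, ((t k : ℕ) : ℝ) ^ p ≤ ((P s).δ : ℝ) ^ p)

/-! ### Fuzzy mapping -/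

/-- A coordinate of a point. -/
noncomputable def toCoord (x : Fin P.u) : Coord P :=
  ⟨((x : ℕ) : ℤ), by have := x.2; rw [Finset.mem_Icc]; omega⟩

/-- The interval `[x - δ, x + δ]`. -/
noncomputable def nbhd (x : Fin P.u) : Finset (Coord P) :=
  Finset.univ.filter fun c => |(c : ℤ) - ((x : ℕ) : ℤ)| ≤ P.δ

/-- Add a labelled interval to a collection, absorbing the intervals that it meets. -/
noncomputable def insertInterval (I : List (Finset (Coord P) × BF P.ℓ)) (U : Finset (Coord P)) (r : BF P.ℓ) :
    List (Finset (Coord P) × BF P.ℓ) :=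
  let res := I.foldl (fun st e =>
    if (st.1 ∩ e.1).Nonempty then (st.1 ∪ e.1, st.2) else (st.1, st.2 ++ [e])) (U, [])
  res.2 ++ [(res.1, r)]

/-- The labelled intervals of local mapping in dimension `k`, for the points `x` and the sampled
values `r`. -/
noncomputable def intervals {n : ℕ} (x : Fin n → Point P) (r : Fin n → Fin P.d → BF P.ℓ) (k : Fin P.d) :
    List (Finset (Coord P) × BF P.ℓ) :=
  (List.finRange n).foldl (fun I j => insertInterval I (nbhd (x j k)) (r j k)) []

/-- The label of the interval that contains `c`. -/
noncomputable def labelOf (I : List (Finset (Coord P) × BF P.ℓ)) (c : Coord P) : BF P.ℓ :=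
  ((I.find? fun e => decide (c ∈ e.1)).map Prod.snd).getD 0

/-- The local identifiers. -/
noncomputable def pid {n : ℕ} (x : Fin n → Point P) (r : Fin n → Fin P.d → BF P.ℓ) (j : Fin n) : BF P.ℓ :=
  ∑ k, labelOf (intervals x r k) (toCoord (x j k))

variable (P) in
/-- The size to which the list of a party with `n` points is padded. -/
abbrev padSize (n : ℕ) : ℕ := n * P.d * (2 * P.δ + 1)

variable (P) in
/-- Keys for fuzzy mapping: `k ‖ x`, or one of the dummy keys of the padding. -/
abbrev MapKey (n : ℕ) := (Fin P.d × Coord P) ⊕ Fin (padSize P n)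

/-- The list of local mapping before padding. -/
noncomputable def localListCore {n : ℕ} (x : Fin n → Point P) (r : Fin n → Fin P.d → BF P.ℓ) :
    Finset (MapKey P n × BF P.ℓ) :=
  Finset.univ.biUnion fun k => (intervals x r k).toFinset.biUnion fun e =>
    e.1.image fun c => (Sum.inl (k, c), e.2)

/-- The list of local mapping, padded with dummy items to size `padSize P n`. -/
noncomputable def localList {n : ℕ} (x : Fin n → Point P) (r : Fin n → Fin P.d → BF P.ℓ)
    (e : Fin (padSize P n) → BF P.ℓ) : Finset (MapKey P n × BF P.ℓ) :=
  localListCore x r ∪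
    (Finset.univ.filter fun i : Fin (padSize P n) =>
      (i : ℕ) < padSize P n - (localListCore x r).card).image fun i => (Sum.inr i, e i)

variable (P) in
/-- What a party with `a` points, whose peer has `b` points, sees in fuzzy mapping: the sampled
labels and dummy values, its share of the PRF key, the oracle and the shares from the so-OPPRF in
which it is the sender, the shares from the so-OPPRF in which it is the receiver, and the
identifiers of its points. -/
structure FMapView (a b : ℕ) where
  labels : Fin a → Fin P.d → BF P.ℓ
  dummies : Fin (padSize P a) → BF P.ℓ
  keyShare : BF P.κ
  oracle : MapKey P a → BF P.ℓ
  sharesOther : Fin b × Fin P.d → BF P.ℓ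
  sharesOwn : Fin a × Fin P.d → BF P.ℓ
  ids : Fin a → BF P.ℓ

/-- The fuzzy mapping protocol on inputs `q` (sender) and `w` (receiver). -/
noncomputable def fuzzyMap (F : BF P.κ → BF P.ℓ → BF P.ℓ) (q : Fin P.m → Point P)
    (w : Fin P.n → Point P) : PMF (FMapView P P.m P.n × FMapView P P.n P.m) := do
  let labS ← PMF.uniformOfFintype (Fin P.m → Fin P.d → BF P.ℓ)
  let dumS ← PMF.uniformOfFintype (Fin (padSize P P.m) → BF P.ℓ)
  let labR ← PMF.uniformOfFintype (Fin P.n → Fin P.d → BF P.ℓ)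
  let dumR ← PMF.uniformOfFintype (Fin (padSize P P.n) → BF P.ℓ)
  let kS ← PMF.uniformOfFintype (BF P.κ)
  let kR ← PMF.uniformOfFintype (BF P.κ)
  let o₁ ← soOPPRF (localList q labS dumS)
    (fun ik : Fin P.n × Fin P.d => Sum.inl (ik.2, toCoord (w ik.1 ik.2)))
  let idW := siOPRF F kS kR (fun i => ∑ k, o₁.shareS (i, k))
    (fun i => (∑ k, o₁.shareR (i, k)) + pid w labR i)
  let o₂ ← soOPPRF (localList w labR dumR)
    (fun jk : Fin P.m × Fin P.d => Sum.inl (jk.2, toCoord (q jk.1 jk.2)))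
  let idQ := siOPRF F kR kS (fun j => ∑ k, o₂.shareS (j, k))
    (fun j => (∑ k, o₂.shareR (j, k)) + pid q labS j)
  pure (⟨labS, dumS, kS, o₁.oracle, o₁.shareS, o₂.shareR, idQ⟩,
    ⟨labR, dumR, kR, o₂.oracle, o₂.shareS, o₁.shareR, idW⟩)

/-! ### The fuzzy PSI protocol for the `L_p` distance -/

variable (P) in
/-- Keys `ID ‖ k ‖ x` for the refined filtering. -/
abbrev FilterKey := BF P.ℓ × Fin P.d × Coord P

/-- The list of the receiver in the refined filtering: `ID_{w_i} ‖ k ‖ (w_{i,k} + t)` has the value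
`|t| ^ p` for `t ∈ [-δ, δ]`. -/
noncomputable def filterList (p : ℝ) (w : Fin P.n → Point P) (ids : Fin P.n → BF P.ℓ) :
    Finset (FilterKey P × BF P.ℓ) :=
  Finset.univ.biUnion fun i => Finset.univ.biUnion fun k =>
    (nbhd (w i k)).image fun c =>
      ((ids i, k, c), BF.ofNat P.ℓ (powVal P p ((c : ℤ) - ((w i k : ℕ) : ℤ)).natAbs))

variable (P) in
/-- The view of the sender: its input, the random order in which it processes its points, and what
it sees in fuzzy mapping, so-OPPRF and B2A. -/
structure SenderView where
  input : Fin P.m → Point P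
  order : Equiv.Perm (Fin P.m)
  fmap : FMapView P P.m P.n
  shares : Fin P.m × Fin P.d → BF P.ℓ
  arithShares : Fin P.m × Fin P.d → ZMod (2 ^ P.ℓ)

variable (P) in
/-- The view of the receiver: its input, and what it sees in fuzzy mapping, so-OPPRF, B2A, the
interval tests and the oblivious transfers. -/
structure ReceiverView where
  input : Fin P.n → Point P
  fmap : FMapView P P.n P.m
  oracle : FilterKey P → BF P.ℓ
  shares : Fin P.m × Fin P.d → BF P.ℓ
  arithShares : Fin P.m × Fin P.d → ZMod (2 ^ P.ℓ)
  bits : Fin P.m → Bool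
  received : Fin P.m → Option (Point P)

/-- The protocol on inputs `q` (sender) and `w` (receiver): the views of sender and receiver, and
the output of the receiver. -/
noncomputable def fpsiProtocol (p : ℝ) (F : BF P.κ → BF P.ℓ → BF P.ℓ) (q₀ : Fin P.m → Point P)
    (w : Fin P.n → Point P) : PMF (SenderView P × ReceiverView P × Finset (Point P)) := do
  let σ ← PMF.uniformOfFintype (Equiv.Perm (Fin P.m))
  let q := fun j => q₀ (σ j)
  let fm ← fuzzyMap F q w
  let o ← soOPPRF (filterList p w fm.2.ids)
    (fun jk : Fin P.m × Fin P.d => (fm.1.ids jk.1, jk.2, toCoord (q jk.1 jk.2)))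
  let a ← b2a o.shareR o.shareS
  let b := fun j => intervalTest (powVal P p P.δ) (∑ k, a.1 (j, k)) (∑ k, a.2 (j, k))
  let z := fun j => oblTransfer (none, some (q j)) (b j)
  pure (⟨q₀, σ, fm.1, o.shareR, a.1⟩, ⟨w, fm.2, o.oracle, o.shareS, a.2, b, z⟩,
    (Finset.univ.filter fun j => b j = true).biUnion fun j => (z j).toFinset)

/-! ### Encodings of parameters, inputs, outputs and views as data -/

def encPoint (x : Point P) : Data := encVec encFin x

/-- A set of points, listed in lexicographic order. -/
noncomputable def encPointSet (Z : Finset (Point P)) : Data :=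
  encList (fun x => encPoint (ofLex x)) ((Z.map toLex.toEmbedding).sort (· ≤ ·))

def encShares {α : Type} {a b : ℕ} (e : α → Data) (x : Fin a × Fin b → α) : Data :=
  encVec (fun i => encVec e fun k => x (i, k)) id

/-- Coordinates, shifted by `δ` to become natural numbers. -/
def encCoord (c : Coord P) : Data := .num ((c : ℤ) + P.δ).toNat

def encMapKey {n : ℕ} : MapKey P n → Data
  | .inl (k, c) => .pair (.num 0) (.pair (encFin k) (encCoord c))
  | .inr i => .pair (.num 1) (encFin i)

def encFilterKey (x : FilterKey P) : Data :=
  .pair (encBF x.1) (.pair (encFin x.2.1) (encCoord x.2.2))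

/-- The part of the view of fuzzy mapping other than the oracle. -/
def encFMapView {a b : ℕ} (v : FMapView P a b) : Data :=
  .pair (encVec (encVec encBF) v.labels) <| .pair (encVec encBF v.dummies) <|
  .pair (encBF v.keyShare) <| .pair (encShares encBF v.sharesOther) <|
  .pair (encShares encBF v.sharesOwn) (encVec encBF v.ids)

noncomputable def SenderView.toView (v : SenderView P) : View :=
  (.pair (encVec encPoint v.input) <| .pair (encVec encFin v.order) <|
    .pair (encFMapView v.fmap) <| .pair (encShares encBF v.shares)
      (encShares encZMod v.arithShares),
    oracleOf encMapKey v.fmap.oracle)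

/-- The receiver has access to two oracles; the first component of a query selects one of them. -/
noncomputable def ReceiverView.toView (v : ReceiverView P) : View :=
  (.pair (encVec encPoint v.input) <| .pair (encFMapView v.fmap) <|
    .pair (encShares encBF v.shares) <| .pair (encShares encZMod v.arithShares) <|
    .pair (encVec encBool v.bits) (encVec (encOption encPoint) v.received),
    oracleOf
      (Sum.elim (fun x => .pair (.num 0) (encMapKey x)) fun x => .pair (.num 1) (encFilterKey x))
      (Sum.elim v.fmap.oracle v.oracle))

/-- The outputs: nothing for the sender, a set of points for the receiver. -/
noncomputable def encOut (Z : Finset (Point P)) : Data × Data := (.num 0, encPointSet Z)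

/-- The protocol, with views and outputs encoded. -/
noncomputable def fpsiExecution (p : ℝ) (F : BF P.κ → BF P.ℓ → BF P.ℓ) (q : Fin P.m → Point P)
    (w : Fin P.n → Point P) : PMF Execution :=
  (fun r => ⟨r.1.toView, r.2.1.toView, encOut r.2.2⟩) <$> fpsiProtocol p F q w

variable (P) in
/-- The public parameters: sizes in unary, and the table of the programmed values `|t| ^ p` for
`0 ≤ t ≤ δ`, whose last entry is the threshold. -/
noncomputable def encParams (p : ℝ) : Data :=
  encList id [unary P.m, unary P.n, unary P.d, unary P.δ, .num P.u, unary P.ℓ, unary P.κ,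
    encVec (fun t : Fin (P.δ + 1) => .num (powVal P p t)) id]

end FPSI

/-! ### Running times and output sizes in the program model. -/

namespace FPSI

/-! ### Polynomially bounded monotone functions -/

/-! A run is a function of finitely many independent uniform choices, so acceptance probabilities
are finite averages and the proof is a chain of changes to these averages.

Correctness. If a sender point and a receiver point are within `δ` in every coordinate, each lies in
the other's labelled intervals. Both PRF arguments are then the sum of the two local identifiers
(`mapIn_eq_of_close`), so the identifiers agree. By the disjoint projection assumption every point
has a dimension whose label enters no other argument of its owner, so two arguments of one party
coincide with probability at most `2 ^ (-ℓ)` (`expect_mapIn_collision`); distinct arguments give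
distinct identifiers up to a negligible error (`prf_collision`). When the receiver's identifiers are
distinct, two cases remain for a sender point. Either one receiver point programs all its `d` keys,
and the interval test decides the distance exactly (`filterSum_covered`); or some key has a fresh
uniform value, and the sum is below the threshold with probability at most `(c_δ + 1) * 2 ^ (-ℓ)`
(`expect_filterSum_uncovered`). A union bound shows that bad runs are negligible
(`exists_failure_bound`).

Privacy. In a good run every share that a party receives is masked by a uniform value, and `kS + kR`
is uniform given one of the two key shares. Translating the averages (`expect_sender_eq`,
`expect_receiver_eq`) leaves a view made of the own input, uniform values, programmed functions, PRF
values at the arguments and, for the receiver, the matched points in random order. The PRF is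
replaced by a random function (`prf_views`), whose values at distinct arguments are independent and
uniform. The other party's input then survives only in the output and in the matched points; in
uniformly random order the latter have a law that depends on the output set alone
(`exists_perm_getElem?_eq_matched`).

Simulation. The simulators read all these values from disjoint parts of their tape. A random
function on an exponentially large domain is sampled by letting its value at a key be the tape word
at an address that determines the key. The sampling is exact except for the random order, which
comes from sorting random words and fails to be uniform only through ties.

Since the model counts steps, simulators and reductions are explicit programs. The PRF reduction
runs a distinguisher inside another program (`sim`), with a simulated tape and simulated oracles. -/

theorem eval_mono (q : Polynomial ℕ) : Monotone fun s => q.eval s := by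
  intro a b h
  simp only [Polynomial.eval_eq_sum_range]
  gcongr

/-- Monotone functions with a polynomial bound. -/
structure MonoPoly (f : ℕ → ℕ) : Prop where
  mono : Monotone f
  poly : PolyBounded f

namespace MonoPoly

theorem eval (q : Polynomial ℕ) : MonoPoly fun s => q.eval s :=
  ⟨eval_mono q, q, fun _ => le_rfl⟩

theorem const (c : ℕ) : MonoPoly fun _ => c := ⟨fun _ _ _ => le_rfl, .C c, fun _ => by simp⟩

theorem self : MonoPoly fun s => s := ⟨fun _ _ h => h, .X, fun _ => by simp⟩

theorem add {f g : ℕ → ℕ} (hf : MonoPoly f) (hg : MonoPoly g) : MonoPoly fun s => f s + g s := by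
  obtain ⟨hf, p, hp⟩ := hf
  obtain ⟨hg, q, hq⟩ := hg
  refine ⟨fun a b h => add_le_add (hf h) (hg h), p + q, fun s => ?_⟩
  simpa using add_le_add (hp s) (hq s)

theorem mul {f g : ℕ → ℕ} (hf : MonoPoly f) (hg : MonoPoly g) : MonoPoly fun s => f s * g s := by
  obtain ⟨hf, p, hp⟩ := hf
  obtain ⟨hg, q, hq⟩ := hg
  refine ⟨fun a b h => Nat.mul_le_mul (hf h) (hg h), p * q, fun s => ?_⟩
  simpa using Nat.mul_le_mul (hp s) (hq s)

theorem comp {f g : ℕ → ℕ} (hf : MonoPoly f) (hg : MonoPoly g) : MonoPoly fun s => f (g s) := by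
  obtain ⟨hf, p, hp⟩ := hf
  obtain ⟨hg, q, hq⟩ := hg
  refine ⟨fun a b h => hf (hg h), p.comp q, fun s => ?_⟩
  rw [Polynomial.eval_comp]
  exact (hp _).trans (eval_mono p (hq s))

end MonoPoly

/-! ### Sizes of data -/

theorem Data.one_le_size (x : Data) : 1 ≤ x.size := by
  cases x <;> simp [Data.size]

theorem Data.fst_size (x : Data) : x.fst.size ≤ x.size := by
  cases x <;> simp [Data.size, Data.fst]; omega

theorem Data.snd_size (x : Data) : x.snd.size ≤ x.size := by
  cases x <;> simp [Data.size, Data.snd]; omega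

theorem natSize_le_self (n : ℕ) : Nat.size n ≤ n := Nat.size_le.2 Nat.lt_two_pow_self

theorem natSize_add (a b : ℕ) : Nat.size (a + b) ≤ Nat.size a + Nat.size b + 1 := by
  rw [Nat.size_le, pow_succ, pow_add]
  have ha := Nat.lt_size_self a
  have hb := Nat.lt_size_self b
  have h1 : 1 ≤ 2 ^ Nat.size a := Nat.one_le_two_pow
  have h2 : 1 ≤ 2 ^ Nat.size b := Nat.one_le_two_pow
  nlinarith

theorem natSize_mul (a b : ℕ) : Nat.size (a * b) ≤ Nat.size a + Nat.size b := by
  rw [Nat.size_le, pow_add]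
  exact Nat.mul_lt_mul'' (Nat.lt_size_self a) (Nat.lt_size_self b)

theorem Data.arith_size {op : ℕ → ℕ → ℕ} (hop : ∀ a b, Nat.size (op a b) ≤ Nat.size a + Nat.size b + 1)
    (x : Data) : (x.arith op).size ≤ x.size := by
  match x with
  | .num _ => simp [Data.arith, Data.size]
  | .pair (.num a) (.num b) => have := hop a b; simp only [Data.arith, Data.size]; omega
  | .pair (.pair _ _) _ => simp [Data.arith, Data.size]
  | .pair (.num _) (.pair _ _) => simp [Data.arith, Data.size]

theorem Data.arith_toNat_le {op : ℕ → ℕ → ℕ} (a b : Data) :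
    ((Data.pair a b).arith op).toNat ≤ op a.toNat b.toNat := by
  match a, b with
  | .num _, .num _ => simp [Data.arith, Data.toNat]
  | .pair _ _, _ => simp [Data.arith, Data.toNat]
  | .num _, .pair _ _ => simp [Data.arith, Data.toNat]

theorem Data.isPair_size (x : Data) : x.isPair.size ≤ 2 := by
  cases x <;> simp [Data.size, Data.isPair]

theorem Data.toNat_size (x : Data) : (Data.num x.toNat).size ≤ x.size := by
  cases x <;> simp [Data.size, Data.toNat]

@[simp] theorem Data.fst_pair (a b : Data) : (Data.pair a b).fst = a := rfl
@[simp] theorem Data.snd_pair (a b : Data) : (Data.pair a b).snd = b := rfl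
@[simp] theorem Data.toNat_num (n : ℕ) : (Data.num n).toNat = n := rfl
@[simp] theorem Data.arith_num (op : ℕ → ℕ → ℕ) (a b : ℕ) :
    (Data.pair (.num a) (.num b)).arith op = .num (op a b) := rfl

/-! ### Values and costs of programs -/

namespace Prog

/-- The output of a program. -/
def ev (A : Prog) (t : ℕ → ℕ) (O : Data → Data) (x : Data) : Data := (A.run t O x).1

/-- The number of steps of a program. -/
def cost (A : Prog) (t : ℕ → ℕ) (O : Data → Data) (x : Data) : ℕ := (A.run t O x).2

variable (t : ℕ → ℕ) (O : Data → Data) (x : Data)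

@[simp] theorem ev_id : Prog.id.ev t O x = x := rfl
@[simp] theorem ev_const (c : Data) : (Prog.const c).ev t O x = c := rfl
@[simp] theorem ev_comp (f g : Prog) : (Prog.comp f g).ev t O x = f.ev t O (g.ev t O x) := rfl
@[simp] theorem ev_pair (f g : Prog) :
    (Prog.pair f g).ev t O x = .pair (f.ev t O x) (g.ev t O x) := rfl
@[simp] theorem ev_fst : Prog.fst.ev t O x = x.fst := rfl
@[simp] theorem ev_snd : Prog.snd.ev t O x = x.snd := rfl
@[simp] theorem ev_isPair : Prog.isPair.ev t O x = x.isPair := rfl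
@[simp] theorem ev_size : Prog.size.ev t O x = .num x.size := rfl
@[simp] theorem ev_add : Prog.add.ev t O x = x.arith (· + ·) := rfl
@[simp] theorem ev_sub : Prog.sub.ev t O x = x.arith (· - ·) := rfl
@[simp] theorem ev_mul : Prog.mul.ev t O x = x.arith (· * ·) := rfl
@[simp] theorem ev_mod : Prog.mod.ev t O x = x.arith (· % ·) := rfl
@[simp] theorem ev_rand : Prog.rand.ev t O x = .num (t x.toNat) := rfl
@[simp] theorem ev_query : Prog.query.ev t O x = O x := rfl

theorem ev_ite (c f g : Prog) : (Prog.ite c f g).ev t O x =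
    if (c.ev t O x).toNat ≠ 0 then f.ev t O x else g.ev t O x := by
  simp only [ev, run]
  split_ifs <;> simp_all

/-- The step counter never influences the data, so values iterate on their own and the cost is a sum
over the visited states. -/
theorem loop_iterate (f : Prog) (n : ℕ) (st : Data × ℕ) :
    (fun st : Data × ℕ => let y := f.run t O st.1; (y.1, st.2 + y.2 + 1))^[n] st =
      ((f.ev t O)^[n] st.1,
        st.2 + ∑ i ∈ Finset.range n, (f.cost t O ((f.ev t O)^[i] st.1) + 1)) := by
  induction n with
  | zero => simp
  | succ n ih =>
    rw [Function.iterate_succ_apply', ih, Function.iterate_succ_apply', Finset.sum_range_succ]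
    simp only [ev, cost, Prod.mk.injEq, true_and]
    ring

theorem ev_loop (f : Prog) : (Prog.loop f).ev t O x = (f.ev t O)^[x.fst.toNat] x.snd := by
  have := loop_iterate t O f x.fst.toNat (step x x.snd)
  exact congrArg Prod.fst this

theorem cost_loop (f : Prog) : (Prog.loop f).cost t O x = x.size + x.snd.size + 1 +
    ∑ i ∈ Finset.range x.fst.toNat, (f.cost t O ((f.ev t O)^[i] x.snd) + 1) := by
  have := loop_iterate t O f x.fst.toNat (step x x.snd)
  exact congrArg Prod.snd this

theorem cost_comp (f g : Prog) : (Prog.comp f g).cost t O x =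
    g.cost t O x + f.cost t O (g.ev t O x) + 1 := rfl
theorem cost_pair (f g : Prog) : (Prog.pair f g).cost t O x =
    f.cost t O x + g.cost t O x + 1 := rfl
theorem cost_ite (c f g : Prog) : (Prog.ite c f g).cost t O x =
    c.cost t O x + (if (c.ev t O x).toNat ≠ 0 then f.cost t O x else g.cost t O x) + 1 := by
  simp only [ev, cost, run]
  split_ifs <;> simp_all

/-- Every primitive step is charged for its output, and in a nonempty `loop` the last pass has
already paid for the result. A bound on time is therefore also a bound on output size. -/
theorem ev_size_le (A : Prog) : ∀ x, (A.ev t O x).size ≤ A.cost t O x := by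
  induction A with
  | comp f g hf hg => intro x; rw [ev_comp, cost_comp]; have := hf (g.ev t O x); omega
  | pair f g hf hg =>
    intro x; rw [ev_pair, cost_pair]; have := hf x; have := hg x; simp only [Data.size]; omega
  | ite c f g hc hf hg =>
    intro x; rw [ev_ite, cost_ite]; have := hf x; have := hg x; split_ifs <;> omega
  | loop f hf =>
    intro x
    rw [ev_loop, cost_loop]
    generalize x.fst.toNat = n
    cases n with
    | zero => simp; omega
    | succ n =>
      rw [Finset.sum_range_succ, Function.iterate_succ_apply']
      have := hf ((f.ev t O)^[n] x.snd)
      omega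
  | _ => intro x; simp only [ev, cost, run, step]; omega

/-- Used in `cost_sim`: the data met by a simulated program are no larger than its step count. -/
theorem size_le_cost (A : Prog) : ∀ x, x.size ≤ A.cost t O x := by
  induction A with
  | comp f g hf hg => intro x; rw [cost_comp]; have := hg x; omega
  | pair f g hf hg => intro x; rw [cost_pair]; have := hf x; omega
  | ite c f g hc hf hg => intro x; rw [cost_ite]; have := hc x; omega
  | loop f hf => intro x; rw [cost_loop]; omega
  | _ => intro x; simp only [cost, run, step]; omega

end Prog

/-- A bound on the sizes of the words of a tape and of the answers of an oracle. -/
structure EnvBd (t : ℕ → ℕ) (O : Data → Data) (s : ℕ) : Prop where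
  tape : ∀ a, (Data.num (t a)).size ≤ s
  oracle : ∀ y, (O y).size ≤ s

theorem EnvBd.mono {t : ℕ → ℕ} {O : Data → Data} {s s' : ℕ} (h : EnvBd t O s) (hs : s ≤ s') :
    EnvBd t O s' := ⟨fun a => (h.tape a).trans hs, fun y => (h.oracle y).trans hs⟩

/-- Programs that run in polynomial time, as a class. -/
class PT (A : Prog) : Prop where
  out : A.PolyTime

theorem PT.bound (A : Prog) [h : PT A] : ∃ f, MonoPoly f ∧ ∀ t O x s, EnvBd t O s → x.size ≤ s →
    A.cost t O x ≤ f s := by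
  obtain ⟨q, hq⟩ := h.out
  exact ⟨_, MonoPoly.eval q, fun t O x s he hx => hq t O x s hx he.tape he.oracle⟩

theorem PT.of {A : Prog} {f : ℕ → ℕ} (hf : MonoPoly f)
    (h : ∀ t O x s, EnvBd t O s → x.size ≤ s → A.cost t O x ≤ f s) : PT A := by
  obtain ⟨-, q, hq⟩ := hf
  exact ⟨q, fun t O x s hx ht hO => (h t O x s ⟨ht, hO⟩ hx).trans (hq s)⟩

/-- Programs whose numerical value is polynomially bounded. -/
class PV (A : Prog) : Prop where
  out : ∃ f, MonoPoly f ∧ ∀ t O x s, EnvBd t O s → x.size ≤ s → (A.ev t O x).toNat ≤ f s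

/-- Programs for which the size of the output is polynomially bounded. -/
theorem PT.evBound (A : Prog) [PT A] : ∃ f, MonoPoly f ∧ ∀ t O x s, EnvBd t O s → x.size ≤ s →
    (A.ev t O x).size ≤ f s := by
  obtain ⟨f, hf, h⟩ := PT.bound A
  exact ⟨f, hf, fun t O x s he hx => (A.ev_size_le t O x).trans (h t O x s he hx)⟩

section primitive

theorem PT.of_step {A : Prog} (c : ℕ)
    (h : ∀ t O x s, EnvBd t O s → x.size ≤ s → ∃ y, A.run t O x = step x y ∧ y.size ≤ s + c) :
    PT A := by
  refine PT.of (f := fun s => s + (s + c) + 1)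
    ((MonoPoly.self.add (MonoPoly.self.add (.const c))).add (.const 1)) fun t O x s he hx => ?_
  obtain ⟨y, hy, hs⟩ := h t O x s he hx
  simp only [Prog.cost, hy, step]; omega

instance : PT .id := .of_step 0 fun _ _ x _ _ hx => ⟨x, rfl, hx⟩
instance (c : Data) : PT (.const c) := .of_step c.size fun _ _ _ _ _ _ => ⟨c, rfl, by omega⟩
instance : PT .fst := .of_step 0 fun _ _ x _ _ hx => ⟨_, rfl, x.fst_size.trans hx⟩
instance : PT .snd := .of_step 0 fun _ _ x _ _ hx => ⟨_, rfl, x.snd_size.trans hx⟩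
instance : PT .isPair := .of_step 2 fun _ _ x _ _ _ => ⟨_, rfl, x.isPair_size.trans (by omega)⟩
instance : PT .size := .of_step 1 fun _ _ x _ _ hx => ⟨_, rfl, by
  have := natSize_le_self x.size; simp only [Data.size]; omega⟩
instance : PT .add := .of_step 0 fun _ _ x _ _ hx => ⟨_, rfl,
  (Data.arith_size natSize_add x).trans hx⟩
instance : PT .sub := .of_step 0 fun _ _ x _ _ hx => ⟨_, rfl,
  (Data.arith_size (fun a b => (Nat.size_le_size (Nat.sub_le a b)).trans (by omega)) x).trans hx⟩
instance : PT .mul := .of_step 0 fun _ _ x _ _ hx => ⟨_, rfl,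
  (Data.arith_size (fun a b => (natSize_mul a b).trans (by omega)) x).trans hx⟩
instance : PT .mod := .of_step 0 fun _ _ x _ _ hx => ⟨_, rfl,
  (Data.arith_size (fun a b => (Nat.size_le_size (Nat.mod_le a b)).trans (by omega)) x).trans hx⟩
instance : PT .rand := .of_step 0 fun _ _ _ _ he _ => ⟨_, rfl, he.tape _⟩
instance : PT .query := .of_step 0 fun _ _ _ _ he _ => ⟨_, rfl, he.oracle _⟩

instance (f g : Prog) [PT f] [PT g] : PT (.comp f g) := by
  obtain ⟨p, hp, hf⟩ := PT.bound f
  obtain ⟨q, hq, hg⟩ := PT.bound g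
  refine PT.of (f := fun s => q s + p (s + q s) + 1)
    ((hq.add (hp.comp (MonoPoly.self.add hq))).add (.const 1)) fun t O x s he hx => ?_
  rw [Prog.cost_comp]
  have h1 := hg t O x s he hx
  have h2 := hf t O (g.ev t O x) (s + q s) (he.mono (by omega))
    ((g.ev_size_le t O x).trans (by omega))
  omega

instance (f g : Prog) [PT f] [PT g] : PT (.pair f g) := by
  obtain ⟨p, hp, hf⟩ := PT.bound f
  obtain ⟨q, hq, hg⟩ := PT.bound g
  refine PT.of ((hp.add hq).add (.const 1)) fun t O x s he hx => ?_
  rw [Prog.cost_pair]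
  have h1 := hg t O x s he hx
  have h2 := hf t O x s he hx
  omega

instance (c f g : Prog) [PT c] [PT f] [PT g] : PT (.ite c f g) := by
  obtain ⟨r, hr, hc⟩ := PT.bound c
  obtain ⟨p, hp, hf⟩ := PT.bound f
  obtain ⟨q, hq, hg⟩ := PT.bound g
  refine PT.of ((hr.add (hp.add hq)).add (.const 1)) fun t O x s he hx => ?_
  rw [Prog.cost_ite]
  have h1 := hg t O x s he hx
  have h2 := hf t O x s he hx
  have h3 := hc t O x s he hx
  split_ifs <;> omega

end primitive

/-! ### Bounded values -/

instance (c : Data) : PV (.const c) := ⟨_, .const c.toNat, fun _ _ _ _ _ _ => le_rfl⟩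

/-- A number of size `s` may be as large as `2 ^ s`, so outputs of polynomial-time programs are not
in general usable as loop counts. Sizes are, and this is how parameters given in unary become loop
counts. -/
instance (f : Prog) [PT f] : PV (.comp .size f) := by
  obtain ⟨p, hp, hf⟩ := PT.evBound f
  exact ⟨p, hp, fun t O x s he hx => by simpa using hf t O x s he hx⟩

theorem PV.arith {A f g : Prog} {op : ℕ → ℕ → ℕ} {p q r : ℕ → ℕ}
    (hA : ∀ t O x, A.ev t O x = (Data.pair (f.ev t O x) (g.ev t O x)).arith op)
    (hr : MonoPoly r)
    (hf : ∀ t O x s, EnvBd t O s → x.size ≤ s → (f.ev t O x).toNat ≤ p s)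
    (hg : ∀ t O x s, EnvBd t O s → x.size ≤ s → (g.ev t O x).toNat ≤ q s)
    (hop : ∀ s a b, a ≤ p s → b ≤ q s → op a b ≤ r s) : PV A :=
  ⟨r, hr, fun t O x s he hx => by
    rw [hA]
    exact (Data.arith_toNat_le _ _).trans (hop s _ _ (hf t O x s he hx) (hg t O x s he hx))⟩

instance (f g : Prog) [hf : PV f] [hg : PV g] : PV (.comp .add (.pair f g)) := by
  obtain ⟨p, hp, hf⟩ := hf.out
  obtain ⟨q, hq, hg⟩ := hg.out
  exact .arith (fun _ _ _ => rfl) (hp.add hq) hf hg fun s a b ha hb => add_le_add ha hb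

instance (f g : Prog) [hf : PV f] [hg : PV g] : PV (.comp .mul (.pair f g)) := by
  obtain ⟨p, hp, hf⟩ := hf.out
  obtain ⟨q, hq, hg⟩ := hg.out
  exact .arith (fun _ _ _ => rfl) (hp.mul hq) hf hg fun s a b ha hb => Nat.mul_le_mul ha hb

/-- Truncated subtraction never exceeds its first argument, so the second one needs no bound. -/
theorem PV.sub_left (f g : Prog) [hf : PV f] : PV (.comp .sub (.pair f g)) := by
  obtain ⟨p, hp, hf⟩ := hf.out
  refine ⟨p, hp, fun t O x s he hx => ?_⟩
  exact (Data.arith_toNat_le _ _).trans ((Nat.sub_le _ _).trans (hf t O x s he hx))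

instance (f g : Prog) [PV f] : PV (.comp .sub (.pair f g)) := PV.sub_left f g

/-! ### Loops -/

namespace Prog

/-- `n := c x`; starting from `i x`, replace `acc` by `f ((x, j), acc)` for `j = 0, …, n - 1`. -/
def forN (c i f : Prog) : Prog :=
  .comp .snd <| .comp
    (.loop (.pair (.pair (.comp .fst .fst) (.comp .add (.pair (.comp .snd .fst) (.const (.num 1)))))
      f))
    (.pair c (.pair (.pair .id (.const (.num 0))) i))

/-- The values of the accumulator of `forN`. -/
def forVal (i f : Prog) (t : ℕ → ℕ) (O : Data → Data) (x : Data) : ℕ → Data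
  | 0 => i.ev t O x
  | j + 1 => f.ev t O (.pair (.pair x (.num j)) (forVal i f t O x j))

theorem forN_iterate (i f : Prog) (t : ℕ → ℕ) (O : Data → Data) (x : Data) (j : ℕ) :
    (Prog.ev (.pair (.pair (.comp .fst .fst)
      (.comp .add (.pair (.comp .snd .fst) (.const (.num 1))))) f) t O)^[j]
      (.pair (.pair x (.num 0)) (i.ev t O x)) =
    .pair (.pair x (.num j)) (forVal i f t O x j) := by
  induction j with
  | zero => rfl
  | succ j ih => rw [Function.iterate_succ_apply', ih]; simp [forVal]

theorem ev_forN (c i f : Prog) (t : ℕ → ℕ) (O : Data → Data) (x : Data) :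
    (forN c i f).ev t O x = forVal i f t O x (c.ev t O x).toNat := by
  simp only [forN, ev_comp, ev_loop, ev_pair, Data.fst_pair, Data.snd_pair, ev_snd, ev_id, ev_const]
  rw [forN_iterate]; rfl

end Prog

open Prog in
-- Polynomial time of the body alone is not enough, because sizes could multiply from pass to pass.
-- The hypothesis `h` lets the accumulator grow by an amount that depends only on the fixed input
-- and the counter, so it stays polynomial over polynomially many passes.
theorem PT.forN (c i f : Prog) [PT c] [hc : PV c] [PT i] [PT f] {r : ℕ → ℕ} (hr : MonoPoly r)
    (h : ∀ t O s, EnvBd t O s → ∀ x j acc, x.size ≤ s → (Data.num j).size ≤ s →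
      (f.ev t O (.pair (.pair x (.num j)) acc)).size ≤ acc.size + r s) : PT (forN c i f) := by
  obtain ⟨v, hv, hcv⟩ := hc.out
  obtain ⟨p, hp, hpc⟩ := PT.bound c
  obtain ⟨q, hq, hqi⟩ := PT.bound i
  obtain ⟨b, hb, hbf⟩ := PT.bound (.pair (.pair (.comp .fst .fst)
      (.comp .add (.pair (.comp .snd .fst) (.const (.num 1))))) f)
  -- `S` bounds the input and the counter, `M` the accumulator and `W` the whole loop state, so `b
  -- (W s)` bounds the cost of each pass.
  set S : ℕ → ℕ := fun s => s + v s + 1 with hS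
  have mS : MonoPoly S := (MonoPoly.self.add hv).add (.const 1)
  set M : ℕ → ℕ := fun s => q s + v s * r (S s) with hM
  have mM : MonoPoly M := hq.add (hv.mul (hr.comp mS))
  set W : ℕ → ℕ := fun s => S s + S s + M s + 2 with hW
  have mW : MonoPoly W := ((mS.add mS).add mM).add (.const 2)
  refine PT.of (f := fun s => (p s + (s + 3 + s + s + 1 + q s + 1) + 1) + (p s + W s + 1 + W s + 1 +
    v s * (b (W s) + 1)) + 1 + (W s + W s + 1) + 1) ?_ ?_
  · have m1 := (((hp.add (((((((MonoPoly.self.add (.const 3)).add .self).add .self).add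
      (.const 1)).add hq)).add (.const 1)))).add (.const 1))
    have m2 := (((((hp.add mW).add (.const 1)).add mW).add (.const 1)).add
      (hv.mul ((hb.comp mW).add (.const 1))))
    exact (((m1.add m2).add (.const 1)).add ((mW.add mW).add (.const 1))).add (.const 1)
  · intro t O x s he hx
    have hn := hcv t O x s he hx
    set n := (c.ev t O x).toNat with hnd
    have hacc : ∀ j ≤ n, (forVal i f t O x j).size ≤ q s + j * r (S s) := by
      intro j
      induction j with
      | zero => intro _; simpa [forVal] using (i.ev_size_le t O x).trans (hqi t O x s he hx)
      | succ j ih =>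
        intro hj
        have h1 := ih (by omega)
        have h2 := h t O (S s) (he.mono (by simp only [hS]; omega)) x j (forVal i f t O x j)
          (by simp only [hS]; omega)
          (by have := natSize_le_self j; simp only [hS, Data.size]; omega)
        simp only [forVal]
        rw [add_mul]; omega
    have hst : ∀ j ≤ n, (Data.pair (.pair x (.num j)) (forVal i f t O x j)).size ≤ W s := by
      intro j hj
      have h1 := hacc j hj
      have h2 : j * r (S s) ≤ v s * r (S s) := Nat.mul_le_mul (hj.trans hn) le_rfl
      have := natSize_le_self j
      simp only [hM] at *
      simp only [Data.size, hW, hS] at *; omega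
    have h0 := hst 0 (by omega)
    have hlast := hst n le_rfl
    have hce := c.ev_size_le t O x
    have hc1 := hpc t O x s he hx
    have hi1 := hqi t O x s he hx
    have hsum : ∑ j ∈ Finset.range n, (Prog.cost (.pair (.pair (.comp .fst .fst)
        (.comp .add (.pair (.comp .snd .fst) (.const (.num 1))))) f) t O
        (.pair (.pair x (.num j)) (forVal i f t O x j)) + 1) ≤ v s * (b (W s) + 1) := by
      refine (Finset.sum_le_card_nsmul _ _ (b (W s) + 1) fun j hj => ?_).trans ?_
      · have := hbf t O (.pair (.pair x (.num j)) (forVal i f t O x j)) (W s)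
          (he.mono (by simp only [hW, hS]; omega)) (hst j (Finset.mem_range.1 hj).le)
        omega
      · rw [Finset.card_range, smul_eq_mul]
        exact Nat.mul_le_mul_right _ hn
    have e1 : (Prog.forN c i f).cost t O x =
      (c.cost t O x + ((x.size + x.size + 1 + (x.size + 1 + 1) + 1) + i.cost t O x + 1) + 1) +
      ((c.ev t O x).size + (Data.pair (.pair x (.num 0)) (i.ev t O x)).size + 1 +
        (Data.pair (.pair x (.num 0)) (i.ev t O x)).size + 1 +
      ∑ j ∈ Finset.range n, (Prog.cost (.pair (.pair (.comp .fst .fst)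
        (.comp .add (.pair (.comp .snd .fst) (.const (.num 1))))) f) t O
        (.pair (.pair x (.num j)) (forVal i f t O x j)) + 1)) + 1 +
      ((Data.pair (.pair x (.num n)) (forVal i f t O x n)).size +
        (forVal i f t O x n).size + 1) + 1 := by
      unfold Prog.forN
      rw [cost_comp, cost_comp, cost_loop, ev_comp, ev_loop]
      simp only [ev_pair, Data.fst_pair, Data.snd_pair, ev_id, ev_const, cost_pair]
      simp only [forN_iterate]
      simp only [← hnd, cost, run, step, Data.size, Data.snd_pair]
      simp
    rw [e1]
    have h3 : (forVal i f t O x n).size ≤ W s := by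
      simp only [Data.size] at hlast; omega
    have h4 : (Data.pair (.pair x (.num 0)) (forVal i f t O x 0)).size =
      (Data.pair (.pair x (.num 0)) (i.ev t O x)).size := rfl
    omega

end FPSI

/-! ### A library of polynomial-time programs: tests, tables, searches, sums, list access. -/

namespace FPSI

namespace Prog

/-! ### Derived programs -/

abbrev numP (n : ℕ) : Prog := .const (.num n)
abbrev addP (f g : Prog) : Prog := .comp .add (.pair f g)
abbrev subP (f g : Prog) : Prog := .comp .sub (.pair f g)
abbrev mulP (f g : Prog) : Prog := .comp .mul (.pair f g)
abbrev modP (f g : Prog) : Prog := .comp .mod (.pair f g)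
/-- The test `f < g`; a test is true if its value is a nonzero number. -/
abbrev ltP (f g : Prog) : Prog := subP g f
abbrev notP (f : Prog) : Prog := .ite f (numP 0) (numP 1)
abbrev andP (f g : Prog) : Prog := .ite f g (numP 0)
abbrev leP (f g : Prog) : Prog := notP (ltP g f)
abbrev eqP (f g : Prog) : Prog := andP (leP f g) (leP g f)
/-- The number represented in unary by the value of `f`. -/
abbrev uval (f : Prog) : Prog := subP (.comp .size f) (numP 2)

/-- A program evaluates to a true value. -/
def Holds (A : Prog) (t : ℕ → ℕ) (O : Data → Data) (x : Data) : Prop := (A.ev t O x).toNat ≠ 0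

section values
variable {t : ℕ → ℕ} {O : Data → Data} {x : Data} {f g c : Prog} {a b : ℕ}

theorem ev_addP (hf : f.ev t O x = .num a) (hg : g.ev t O x = .num b) :
    (addP f g).ev t O x = .num (a + b) := by simp [hf, hg]
theorem ev_subP (hf : f.ev t O x = .num a) (hg : g.ev t O x = .num b) :
    (subP f g).ev t O x = .num (a - b) := by simp [hf, hg]
theorem ev_mulP (hf : f.ev t O x = .num a) (hg : g.ev t O x = .num b) :
    (mulP f g).ev t O x = .num (a * b) := by simp [hf, hg]
theorem ev_modP (hf : f.ev t O x = .num a) (hg : g.ev t O x = .num b) :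
    (modP f g).ev t O x = .num (a % b) := by simp [hf, hg]

theorem holds_ltP (hf : f.ev t O x = .num a) (hg : g.ev t O x = .num b) :
    (ltP f g).Holds t O x ↔ a < b := by
  simp only [Holds, ev_subP hg hf, Data.toNat_num]; omega

theorem ev_ite_holds (h : c.Holds t O x) : (Prog.ite c f g).ev t O x = f.ev t O x := by
  rw [ev_ite]
  exact if_pos h

theorem ev_ite_not (h : ¬ c.Holds t O x) : (Prog.ite c f g).ev t O x = g.ev t O x := by
  rw [ev_ite]
  exact if_neg h

theorem holds_notP : (notP f).Holds t O x ↔ ¬ f.Holds t O x := by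
  by_cases h : f.Holds t O x
  · simp only [h, not_true_eq_false, iff_false]; simp [Holds, ev_ite_holds h]
  · simp only [h, not_false_eq_true, iff_true]; simp [Holds, ev_ite_not h]

theorem holds_andP : (andP f g).Holds t O x ↔ f.Holds t O x ∧ g.Holds t O x := by
  by_cases h : f.Holds t O x
  · simp only [h, true_and]; simp only [Holds, ev_ite_holds h]
  · simp only [h, false_and, iff_false]; simp [Holds, ev_ite_not h]

theorem holds_leP (hf : f.ev t O x = .num a) (hg : g.ev t O x = .num b) :
    (leP f g).Holds t O x ↔ a ≤ b := by rw [holds_notP, holds_ltP hg hf]; omega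

theorem holds_eqP (hf : f.ev t O x = .num a) (hg : g.ev t O x = .num b) :
    (eqP f g).Holds t O x ↔ a = b := by
  rw [holds_andP, holds_leP hf hg, holds_leP hg hf]; omega

theorem holds_comp : (Prog.comp f g).Holds t O x ↔ f.Holds t O (g.ev t O x) := Iff.rfl

theorem holds_isPair : (Prog.comp .isPair f).Holds t O x ↔ ∃ a b, f.ev t O x = .pair a b := by
  simp only [Holds, ev_comp, ev_isPair]
  cases f.ev t O x <;> simp [Data.isPair]

theorem size_two_pow (n : ℕ) : Nat.size (2 ^ n) = n + 1 := Nat.size_pow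

/-- `unary n` is a leaf holding `2 ^ n`, which has `n + 1` binary digits and hence size `n + 2`;
this explains the constant subtracted in `uval`. -/
theorem ev_uval (hf : f.ev t O x = unary a) : (uval f).ev t O x = .num a := by
  simp [hf, unary, Data.size, size_two_pow]

end values

/-- `[g (x, 0), …, g (x, c x - 1)]`. -/
def tab (c g : Prog) : Prog :=
  -- Pairing builds a list from its last item, so pass `j` computes the entry with index `c x - (j +
  -- 1)`.
  forN c (numP 0) (.pair
    (.comp (.comp g (.pair .fst (subP (.comp c .fst) (addP .snd (numP 1))))) .fst) .snd)

/-- `v (x, j)` for the last `j < c x` for which `g (x, j)` is true, and `i x` if there is none. -/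
def selN (c i g v : Prog) : Prog := forN c i (.ite (.comp g .fst) (.comp v .fst) .snd)

/-- The test whether `g (x, j)` is true for some `j < c x`. -/
abbrev exN (c g : Prog) : Prog := selN c (numP 0) g (numP 1)

/-- The sum of `g (x, j)` for `j < c x`. -/
def sumN (c g : Prog) : Prog := forN c (numP 0) (addP .snd (.comp g .fst))

instance (c g : Prog) [PT c] [PV c] [PT g] : PT (tab c g) := by
  obtain ⟨p, hp, h⟩ := PT.evBound (.comp g (.pair .fst (subP (.comp c .fst) (addP .snd (numP 1)))))
  refine PT.forN _ _ _ (r := fun s => p (s + s + 1) + 1)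
    ((hp.comp ((MonoPoly.self.add .self).add (.const 1))).add (.const 1))
    fun t O s he x j acc hx hj => ?_
  have := h t O (.pair x (.num j)) (s + s + 1) (he.mono (by omega))
    (by simp only [Data.size] at *; omega)
  simp only [ev_pair, ev_comp, ev_fst, ev_snd, Data.fst_pair, Data.snd_pair, Data.size] at *
  omega

instance (c i g v : Prog) [PT c] [PV c] [PT i] [PT g] [PT v] : PT (selN c i g v) := by
  obtain ⟨p, hp, h⟩ := PT.evBound v
  refine PT.forN _ _ _ (r := fun s => p (s + s + 1))
    (hp.comp ((MonoPoly.self.add .self).add (.const 1)))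
    fun t O s he x j acc hx hj => ?_
  have := h t O (.pair x (.num j)) (s + s + 1) (he.mono (by omega))
    (by simp only [Data.size] at *; omega)
  rw [ev_ite]
  split_ifs
  · simp only [ev_comp, ev_fst, Data.fst_pair]; omega
  · simp only [ev_snd, Data.snd_pair]; omega

instance (c g : Prog) [PT c] [PV c] [PT g] : PT (sumN c g) := by
  obtain ⟨p, hp, h⟩ := PT.evBound g
  refine PT.forN _ _ _ (r := fun s => p (s + s + 1) + 1)
    ((hp.comp ((MonoPoly.self.add .self).add (.const 1))).add (.const 1))
    fun t O s he x j acc hx hj => ?_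
  have := h t O (.pair x (.num j)) (s + s + 1) (he.mono (by omega))
    (by simp only [Data.size] at *; omega)
  have h2 := Data.arith_size natSize_add (.pair acc (g.ev t O (.pair x (.num j))))
  simp only [ev_pair, ev_comp, ev_fst, ev_snd, ev_add, Data.fst_pair, Data.snd_pair, Data.size] at h2 ⊢
  exact h2.trans (by omega)

section
variable {t : ℕ → ℕ} {O : Data → Data} {x : Data} {c i g v : Prog} {n : ℕ}

theorem encList_map {α β : Type} (e : β → Data) (f : α → β) (l : List α) :
    encList e (l.map f) = encList (fun a => e (f a)) l := by
  induction l with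
  | nil => rfl
  | cons a l ih => simp [encList, ih]

theorem ev_tab_range (hc : c.ev t O x = .num n) :
    (tab c g).ev t O x = encList (fun i => g.ev t O (.pair x (.num i))) (List.range n) := by
  rw [tab, ev_forN, hc, Data.toNat_num]
  -- After `j` passes the accumulator is the list of the last `j` entries.
  suffices H : ∀ j ≤ n, forVal (numP 0) (.pair
      (.comp (.comp g (.pair .fst (subP (.comp c .fst) (addP .snd (numP 1))))) .fst) .snd) t O x j
      = encList (fun i => g.ev t O (.pair x (.num i))) (List.range' (n - j) j) by
    rw [H n le_rfl, Nat.sub_self, List.range_eq_range']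
  intro j
  induction j with
  | zero => intro _; rfl
  | succ j ih =>
    intro hj
    have : n - j = (n - (j + 1)) + 1 := by omega
    rw [List.range'_succ, ← this]
    simp [forVal, encList, ih (by omega), hc]

theorem encVec_eq_range {α : Type} (e : α → Data) (v : Fin n → α) (F : ℕ → Data)
    (h : ∀ i : Fin n, F i = e (v i)) : encList F (List.range n) = encVec e v := by
  have : List.range n = List.ofFn fun i : Fin n => (i : ℕ) := by
    apply List.ext_getElem <;> simp
  rw [encVec, this, List.ofFn_eq_map, List.ofFn_eq_map, encList_map, encList_map]
  simp only [h]

theorem ev_tab {α : Type} {e : α → Data} {w : Fin n → α} (hc : c.ev t O x = .num n)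
    (hg : ∀ i : Fin n, g.ev t O (.pair x (.num i)) = e (w i)) :
    (tab c g).ev t O x = encVec e w := by
  rw [ev_tab_range hc]
  exact encVec_eq_range e w _ hg

/-- Needed for loops that replace the whole accumulator by a new table, as `clsP` does; such a loop
must be bounded on malformed inputs too, so nothing is assumed about the form of the value of `c`.
-/
theorem tab_size_le {B : ℕ} (hB : ∀ i, (g.ev t O (.pair x (.num i))).size ≤ B) :
    ((tab c g).ev t O x).size ≤ (c.ev t O x).toNat * (B + 1) + 1 := by
  rw [tab, ev_forN]
  have hB' : ∀ y, ((Prog.comp g (.pair .fst (subP (.comp c .fst) (addP .snd (numP 1))))).ev t O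
      (.pair x (.num y))).size ≤ B := by
    intro y
    rw [ev_comp, ev_pair, ev_comp]
    generalize (Prog.pair (.comp c .fst) (addP .snd (numP 1))).ev t O (.pair x (.num y)) = d
    rw [ev_sub, ev_fst, Data.fst_pair]
    obtain ⟨k, hk⟩ : ∃ k, d.arith (· - ·) = .num k := by
      match d with
      | .num _ => exact ⟨_, rfl⟩
      | .pair (.num a) (.num b) => exact ⟨_, rfl⟩
      | .pair (.pair _ _) _ => exact ⟨_, rfl⟩
      | .pair (.num _) (.pair _ _) => exact ⟨_, rfl⟩
    rw [hk]; exact hB k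
  generalize (c.ev t O x).toNat = n
  induction n with
  | zero => simp [forVal, Data.size]
  | succ n ih =>
    have := hB' n
    rw [forVal, ev_pair, Data.size, ev_comp, ev_snd, Data.snd_pair, ev_fst, Data.fst_pair, add_mul]
    omega

theorem ev_selN (hc : c.ev t O x = .num n) :
    (∃ j < n, g.Holds t O (.pair x (.num j)) ∧
      (∀ k < n, g.Holds t O (.pair x (.num k)) → k ≤ j) ∧
      (selN c i g v).ev t O x = v.ev t O (.pair x (.num j))) ∨
    ((∀ j < n, ¬ g.Holds t O (.pair x (.num j))) ∧ (selN c i g v).ev t O x = i.ev t O x) := by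
  rw [selN, ev_forN, hc, Data.toNat_num]
  clear hc
  induction n with
  | zero => right; simp [forVal]
  | succ n ih =>
    rw [forVal]
    by_cases hn : g.Holds t O (.pair x (.num n))
    · left
      refine ⟨n, by omega, hn, fun k hk _ => by omega, ?_⟩
      rw [ev_ite_holds (by simpa [holds_comp] using hn)]; simp
    · rw [ev_ite_not (by simpa [holds_comp] using hn), ev_snd, Data.snd_pair]
      rcases ih with ⟨j, hj, h1, h2, h3⟩ | ⟨h1, h2⟩
      · left
        refine ⟨j, by omega, h1, fun k hk hgk => h2 k ?_ hgk, h3⟩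
        rcases Nat.lt_succ_iff_lt_or_eq.1 hk with h | rfl
        · exact h
        · exact absurd hgk hn
      · right
        refine ⟨fun j hj => ?_, h2⟩
        rcases Nat.lt_succ_iff_lt_or_eq.1 hj with h | rfl
        · exact h1 j h
        · exact hn

theorem holds_exN (hc : c.ev t O x = .num n) :
    (exN c g).Holds t O x ↔ ∃ j < n, g.Holds t O (.pair x (.num j)) := by
  rcases ev_selN (i := numP 0) (g := g) (v := numP 1) hc with ⟨j, hj, h1, -, h3⟩ | ⟨h1, h2⟩
  · simp only [Holds, h3, ev_const, Data.toNat_num]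
    exact ⟨fun _ => ⟨j, hj, h1⟩, fun _ => one_ne_zero⟩
  · simp only [Holds, h2, ev_const, Data.toNat_num, ne_eq, not_true_eq_false, false_iff, not_exists,
      not_and]
    exact fun j hj h => h1 j hj h

theorem ev_sumN {w : ℕ → ℕ} (hc : c.ev t O x = .num n)
    (hg : ∀ j < n, g.ev t O (.pair x (.num j)) = .num (w j)) :
    (sumN c g).ev t O x = .num (∑ j ∈ Finset.range n, w j) := by
  rw [sumN, ev_forN, hc, Data.toNat_num]
  clear hc
  induction n with
  | zero => simp [forVal]
  | succ n ih =>
    rw [forVal, Finset.sum_range_succ]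
    refine ev_addP ?_ ?_
    · simpa using ih fun j hj => hg j (by omega)
    · simpa using hg n (by omega)

end

/-! ### Access to lists -/

/-- Auxiliary loop for `dropP`. -/
def dropLoop : Prog :=
  -- The index is a binary number and may be exponentially large; the guard by the size of the list
  -- makes it an admissible loop count.
  forN (.ite (ltP .snd (.comp .size .fst)) .snd (numP 0)) .fst (.comp .snd .snd)

/-- On input `(l, i)`, the list `l` without its first `i` items. -/
def dropP : Prog := .ite (ltP .snd (.comp .size .fst)) dropLoop (numP 0)

/-- Item `I` of the list `L`. -/
abbrev nthP (L I : Prog) : Prog := .comp .fst (.comp dropP (.pair L I))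

theorem arith_sub_toNat_ne {a b : Data} (h : ((Data.pair a b).arith (· - ·)).toNat ≠ 0) :
    b.toNat < a.toNat ∧ b = .num b.toNat := by
  match a, b with
  | .num m, .num n => simp at h ⊢; omega
  | .pair _ _, _ => simp [Data.arith] at h
  | .num _, .pair _ _ => simp [Data.arith] at h

instance : PT dropLoop := by
  have : PV (.ite (ltP .snd (.comp .size .fst)) .snd (numP 0)) := by
    refine ⟨fun s => s, .self, fun t O x s he hx => ?_⟩
    rw [ev_ite]
    split_ifs with h
    · have h1 := (arith_sub_toNat_ne (a := .num x.fst.size) (b := x.snd) h).1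
      have h2 := x.fst_size
      rw [Data.toNat_num] at h1
      rw [ev_snd]
      exact (h1.trans_le (h2.trans hx)).le
    · simp
  refine PT.forN _ _ _ (MonoPoly.const 0) fun t O s _ x j acc _ _ => ?_
  simpa using acc.snd_size

instance : PT dropP := by unfold dropP; infer_instance

/-- An index rejected by the size guard of `dropP` is thus beyond the end of the list, where the
answer `0` is the empty list. -/
theorem length_lt_encList {α : Type} (e : α → Data) (l : List α) :
    l.length < (encList e l).size := by
  induction l with
  | nil => simp [encList, Data.size]
  | cons a l ih => simp only [encList, Data.size, List.length_cons]; omega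

theorem ev_dropP {α : Type} (e : α → Data) (l : List α) (t : ℕ → ℕ) (O : Data → Data) (i : ℕ) :
    dropP.ev t O (.pair (encList e l) (.num i)) = encList e (l.drop i) := by
  have hlt : (ltP .snd (.comp .size .fst)).Holds t O (.pair (encList e l) (.num i)) ↔
      i < (encList e l).size := holds_ltP rfl rfl
  rw [dropP]
  by_cases h : i < (encList e l).size
  · rw [ev_ite_holds (hlt.2 h), dropLoop, ev_forN, ev_ite_holds (hlt.2 h)]
    simp only [ev_snd, Data.snd_pair, Data.toNat_num]
    clear h hlt
    induction i with
    | zero => rfl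
    | succ i ih =>
      have hd : ∀ m : List α, (encList e m).snd = encList e m.tail := by
        intro m; cases m <;> rfl
      simp only [forVal] at *
      rw [ev_comp, ev_snd, ev_snd, Data.snd_pair]
      -- The index also occurs in the input of the loop. The passes do not read it, so it can be
      -- changed to fit the induction hypothesis.
      have hf : ∀ y z i, forVal .fst (.comp .snd .snd) t O (.pair y z) i =
          forVal .fst (.comp .snd .snd) t O (.pair y (.num 0)) i := by
        intro y z i
        induction i with
        | zero => rfl
        | succ i ih => simp [forVal, ih]
      rw [hf, ← hf _ (.num i), ih, hd, List.tail_drop]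
  · rw [ev_ite_not (fun h' => h (hlt.1 h'))]
    have := length_lt_encList e l
    rw [List.drop_eq_nil_of_le (by omega)]; rfl

theorem ev_nthP {α : Type} {e : α → Data} {n : ℕ} {w : Fin n → α} {t : ℕ → ℕ} {O : Data → Data}
    {x : Data} {L I : Prog} (hL : L.ev t O x = encVec e w) {i : ℕ} (hI : I.ev t O x = .num i)
    (hi : i < n) : (nthP L I).ev t O x = e (w ⟨i, hi⟩) := by
  rw [ev_comp, ev_comp, ev_pair, hL, hI, encVec, ev_dropP,
    List.drop_eq_getElem_cons (by simpa using hi)]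
  simp [encList]

end Prog
end FPSI

/-! ### Interpreting one program inside another. -/

namespace FPSI
namespace Prog

/-! ### Running a program with simulated tape and oracle -/

/-- The program that on input `(env, x)` runs a program on `x`, where queries and accesses to the
random tape are answered by `Q` and `R`, which are given `env`. -/
def sim (Q R : Prog) : Prog → Prog
  | .id => .snd
  | .const c => .const c
  | .comp f g => .comp (sim Q R f) (.pair .fst (sim Q R g))
  | .pair f g => .pair (sim Q R f) (sim Q R g)
  | .fst => .comp .fst .snd
  | .snd => .comp .snd .snd
  | .isPair => .comp .isPair .snd
  | .size => .comp .size .snd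
  | .add => .comp .add .snd
  | .sub => .comp .sub .snd
  | .mul => .comp .mul .snd
  | .div => .comp .div .snd
  | .mod => .comp .mod .snd
  | .xor => .comp .xor .snd
  | .ite c f g => .ite (sim Q R c) (sim Q R f) (sim Q R g)
  | .loop f => .comp .snd (.comp (.loop (.pair .fst (sim Q R f)))
      (.pair (.comp .fst .snd) (.pair .fst (.comp .snd .snd))))
  | .rand => R
  | .query => Q

variable {Q R : Prog} {t t' : ℕ → ℕ} {O O' : Data → Data} {env : Data}

theorem sim_loop_iterate {f : Prog}
    (h : ∀ x, (sim Q R f).ev t O (.pair env x) = f.ev t' O' x) (n : ℕ) (x : Data) :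
    ((Prog.pair .fst (sim Q R f)).ev t O)^[n] (.pair env x) = .pair env ((f.ev t' O')^[n] x) := by
  induction n with
  | zero => rfl
  | succ n ih => rw [Function.iterate_succ_apply', Function.iterate_succ_apply', ih]; simp [h]

theorem ev_sim (hQ : ∀ x, Q.ev t O (.pair env x) = O' x)
    (hR : ∀ x, R.ev t O (.pair env x) = .num (t' x.toNat)) (P : Prog) :
    ∀ x, (sim Q R P).ev t O (.pair env x) = P.ev t' O' x := by
  induction P with
  | comp f g hf hg => intro x; simp only [sim, ev_comp, ev_pair, ev_fst, Data.fst_pair, hg, hf]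
  | pair f g hf hg => intro x; simp only [sim, ev_pair, hg, hf]
  | ite c f g hc hf hg => intro x; simp only [sim, ev_ite, hc, hg, hf]
  | loop f hf =>
    intro x
    simp only [sim, ev_comp, ev_pair, ev_fst, ev_snd, ev_loop, Data.fst_pair, Data.snd_pair,
      sim_loop_iterate hf]
  | rand => intro x; simp only [sim, hR, ev_rand]
  | query => intro x; simp only [sim, hQ, ev_query]
  | _ => intro x; rfl

theorem one_le_cost (A : Prog) (t : ℕ → ℕ) (O : Data → Data) (x : Data) : 1 ≤ A.cost t O x :=
  x.one_le_size.trans (A.size_le_cost t O x)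

/-- Every datum in the simulated run is no larger than its step count, hence than `M`, so each
simulated step costs at most `F M`. The term `40 * (M + 1)` pays for copying `env` and for the extra
projections and pairings. -/
theorem cost_sim {F : ℕ → ℕ} (hQ : ∀ x, Q.ev t O (.pair env x) = O' x)
    (hR : ∀ x, R.ev t O (.pair env x) = .num (t' x.toNat)) {M : ℕ} (henv : env.size ≤ M)
    (hF : 40 * (M + 1) ≤ F M)
    (hQc : ∀ x, x.size ≤ M → Q.cost t O (.pair env x) ≤ F M)
    (hRc : ∀ x, x.size ≤ M → R.cost t O (.pair env x) ≤ F M) (P : Prog) :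
    ∀ x, P.cost t' O' x ≤ M → (sim Q R P).cost t O (.pair env x) ≤ P.cost t' O' x * F M := by
  have key : ∀ (p : Prog) (x : Data), p.cost t' O' x ≤ M → p.cost t O x = p.cost t' O' x →
      (Prog.comp p .snd).cost t O (.pair env x) ≤ p.cost t' O' x * F M := by
    intro p x hM he
    have h1 := Nat.le_mul_of_pos_left (F M) (p.one_le_cost t' O' x)
    have h2 := p.size_le_cost t' O' x
    rw [cost_comp, ev_snd, Data.snd_pair, he]
    have : Prog.snd.cost t O (.pair env x) = env.size + x.size + 1 + x.size + 1 := rfl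
    omega
  induction P with
  | id =>
    intro x hM
    have h1 := Nat.le_mul_of_pos_left (F M) (Prog.id.one_le_cost t' O' x)
    have h2 := Prog.id.size_le_cost t' O' x
    have : (sim Q R .id).cost t O (.pair env x) = env.size + x.size + 1 + x.size + 1 := rfl
    omega
  | const c =>
    intro x hM
    have h1 := Nat.le_mul_of_pos_left (F M) ((Prog.const c).one_le_cost t' O' x)
    have h2 := (Prog.const c).size_le_cost t' O' x
    have h3 : (Prog.const c).cost t' O' x = x.size + c.size + 1 := rfl
    have : (sim Q R (.const c)).cost t O (.pair env x) = env.size + x.size + 1 + c.size + 1 := rfl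
    omega
  | comp f g hf hg =>
    intro x hM
    have hx := g.size_le_cost t' O' x
    rw [cost_comp] at hM
    have h1 := hg x (by omega)
    have h2 := hf (g.ev t' O' x) (by omega)
    rw [sim, cost_comp, cost_pair, ev_pair, ev_sim hQ hR, ev_fst, Data.fst_pair, cost_comp, add_mul,
      add_mul]
    have : Prog.fst.cost t O (.pair env x) = env.size + x.size + 1 + env.size + 1 := rfl
    omega
  | pair f g hf hg =>
    intro x hM
    rw [cost_pair] at hM
    have h1 := hg x (by omega)
    have h2 := hf x (by omega)
    rw [sim, cost_pair, cost_pair, add_mul, add_mul]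
    omega
  | ite c f g hc hf hg =>
    intro x hM
    rw [cost_ite] at hM
    have h1 := hc x (by omega)
    rw [sim, cost_ite, cost_ite, ev_sim hQ hR, add_mul, add_mul]
    split_ifs at hM ⊢
    · have := hf x (by omega); omega
    · have := hg x (by omega); omega
  | loop f hf =>
    intro x hM
    have hx := (Prog.loop f).size_le_cost t' O' x
    have hy := (Prog.loop f).ev_size_le t' O' x
    have hn := x.snd_size
    have hm := x.fst_size
    have hp := x.one_le_size
    have hev := ev_sim hQ hR (.loop f) x
    have hsum : ∀ i < x.fst.toNat, (Prog.pair .fst (sim Q R f)).cost t O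
        (.pair env ((f.ev t' O')^[i] x.snd)) + 1 ≤ (f.cost t' O' ((f.ev t' O')^[i] x.snd) + 1) * F M
        := by
      intro i hi
      have hle : f.cost t' O' ((f.ev t' O')^[i] x.snd) + 1 ≤ ∑ i ∈ Finset.range x.fst.toNat,
          (f.cost t' O' ((f.ev t' O')^[i] x.snd) + 1) :=
        Finset.single_le_sum (f := fun i => f.cost t' O' ((f.ev t' O')^[i] x.snd) + 1)
          (fun _ _ => Nat.zero_le _) (Finset.mem_range.2 hi)
      rw [cost_loop] at hM
      have h1 := hf ((f.ev t' O')^[i] x.snd) (by omega)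
      have h2 := f.size_le_cost t' O' ((f.ev t' O')^[i] x.snd)
      rw [cost_pair, add_mul]
      have : Prog.fst.cost t O (.pair env ((f.ev t' O')^[i] x.snd)) =
        env.size + ((f.ev t' O')^[i] x.snd).size + 1 + env.size + 1 := rfl
      omega
    have hs := Finset.sum_le_sum fun i hi => hsum i (Finset.mem_range.1 hi)
    rw [← Finset.sum_mul] at hs
    have h0 : F M ≤ (x.size + x.snd.size + 1) * F M := Nat.le_mul_of_pos_left _ (by omega)
    rw [ev_loop] at hy
    rw [sim, cost_comp, cost_comp, cost_loop, cost_loop, add_mul, cost_pair, cost_pair, cost_comp,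
      cost_comp]
    simp only [ev_comp, ev_pair, ev_fst, ev_snd, ev_loop, Data.fst_pair, Data.snd_pair,
      sim_loop_iterate (ev_sim hQ hR f)]
    simp only [cost, run, step, Data.fst_pair, Data.snd_pair, Data.size] at *
    omega
  | rand =>
    intro x hM
    have h2 := Prog.rand.size_le_cost t' O' x
    exact (hRc x (by omega)).trans
      (Nat.le_mul_of_pos_left (F M) (Prog.rand.one_le_cost t' O' x))
  | query =>
    intro x hM
    have h2 := Prog.query.size_le_cost t' O' x
    exact (hQc x (by omega)).trans
      (Nat.le_mul_of_pos_left (F M) (Prog.query.one_le_cost t' O' x))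
  | _ => intro x hM; exact key _ x hM rfl

/-- The simulation of a polynomial-time program runs in polynomial time if the sizes of the
simulated words and answers are bounded independently of the query. -/
theorem PT_sim {Q R I A : Prog} [PT Q] [PT R] [PT I] [hA : PT A] {b : ℕ → ℕ} (hb : MonoPoly b)
    (hR : ∀ t O env x, ∃ n, R.ev t O (.pair env x) = .num n)
    (hR' : ∀ t O env x, R.ev t O (.pair env x) = R.ev t O (.pair env (.num x.toNat)))
    (hbd : ∀ t O s env x, EnvBd t O s → env.size ≤ s → (Q.ev t O (.pair env x)).size ≤ b s ∧
      (R.ev t O (.pair env x)).size ≤ b s)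
    (hI : ∀ t O x, ∃ env y, I.ev t O x = .pair env y) : PT (.comp (sim Q R A) I) := by
  obtain ⟨p, hp, hI'⟩ := PT.bound I
  obtain ⟨q, hq, hQ⟩ := PT.bound Q
  obtain ⟨r, hr, hR''⟩ := PT.bound R
  obtain ⟨a, ha, hA'⟩ := PT.bound A
  -- `F` is the overhead per simulated step, `S` bounds the environment, and `C` bounds the number
  -- of simulated steps.
  set F : ℕ → ℕ := fun M => 40 * (M + 1) + q (M + M + 1) + r (M + M + 1) with hF
  have mF : MonoPoly F := (((MonoPoly.const 40).mul (MonoPoly.self.add (.const 1))).add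
    (hq.comp ((MonoPoly.self.add .self).add (.const 1)))).add
    (hr.comp ((MonoPoly.self.add .self).add (.const 1)))
  set S : ℕ → ℕ := fun s => s + p s with hS
  have mS : MonoPoly S := MonoPoly.self.add hp
  set C : ℕ → ℕ := fun s => a (S s + b (S s)) with hC
  have mC : MonoPoly C := ha.comp (mS.add (hb.comp mS))
  refine PT.of (f := fun s => p s + C s * F (S s + C s) + 1)
    ((hp.add (mC.mul (mF.comp (mS.add mC)))).add (.const 1)) fun t O x s he hx => ?_
  obtain ⟨env, y, hy⟩ := hI t O x
  have h1 := hI' t O x s he hx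
  have h2 := I.ev_size_le t O x
  rw [hy, Data.size] at h2
  set t' : ℕ → ℕ := fun n => (R.ev t O (.pair env (.num n))).toNat
  set O' : Data → Data := fun x => Q.ev t O (.pair env x)
  have hRt : ∀ x, R.ev t O (.pair env x) = .num (t' x.toNat) := by
    intro x
    obtain ⟨n, hn⟩ := hR t O env (.num x.toNat)
    simp only [t', hR' t O env x, hn, Data.toNat_num]
  have heS : EnvBd t O (S s) := he.mono (by simp only [hS]; omega)
  have henv : env.size ≤ S s := by simp only [hS]; omega
  -- The time bound of `A` refers to the sizes of answers and words. These are at most `b (S s)`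
  -- whatever is asked, so there is no circular dependence on the length of the queries.
  have hcost : A.cost t' O' y ≤ C s := by
    refine hA' t' O' y _ ⟨fun n => ?_, fun z => ?_⟩ ?_
    · have := (hbd t O (S s) env (.num n) heS henv).2
      rw [hRt] at this
      exact this.trans (by omega)
    · exact (hbd t O (S s) env z heS henv).1.trans (by omega)
    · simp only [hS]; omega
  rw [cost_comp, hy]
  have := cost_sim (F := F) (M := S s + C s) (t' := t') (O' := O') (fun _ => rfl) hRt (by omega)
    (by simp only [hF]; omega)
    (fun x hx => (hQ t O _ (S s + C s + (S s + C s) + 1) (heS.mono (by omega))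
      (by simp only [Data.size]; omega)).trans (by simp only [hF]; omega))
    (fun x hx => (hR'' t O _ (S s + C s + (S s + C s) + 1) (heS.mono (by omega))
      (by simp only [Data.size]; omega)).trans (by simp only [hF]; omega)) A y (by omega)
  have h3 : A.cost t' O' y * F (S s + C s) ≤ C s * F (S s + C s) := Nat.mul_le_mul_right _ hcost
  omega

end Prog
end FPSI

/-! ### Acceptance probabilities as finite averages, and maps that preserve averages. -/

namespace FPSI

open scoped BigOperators
open Finset (expect)

/-! ### Averages -/

section average
variable {α β : Type*} [Fintype α] [Fintype β]

theorem abs_expect_sub_le {f g c : α → ℝ} (h : ∀ a, |f a - g a| ≤ c a) :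
    |(𝔼 a, f a) - 𝔼 a, g a| ≤ 𝔼 a, c a := by
  rw [← Finset.expect_sub_distrib]
  exact (Finset.abs_expect_le _ _).trans (Finset.expect_le_expect fun a _ => h a)

theorem expect_le_const [Nonempty α] {f : α → ℝ} {c : ℝ} (h : ∀ a, f a ≤ c) : 𝔼 a, f a ≤ c :=
  (Finset.expect_le_expect fun a _ => h a).trans (Fintype.expect_const c).le

theorem expect_nonneg' {f : α → ℝ} (h : ∀ a, 0 ≤ f a) : 0 ≤ 𝔼 a, f a :=
  Finset.expect_nonneg fun a _ => h a

theorem abs_expect_sub_le_const [Nonempty α] {f g : α → ℝ} {c : ℝ} (h : ∀ a, |f a - g a| ≤ c) :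
    |(𝔼 a, f a) - 𝔼 a, g a| ≤ c :=
  (abs_expect_sub_le h).trans (expect_le_const fun _ => le_rfl)

theorem expect_congr' {f g : α → ℝ} (h : ∀ a, f a = g a) : 𝔼 a, f a = 𝔼 a, g a :=
  Finset.expect_congr rfl fun a _ => h a

theorem expect_prod (f : α × β → ℝ) : 𝔼 x, f x = 𝔼 a, 𝔼 b, f (a, b) := by
  rw [← Finset.univ_product_univ, Finset.expect_product]

end average

/-- A map all of whose fibres have the same cardinality, so that it preserves averages. -/
def Balanced {X Y : Type} (φ : X → Y) : Prop :=
  ∃ (C : Type) (_ : Fintype C) (_ : Nonempty C) (e : X ≃ Y × C), ∀ x, (e x).1 = φ x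

namespace Balanced
variable {X Y Z X' Y' K K' : Type}

theorem expect [Fintype X] [Fintype Y] {φ : X → Y} (hφ : Balanced φ) (h : Y → ℝ) :
    𝔼 x, h (φ x) = 𝔼 y, h y := by
  obtain ⟨C, _, _, e, he⟩ := hφ
  rw [Fintype.expect_equiv e _ (fun p => h p.1) fun x => by rw [he], expect_prod]
  exact expect_congr' fun y => Fintype.expect_const (h y)

theorem of_equiv (e : X ≃ Y) : Balanced e :=
  ⟨Unit, inferInstance, inferInstance, e.trans (Equiv.prodPUnit Y).symm, fun _ => rfl⟩

theorem comp {ψ : Y → Z} {φ : X → Y} (hψ : Balanced ψ) (hφ : Balanced φ) :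
    Balanced fun x => ψ (φ x) := by
  obtain ⟨C, _, _, e, he⟩ := hφ
  obtain ⟨C', _, _, e', he'⟩ := hψ
  refine ⟨C' × C, inferInstance, inferInstance,
    e.trans ((e'.prodCongr (.refl _)).trans (Equiv.prodAssoc _ _ _)), fun x => ?_⟩
  simp [he, he']

theorem prodMap {φ : X → Y} {ψ : X' → Y'} (hφ : Balanced φ) (hψ : Balanced ψ) :
    Balanced (Prod.map φ ψ) := by
  obtain ⟨C, _, _, e, he⟩ := hφ
  obtain ⟨C', _, _, e', he'⟩ := hψ
  exact ⟨C × C', inferInstance, inferInstance,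
    (e.prodCongr e').trans (Equiv.prodProdProdComm _ _ _ _), fun x => by simp [he, he', Prod.map]⟩

theorem unit [Fintype X] [Nonempty X] : Balanced fun _ : X => () :=
  ⟨X, inferInstance, inferInstance, (Equiv.punitProd X).symm, fun _ => rfl⟩

theorem arrow [Finite K] {φ : X → Y} (hφ : Balanced φ) :
    Balanced fun (f : K → X) k => φ (f k) := by
  obtain ⟨C, _, _, e, he⟩ := hφ
  have := Fintype.ofFinite K
  classical
  refine ⟨K → C, inferInstance, inferInstance,
    (Equiv.arrowCongr (.refl _) e).trans (Equiv.arrowProdEquivProdArrow _ _ _), fun f => ?_⟩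
  ext k
  simp [Equiv.arrowProdEquivProdArrow, he]

/-- Each fibre is the set of functions on the complement of the range of `e`. In this form distinct
tape addresses, and values of a random function at distinct points, are independent and uniform. -/
theorem restrict [Finite K'] [Fintype X] [Nonempty X] {e : K → K'} (he : e.Injective) :
    Balanced fun (f : K' → X) k => f (e k) := by
  classical
  have := Fintype.ofFinite K'
  refine ⟨{x // x ∉ Set.range e} → X, inferInstance, inferInstance,
    (Equiv.piEquivPiSubtypeProd (· ∈ Set.range e) fun _ => X).trans
      (((Equiv.ofInjective e he).symm.arrowCongr (.refl X)).prodCongr (.refl _)), fun f => ?_⟩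
  ext k
  simp [Equiv.piEquivPiSubtypeProd]

theorem cons {n : ℕ} {φ : X → Y} {ψ : (Fin n → X) → Y'} (hφ : Balanced φ) (hψ : Balanced ψ) :
    Balanced fun f : Fin (n + 1) → X => (φ (f 0), ψ fun i => f i.succ) := by
  have := (hφ.prodMap hψ).comp (of_equiv (Fin.consEquiv fun _ : Fin (n + 1) => X).symm)
  exact this

theorem sum {φ : (K → X) → Y} {ψ : (K' → X) → Y'} (hφ : Balanced φ) (hψ : Balanced ψ) :
    Balanced fun f : K ⊕ K' → X => (φ fun k => f (.inl k), ψ fun k => f (.inr k)) :=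
  (hφ.prodMap hψ).comp (of_equiv (Equiv.sumArrowEquivProdArrow K K' X))

end Balanced

/-! ### The binary field as a set of numbers -/

theorem BF.toNat_ofNat (ℓ v : ℕ) : (BF.ofNat ℓ v).toNat = v % 2 ^ ℓ := by
  unfold BF.toNat BF.ofNat
  induction ℓ with
  | zero => simp [Nat.mod_one]
  | succ ℓ ih =>
    rw [Fin.sum_univ_castSucc]
    simp only [Fin.val_castSucc, Fin.val_last]
    rw [ih, Nat.mod_pow_succ, ZMod.val_natCast, mul_comm]

theorem BF.ofNat_inj {ℓ a b : ℕ} (ha : a < 2 ^ ℓ) (hb : b < 2 ^ ℓ)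
    (h : BF.ofNat ℓ a = BF.ofNat ℓ b) : a = b := by
  have := congrArg BF.toNat h
  rwa [toNat_ofNat, toNat_ofNat, Nat.mod_eq_of_lt ha, Nat.mod_eq_of_lt hb] at this

/-- Numbers below `2 ^ ℓ` as bit strings. -/
noncomputable def BF.equiv (ℓ : ℕ) : Fin (2 ^ ℓ) ≃ BF ℓ :=
  Equiv.ofBijective (fun i => BF.ofNat ℓ i) <| by
    rw [Fintype.bijective_iff_injective_and_card]
    exact ⟨fun a b h => Fin.ext (ofNat_inj a.2 b.2 h), by simp [ZMod.card]⟩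

theorem BF.toNat_lt {ℓ : ℕ} (x : BF ℓ) : x.toNat < 2 ^ ℓ := by
  obtain ⟨i, rfl⟩ := (BF.equiv ℓ).surjective x
  exact (toNat_ofNat ℓ i).trans_lt (Nat.mod_lt _ (by positivity))

theorem BF.ofNat_toNat {ℓ : ℕ} (x : BF ℓ) : BF.ofNat ℓ x.toNat = x := by
  obtain ⟨i, rfl⟩ := (BF.equiv ℓ).surjective x
  change BF.ofNat ℓ (BF.toNat (BF.ofNat ℓ i)) = BF.ofNat ℓ i
  rw [toNat_ofNat, Nat.mod_eq_of_lt i.2]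

theorem BF.toNat_injective {ℓ : ℕ} : Function.Injective (BF.toNat (ℓ := ℓ)) := fun a b h => by
  rw [← a.ofNat_toNat, h, b.ofNat_toNat]

theorem BF.ofNat_mod (ℓ v : ℕ) : BF.ofNat ℓ (v % 2 ^ ℓ) = BF.ofNat ℓ v := by
  rw [← toNat_ofNat, ofNat_toNat]

/-- Because `2 ^ ℓ` divides `2 ^ T`, residues of uniform words are exactly uniform; field elements
and arithmetic shares are therefore sampled without error. -/
theorem balanced_mod {T ℓ : ℕ} (h : ℓ ≤ T) : Balanced fun w : Fin (2 ^ T) =>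
    (⟨w % 2 ^ ℓ, Nat.mod_lt _ (by positivity)⟩ : Fin (2 ^ ℓ)) := by
  have e : 2 ^ T = 2 ^ (T - ℓ) * 2 ^ ℓ := by rw [← pow_add]; congr 1; omega
  refine ⟨Fin (2 ^ (T - ℓ)), inferInstance, inferInstance,
    (finCongr e).trans (finProdFinEquiv.symm.trans (Equiv.prodComm _ _)), fun w => ?_⟩
  ext
  simp [finProdFinEquiv]

theorem balanced_ofNat {T ℓ : ℕ} (h : ℓ ≤ T) :
    Balanced fun w : Fin (2 ^ T) => BF.ofNat ℓ w := by
  have H := (Balanced.of_equiv (BF.equiv ℓ)).comp (balanced_mod h)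
  convert H using 2 with w
  exact (BF.ofNat_mod ℓ w).symm

theorem balanced_zmod {T ℓ : ℕ} (h : ℓ ≤ T) :
    Balanced fun w : Fin (2 ^ T) => ((w : ℕ) : ZMod (2 ^ ℓ)) := by
  have hb : Function.Bijective fun i : Fin (2 ^ ℓ) => ((i : ℕ) : ZMod (2 ^ ℓ)) := by
    rw [Fintype.bijective_iff_injective_and_card]
    refine ⟨fun a b h => Fin.ext ?_, by simp [ZMod.card]⟩
    have := congrArg ZMod.val h
    simpa [ZMod.val_natCast, Nat.mod_eq_of_lt a.2, Nat.mod_eq_of_lt b.2] using this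
  have H := (Balanced.of_equiv (Equiv.ofBijective _ hb)).comp (balanced_mod h)
  convert H using 2 with w
  simp

/-! ### Acceptance probabilities as averages -/

/-- The probability that `D` outputs `1` on a view. -/
noncomputable def accept (D : Adversary) (s : ℕ) (v : View) : ℝ :=
  𝔼 ω : Fin (2 ^ D.tapeLen.eval s) → Fin (2 ^ D.tapeLen.eval s),
    open Classical in
    if D.prog.ev (tapeOf ω) v.2 (.pair (unary s) (.pair (D.advice s) v.1)) = .num 1 then 1 else 0

/-- The passage from `PMF` to averages over finite types, the form in which all later hybrid steps
are carried out. -/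
theorem uniform_bind_toReal {α β : Type} [Fintype α] [Nonempty α] (f : α → PMF β) (b : β) :
    ((PMF.uniformOfFintype α >>= f) b).toReal = 𝔼 a, (f a b).toReal := by
  rw [show (PMF.uniformOfFintype α >>= f) = (PMF.uniformOfFintype α).bind f from rfl,
    PMF.bind_apply, tsum_fintype, ENNReal.toReal_sum, Fintype.expect_eq_sum_div_card,
    Finset.sum_div]
  · refine Finset.sum_congr rfl fun a _ => ?_
    simp [ENNReal.toReal_mul, div_eq_inv_mul]
  · intro a _
    exact ENNReal.mul_ne_top (PMF.apply_ne_top _ _) (PMF.apply_ne_top _ _)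

theorem acceptProb_bind {α : Type} [Fintype α] [Nonempty α] (D : Adversary) (s : ℕ)
    (f : α → PMF View) :
    acceptProb D s (PMF.uniformOfFintype α >>= f) = 𝔼 a, acceptProb D s (f a) := by
  unfold acceptProb
  rw [bind_assoc, uniform_bind_toReal]

theorem acceptProb_pure (D : Adversary) (s : ℕ) (v : View) :
    acceptProb D s (pure v) = accept D s v := by
  unfold acceptProb accept
  rw [pure_bind, uniform_bind_toReal]
  refine expect_congr' fun ω => ?_
  rw [show (pure (D.prog.run (tapeOf ω) v.2 (.pair (unary s) (.pair (D.advice s) v.1))).1 :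
    PMF Data) = PMF.pure (D.prog.ev (tapeOf ω) v.2 (.pair (unary s) (.pair (D.advice s) v.1)))
    from rfl, PMF.pure_apply]
  by_cases h : D.prog.ev (tapeOf ω) v.2 (.pair (unary s) (.pair (D.advice s) v.1)) = .num 1
  · rw [if_pos h, if_pos h.symm]; simp
  · rw [if_neg h, if_neg (Ne.symm h)]; simp

theorem acceptProb_map {α : Type} [Fintype α] [Nonempty α] (D : Adversary) (s : ℕ)
    (f : α → View) :
    acceptProb D s (f <$> PMF.uniformOfFintype α) = 𝔼 a, accept D s (f a) := by
  rw [map_eq_bind_pure_comp, acceptProb_bind]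
  exact expect_congr' fun a => acceptProb_pure D s _

theorem accept_nonneg (D : Adversary) (s : ℕ) (v : View) : 0 ≤ accept D s v :=
  expect_nonneg' fun _ => by split_ifs <;> simp

theorem accept_le_one (D : Adversary) (s : ℕ) (v : View) : accept D s v ≤ 1 :=
  expect_le_const fun _ => by split_ifs <;> simp

theorem abs_accept_sub_le_one (D : Adversary) (s : ℕ) (v w : View) :
    |accept D s v - accept D s w| ≤ 1 := by
  have := accept_nonneg D s v
  have := accept_nonneg D s w
  have := accept_le_one D s v
  have := accept_le_one D s w
  rw [abs_le]; constructor <;> linarith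

/-! ### Negligible functions -/

namespace Negligible

theorem add {μ ν : ℕ → ℝ} (hμ : Negligible μ) (hν : Negligible ν) :
    Negligible fun s => μ s + ν s := Asymptotics.SuperpolynomialDecay.add hμ hν

theorem mono {μ ν : ℕ → ℝ} (hμ : Negligible μ) (h : ∀ s, |ν s| ≤ |μ s|) : Negligible ν :=
  Asymptotics.SuperpolynomialDecay.trans_abs_le hμ h

theorem poly_mul {μ : ℕ → ℝ} {f : ℕ → ℕ} (hμ : Negligible μ) (hf : PolyBounded f) :
    Negligible fun s => (f s : ℝ) * μ s := by
  obtain ⟨q, hq⟩ := hf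
  have := Asymptotics.SuperpolynomialDecay.polynomial_mul hμ (q.map (Nat.castRingHom ℝ))
  refine mono this fun s => ?_
  rw [abs_mul, abs_mul]
  refine mul_le_mul_of_nonneg_right ?_ (abs_nonneg _)
  have e : Polynomial.eval (s : ℝ) (q.map (Nat.castRingHom ℝ)) = ((q.eval s : ℕ) : ℝ) := by
    rw [show (s : ℝ) = Nat.castRingHom ℝ s from rfl, Polynomial.eval_map, Polynomial.eval₂_hom]
    rfl
  rw [e, Nat.abs_cast, Nat.abs_cast]
  exact_mod_cast hq s

theorem two_pow : Negligible fun s => ((2 : ℝ) ^ s)⁻¹ := by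
  intro n
  have := tendsto_pow_const_mul_const_pow_of_abs_lt_one n (r := (1 / 2 : ℝ)) (by norm_num [abs_lt])
  refine this.congr fun s => ?_
  simp

theorem const_mul {μ : ℕ → ℝ} (c : ℕ) (hμ : Negligible μ) : Negligible fun s => (c : ℝ) * μ s :=
  hμ.poly_mul (f := fun _ => c) ⟨.C c, fun s => by simp⟩

end Negligible

end FPSI

/-! ### The reduction from distinguishing views to breaking the PRF. -/

namespace FPSI

open scoped BigOperators
open Finset (expect)
open Prog

theorem ev_notP (f : Prog) (t : ℕ → ℕ) (O : Data → Data) (x : Data) [Decidable (f.Holds t O x)] :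
    (notP f).ev t O x = .num (if f.Holds t O x then 0 else 1) := by
  split_ifs with h
  · rw [ev_ite_holds h, ev_const]
  · rw [ev_ite_not h, ev_const]

theorem ev_eqP {t : ℕ → ℕ} {O : Data → Data} {x : Data} {f g : Prog} {a b : ℕ}
    (hf : f.ev t O x = .num a) (hg : g.ev t O x = .num b) :
    (eqP f g).ev t O x = .num (if a = b then 1 else 0) := by
  classical
  have h1 := holds_leP hf hg
  have h2 := holds_ltP hf hg
  by_cases h : a ≤ b
  · rw [ev_ite_holds (h1.2 h), ev_notP]
    by_cases h' : a < b
    · rw [if_pos (h2.2 h'), if_neg h'.ne]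
    · rw [if_neg fun k => h' (h2.1 k), if_pos (by omega)]
  · rw [ev_ite_not fun k => h (h1.1 k), if_neg (by omega), ev_const]

/-! ### Sizes of encodings -/

theorem encVec_size_le {α : Type} {n B : ℕ} {e : α → Data} {v : Fin n → α}
    (h : ∀ i, (e (v i)).size ≤ B) : (encVec e v).size ≤ n * (B + 1) + 1 := by
  have : ∀ l : List α, (∀ a ∈ l, (e a).size ≤ B) → (encList e l).size ≤ l.length * (B + 1) + 1 := by
    intro l
    induction l with
    | nil => intro _; simp [encList, Data.size]
    | cons a l ih =>
      intro hl
      have h1 := hl a (by simp)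
      have h2 := ih fun b hb => hl b (by simp [hb])
      simp only [encList, Data.size, List.length_cons]
      rw [add_mul]; omega
  have := this (List.ofFn v) fun a ha => by
    obtain ⟨i, rfl⟩ := List.mem_ofFn.1 ha
    exact h i
  simpa [encVec] using this

theorem size_num_of_lt {v n : ℕ} (h : v < 2 ^ n) : (Data.num v).size ≤ n + 1 := by
  simp only [Data.size]; have := Nat.size_le.2 h; omega

theorem encBF_size {ℓ : ℕ} (x : BF ℓ) : (encBF x).size ≤ ℓ + 1 := size_num_of_lt x.toNat_lt

theorem unary_size (n : ℕ) : (unary n).size = n + 2 := by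
  simp [unary, Data.size, size_two_pow]

theorem encBF_injective {ℓ : ℕ} : Function.Injective (encBF (ℓ := ℓ)) := fun a b h => by
  simp only [encBF, Data.num.injEq] at h
  exact BF.toNat_injective h

theorem oracleOf_apply {α : Type} {ℓ : ℕ} {e : α → Data} (he : Function.Injective e)
    (f : α → BF ℓ) (a : α) : oracleOf e f (e a) = encBF (f a) := by
  have h : ∃ b, e b = e a := ⟨a, rfl⟩
  rw [oracleOf, dif_pos h, he h.choose_spec]

theorem PolyBounded.add {f g : ℕ → ℕ} (hf : PolyBounded f) (hg : PolyBounded g) :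
    PolyBounded fun s => f s + g s := by
  obtain ⟨p, hp⟩ := hf
  obtain ⟨q, hq⟩ := hg
  exact ⟨p + q, fun s => by simpa using add_le_add (hp s) (hq s)⟩

theorem PolyBounded.mul {f g : ℕ → ℕ} (hf : PolyBounded f) (hg : PolyBounded g) :
    PolyBounded fun s => f s * g s := by
  obtain ⟨p, hp⟩ := hf
  obtain ⟨q, hq⟩ := hg
  exact ⟨p * q, fun s => by simpa using Nat.mul_le_mul (hp s) (hq s)⟩

theorem PolyBounded.const (c : ℕ) : PolyBounded fun _ => c := (MonoPoly.const c).poly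

theorem PolyBounded.mono {f g : ℕ → ℕ} (hf : PolyBounded f) (h : ∀ s, g s ≤ f s) :
    PolyBounded g := by
  obtain ⟨p, hp⟩ := hf
  exact ⟨p, fun s => (h s).trans (hp s)⟩

/-! ### The reduction to pseudorandomness -/

theorem arith_eq_num (op : ℕ → ℕ → ℕ) (d : Data) : ∃ k, d.arith op = .num k := by
  match d with
  | .num _ => exact ⟨_, rfl⟩
  | .pair (.num a) (.num b) => exact ⟨_, rfl⟩
  | .pair (.pair _ _) _ => exact ⟨_, rfl⟩
  | .pair (.num _) (.pair _ _) => exact ⟨_, rfl⟩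

theorem arith_add_zero (x : Data) : (Data.pair x (.num 0)).arith (· + ·) = .num x.toNat := by
  cases x <;> simp [Data.arith, Data.toNat]

/-- Access to a tape of words of `T` bits, simulated on input `((2 ^ T, ctx), x)`. -/
def tapeP : Prog :=
  -- Adding `0` turns any datum into the number that `rand` would use as an address. The residue 15
  -- modulo 16 of the outer tape is reserved for the tape of the inner adversary.
  .ite (ltP (addP .snd (numP 0)) (.comp .fst .fst))
    (modP (.comp .rand (addP (mulP (numP 16) (addP .snd (numP 0))) (numP 15))) (.comp .fst .fst))
    (numP 0)

/-- The part of the tape of an adversary that it uses to run another one. -/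
def subtape (T : ℕ) (t : ℕ → ℕ) (a : Fin (2 ^ T)) : Fin (2 ^ T) :=
  ⟨t (16 * a + 15) % 2 ^ T, Nat.mod_lt _ (by positivity)⟩

theorem ev_tapeP (T : ℕ) (t : ℕ → ℕ) (O : Data → Data) (ctx x : Data) :
    tapeP.ev t O (.pair (.pair (.num (2 ^ T)) ctx) x) = .num (tapeOf (subtape T t) x.toNat) := by
  have h1 : (addP .snd (numP 0)).ev t O (.pair (.pair (.num (2 ^ T)) ctx) x) = .num x.toNat := by
    simp [arith_add_zero]
  have h2 : (Prog.comp .fst .fst).ev t O (.pair (.pair (.num (2 ^ T)) ctx) x) = .num (2 ^ T) := rfl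
  have h3 := holds_ltP h1 h2
  unfold tapeP tapeOf
  split_ifs with h
  · rw [ev_ite_holds (h3.2 h)]
    refine ev_modP ?_ h2
    rw [ev_comp, ev_addP (ev_mulP rfl h1) rfl]; rfl
  · rw [ev_ite_not (fun h' => h (h3.1 h'))]; rfl

theorem tapeP_num (t : ℕ → ℕ) (O : Data → Data) (x : Data) : ∃ n, tapeP.ev t O x = .num n := by
  unfold tapeP
  rw [ev_ite]
  split_ifs
  · exact arith_eq_num _ _
  · exact ⟨0, rfl⟩

theorem tapeP_toNat (t : ℕ → ℕ) (O : Data → Data) (env x : Data) :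
    tapeP.ev t O (.pair env x) = tapeP.ev t O (.pair env (.num x.toNat)) := by
  unfold tapeP
  simp only [ev_ite, ev_comp, ev_pair, ev_fst, ev_snd, Data.fst_pair, Data.snd_pair, ev_add,
    ev_const, arith_add_zero, Data.toNat_num, ev_sub, ev_mod, ev_mul, ev_rand]

/-- Reduction modulo the word range cannot enlarge a tape word, which gives the query-independent
bound that `PT_sim` requires. -/
theorem tapeP_size {t : ℕ → ℕ} {O : Data → Data} {s : ℕ} (he : EnvBd t O s) (x : Data) :
    (tapeP.ev t O x).size ≤ s + 1 := by
  unfold tapeP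
  rw [ev_ite]
  split_ifs
  · rw [ev_comp, ev_mod, ev_pair]
    have h : ∃ w, (Prog.comp .rand (addP (mulP (numP 16) (addP .snd (numP 0))) (numP 15))).ev t O x
        = .num (t w) := ⟨_, rfl⟩
    obtain ⟨w, hw⟩ := h
    rw [hw]
    have h1 := he.tape w
    have h2 : ∀ d, ((Data.pair (.num (t w)) d).arith (· % ·)).size ≤ (Data.num (t w)).size := by
      intro d
      match d with
      | .num b => simpa [Data.size] using Nat.size_le_size (Nat.mod_le _ _)
      | .pair _ _ => simp [Data.arith, Data.size]
    exact (h2 _).trans (h1.trans (by omega))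
  · simp [Data.size]

instance : PT tapeP := by unfold tapeP; infer_instance

/-- The advice. -/
abbrev advP : Prog := .comp .fst .snd

/-- The answers to the queries of the reduction. -/
abbrev redIds : Prog := tab (uval (.comp .fst (.comp .snd (.comp .snd advP))))
  (.comp .query (nthP (.comp (.comp .fst (.comp .snd (.comp .snd (.comp .snd advP)))) .fst) .snd))

/-- The context and the view computed by the reduction. -/
abbrev redPlug (plug : Prog) : Prog :=
  .comp plug (.pair (.comp .snd (.comp .snd (.comp .snd (.comp .snd advP)))) redIds)

/-- On input `(unary s, (adv, _))` with `adv = (2 ^ T, (a, (unary N, (xs, tmpl))))`, query the `N`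
items of `xs`, insert the answers into the template, and prepare the input for `sim`. -/
def redInit (plug : Prog) : Prog :=
  .pair (.pair (.comp .fst advP) (.comp .fst (redPlug plug)))
    (.pair .fst (.pair (.comp .fst (.comp .snd advP)) (.comp .snd (redPlug plug))))

set_option synthInstance.maxSize 2000 in
instance (plug : Prog) [PT plug] : PT (redInit plug) := by unfold redInit; infer_instance

theorem ev_redInit {plug : Prog} {t : ℕ → ℕ} {O : Data → Data} {us T2 a tm z ctx vd : Data}
    {ℓ N : ℕ} {xs ids : Fin N → BF ℓ} (hO : ∀ j, O (encBF (xs j)) = encBF (ids j))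
    (hp : plug.ev t O (.pair tm (encVec encBF ids)) = .pair ctx vd) :
    (redInit plug).ev t O (.pair us (.pair (.pair T2 (.pair a (.pair (unary N)
      (.pair (encVec encBF xs) tm)))) z)) =
      .pair (.pair T2 ctx) (.pair us (.pair a vd)) := by
  have h : redIds.ev t O (.pair us (.pair (.pair T2 (.pair a (.pair (unary N)
      (.pair (encVec encBF xs) tm)))) z)) = encVec encBF ids := by
    refine ev_tab (ev_uval rfl) fun j => ?_
    rw [ev_comp, ev_nthP (w := xs) rfl rfl j.2, ev_query, hO]
  have h2 : (redPlug plug).ev t O (.pair us (.pair (.pair T2 (.pair a (.pair (unary N)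
      (.pair (encVec encBF xs) tm)))) z)) = .pair ctx vd := by
    rw [ev_comp, ev_pair, h, ← hp]; rfl
  rw [redInit]
  simp only [ev_pair, ev_comp _ _ _ .fst (redPlug plug), ev_comp _ _ _ .snd (redPlug plug), h2]
  rfl

/-- A supremum need not be attained, but an index within a factor 2 of it exists. Put into the
advice of the reduction, that index yields one negligible bound for all inputs at once. -/
theorem exists_half_max {ι : Type*} [Nonempty ι] {d : ι → ℝ} (h0 : ∀ i, 0 ≤ d i)
    (h1 : ∀ i, d i ≤ 1) : ∃ i₀, ∀ i, d i ≤ 2 * d i₀ := by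
  have hb : BddAbove (Set.range d) := ⟨1, by rintro _ ⟨i, rfl⟩; exact h1 i⟩
  by_cases hz : ⨆ i, d i = 0
  · obtain ⟨i₀⟩ := ‹Nonempty ι›
    exact ⟨i₀, fun i => ((le_ciSup hb i).trans hz.le).trans (by linarith [h0 i₀])⟩
  · obtain ⟨j⟩ := ‹Nonempty ι›
    have hpos : 0 < ⨆ i, d i := lt_of_le_of_ne ((h0 j).trans (le_ciSup hb j)) (Ne.symm hz)
    have : Nonempty ι := ⟨j⟩
    obtain ⟨i₀, hi⟩ := exists_lt_of_lt_ciSup (half_lt_self hpos)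
    exact ⟨i₀, fun i => (le_ciSup hb i).trans (by linarith)⟩

theorem expect_mem_unit {α : Type*} [Fintype α] [Nonempty α] {f : α → ℝ}
    (h : ∀ a, 0 ≤ f a ∧ f a ≤ 1) : 0 ≤ 𝔼 a, f a ∧ 𝔼 a, f a ≤ 1 :=
  ⟨expect_nonneg' fun a => (h a).1, expect_le_const fun a => (h a).2⟩

/-- Views that are computed from the values of a pseudorandom function at given points, and whose
oracle is computed from a random function, do not change noticeably if a random function is used
instead. -/
theorem prf_views {κ ℓ N : ℕ → ℕ} {F : ∀ s, BF (κ s) → BF (ℓ s) → BF (ℓ s)}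
    (hF : Pseudorandom F) (hℓ : PolyBounded ℓ) (hN : PolyBounded N)
    {plug A : Prog} [PT plug] [PT A]
    (hA : ∃ b, MonoPoly b ∧ ∀ t O s ctx y, EnvBd t O s → ctx.size ≤ s →
      (A.ev t O (.pair ctx y)).size ≤ b s)
    {Key : ℕ → Type} [∀ s, Fintype (Key s)] [∀ s, DecidableEq (Key s)] {addr : ∀ s, Key s → ℕ}
    (haddr : ∀ s, Function.Injective (addr s)) (h15 : ∀ s k, addr s k % 16 ≠ 15)
    (hT : ∃ q, PolyBounded q ∧ ∀ s k, addr s k < 2 ^ q s)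
    {ι : ℕ → Type} {xs : ∀ s, ι s → Fin (N s) → BF (ℓ s)} {tmpl : ∀ s, ι s → Data}
    (htm : ∃ q, PolyBounded q ∧ ∀ s i, (tmpl s i).size ≤ q s)
    {vd : ∀ s, ι s → (Fin (N s) → BF (ℓ s)) → Data}
    {orc : ∀ s, ι s → (Fin (N s) → BF (ℓ s)) → (Key s → BF (ℓ s)) → Data → Data}
    (hplug : ∀ s i ids t O, ∃ ctx,
      plug.ev t O (.pair (tmpl s i) (encVec encBF ids)) = .pair ctx (vd s i ids) ∧
      ∀ t O y, A.ev t O (.pair ctx y) =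
        orc s i ids (fun k => BF.ofNat (ℓ s) (t (addr s k))) y)
    (D : Adversary) : ∃ μ, Negligible μ ∧ ∀ s (i : ι s),
      |(𝔼 k, 𝔼 g, accept D s (vd s i fun j => F s k (xs s i j),
          orc s i (fun j => F s k (xs s i j)) g)) -
        𝔼 G : BF (ℓ s) → BF (ℓ s), 𝔼 g, accept D s (vd s i fun j => G (xs s i j),
          orc s i (fun j => G (xs s i j)) g)| ≤ μ s := by
  classical
  obtain ⟨b, hb, hAb⟩ := hA
  obtain ⟨qT, ⟨qT', hqT⟩, hT⟩ := hT
  obtain ⟨qt, hqt, htm⟩ := htm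
  obtain ⟨qℓ, hqℓ⟩ := hℓ
  set dist : ∀ s, ι s → ℝ := fun s i => |(𝔼 k, 𝔼 g, accept D s (vd s i fun j => F s k (xs s i j),
          orc s i (fun j => F s k (xs s i j)) g)) -
        𝔼 G : BF (ℓ s) → BF (ℓ s), 𝔼 g, accept D s (vd s i fun j => G (xs s i j),
          orc s i (fun j => G (xs s i j)) g)| with hdist
  have hmax : ∀ s, Nonempty (ι s) → ∃ i₀, ∀ i, dist s i ≤ 2 * dist s i₀ := by
    intro s _
    refine exists_half_max (fun i => abs_nonneg _) fun i => ?_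
    have h : ∀ v, 0 ≤ accept D s v ∧ accept D s v ≤ 1 :=
      fun v => ⟨accept_nonneg D s v, accept_le_one D s v⟩
    have h1 := expect_mem_unit fun k => expect_mem_unit fun g => h (vd s i fun j =>
      F s k (xs s i j), orc s i (fun j => F s k (xs s i j)) g)
    have h2 := expect_mem_unit fun G : BF (ℓ s) → BF (ℓ s) => expect_mem_unit fun g =>
      h (vd s i fun j => G (xs s i j), orc s i (fun j => G (xs s i j)) g)
    rw [hdist, abs_le]
    constructor <;> linarith [h1.1, h1.2, h2.1, h2.2]
  choose best hbest using hmax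
  -- The advice hard-wires an index `i` through the points to be queried and the template of the
  -- view, together with the advice of `D` and the length of its tape.
  set adv : ∀ s, ι s → Data := fun s i => .pair (.num (2 ^ D.tapeLen.eval s)) (.pair (D.advice s)
    (.pair (unary (N s)) (.pair (encVec encBF (xs s i)) (tmpl s i)))) with hadv
  have hDpt : PT D.prog := ⟨D.polyTime⟩
  have hI : PT (redInit plug) := inferInstance
  let B : Adversary :=
    { prog := .comp (sim (.comp A (.pair (.comp .snd .fst) .snd)) tapeP D.prog) (redInit plug)
      polyTime := by
        refine (PT_sim (b := fun s => b s + s + 1) ((hb.add .self).add (.const 1))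
          (fun t O env x => tapeP_num t O _) tapeP_toNat (fun t O s env x he hs => ⟨?_, ?_⟩)
          (fun t O x => ⟨_, _, rfl⟩)).out
        · have := hAb t O s env.snd x he (env.snd_size.trans hs)
          simp only [ev_comp, ev_pair, ev_fst, ev_snd, Data.fst_pair, Data.snd_pair]
          omega
        · exact (tapeP_size he _).trans (by omega)
      advice := fun s => if h : Nonempty (ι s) then adv s (best s h) else .num 0
      advice_poly := by
        obtain ⟨qa, hqa⟩ := D.advice_poly
        have hT' : PolyBounded fun s => D.tapeLen.eval s := ⟨_, fun s => le_rfl⟩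
        have hℓ' : PolyBounded ℓ := ⟨qℓ, hqℓ⟩
        have ha : PolyBounded fun s => (D.advice s).size := D.advice_poly
        refine (((((hT'.add (.const 2)).add ha).add (hN.add (.const 2))).add
          ((hN.mul (hℓ'.add (.const 2))).add (.const 1))).add hqt).add (.const 5) |>.mono
          fun s => ?_
        split_ifs with h
        · have h1 := htm s (best s h)
          have h2 : (encVec encBF (xs s (best s h))).size ≤ N s * (ℓ s + 2) + 1 :=
            encVec_size_le fun i => encBF_size _
          have h3 := unary_size (N s)
          have h4 : (Data.num (2 ^ D.tapeLen.eval s)).size = D.tapeLen.eval s + 2 :=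
            unary_size (D.tapeLen.eval s)
          simp only [hadv, Data.size] at h4 ⊢
          omega
        · simp [Data.size]
      -- Four extra bits make room for the addresses `16 * a + 15`; the last two summands cover the
      -- addresses of the keys and the length of field elements.
      tapeLen := D.tapeLen + .C 4 + qT' + qℓ }
  obtain ⟨μ, hμ, hB⟩ := hF B
  refine ⟨fun s => 2 * μ s, by simpa using hμ.const_mul 2, fun s i => ?_⟩
  have hne : Nonempty (ι s) := ⟨i⟩
  refine (hbest s hne i).trans (mul_le_mul_of_nonneg_left ?_ two_pos.le)
  set i₀ := best s hne
  refine le_trans (le_of_eq ?_) (hB s ())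
  -- For a fixed oracle `f` the reduction reproduces the view of `D` exactly, so the two experiments
  -- of the PRF game become the two averages to be compared.
  have key : ∀ f : BF (ℓ s) → BF (ℓ s), accept B s (.num 0, oracleOf encBF f) =
      𝔼 g, accept D s (vd s i₀ fun j => f (xs s i₀ j), orc s i₀ (fun j => f (xs s i₀ j)) g) := by
    intro f
    set T := D.tapeLen.eval s with hTd
    have hT' : B.tapeLen.eval s = T + 4 + qT'.eval s + qℓ.eval s := by simp [B, hTd]
    have hA1 : ∀ a : Fin (2 ^ T), 16 * (a : ℕ) + 15 < 2 ^ B.tapeLen.eval s := by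
      intro a
      have := a.2
      calc 16 * (a : ℕ) + 15 < 2 ^ (T + 4) := by rw [pow_add]; omega
        _ ≤ _ := Nat.pow_le_pow_right two_pos (by omega)
    have hA2 : ∀ k : Key s, addr s k < 2 ^ B.tapeLen.eval s := fun k => (hT s k).trans_le
      (Nat.pow_le_pow_right two_pos ((hqT s).trans (by omega)))
    -- A single tape serves both as the tape of `D` and as the table of the random function;
    -- residues modulo 16 keep the two sets of addresses apart.
    set e : Fin (2 ^ T) ⊕ Key s → Fin (2 ^ B.tapeLen.eval s) :=
      Sum.elim (fun a => ⟨16 * a + 15, hA1 a⟩) fun k => ⟨addr s k, hA2 k⟩ with he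
    have hinj : Function.Injective e := by
      rintro (a | a) (c | c) h <;> simp only [he, Sum.elim_inl, Sum.elim_inr, Fin.mk.injEq] at h
      · congr 1; ext; omega
      · exact absurd (h ▸ by omega : addr s c % 16 = 15) (h15 s c)
      · exact absurd (h ▸ by omega : addr s a % 16 = 15) (h15 s a)
      · rw [haddr s h]
    have bal := (Balanced.sum (K := Fin (2 ^ T)) (K' := Key s)
      (Balanced.arrow (balanced_mod (T := B.tapeLen.eval s) (ℓ := T) (by omega)))
      (Balanced.arrow (balanced_ofNat (T := B.tapeLen.eval s) (ℓ := ℓ s)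
        ((hqℓ s).trans (by omega))))).comp (Balanced.restrict hinj)
    have := bal.expect fun p : (Fin (2 ^ T) → Fin (2 ^ T)) × (Key s → BF (ℓ s)) =>
      if D.prog.ev (tapeOf p.1) (orc s i₀ (fun j => f (xs s i₀ j)) p.2)
        (.pair (unary s) (.pair (D.advice s) (vd s i₀ fun j => f (xs s i₀ j)))) = .num 1
      then (1 : ℝ) else 0
    rw [expect_prod, Finset.expect_comm] at this
    unfold accept
    rw [← this]
    refine expect_congr' fun ω => ?_
    obtain ⟨ctx, hp, ho⟩ := hplug s i₀ (fun j => f (xs s i₀ j)) (tapeOf ω) (oracleOf encBF f)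
    have hadvs : B.advice s = adv s i₀ := dif_pos hne
    have hev : B.prog.ev (tapeOf ω) (oracleOf encBF f)
        (.pair (unary s) (.pair (B.advice s) (.num 0))) =
        (sim (.comp A (.pair (.comp .snd .fst) .snd)) tapeP D.prog).ev (tapeOf ω)
          (oracleOf encBF f) (.pair (.pair (.num (2 ^ T)) ctx)
            (.pair (unary s) (.pair (D.advice s) (vd s i₀ fun j => f (xs s i₀ j))))) := by
      rw [hadvs]
      change Prog.ev _ _ _ (Prog.ev (redInit plug) _ _ _) = _
      rw [hadv, ev_redInit (fun j => oracleOf_apply encBF_injective f _) hp]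
    have hs : ∀ k : Key s, tapeOf ω (addr s k) = ω ⟨addr s k, hA2 k⟩ := fun k => dif_pos (hA2 k)
    have hst : subtape T (tapeOf ω) = fun a => ⟨(ω ⟨16 * a + 15, hA1 a⟩ : ℕ) % 2 ^ T,
        Nat.mod_lt _ (by positivity)⟩ := by
      funext a
      simp only [subtape, tapeOf, dif_pos (hA1 a)]
    have hsim := ev_sim (Q := .comp A (.pair (.comp .snd .fst) .snd)) (R := tapeP) (t := tapeOf ω)
      (O := oracleOf encBF f) (env := .pair (.num (2 ^ T)) ctx)
      (t' := tapeOf (subtape T (tapeOf ω)))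
      (O' := orc s i₀ (fun j => f (xs s i₀ j)) fun k => BF.ofNat (ℓ s) (tapeOf ω (addr s k)))
      (fun x => ho _ _ x) (fun x => ev_tapeP T _ _ ctx x) D.prog
    rw [hev, hsim, hst]
    simp only [hs]
    rfl
  rw [acceptProb_map, acceptProb_map]
  simp only [key, hdist]

/-- Collisions of a pseudorandom function. -/
theorem prf_collision {κ ℓ : ℕ → ℕ} {F : ∀ s, BF (κ s) → BF (ℓ s) → BF (ℓ s)}
    (hF : Pseudorandom F) (hℓ : PolyBounded ℓ) : ∃ μ, Negligible μ ∧
      ∀ s (x y : BF (ℓ s)), x ≠ y →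
        𝔼 k, (if F s k x = F s k y then (1 : ℝ) else 0) ≤ μ s + ((2 : ℝ) ^ ℓ s)⁻¹ := by
  classical
  -- This distinguisher receives the values at two points and accepts when they are equal. It is fed
  -- to `prf_views` with an empty set of keys, as it needs no oracle.
  let D : Adversary :=
    { prog := eqP (.comp .fst (.comp .snd .snd)) (.comp .fst (.comp .snd (.comp .snd .snd)))
      polyTime := PT.out
      advice := fun _ => .num 0
      advice_poly := (PolyBounded.const 1).mono fun s => by simp [Data.size]
      tapeLen := 0 }
  have hD : ∀ s (x y : BF (ℓ s)) O, accept D s (encVec encBF ![x, y], O) =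
      if x = y then 1 else 0 := by
    intro s x y O
    unfold accept
    refine (expect_congr' fun ω => ?_).trans (Fintype.expect_const _)
    have h1 : ∀ t, (eqP (.comp .fst (.comp .snd .snd)) (.comp .fst (.comp .snd (.comp .snd .snd)))).ev
        t O (.pair (unary s) (.pair (.num 0) (encVec encBF ![x, y]))) =
          .num (if x.toNat = y.toNat then 1 else 0) := by
      intro t
      exact ev_eqP rfl rfl
    have h2 : x.toNat = y.toNat ↔ x = y := BF.toNat_injective.eq_iff
    simp only [D, h1, h2, Data.num.injEq]
    split_ifs <;> simp_all
  obtain ⟨μ, hμ, h⟩ := prf_views (N := fun _ => 2) hF hℓ (.const 2) (plug := .pair (numP 0) .snd)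
    (A := numP 0) ⟨_, .const 1, fun t O s ctx y _ _ => by simp [Data.size]⟩ (Key := fun _ => Empty)
    (addr := fun _ k => k.elim) (fun _ k => k.elim) (fun _ k => k.elim)
    ⟨_, .const 0, fun _ k => k.elim⟩ (ι := fun s => BF (ℓ s) × BF (ℓ s))
    (xs := fun s i => ![i.1, i.2]) (tmpl := fun _ _ => .num 0)
    ⟨_, .const 1, fun _ _ => by simp [Data.size]⟩
    (vd := fun s i ids => encVec encBF ids) (orc := fun _ _ _ _ _ => .num 0)
    (fun s i ids t O => ⟨.num 0, rfl, fun t O y => rfl⟩) D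
  refine ⟨μ, hμ, fun s x y hxy => ?_⟩
  have hpair : ∀ f : BF (ℓ s) → BF (ℓ s), (fun j => f ((![x, y] : Fin 2 → BF (ℓ s)) j)) =
      ![f x, f y] := by
    intro f; funext j; fin_cases j <;> rfl
  have h1 := h s (x, y)
  simp only [hpair, hD, Fintype.expect_const] at h1
  -- Restriction to the two distinct points is balanced, which leaves the collision probability of
  -- two independent uniform values.
  have h2 : 𝔼 G : BF (ℓ s) → BF (ℓ s), (if G x = G y then (1 : ℝ) else 0) = ((2 : ℝ) ^ ℓ s)⁻¹ := by
    have hinj : Function.Injective (![x, y] : Fin 2 → BF (ℓ s)) := by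
      intro a c hac
      fin_cases a <;> fin_cases c <;> simp_all
    have hb := (Balanced.restrict (X := BF (ℓ s)) hinj).expect
      fun v : Fin 2 → BF (ℓ s) => if v 0 = v 1 then (1 : ℝ) else 0
    refine hb.trans ?_
    have hb2 := (Balanced.of_equiv (finTwoArrowEquiv (BF (ℓ s)))).expect
      fun v : BF (ℓ s) × BF (ℓ s) => if v.1 = v.2 then (1 : ℝ) else 0
    refine hb2.trans ?_
    rw [expect_prod]
    simp [ZMod.card]
  rw [h2] at h1
  have := (abs_le.1 h1).2
  linarith

end FPSI

/-! ### Local mapping in closed form: merged intervals, labels, padding. -/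

namespace FPSI

variable {P : Params}

/-! ### Merging intervals -/

theorem mem_nbhd {x : Fin P.u} {c : Coord P} :
    c ∈ nbhd x ↔ |(c : ℤ) - ((x : ℕ) : ℤ)| ≤ P.δ := by
  simp [nbhd]

theorem toCoord_mem_nbhd (x y : Fin P.u) :
    toCoord y ∈ nbhd x ↔ |((y : ℕ) : ℤ) - ((x : ℕ) : ℤ)| ≤ P.δ := mem_nbhd

theorem nbhd_inter {x y : Fin P.u} : (nbhd (P := P) x ∩ nbhd y).Nonempty ↔
    (x : ℕ) ≤ y + 2 * P.δ ∧ (y : ℕ) ≤ x + 2 * P.δ := by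
  constructor
  · rintro ⟨c, hc⟩
    rw [Finset.mem_inter, mem_nbhd, mem_nbhd, abs_le, abs_le] at hc
    omega
  · intro h
    have hx := x.2
    have hy := y.2
    -- The larger of the two left endpoints lies in both intervals as soon as they meet.
    refine ⟨⟨max (x : ℕ) (y : ℕ) - P.δ, ?_⟩, ?_⟩
    · rw [Finset.mem_Icc]; omega
    · rw [Finset.mem_inter, mem_nbhd, mem_nbhd, abs_le, abs_le]; dsimp only; omega

/-- The labelled sets in a list are pairwise disjoint. -/
def PairDisj (I : List (Finset (Coord P) × BF P.ℓ)) : Prop :=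
  I.Pairwise fun e e' => e.1 ∩ e'.1 = ∅

theorem PairDisj.unique {I : List (Finset (Coord P) × BF P.ℓ)} (h : PairDisj I) {e e'}
    (he : e ∈ I) (he' : e' ∈ I) {c : Coord P} (hc : c ∈ e.1) (hc' : c ∈ e'.1) : e = e' := by
  by_contra hne
  have : e.1 ∩ e'.1 = ∅ := by
    have : Std.Symm fun e e' : Finset (Coord P) × BF P.ℓ => e.1 ∩ e'.1 = ∅ :=
      ⟨fun x y h => by rw [Finset.inter_comm]; exact h⟩
    exact List.Pairwise.forall h he he' hne
  exact (Finset.eq_empty_iff_forall_notMem.1 this c) (Finset.mem_inter.2 ⟨hc, hc'⟩)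

/-- The fold tests entries against a union `V` that grows. As the entries are pairwise disjoint,
absorbing one does not change which later ones are met, so the tests can be made against the
original `U`. -/
theorem absorb_spec (U : Finset (Coord P)) (I : List (Finset (Coord P) × BF P.ℓ))
    (hI : PairDisj I) : ∀ (V : Finset (Coord P)) (R : List (Finset (Coord P) × BF P.ℓ)),
    (∀ e ∈ I, (V ∩ e.1).Nonempty ↔ (U ∩ e.1).Nonempty) →
    (∀ c, c ∈ (I.foldl (fun st e => if (st.1 ∩ e.1).Nonempty then (st.1 ∪ e.1, st.2)
        else (st.1, st.2 ++ [e])) (V, R)).1 ↔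
      c ∈ V ∨ ∃ e ∈ I, (U ∩ e.1).Nonempty ∧ c ∈ e.1) ∧
    (I.foldl (fun st e => if (st.1 ∩ e.1).Nonempty then (st.1 ∪ e.1, st.2)
        else (st.1, st.2 ++ [e])) (V, R)).2 = R ++ I.filter fun e => ¬ (U ∩ e.1).Nonempty := by
  induction I with
  | nil => intro V R _; simp
  | cons e I ih =>
    intro V R hV
    have hI' := List.pairwise_cons.1 hI
    rw [List.foldl_cons]
    by_cases he : (V ∩ e.1).Nonempty
    · have hU := (hV e (by simp)).1 he
      rw [if_pos he]
      have := ih hI'.2 (V ∪ e.1) R fun e' he' => by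
        rw [Finset.union_inter_distrib_right, hI'.1 e' he', Finset.union_empty]
        exact hV e' (by simp [he'])
      refine ⟨fun c => ?_, ?_⟩
      · rw [this.1 c]; simp [hU, or_assoc]
      · rw [this.2, List.filter_cons_of_neg (by simpa using hU.ne_empty)]
    · have hU : ¬ (U ∩ e.1).Nonempty := fun h => he ((hV e (by simp)).2 h)
      rw [if_neg he]
      have := ih hI'.2 V (R ++ [e]) fun e' he' => hV e' (by simp [he'])
      refine ⟨fun c => ?_, ?_⟩
      · rw [this.1 c]; simp [hU]
      · rw [this.2, List.filter_cons_of_pos (by simpa using hU), List.append_assoc,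
          List.singleton_append]

theorem insertInterval_spec {I : List (Finset (Coord P) × BF P.ℓ)} (hI : PairDisj I)
    (U : Finset (Coord P)) (r : BF P.ℓ) : ∃ V : Finset (Coord P),
    (∀ c, c ∈ V ↔ c ∈ U ∨ ∃ e ∈ I, (U ∩ e.1).Nonempty ∧ c ∈ e.1) ∧
    insertInterval I U r = (I.filter fun e => ¬ (U ∩ e.1).Nonempty) ++ [(V, r)] := by
  have := absorb_spec U I hI U [] fun _ _ => Iff.rfl
  exact ⟨_, this.1, by rw [insertInterval]; simp only [this.2, List.nil_append]⟩

/-- A surviving entry misses `U`, and by disjointness it misses every absorbed entry; hence it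
misses the new union. -/
theorem insertInterval_pairDisj {I : List (Finset (Coord P) × BF P.ℓ)} (hI : PairDisj I)
    (U : Finset (Coord P)) (r : BF P.ℓ) : PairDisj (insertInterval I U r) := by
  obtain ⟨V, hV, h⟩ := insertInterval_spec hI U r
  rw [h, PairDisj, List.pairwise_append]
  refine ⟨hI.filter _, by simp, fun e he e' he' => ?_⟩
  obtain rfl : e' = (V, r) := by simpa using he'
  have he2 : e ∈ I ∧ ¬ (U ∩ e.1).Nonempty := by simpa [List.mem_filter] using he
  rw [Finset.eq_empty_iff_forall_notMem]
  intro c hc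
  rw [Finset.mem_inter, hV] at hc
  rcases hc.2 with h1 | ⟨e1, h1, h2, h3⟩
  · exact he2.2 ⟨c, Finset.mem_inter.2 ⟨h1, hc.1⟩⟩
  · rw [hI.unique he2.1 h1 hc.1 h3] at he2
    exact he2.2 h2

/-! ### Classes of overlapping intervals -/

/-- The largest index in the class of `a`, when the indices below `j` are merged one after the
other with all classes that they meet. -/
def cls (M : ℕ → ℕ → Prop) [DecidableRel M] : ℕ → ℕ → ℕ
  | 0, _ => 0
  | j + 1, a =>
    if a = j then j else if ∃ b < j, cls M j b = cls M j a ∧ M b j then j else cls M j a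

section cls
variable {M : ℕ → ℕ → Prop} [DecidableRel M]

theorem cls_lt {j : ℕ} : ∀ {a : ℕ}, a < j → cls M j a < j := by
  induction j with
  | zero => intro a h; omega
  | succ j ih =>
    intro a h
    rw [cls]
    split_ifs with h1 h2
    · omega
    · omega
    · have := ih (a := a) (by omega); omega

/-- Classes merge only along an overlap, so an index without overlaps neither joins another class
nor is joined by one. -/
theorem cls_isolated {n i : ℕ} (hi : ∀ b < n, b ≠ i → ¬ M b i ∧ ¬ M i b) (j : ℕ) (hj : j ≤ n) :
    (i < j → cls M j i = i) ∧ ∀ a < j, a ≠ i → cls M j a ≠ i := by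
  induction j with
  | zero => exact ⟨fun h => by omega, fun a h => by omega⟩
  | succ j ih =>
    replace ih := ih (by omega)
    constructor
    · intro h
      rw [cls]
      split_ifs with h1 h2
      · exact h1.symm
      · obtain ⟨b, hb, hb1, hb2⟩ := h2
        rw [ih.1 (by omega)] at hb1
        have : b = i := by
          by_contra hne
          exact ih.2 b hb hne hb1
        subst this
        exact absurd hb2 (hi j (by omega) (by omega)).2
      · exact ih.1 (by omega)
    · intro a ha hne
      rw [cls]
      split_ifs with h1 h2
      · omega
      · obtain ⟨b, hb, hb1, hb2⟩ := h2
        rintro rfl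
        exact (hi b (by omega) (by omega)).1 hb2
      · exact ih.2 a (by omega) hne

end cls

section classes
variable {n : ℕ} (x : Fin n → Point P) (k : Fin P.d)

/-- Coordinate `k` of the point with index `a`. -/
def coordAt (a : ℕ) : ℕ := if h : a < n then x ⟨a, h⟩ k else 0

/-- Two intervals of dimension `k` overlap. -/
def overlap (a b : ℕ) : Prop :=
  coordAt x k a ≤ coordAt x k b + 2 * P.δ ∧ coordAt x k b ≤ coordAt x k a + 2 * P.δ

instance : DecidableRel (overlap x k) := fun _ _ => by unfold overlap; infer_instance

/-- The index of the point that determines the label of the interval of a point. -/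
def clsFin (i : Fin n) : Fin n := ⟨cls (overlap x k) n i, cls_lt i.2⟩

variable {x k}

theorem coordAt_fin (i : Fin n) : coordAt x k i = x i k := by simp [coordAt]

theorem overlap_fin {a b : Fin n} : overlap x k a b ↔ (nbhd (x a k) ∩ nbhd (x b k)).Nonempty := by
  rw [nbhd_inter, overlap, coordAt_fin, coordAt_fin]

/-- The labelled set `e` is the union of the intervals in the class of `a`. -/
def Represents (x : Fin n → Point P) (r : Fin n → Fin P.d → BF P.ℓ) (k : Fin P.d) (j : ℕ)
    (hj : j ≤ n) (e : Finset (Coord P) × BF P.ℓ) (a : ℕ) (ha : a < j) : Prop :=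
  e.2 = r ⟨cls (overlap x k) j a, (cls_lt ha).trans_le hj⟩ k ∧ ∀ c, c ∈ e.1 ↔
    ∃ b : Fin n, (b : ℕ) < j ∧ cls (overlap x k) j b = cls (overlap x k) j a ∧ c ∈ nbhd (x b k)

/-- The invariant behind the closed form of labels: after `j` points the stored sets are the unions
over the classes of `cls`. A merged interval takes the newest label, which is why a class is named
by its largest index. -/
theorem intervals_prefix (r : Fin n → Fin P.d → BF P.ℓ) (j : ℕ) (hj : j ≤ n) :
    ∃ I, ((List.finRange n).take j).foldl (fun I j => insertInterval I (nbhd (x j k)) (r j k)) []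
        = I ∧ PairDisj I ∧
      (∀ a (ha : a < j), ∃ e ∈ I, Represents x r k j hj e a ha) ∧
      ∀ e ∈ I, ∃ a, ∃ ha : a < j, Represents x r k j hj e a ha := by
  induction j with
  | zero => exact ⟨[], by simp, by simp [PairDisj], fun a ha => by omega, by simp⟩
  | succ j ih =>
    obtain ⟨I, hI, hd, hA, hB⟩ := ih (by omega)
    set jj : Fin n := ⟨j, hj⟩ with hjj
    refine ⟨insertInterval I (nbhd (x jj k)) (r jj k), ?_, insertInterval_pairDisj hd _ _, ?_⟩
    · rw [List.take_add_one, List.foldl_append, hI]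
      have : (List.finRange n)[j]? = some jj := by
        rw [List.getElem?_eq_getElem (by simpa using hj)]; simp [hjj]
      simp [this]
    obtain ⟨V, hV, hins⟩ := insertInterval_spec hd (nbhd (x jj k)) (r jj k)
    have hmem : ∀ e, e ∈ insertInterval I (nbhd (x jj k)) (r jj k) ↔
        (e ∈ I ∧ ¬ (nbhd (x jj k) ∩ e.1).Nonempty) ∨ e = (V, r jj k) := by
      intro e; rw [hins]; simp [List.mem_filter]
    -- Meeting a stored union amounts to overlapping the interval of some member of its class; this
    -- translates the set condition of the algorithm into the recursion of `cls`.
    have hmeets : ∀ a (ha : a < j) e, Represents x r k j (by omega) e a ha →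
        ((nbhd (x jj k) ∩ e.1).Nonempty ↔
          ∃ b < j, cls (overlap x k) j b = cls (overlap x k) j a ∧ overlap x k b j) := by
      intro a ha e he
      constructor
      · rintro ⟨c, hc⟩
        rw [Finset.mem_inter, he.2] at hc
        obtain ⟨h1, b, hb, hb1, hb2⟩ := hc
        exact ⟨b, hb, hb1, (overlap_fin (b := jj)).2 ⟨c, Finset.mem_inter.2 ⟨hb2, h1⟩⟩⟩
      · rintro ⟨b, hb, hb1, hb2⟩
        obtain ⟨c, hc⟩ := (overlap_fin (a := ⟨b, by omega⟩) (b := jj)).1 hb2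
        rw [Finset.mem_inter] at hc
        exact ⟨c, Finset.mem_inter.2 ⟨hc.2, (he.2 c).2 ⟨_, hb, hb1, hc.1⟩⟩⟩
    have hlt : ∀ a < j, cls (overlap x k) j a < j := fun a ha => cls_lt ha
    have hclsj : cls (overlap x k) (j + 1) j = j := by rw [cls, if_pos rfl]
    have hhit : ∀ a < j, (∃ b < j, cls (overlap x k) j b = cls (overlap x k) j a ∧ overlap x k b j) →
        cls (overlap x k) (j + 1) a = j := by
      intro a ha h; rw [cls, if_neg (by omega), if_pos h]
    have hmiss : ∀ a < j, ¬ (∃ b < j, cls (overlap x k) j b = cls (overlap x k) j a ∧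
        overlap x k b j) → cls (overlap x k) (j + 1) a = cls (overlap x k) j a := by
      intro a ha h; rw [cls, if_neg (by omega), if_neg h]
    have hnew : ∀ a (ha : a < j + 1), cls (overlap x k) (j + 1) a = j →
        Represents x r k (j + 1) hj (V, r jj k) a ha := by
      intro a ha hc
      refine ⟨by simp only [hc, hjj], fun c => ?_⟩
      rw [hV, hc]
      constructor
      · rintro (h | ⟨e, he, h1, h2⟩)
        · exact ⟨jj, Nat.lt_succ_self j, hclsj, h⟩
        · obtain ⟨a', ha', hrep⟩ := hB e he
          have hh := (hmeets a' ha' e hrep).1 h1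
          obtain ⟨b, hb, hb1, hb2⟩ := (hrep.2 c).1 h2
          refine ⟨b, by omega, hhit b hb ?_, hb2⟩
          rw [hb1]; exact hh
      · rintro ⟨b, hb, hb1, hb2⟩
        rcases Nat.lt_succ_iff_lt_or_eq.1 hb with hb' | hb'
        · right
          obtain ⟨e, he, hrep⟩ := hA b hb'
          refine ⟨e, he, (hmeets b hb' e hrep).2 ?_, (hrep.2 c).2 ⟨b, hb', rfl, hb2⟩⟩
          by_contra hno
          rw [hmiss b hb' hno] at hb1
          have := hlt b hb'; omega
        · left
          obtain rfl : b = jj := Fin.ext hb'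
          exact hb2
    have hold : ∀ a (ha : a < j) e, Represents x r k j (by omega) e a ha →
        ¬ (∃ b < j, cls (overlap x k) j b = cls (overlap x k) j a ∧ overlap x k b j) →
        Represents x r k (j + 1) hj e a (by omega) := by
      intro a ha e he hno
      have h1 := hmiss a ha hno
      refine ⟨by simp only [h1]; exact he.1, fun c => ?_⟩
      rw [he.2, h1]
      constructor
      · rintro ⟨b, hb, hb1, hb2⟩
        refine ⟨b, by omega, ?_, hb2⟩
        rw [hmiss b hb (by rw [hb1]; exact hno), hb1]
      · rintro ⟨b, hb, hb1, hb2⟩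
        have hla := hlt a ha
        rcases Nat.lt_succ_iff_lt_or_eq.1 hb with hb' | hb'
        · refine ⟨b, hb', ?_, hb2⟩
          by_cases hh : ∃ b' < j, cls (overlap x k) j b' = cls (overlap x k) j b ∧ overlap x k b' j
          · rw [hhit b hb' hh] at hb1; omega
          · rwa [hmiss b hb' hh] at hb1
        · rw [hb', hclsj] at hb1; omega
    constructor
    · intro a ha
      by_cases hc : cls (overlap x k) (j + 1) a = j
      · exact ⟨_, (hmem _).2 (.inr rfl), hnew a ha hc⟩
      · have ha' : a < j := by
          rcases Nat.lt_succ_iff_lt_or_eq.1 ha with h | rfl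
          · exact h
          · exact absurd hclsj hc
        have hno : ¬ ∃ b < j, cls (overlap x k) j b = cls (overlap x k) j a ∧ overlap x k b j :=
          fun h => hc (hhit a ha' h)
        obtain ⟨e, he, hrep⟩ := hA a ha'
        exact ⟨e, (hmem _).2 (.inl ⟨he, fun h => hno ((hmeets a ha' e hrep).1 h)⟩),
          hold a ha' e hrep hno⟩
    · intro e he
      rcases (hmem e).1 he with ⟨he1, he2⟩ | rfl
      · obtain ⟨a, ha, hrep⟩ := hB e he1
        exact ⟨a, by omega, hold a ha e hrep fun h => he2 ((hmeets a ha e hrep).2 h)⟩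
      · exact ⟨j, by omega, hnew j (by omega) hclsj⟩

theorem intervals_spec (r : Fin n → Fin P.d → BF P.ℓ) : PairDisj (intervals x r k) ∧
    (∀ a : Fin n, ∃ e ∈ intervals x r k, nbhd (x a k) ⊆ e.1 ∧ e.2 = r (clsFin x k a) k) ∧
    ∀ e ∈ intervals x r k, ∀ c ∈ e.1, ∃ a : Fin n, c ∈ nbhd (x a k) := by
  obtain ⟨I, hI, hd, hA, hB⟩ := intervals_prefix (x := x) (k := k) r n le_rfl
  have : intervals x r k = I := by
    rw [← hI, List.take_of_length_le (by simp)]; rfl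
  rw [this]
  refine ⟨hd, fun a => ?_, fun e he c hc => ?_⟩
  · obtain ⟨e, he, h1, h2⟩ := hA a a.2
    exact ⟨e, he, fun c hc => (h2 c).2 ⟨a, a.2, rfl, hc⟩, h1⟩
  · obtain ⟨a, ha, h1, h2⟩ := hB e he
    obtain ⟨b, -, -, hb⟩ := (h2 c).1 hc
    exact ⟨b, hb⟩

/-- The stored sets are disjoint, so the first set found to contain `c` is the one containing the
whole interval of `a`. In particular the label does not depend on which covering point `a` is
chosen. -/
theorem labelOf_intervals (r : Fin n → Fin P.d → BF P.ℓ) {c : Coord P} {a : Fin n}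
    (hc : c ∈ nbhd (x a k)) : labelOf (intervals x r k) c = r (clsFin x k a) k := by
  obtain ⟨hd, hA, -⟩ := intervals_spec (x := x) (k := k) r
  obtain ⟨e, he, h1, h2⟩ := hA a
  have hf : (intervals x r k).find? (fun e => decide (c ∈ e.1)) = some e := by
    cases hfd : (intervals x r k).find? (fun e => decide (c ∈ e.1)) with
    | none =>
      rw [List.find?_eq_none] at hfd
      exact absurd (h1 hc) (by simpa using hfd e he)
    | some e' =>
      have h3 := List.mem_of_find?_eq_some hfd
      have h4 : c ∈ e'.1 := by simpa using List.find?_some hfd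
      rw [hd.unique h3 he h4 (h1 hc)]
  rw [labelOf, hf, ← h2]; rfl

theorem pid_eq (r : Fin n → Fin P.d → BF P.ℓ) (j : Fin n) :
    pid x r j = ∑ k, r (clsFin x k j) k :=
  Finset.sum_congr rfl fun k _ => labelOf_intervals r <| by
    rw [toCoord_mem_nbhd]; simp

/-! ### The list of local mapping -/

theorem mem_localListCore {r : Fin n → Fin P.d → BF P.ℓ} {y : MapKey P n} {z : BF P.ℓ} :
    (y, z) ∈ localListCore x r ↔
      ∃ k c a, y = .inl (k, c) ∧ c ∈ nbhd (x a k) ∧ z = r (clsFin x k a) k := by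
  simp only [localListCore, Finset.mem_biUnion, Finset.mem_univ, true_and, List.mem_toFinset,
    Finset.mem_image, Prod.mk.injEq]
  constructor
  · rintro ⟨k, e, he, c, hc, rfl, rfl⟩
    obtain ⟨hd, hA, hB⟩ := intervals_spec (x := x) (k := k) r
    obtain ⟨a, ha⟩ := hB e he c hc
    obtain ⟨e', he', h1, h2⟩ := hA a
    rw [hd.unique he he' hc (h1 ha)]
    exact ⟨k, c, a, rfl, ha, h2⟩
  · rintro ⟨k, c, a, rfl, ha, rfl⟩
    obtain ⟨e, he, h1, h2⟩ := (intervals_spec (x := x) (k := k) r).2.1 a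
    exact ⟨k, e, he, c, h1 ha, rfl, h2⟩

theorem programmed_eq {Key : Type} {ℓ : ℕ} {L : Finset (Key × BF ℓ)} {g : Key → BF ℓ} {y : Key}
    {z : BF ℓ} (h : (y, z) ∈ L) (hu : ∀ z', (y, z') ∈ L → z' = z) : programmed L g y = z := by
  rw [programmed, dif_pos ⟨z, h⟩]
  exact hu _ (Exists.choose_spec (⟨z, h⟩ : ∃ z, (y, z) ∈ L))

theorem programmed_of_notMem {Key : Type} {ℓ : ℕ} {L : Finset (Key × BF ℓ)} {g : Key → BF ℓ}
    {y : Key} (h : ∀ z, (y, z) ∉ L) : programmed L g y = g y :=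
  dif_neg fun ⟨z, hz⟩ => h z hz

theorem mem_localList_inl {r : Fin n → Fin P.d → BF P.ℓ} {e : Fin (padSize P n) → BF P.ℓ}
    {k : Fin P.d} {c : Coord P} {z : BF P.ℓ} : (Sum.inl (k, c), z) ∈ localList x r e ↔
      ∃ a, c ∈ nbhd (x a k) ∧ z = r (clsFin x k a) k := by
  rw [localList, Finset.mem_union, mem_localListCore]
  constructor
  · rintro (⟨k', c', a, h, ha, rfl⟩ | h)
    · obtain ⟨rfl, rfl⟩ : k = k' ∧ c = c' := by simpa using h
      exact ⟨a, ha, rfl⟩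
    · simp at h
  · rintro ⟨a, ha, rfl⟩
    exact .inl ⟨k, c, a, rfl, ha, rfl⟩

theorem mapFn_inl_covered (r : Fin n → Fin P.d → BF P.ℓ) (e : Fin (padSize P n) → BF P.ℓ)
    (g : MapKey P n → BF P.ℓ) {c : Coord P} {a : Fin n} (hc : c ∈ nbhd (x a k)) :
    programmed (localList x r e) g (.inl (k, c)) = r (clsFin x k a) k := by
  refine programmed_eq (mem_localList_inl.2 ⟨a, hc, rfl⟩) fun z hz => ?_
  obtain ⟨b, hb, rfl⟩ := mem_localList_inl.1 hz
  rw [← labelOf_intervals r hb, labelOf_intervals r hc]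

theorem mapFn_inl_free (r : Fin n → Fin P.d → BF P.ℓ) (e : Fin (padSize P n) → BF P.ℓ)
    (g : MapKey P n → BF P.ℓ) {c : Coord P} (hc : ∀ a, c ∉ nbhd (x a k)) :
    programmed (localList x r e) g (.inl (k, c)) = g (.inl (k, c)) :=
  programmed_of_notMem fun z hz => by
    obtain ⟨b, hb, -⟩ := mem_localList_inl.1 hz
    exact hc b hb

/-- The element with offset `t` in the interval of the point `j` occurs in an interval of an
earlier point. -/
def IsDup (x : Fin n → Point P) (k : Fin P.d) (j t : ℕ) : Prop :=
  ∃ a < n, a < j ∧ coordAt x k a ≤ coordAt x k j + t ∧ coordAt x k j + t ≤ coordAt x k a + 2 * P.δ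

open Classical in
/-- The number of repeated elements in the intervals. -/
noncomputable def dupCount (x : Fin n → Point P) : ℕ :=
  ∑ k : Fin P.d, ∑ j : Fin n, ∑ t : Fin (2 * P.δ + 1), if IsDup x k j t then 1 else 0

open Classical in
-- Each covered coordinate is charged to the first point whose interval contains it, which gives a
-- bijection with the non-repeated triples of dimension, point and offset.
theorem card_localListCore (r : Fin n → Fin P.d → BF P.ℓ) :
    (localListCore x r).card = (Finset.univ.filter fun a : Fin P.d × Fin n × Fin (2 * P.δ + 1) =>
      ¬ IsDup x a.1 a.2.1 a.2.2).card := by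
  symm
  have hc : ∀ (k : Fin P.d) (j : Fin n) (t : Fin (2 * P.δ + 1)),
      ((x j k : ℕ) : ℤ) + (t : ℕ) - P.δ ∈ Finset.Icc (-(P.δ : ℤ)) (P.u - 1 + P.δ) := by
    intro k j t
    have := (x j k).2
    have := t.2
    rw [Finset.mem_Icc]; omega
  refine Finset.card_bij (fun a _ => (.inl (a.1, ⟨_, hc a.1 a.2.1 a.2.2⟩),
    r (clsFin x a.1 a.2.1) a.1)) ?_ ?_ ?_
  · rintro ⟨k, j, t⟩ -
    rw [mem_localListCore]
    refine ⟨k, _, j, rfl, ?_, rfl⟩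
    have := t.2
    rw [mem_nbhd, abs_le]; dsimp only; omega
  · rintro ⟨k, j, t⟩ h1 ⟨k', j', t'⟩ h2 h
    simp only [Finset.mem_filter, Finset.mem_univ, true_and, IsDup, coordAt_fin, Prod.mk.injEq,
      Sum.inl.injEq, Subtype.mk.injEq] at h1 h2 h
    obtain ⟨⟨rfl, h⟩, -⟩ := h
    have ht := t.2
    have ht' := t'.2
    have hj : j = j' := by
      rcases lt_trichotomy j j' with hlt | rfl | hlt
      · exact absurd ⟨j, j.2, hlt, by rw [coordAt_fin]; omega, by rw [coordAt_fin]; omega⟩ h2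
      · rfl
      · exact absurd ⟨j', j'.2, hlt, by rw [coordAt_fin]; omega, by rw [coordAt_fin]; omega⟩ h1
    subst hj
    have : t = t' := Fin.ext (by omega)
    rw [this]
  · rintro ⟨y, z⟩ h
    obtain ⟨k, c, a, rfl, ha, rfl⟩ := mem_localListCore.1 h
    have hex : ∃ j : ℕ, ∃ hj : j < n, c ∈ nbhd (x ⟨j, hj⟩ k) := ⟨a, a.2, ha⟩
    obtain ⟨hj, hmem⟩ := Nat.find_spec hex
    have hmin : ∀ b (hb : b < n), b < Nat.find hex → c ∉ nbhd (x ⟨b, hb⟩ k) :=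
      fun b hb hlt hm => Nat.find_min hex hlt ⟨hb, hm⟩
    set j : Fin n := ⟨Nat.find hex, hj⟩ with hjd
    have hm := mem_nbhd.1 hmem
    rw [abs_le] at hm
    have htn : ((c : ℤ) - (x j k : ℕ) + P.δ).toNat < 2 * P.δ + 1 := by omega
    have hct : ((x j k : ℕ) : ℤ) + (((c : ℤ) - (x j k : ℕ) + P.δ).toNat : ℕ) - P.δ = c := by omega
    refine ⟨⟨k, j, ⟨_, htn⟩⟩, ?_, ?_⟩
    · simp only [Finset.mem_filter, Finset.mem_univ, true_and, IsDup, coordAt_fin]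
      rintro ⟨b, hb, hbj, h1, h2⟩
      refine hmin b hb hbj ?_
      have : coordAt x k b = x ⟨b, hb⟩ k := coordAt_fin ⟨b, hb⟩
      rw [this] at h1 h2
      rw [mem_nbhd, abs_le]; omega
    · simp only [hct, Subtype.coe_eta]
      rw [← labelOf_intervals r hmem, labelOf_intervals r ha]

/-- The number of dummy items does not depend on the labels and is a plain count, which `dupP` can
evaluate from the points alone. -/
theorem padSize_sub_card (r : Fin n → Fin P.d → BF P.ℓ) :
    padSize P n - (localListCore x r).card = dupCount x := by
  classical
  have h1 : dupCount x = (Finset.univ.filter fun a : Fin P.d × Fin n × Fin (2 * P.δ + 1) =>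
      IsDup x a.1 a.2.1 a.2.2).card := by
    rw [dupCount, Finset.card_filter, Fintype.sum_prod_type]
    simp only [Fintype.sum_prod_type]
  have h2 := Finset.card_filter_add_card_filter_not
    (s := (Finset.univ : Finset (Fin P.d × Fin n × Fin (2 * P.δ + 1))))
    (fun a => IsDup x a.1 a.2.1 a.2.2)
  rw [card_localListCore, h1]
  have h3 : (Finset.univ : Finset (Fin P.d × Fin n × Fin (2 * P.δ + 1))).card = padSize P n := by
    rw [Finset.card_univ]; simp only [Fintype.card_prod, Fintype.card_fin, padSize]; ring
  omega

theorem mapFn_inr (r : Fin n → Fin P.d → BF P.ℓ) (e : Fin (padSize P n) → BF P.ℓ)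
    (g : MapKey P n → BF P.ℓ) (i : Fin (padSize P n)) :
    programmed (localList x r e) g (.inr i) = if (i : ℕ) < dupCount x then e i else g (.inr i) := by
  have hmem : ∀ z, (Sum.inr i, z) ∈ localList x r e ↔ (i : ℕ) < dupCount x ∧ z = e i := by
    intro z
    rw [localList, Finset.mem_union, mem_localListCore, padSize_sub_card]
    simp only [reduceCtorEq, false_and, exists_false, false_or, Finset.mem_image,
      Finset.mem_filter, Finset.mem_univ, true_and, Prod.mk.injEq, Sum.inr.injEq]
    constructor
    · rintro ⟨i', h, rfl, rfl⟩; exact ⟨h, rfl⟩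
    · rintro ⟨h, rfl⟩; exact ⟨i, h, rfl, rfl⟩
  split_ifs with h
  · exact programmed_eq ((hmem _).2 ⟨h, rfl⟩) fun z hz => ((hmem z).1 hz).2
  · exact programmed_of_notMem fun z hz => h ((hmem z).1 hz).1

/-- In a dimension in which the interval of the point `i` is disjoint from the others, no other
point has the label of `i`. -/
theorem clsFin_isolated {i : Fin n}
    (hi : ∀ j, j ≠ i → Set.Icc (((x i k : ℕ) : ℤ) - P.δ) (((x i k : ℕ) : ℤ) + P.δ) ∩
      Set.Icc (((x j k : ℕ) : ℤ) - P.δ) (((x j k : ℕ) : ℤ) + P.δ) = ∅) :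
    clsFin x k i = i ∧ ∀ j, j ≠ i → clsFin x k j ≠ i := by
  have h : ∀ b < n, b ≠ (i : ℕ) → ¬ overlap x k b i ∧ ¬ overlap x k i b := by
    intro b hb hne
    have hemp := hi ⟨b, hb⟩ fun h => hne (congrArg Fin.val h)
    have h1 : ¬ overlap x k i b := by
      intro ho
      have hb' : coordAt x k b = x ⟨b, hb⟩ k := coordAt_fin ⟨b, hb⟩
      rw [overlap, coordAt_fin, hb'] at ho
      have : (max (x i k : ℕ) (x ⟨b, hb⟩ k : ℕ) - P.δ : ℤ) ∈ (∅ : Set ℤ) := by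
        rw [← hemp, Set.mem_inter_iff, Set.mem_Icc, Set.mem_Icc]; omega
      exact this
    exact ⟨fun ho => h1 ⟨ho.2, ho.1⟩, h1⟩
  have := cls_isolated h n le_rfl
  refine ⟨Fin.ext (this.1 i.2), fun j hj hc => this.2 j j.2 (fun h => hj (Fin.ext h)) ?_⟩
  exact congrArg Fin.val hc

end classes

end FPSI

/-! ### Programs that recompute classes and repetitions from a context. -/

namespace FPSI

open Prog

variable {P : Params}

/-! ### Contexts -/

/-- The encoding of the public parameters with a given table of values. -/
def pubWith (P : Params) (tb : Data) : Data :=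
  encList id [unary P.m, unary P.n, unary P.d, unary P.δ, .num P.u, unary P.ℓ, unary P.κ, tb]

/-- What is needed to answer queries to the functions `F'` of a party with the points `x`. -/
def mapCtx (tb : Data) {n : ℕ} (x : Fin n → Point P) (lab : Fin n → Fin P.d → BF P.ℓ)
    (dum : Fin (padSize P n) → BF P.ℓ) (ids : Data) : Data :=
  .pair (unary n) <| .pair (pubWith P tb) <| .pair (encVec encPoint x) <|
    .pair (encVec (encVec encBF) lab) <| .pair (encVec encBF dum) ids

namespace Prog

/-- Items of the list of public parameters. -/
abbrev pubM (X : Prog) : Prog := .comp .fst X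
abbrev pubN (X : Prog) : Prog := .comp .fst (.comp .snd X)
abbrev pubD (X : Prog) : Prog := .comp .fst (.comp .snd (.comp .snd X))
abbrev pubDelta (X : Prog) : Prog := .comp .fst (.comp .snd (.comp .snd (.comp .snd X)))
abbrev pubU (X : Prog) : Prog := .comp .fst (.comp .snd (.comp .snd (.comp .snd (.comp .snd X))))
abbrev pubL (X : Prog) : Prog :=
  .comp .fst (.comp .snd (.comp .snd (.comp .snd (.comp .snd (.comp .snd X)))))
abbrev pubK (X : Prog) : Prog :=
  .comp .fst (.comp .snd (.comp .snd (.comp .snd (.comp .snd (.comp .snd (.comp .snd X))))))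
abbrev pubT (X : Prog) : Prog := .comp .fst (.comp .snd (.comp .snd (.comp .snd (.comp .snd
  (.comp .snd (.comp .snd (.comp .snd X)))))))

/-- Components of a context. -/
abbrev ctxN (C : Prog) : Prog := .comp .fst C
abbrev ctxPub (C : Prog) : Prog := .comp .fst (.comp .snd C)
abbrev ctxPts (C : Prog) : Prog := .comp .fst (.comp .snd (.comp .snd C))
abbrev ctxLab (C : Prog) : Prog := .comp .fst (.comp .snd (.comp .snd (.comp .snd C)))
abbrev ctxDum (C : Prog) : Prog :=
  .comp .fst (.comp .snd (.comp .snd (.comp .snd (.comp .snd C))))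
abbrev ctxIds (C : Prog) : Prog :=
  .comp .snd (.comp .snd (.comp .snd (.comp .snd (.comp .snd C))))
abbrev ctxDelta (C : Prog) : Prog := uval (pubDelta (ctxPub C))
abbrev ctxTwoDelta (C : Prog) : Prog := addP (ctxDelta C) (ctxDelta C)
abbrev ctxCoord (C J K : Prog) : Prog := nthP (nthP (ctxPts C) J) K

section
variable {t : ℕ → ℕ} {O : Data → Data} {z : Data} {C J K A B : Prog} {tb : Data} {n : ℕ}
  {x : Fin n → Point P} {lab : Fin n → Fin P.d → BF P.ℓ} {dum : Fin (padSize P n) → BF P.ℓ}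
  {ids : Data} {j k a b : ℕ}

theorem ev_ite_cases {c f g : Prog} {p : Data → Prop} (hf : p (f.ev t O z)) (hg : p (g.ev t O z)) :
    p ((Prog.ite c f g).ev t O z) := by
  rw [ev_ite]
  split_ifs <;> assumption

theorem ev_ctxN (hC : C.ev t O z = mapCtx tb x lab dum ids) :
    (uval (ctxN C)).ev t O z = .num n := ev_uval (by rw [ev_comp, hC]; rfl)

theorem ev_ctxD (hC : C.ev t O z = mapCtx tb x lab dum ids) :
    (uval (pubD (ctxPub C))).ev t O z = .num P.d :=
  ev_uval (by simp only [ev_comp, hC]; rfl)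

theorem ev_ctxDelta (hC : C.ev t O z = mapCtx tb x lab dum ids) :
    (ctxDelta C).ev t O z = .num P.δ := ev_uval (by simp only [ev_comp, hC]; rfl)

theorem ev_ctxTwoDelta (hC : C.ev t O z = mapCtx tb x lab dum ids) :
    (ctxTwoDelta C).ev t O z = .num (2 * P.δ) := by
  rw [two_mul]; exact ev_addP (ev_ctxDelta hC) (ev_ctxDelta hC)

theorem ev_ctxU (hC : C.ev t O z = mapCtx tb x lab dum ids) :
    (pubU (ctxPub C)).ev t O z = .num P.u := by simp only [ev_comp, hC]; rfl

theorem ev_ctxL (hC : C.ev t O z = mapCtx tb x lab dum ids) :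
    (pubL (ctxPub C)).ev t O z = .num (2 ^ P.ℓ) := by simp only [ev_comp, hC]; rfl

theorem ev_ctxCoord (hC : C.ev t O z = mapCtx tb x lab dum ids) (hJ : J.ev t O z = .num j)
    (hK : K.ev t O z = .num k) (hj : j < n) (hk : k < P.d) :
    (ctxCoord C J K).ev t O z = .num (coordAt x ⟨k, hk⟩ j) := by
  have h1 : (ctxPts C).ev t O z = encVec encPoint x := by simp only [ev_comp, hC]; rfl
  have h2 := ev_nthP h1 hJ hj
  rw [ev_nthP h2 hK hk, encFin, coordAt, dif_pos hj]

/-! ### Classes -/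

abbrev overlapP (C A B K : Prog) : Prog :=
  andP (leP (ctxCoord C A K) (addP (ctxCoord C B K) (ctxTwoDelta C)))
    (leP (ctxCoord C B K) (addP (ctxCoord C A K) (ctxTwoDelta C)))

theorem holds_overlapP (hC : C.ev t O z = mapCtx tb x lab dum ids) (hA : A.ev t O z = .num a)
    (hB : B.ev t O z = .num b) (hK : K.ev t O z = .num k) (ha : a < n) (hb : b < n) (hk : k < P.d) :
    (overlapP C A B K).Holds t O z ↔ overlap x ⟨k, hk⟩ a b := by
  have h1 := ev_ctxCoord hC hA hK ha hk
  have h2 := ev_ctxCoord hC hB hK hb hk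
  rw [holds_andP, holds_leP h1 (ev_addP h2 (ev_ctxTwoDelta hC)),
    holds_leP h2 (ev_addP h1 (ev_ctxTwoDelta hC))]
  rfl

/-- The test, on input `(((((ctx, k), j), acc), a), b)`, whether `b < j` is in the class of `a` and
overlaps `j`. -/
def clsTest : Prog :=
  andP (ltP .snd (.comp .snd (.comp .fst (.comp .fst .fst))))
    (andP (eqP (nthP (.comp .snd (.comp .fst .fst)) .snd)
        (nthP (.comp .snd (.comp .fst .fst)) (.comp .snd .fst)))
      (overlapP (.comp .fst (.comp .fst (.comp .fst (.comp .fst .fst)))) .snd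
        (.comp .snd (.comp .fst (.comp .fst .fst)))
        (.comp .snd (.comp .fst (.comp .fst (.comp .fst .fst))))))

/-- On input `((((ctx, k), j), acc), a)`, the new label of `a`. -/
def clsEntry : Prog :=
  .ite (eqP .snd (.comp .snd (.comp .fst .fst))) (.comp .snd (.comp .fst .fst))
    (.ite (exN (uval (ctxN (.comp .fst (.comp .fst (.comp .fst .fst))))) clsTest)
      (.comp .snd (.comp .fst .fst))
      -- Genuine entries are at most `n`, so reduction modulo `n + 1` does not alter them. For an
      -- arbitrary accumulator it bounds the entry, as polynomial time on all inputs demands.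
      (modP (nthP (.comp .snd .fst) .snd)
        (addP (uval (ctxN (.comp .fst (.comp .fst (.comp .fst .fst))))) (numP 1))))

/-- On input `(ctx, k)`, the list of the labels of all points. -/
def clsP : Prog := forN (uval (ctxN .fst)) (tab (uval (ctxN .fst)) (numP 0))
  (tab (uval (ctxN (.comp .fst (.comp .fst .fst)))) clsEntry)

set_option synthInstance.maxSize 2000 in
instance : PT clsTest := by unfold clsTest; infer_instance

set_option synthInstance.maxSize 2000 in
instance : PT clsEntry := by unfold clsEntry; infer_instance

theorem clsEntry_size {w acc a : Data} {j : ℕ} :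
    (clsEntry.ev t O (.pair (.pair (.pair w (.num j)) acc) a)).size ≤
      (Data.num j).size + (Data.num (((uval (ctxN .fst)).ev t O w).toNat + 1)).size := by
  obtain ⟨v, hv⟩ : ∃ v, (uval (ctxN .fst)).ev t O w = .num v := ⟨_, rfl⟩
  have hv' : (uval (ctxN (.comp .fst (.comp .fst (.comp .fst .fst))))).ev t O
    (.pair (.pair (.pair w (.num j)) acc) a) = .num v := hv
  rw [hv, Data.toNat_num, clsEntry]
  refine ev_ite_cases (p := fun d => d.size ≤ _) (Nat.le_add_right _ _)
    (ev_ite_cases (p := fun d => d.size ≤ _) (Nat.le_add_right _ _) ?_)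
  · rw [ev_comp, ev_pair, ev_addP hv' rfl, ev_mod]
    generalize (nthP (.comp .snd .fst) .snd).ev t O (.pair (.pair (.pair w (.num j)) acc) a) = d
    have : ((Data.pair d (.num (v + 1))).arith (· % ·)).size ≤ (Data.num (v + 1)).size := by
      match d with
      | .num b => simpa [Data.size] using Nat.size_le_size (Nat.mod_lt b (Nat.succ_pos v)).le
      | .pair _ _ => simp [Data.arith, Data.size]
    omega

set_option synthInstance.maxSize 2000 in
instance : PT clsP := by
  obtain ⟨p, hp, h⟩ := (inferInstance : PV (uval (ctxN .fst))).out
  refine PT.forN _ _ _ (r := fun s => p s * (s + (p s + 2) + 1) + 1)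
    ((hp.mul ((MonoPoly.self.add (hp.add (.const 2))).add (.const 1))).add (.const 1))
    fun t O s he x j acc hx hj => ?_
  have h1 := h t O x s he hx
  have hc : (uval (ctxN (.comp .fst (.comp .fst .fst)))).ev t O (.pair (.pair x (.num j)) acc) =
    (uval (ctxN .fst)).ev t O x := rfl
  have h2 := tab_size_le (c := uval (ctxN (.comp .fst (.comp .fst .fst)))) (g := clsEntry)
    (t := t) (O := O) (x := .pair (.pair x (.num j)) acc) (B := s + (p s + 2)) fun i => by
      refine clsEntry_size.trans (add_le_add hj ?_)
      have := natSize_le_self (((uval (ctxN .fst)).ev t O x).toNat + 1)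
      simp only [Data.size]; omega
  rw [hc] at h2
  have h3 := Nat.mul_le_mul_right (s + (p s + 2) + 1) h1
  omega

end

section
variable {t : ℕ → ℕ} {O : Data → Data} {z : Data} {tb : Data} {n : ℕ}
  {x : Fin n → Point P} {lab : Fin n → Fin P.d → BF P.ℓ} {dum : Fin (padSize P n) → BF P.ℓ}
  {ids : Data}

theorem _root_.FPSI.cls_le {M : ℕ → ℕ → Prop} [DecidableRel M] (j a : ℕ) : cls M j a ≤ j := by
  induction j generalizing a with
  | zero => exact le_rfl
  | succ j ih =>
    rw [cls]
    have := ih a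
    split_ifs <;> omega

theorem ev_clsP (k : Fin P.d) :
    clsP.ev t O (.pair (mapCtx tb x lab dum ids) (.num k)) =
      encVec (fun v : ℕ => .num v) fun a : Fin n => cls (overlap x k) n a := by
  set w : Data := .pair (mapCtx tb x lab dum ids) (.num k) with hw
  have hN : (uval (ctxN .fst)).ev t O w = .num n := ev_ctxN (C := .fst) rfl
  rw [clsP, ev_forN, hN, Data.toNat_num]
  suffices H : ∀ j ≤ n, forVal (tab (uval (ctxN .fst)) (numP 0))
      (tab (uval (ctxN (.comp .fst (.comp .fst .fst)))) clsEntry) t O w j =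
      encVec (fun v : ℕ => .num v) fun a : Fin n => cls (overlap x k) j a from H n le_rfl
  intro j
  induction j with
  | zero => intro _; exact ev_tab hN fun i => rfl
  | succ j ih =>
    intro hj
    rw [forVal, ih (by omega)]
    set acc := encVec (fun v : ℕ => .num v) fun a : Fin n => cls (overlap x k) j a with hacc
    refine ev_tab hN fun a => ?_
    set y : Data := .pair (.pair (.pair w (.num j)) acc) (.num a) with hy
    have hnth : ∀ b : Fin n, ∀ y' : Data, ∀ L I : Prog, L.ev t O y' = acc →
        I.ev t O y' = .num (b : ℕ) → (nthP L I).ev t O y' = .num (cls (overlap x k) j b) := by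
      intro b y' L I hL hI
      exact ev_nthP (hL.trans hacc) hI b.2
    have htest : (exN (uval (ctxN (.comp .fst (.comp .fst (.comp .fst .fst))))) clsTest).Holds t O y
        ↔ ∃ b < j, cls (overlap x k) j b = cls (overlap x k) j a ∧ overlap x k b j := by
      rw [holds_exN (n := n) (by exact hN)]
      have : ∀ b, b < n → (clsTest.Holds t O (.pair y (.num b)) ↔
          b < j ∧ cls (overlap x k) j b = cls (overlap x k) j a ∧ overlap x k b j) := by
        intro b hb
        rw [clsTest, holds_andP, holds_andP, holds_ltP (a := b) (b := j) rfl rfl,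
          holds_eqP (hnth ⟨b, hb⟩ _ _ _ rfl rfl) (hnth a _ _ _ rfl rfl),
          holds_overlapP (tb := tb) (x := x) (lab := lab) (dum := dum) (ids := ids) (a := b)
            (b := j) (k := k) rfl rfl rfl rfl hb hj k.2]
      constructor
      · rintro ⟨b, hb, h⟩; exact ⟨b, (this b hb).1 h⟩
      · rintro ⟨b, hb, h⟩; exact ⟨b, by omega, (this b (by omega)).2 ⟨hb, h⟩⟩
    have heq : (eqP .snd (.comp .snd (.comp .fst .fst))).Holds t O y ↔ (a : ℕ) = j :=
      holds_eqP rfl rfl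
    rw [clsEntry, cls]
    split_ifs with h1 h2
    · rw [ev_ite_holds (heq.2 h1)]; rfl
    · rw [ev_ite_not fun h => h1 (heq.1 h), ev_ite_holds (htest.2 h2)]; rfl
    · rw [ev_ite_not fun h => h1 (heq.1 h), ev_ite_not fun h => h2 (htest.1 h),
        ev_modP (b := n + 1) (hnth a _ _ _ rfl rfl) (ev_addP (a := n) (by exact hN) rfl), Nat.mod_eq_of_lt]
      have := cls_le (M := overlap x k) j a
      omega

/-! ### Repeated elements -/

/-- The test for repeated elements, on input `((((z, k), j), t), a)` with `z = (ctx, y)`. -/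
def dupTest : Prog :=
  andP (ltP .snd (.comp .snd (.comp .fst .fst)))
    (andP
      (leP (ctxCoord (.comp .fst (.comp .fst (.comp .fst (.comp .fst .fst)))) .snd
          (.comp .snd (.comp .fst (.comp .fst .fst))))
        (addP (ctxCoord (.comp .fst (.comp .fst (.comp .fst (.comp .fst .fst))))
          (.comp .snd (.comp .fst .fst)) (.comp .snd (.comp .fst (.comp .fst .fst))))
          (.comp .snd .fst)))
      (leP (addP (ctxCoord (.comp .fst (.comp .fst (.comp .fst (.comp .fst .fst))))
          (.comp .snd (.comp .fst .fst)) (.comp .snd (.comp .fst (.comp .fst .fst))))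
          (.comp .snd .fst))
        (addP (ctxCoord (.comp .fst (.comp .fst (.comp .fst (.comp .fst .fst)))) .snd
          (.comp .snd (.comp .fst (.comp .fst .fst))))
          (ctxTwoDelta (.comp .fst (.comp .fst (.comp .fst (.comp .fst .fst))))))))

/-- The number of repeated elements, on input `(ctx, y)`. -/
def dupP : Prog :=
  sumN (uval (pubD (ctxPub .fst))) (sumN (uval (ctxN (.comp .fst .fst)))
    (sumN (addP (ctxTwoDelta (.comp .fst (.comp .fst .fst))) (numP 1))
      (.ite (exN (uval (ctxN (.comp .fst (.comp .fst (.comp .fst .fst))))) dupTest)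
        (numP 1) (numP 0))))

set_option synthInstance.maxSize 2000 in
instance : PT dupTest := by unfold dupTest; infer_instance

set_option synthInstance.maxSize 2000 in
instance : PT dupP := by unfold dupP; infer_instance

theorem ev_dupP (y : Data) : dupP.ev t O (.pair (mapCtx tb x lab dum ids) y) =
    .num (dupCount x) := by
  classical
  set z : Data := .pair (mapCtx tb x lab dum ids) y with hz
  have hd : (uval (pubD (ctxPub .fst))).ev t O z = .num P.d := ev_ctxD (C := .fst) rfl
  have hN : (uval (ctxN .fst)).ev t O z = .num n := ev_ctxN (C := .fst) rfl
  have h2δ : (addP (ctxTwoDelta .fst) (numP 1)).ev t O z = .num (2 * P.δ + 1) :=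
    ev_addP (ev_ctxTwoDelta (C := .fst) rfl) rfl
  have key : ∀ (k : Fin P.d) (j : Fin n) (i : ℕ),
      (exN (uval (ctxN (.comp .fst (.comp .fst (.comp .fst .fst))))) dupTest).Holds t O
        (.pair (.pair (.pair z (.num k)) (.num j)) (.num i)) ↔ IsDup x k j i := by
    intro k j i
    rw [holds_exN (n := n) (by exact hN)]
    refine exists_congr fun a => and_congr_right fun ha => ?_
    have h1 := ev_ctxCoord (t := t) (O := O)
      (z := .pair (.pair (.pair (.pair z (.num k)) (.num j)) (.num i)) (.num a))
      (C := .comp .fst (.comp .fst (.comp .fst (.comp .fst .fst)))) (J := .snd)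
      (K := .comp .snd (.comp .fst (.comp .fst .fst))) (tb := tb) (x := x) (lab := lab) (dum := dum)
      (ids := ids) (j := a) (k := k) rfl rfl rfl ha k.2
    have h2 := ev_ctxCoord (t := t) (O := O)
      (z := .pair (.pair (.pair (.pair z (.num k)) (.num j)) (.num i)) (.num a))
      (C := .comp .fst (.comp .fst (.comp .fst (.comp .fst .fst))))
      (J := .comp .snd (.comp .fst .fst))
      (K := .comp .snd (.comp .fst (.comp .fst .fst))) (tb := tb) (x := x) (lab := lab) (dum := dum)
      (ids := ids) (j := j) (k := k) rfl rfl rfl j.2 k.2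
    have h3 := ev_ctxTwoDelta (t := t) (O := O)
      (z := .pair (.pair (.pair (.pair z (.num k)) (.num j)) (.num i)) (.num a))
      (C := .comp .fst (.comp .fst (.comp .fst (.comp .fst .fst)))) (tb := tb) (x := x)
      (lab := lab) (dum := dum) (ids := ids) rfl
    rw [dupTest, holds_andP, holds_andP, holds_ltP (a := a) (b := j) rfl rfl,
      holds_leP h1 (ev_addP (b := i) h2 rfl), holds_leP (ev_addP (b := i) h2 rfl) (ev_addP h1 h3)]
  rw [dupP, dupCount]
  have e1 := ev_sumN (t := t) (O := O) (x := z) (g := sumN (uval (ctxN (.comp .fst .fst)))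
    (sumN (addP (ctxTwoDelta (.comp .fst (.comp .fst .fst))) (numP 1))
      (.ite (exN (uval (ctxN (.comp .fst (.comp .fst (.comp .fst .fst))))) dupTest)
        (numP 1) (numP 0)))) (w := fun k => if h : k < P.d then
          ∑ j : Fin n, ∑ i : Fin (2 * P.δ + 1), if IsDup x ⟨k, h⟩ j i then 1 else 0 else 0) hd ?_
  · rw [e1, Finset.sum_range]
    simp
  · intro k hk
    rw [dif_pos hk]
    have e2 := ev_sumN (t := t) (O := O) (x := .pair z (.num k))
      (c := uval (ctxN (.comp .fst .fst)))
      (g := sumN (addP (ctxTwoDelta (.comp .fst (.comp .fst .fst))) (numP 1))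
      (.ite (exN (uval (ctxN (.comp .fst (.comp .fst (.comp .fst .fst))))) dupTest)
        (numP 1) (numP 0))) (n := n) (w := fun j => ∑ i : Fin (2 * P.δ + 1),
          if IsDup x ⟨k, hk⟩ j i then 1 else 0) hN ?_
    · rw [e2, Finset.sum_range]
    · intro j hj
      have e3 := ev_sumN (t := t) (O := O) (x := .pair (.pair z (.num k)) (.num j))
        (c := addP (ctxTwoDelta (.comp .fst (.comp .fst .fst))) (numP 1))
        (g := .ite (exN (uval (ctxN (.comp .fst (.comp .fst (.comp .fst .fst))))) dupTest)
          (numP 1) (numP 0)) (n := 2 * P.δ + 1)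
        (w := fun i => if IsDup x ⟨k, hk⟩ j i then 1 else 0) h2δ ?_
      · rw [e3, Finset.sum_range]
      · intro i _
        have hk' := key ⟨k, hk⟩ ⟨j, hj⟩ i
        split_ifs with h
        · rw [ev_ite_holds (hk'.2 h)]; rfl
        · rw [ev_ite_not fun h' => h (hk'.1 h')]; rfl

end

end Prog
end FPSI

/-! ### Answering oracle queries from a context and a random tape. -/

namespace FPSI

open Prog

variable {P : Params}

/-! ### Recognizing encodings of keys -/

theorem encCoord_injective : Function.Injective (encCoord (P := P)) := by
  intro a b h
  have ha := Finset.mem_Icc.1 a.2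
  have hb := Finset.mem_Icc.1 b.2
  simp only [encCoord, Data.num.injEq] at h
  ext; omega

theorem encMapKey_injective {n : ℕ} : Function.Injective (encMapKey (P := P) (n := n)) := by
  rintro (⟨k, c⟩ | i) (⟨k', c'⟩ | i') h <;>
    simp only [encMapKey, encFin, Data.pair.injEq, Data.num.injEq, true_and, zero_ne_one,
      one_ne_zero, false_and] at h
  · rw [Fin.ext h.1, encCoord_injective h.2]
  · rw [Fin.ext h]

theorem encFilterKey_injective : Function.Injective (encFilterKey (P := P)) := by
  rintro ⟨i, k, c⟩ ⟨i', k', c'⟩ h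
  simp only [encFilterKey, encFin, Data.pair.injEq, Data.num.injEq] at h
  rw [encBF_injective h.1, Fin.ext h.2.1, encCoord_injective h.2.2]

/-- Keys of the two oracles of the receiver. -/
def encBothKeys {n : ℕ} : MapKey P n ⊕ FilterKey P → Data :=
  Sum.elim (fun x => .pair (.num 0) (encMapKey x)) fun x => .pair (.num 1) (encFilterKey x)

theorem encBothKeys_injective {n : ℕ} : Function.Injective (encBothKeys (P := P) (n := n)) := by
  rintro (a | a) (b | b) h <;>
    simp only [encBothKeys, Sum.elim_inl, Sum.elim_inr, Data.pair.injEq, Data.num.injEq, true_and,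
      zero_ne_one, one_ne_zero, false_and] at h
  · rw [encMapKey_injective h]
  · rw [encFilterKey_injective h]

theorem oracleOf_of_ne {α : Type} {ℓ : ℕ} {e : α → Data} {f : α → BF ℓ} {y : Data}
    (h : ∀ a, e a ≠ y) : oracleOf e f y = .num 0 := dif_neg fun ⟨a, ha⟩ => h a ha

/-- The coordinate of an element, as a number in the encoding of coordinates. -/
def Coord.nat (c : Coord P) : ℕ := ((c : ℤ) + P.δ).toNat

theorem encCoord_eq (c : Coord P) : encCoord c = .num (Coord.nat c) := rfl

theorem Coord.nat_lt (c : Coord P) : Coord.nat c < P.u + 2 * P.δ := by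
  have := Finset.mem_Icc.1 c.2
  unfold Coord.nat; omega

theorem Coord.exists_nat {v : ℕ} (h : v < P.u + 2 * P.δ) : ∃ c : Coord P, Coord.nat c = v :=
  ⟨⟨(v : ℤ) - P.δ, by rw [Finset.mem_Icc]; omega⟩, by unfold Coord.nat; dsimp only; omega⟩

theorem mem_nbhd_nat {x : Fin P.u} {c : Coord P} :
    c ∈ nbhd x ↔ (x : ℕ) ≤ Coord.nat c ∧ Coord.nat c ≤ x + 2 * P.δ := by
  have := Finset.mem_Icc.1 c.2
  rw [mem_nbhd, abs_le]; unfold Coord.nat; omega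

namespace Prog

abbrev isNumP (X : Prog) (v : ℕ) : Prog := andP (notP (.comp .isPair X)) (eqP X (numP v))

/-- The test whether `X` is a dimension and a coordinate. -/
abbrev coordKeyP (C X : Prog) : Prog :=
  andP (.comp .isPair X) <| andP (notP (.comp .isPair (.comp .fst X))) <|
    andP (notP (.comp .isPair (.comp .snd X))) <|
    andP (ltP (.comp .fst X) (uval (pubD (ctxPub C))))
      (ltP (.comp .snd X) (addP (pubU (ctxPub C)) (ctxTwoDelta C)))

section
variable {t : ℕ → ℕ} {O : Data → Data} {z : Data} {C X : Prog} {tb : Data} {n : ℕ}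
  {x : Fin n → Point P} {lab : Fin n → Fin P.d → BF P.ℓ} {dum : Fin (padSize P n) → BF P.ℓ}
  {ids : Data}

theorem holds_notPair : (notP (.comp .isPair X)).Holds t O z ↔ ∃ v, X.ev t O z = .num v := by
  rw [holds_notP, holds_isPair]
  cases X.ev t O z <;> simp

theorem holds_isNumP {v : ℕ} : (isNumP X v).Holds t O z ↔ X.ev t O z = .num v := by
  rw [holds_andP, holds_notPair]
  constructor
  · rintro ⟨⟨w, hw⟩, h⟩
    rw [holds_eqP hw rfl] at h
    rw [hw, h]
  · intro h
    exact ⟨⟨v, h⟩, (holds_eqP h rfl).2 rfl⟩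

theorem holds_coordKeyP (hC : C.ev t O z = mapCtx tb x lab dum ids) :
    (coordKeyP C X).Holds t O z ↔
      ∃ (k : Fin P.d) (c : Coord P), X.ev t O z = .pair (encFin k) (encCoord c) := by
  have hd := ev_ctxD hC
  have hu := ev_addP (ev_ctxU hC) (ev_ctxTwoDelta hC)
  simp only [coordKeyP]
  rw [holds_andP, holds_andP, holds_andP, holds_andP, holds_isPair, holds_notPair, holds_notPair]
  constructor
  · rintro ⟨⟨a, b, hX⟩, ⟨k, hk⟩, ⟨c, hc⟩, h1, h2⟩
    rw [holds_ltP hk hd] at h1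
    rw [holds_ltP hc hu] at h2
    obtain ⟨c', rfl⟩ := Coord.exists_nat h2
    refine ⟨⟨k, h1⟩, c', ?_⟩
    rw [ev_comp, hX] at hk hc
    rw [hX, encCoord_eq]
    exact congrArg₂ Data.pair hk hc
  · rintro ⟨k, c, h⟩
    have hk : (Prog.comp .fst X).ev t O z = .num k := by rw [ev_comp, h]; rfl
    have hc : (Prog.comp .snd X).ev t O z = .num (Coord.nat c) := by rw [ev_comp, h]; rfl
    exact ⟨⟨_, _, h⟩, ⟨_, hk⟩, ⟨_, hc⟩, (holds_ltP hk hd).2 k.2, (holds_ltP hc hu).2 c.nat_lt⟩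

end

/-! ### Answering queries to the functions `F'` -/

/-- A bound for the elements of the field that is positive in every case. -/
abbrev capP (C : Prog) : Prog := addP (addP (pubL (ctxPub C)) (numP 0)) (numP 1)

/-- Word `idx` of the part `tag` of the tape, reduced modulo `L`. -/
abbrev rndP (tag : ℕ) (idx L : Prog) : Prog :=
  modP (.comp .rand (addP (mulP (numP 16) idx) (numP tag))) L

theorem ev_rndP {t : ℕ → ℕ} {O : Data → Data} {z : Data} {tag i ℓ : ℕ} {idx L : Prog}
    (hi : idx.ev t O z = .num i) (hL : L.ev t O z = .num (2 ^ ℓ)) :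
    (rndP tag idx L).ev t O z = encBF (BF.ofNat ℓ (t (16 * i + tag))) := by
  rw [encBF, BF.toNat_ofNat]
  refine ev_modP ?_ hL
  rw [ev_comp, ev_addP (ev_mulP rfl hi) rfl]; rfl

/-- The dimension and the coordinate in a query, on input `((ctx, y), j)`. -/
abbrev keyDim : Prog := .comp .fst (.comp .snd (.comp .snd .fst))
abbrev keyCoord : Prog := .comp .snd (.comp .snd (.comp .snd .fst))

/-- The test, on input `((ctx, y), j)`, whether the interval of the point `j` contains the
coordinate in the query `y`. -/
def coverP : Prog :=
  andP (leP (ctxCoord (.comp .fst .fst) .snd keyDim) keyCoord)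
    (leP keyCoord (addP (ctxCoord (.comp .fst .fst) .snd keyDim) (ctxTwoDelta (.comp .fst .fst))))

/-- The label of the point `j` in the dimension in the query `y`, on input `((ctx, y), j)`. -/
def labelP : Prog :=
  nthP (nthP (ctxLab (.comp .fst .fst))
    (nthP (.comp clsP (.pair (.comp .fst .fst) keyDim)) .snd)) keyDim

/-- The index of a query in its part of the tape, on input `(ctx, y)`. -/
abbrev keyIdx : Prog :=
  addP (mulP (.comp .snd (.comp .snd .snd)) (uval (pubD (ctxPub .fst))))
    (.comp .fst (.comp .snd .snd))

def ansInl : Prog :=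
  modP (selN (uval (ctxN .fst)) (rndP 0 keyIdx (pubL (ctxPub .fst))) coverP labelP) (capP .fst)

def ansInr : Prog :=
  modP (.ite (ltP (.comp .snd .snd) dupP) (nthP (ctxDum .fst) (.comp .snd .snd))
    (rndP 1 (.comp .snd .snd) (pubL (ctxPub .fst)))) (capP .fst)

abbrev isInl : Prog :=
  andP (.comp .isPair .snd) (andP (isNumP (.comp .fst .snd) 0) (coordKeyP .fst (.comp .snd .snd)))

abbrev ctxPad (C : Prog) : Prog :=
  mulP (mulP (uval (ctxN C)) (uval (pubD (ctxPub C)))) (addP (ctxTwoDelta C) (numP 1))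

abbrev isInr : Prog :=
  andP (.comp .isPair .snd) (andP (isNumP (.comp .fst .snd) 1)
    (andP (notP (.comp .isPair (.comp .snd .snd))) (ltP (.comp .snd .snd) (ctxPad .fst))))

/-- The answer to the query `y` to the function of fuzzy mapping, on input `(ctx, y)`. -/
def ansMap : Prog := .ite isInl ansInl (.ite isInr ansInr (numP 0))

set_option synthInstance.maxSize 4000 in
instance : PT coverP := by unfold coverP; infer_instance
set_option synthInstance.maxSize 4000 in
instance : PT labelP := by unfold labelP; infer_instance
set_option synthInstance.maxSize 4000 in
instance : PT ansInl := by unfold ansInl; infer_instance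
set_option synthInstance.maxSize 4000 in
instance : PT ansInr := by unfold ansInr; infer_instance
set_option synthInstance.maxSize 4000 in
instance : PT ansMap := by unfold ansMap; infer_instance

/-- On a malformed context nothing else limits the answer. Reduction modulo a positive number read
from the context bounds it independently of tape and query, as `prf_views` requires. -/
theorem cap_size (f : Prog) {t : ℕ → ℕ} {O : Data → Data} {ctx y : Data} :
    ((modP f (capP .fst)).ev t O (.pair ctx y)).size ≤ ctx.size + 3 := by
  have h : ∃ v, (capP .fst).ev t O (.pair ctx y) = .num (v + 1) ∧ (Data.num v).size ≤ ctx.size := by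
    refine ⟨((pubL (ctxPub .fst)).ev t O (.pair ctx y)).toNat, ?_, ?_⟩
    · have h0 : (addP (pubL (ctxPub .fst)) (numP 0)).ev t O (.pair ctx y) =
          .num ((pubL (ctxPub .fst)).ev t O (.pair ctx y)).toNat := arith_add_zero _
      exact ev_addP h0 rfl
    · refine (Data.toNat_size _).trans ?_
      simp only [ev_comp, ev_fst, ev_snd, Data.fst_pair]
      exact (Data.fst_size _).trans <| (Data.snd_size _).trans <| (Data.snd_size _).trans <|
        (Data.snd_size _).trans <| (Data.snd_size _).trans <| (Data.snd_size _).trans <|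
        (Data.fst_size _).trans <| Data.snd_size _
  obtain ⟨v, hv, hs⟩ := h
  rw [ev_comp, ev_pair, hv, ev_mod]
  have h1 := natSize_add v 1
  have h2 : Nat.size 1 = 1 := Nat.size_one
  generalize f.ev t O (.pair ctx y) = d
  match d with
  | .num b =>
    have := Nat.size_le_size (show b % (v + 1) < v + 1 from Nat.mod_lt b (Nat.succ_pos v)).le
    simp only [Data.arith, Data.size] at *; omega
  | .pair _ _ => simp [Data.arith, Data.size]

theorem ansMap_size {t : ℕ → ℕ} {O : Data → Data} {ctx y : Data} :
    (ansMap.ev t O (.pair ctx y)).size ≤ ctx.size + 3 :=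
  ev_ite_cases (p := fun d => d.size ≤ _) (cap_size _)
    (ev_ite_cases (p := fun d => d.size ≤ _) (cap_size _) (by simp [Data.size]))

end Prog

/-- The address on the tape of the value of a random function at a key of fuzzy mapping. -/
def addrMap {n : ℕ} : MapKey P n → ℕ
  | .inl (k, c) => 16 * (Coord.nat c * P.d + k) + 0
  | .inr i => 16 * i + 1

namespace Prog
section
variable {t : ℕ → ℕ} {O : Data → Data} {tb : Data} {n : ℕ}
  {x : Fin n → Point P} {lab : Fin n → Fin P.d → BF P.ℓ} {dum : Fin (padSize P n) → BF P.ℓ}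
  {ids : Data}

theorem ev_capP {C : Prog} {z : Data} (hC : C.ev t O z = mapCtx tb x lab dum ids) :
    (capP C).ev t O z = .num (2 ^ P.ℓ + 1) := 
  ev_addP (a := 2 ^ P.ℓ) (b := 1) (ev_addP (a := 2 ^ P.ℓ) (b := 0) (ev_ctxL hC) rfl) rfl

theorem ev_mod_cap {C f : Prog} {z : Data} (hC : C.ev t O z = mapCtx tb x lab dum ids)
    {v : BF P.ℓ} (hf : f.ev t O z = encBF v) : (modP f (capP C)).ev t O z = encBF v := by
  rw [ev_modP hf (ev_capP hC), Nat.mod_eq_of_lt (v.toNat_lt.trans (Nat.lt_succ_self _))]; rfl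

theorem holds_coverP {z : Data} {j : ℕ} (hj : j < n) {tag : Data} {k : Fin P.d} {c : Coord P}
    (hz : z = .pair (.pair (mapCtx tb x lab dum ids) (.pair tag (.pair (encFin k) (encCoord c))))
      (.num j)) : coverP.Holds t O z ↔ c ∈ nbhd (x ⟨j, hj⟩ k) := by
  subst hz
  set z : Data := .pair (.pair (mapCtx tb x lab dum ids)
    (.pair tag (.pair (encFin k) (encCoord c)))) (.num j)
  have hC : (Prog.comp .fst .fst).ev t O z = mapCtx tb x lab dum ids := rfl
  have h1 := ev_ctxCoord (J := .snd) (K := keyDim) (k := k) hC rfl rfl hj k.2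
  have h2 : keyCoord.ev t O z = .num (Coord.nat c) := rfl
  rw [coverP, holds_andP, holds_leP h1 h2, holds_leP h2 (ev_addP h1 (ev_ctxTwoDelta hC)),
    mem_nbhd_nat, coordAt, dif_pos hj]

theorem ev_keyIdx {tag : Data} {k : Fin P.d} {c : Coord P} : keyIdx.ev t O
    (.pair (mapCtx tb x lab dum ids) (.pair tag (.pair (encFin k) (encCoord c)))) =
      .num (Coord.nat c * P.d + k) :=
  ev_addP (ev_mulP rfl (ev_ctxD (C := .fst) rfl)) rfl

/-- Programmed values are recomputed from the points, labels and dummies; any other value is the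
tape word at the address of the key. This evaluates a random function on a huge domain one query at
a time, with consistent answers. -/
theorem ev_ansMap (y : Data) : ansMap.ev t O (.pair (mapCtx tb x lab dum ids) y) =
    oracleOf encMapKey (programmed (localList x lab dum) fun a => BF.ofNat P.ℓ (t (addrMap a)))
      y := by
  set z : Data := .pair (mapCtx tb x lab dum ids) y with hz
  have hC : Prog.fst.ev t O z = mapCtx tb x lab dum ids := rfl
  have hN : (uval (ctxN .fst)).ev t O z = .num n := ev_ctxN hC
  have hpad : (ctxPad .fst).ev t O z = .num (padSize P n) :=
    ev_mulP (ev_mulP hN (ev_ctxD hC)) (ev_addP (ev_ctxTwoDelta hC) rfl)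
  have hinl : isInl.Holds t O z ↔ ∃ k c, y = encMapKey (P := P) (n := n) (.inl (k, c)) := by
    simp only [isInl]
    rw [holds_andP, holds_andP, holds_isPair, holds_isNumP, holds_coordKeyP hC]
    constructor
    · rintro ⟨⟨a, b, h⟩, h1, k, c, h2⟩
      change y = _ at h
      subst h
      change a = _ at h1
      change b = _ at h2
      exact ⟨k, c, by rw [h1, h2]; rfl⟩
    · rintro ⟨k, c, rfl⟩
      exact ⟨⟨_, _, rfl⟩, rfl, k, c, rfl⟩
  have hinr : isInr.Holds t O z ↔ ∃ i, y = encMapKey (P := P) (n := n) (.inr i) := by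
    simp only [isInr]
    rw [holds_andP, holds_andP, holds_isPair, holds_isNumP, holds_andP, holds_notPair]
    constructor
    · rintro ⟨⟨a, b, h⟩, h1, ⟨i, h2⟩, h3⟩
      rw [holds_ltP h2 hpad] at h3
      change y = _ at h
      subst h
      change a = _ at h1
      change b = _ at h2
      exact ⟨⟨i, h3⟩, by rw [h1, h2]; rfl⟩
    · rintro ⟨i, rfl⟩
      exact ⟨⟨_, _, rfl⟩, rfl, ⟨i, rfl⟩, (holds_ltP rfl hpad).2 i.2⟩
  rw [ansMap]
  by_cases h1 : isInl.Holds t O z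
  · rw [ev_ite_holds h1]
    obtain ⟨k, c, rfl⟩ := hinl.1 h1
    rw [oracleOf_apply encMapKey_injective]
    refine ev_mod_cap hC ?_
    rcases ev_selN (t := t) (O := O) (i := rndP 0 keyIdx (pubL (ctxPub .fst))) (g := coverP)
      (v := labelP) hN with ⟨j, hj, h2, -, h3⟩ | ⟨h2, h3⟩
    · rw [h3, mapFn_inl_covered (k := k) lab dum _ ((holds_coverP hj rfl).1 h2)]
      have hcl : (nthP (.comp clsP (.pair (.comp .fst .fst) keyDim)) .snd).ev t O
          (.pair z (.num j)) = .num (cls (overlap x k) n j) := by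
        refine ev_nthP (w := fun a : Fin n => cls (overlap x k) n a)
          (e := fun v : ℕ => Data.num v) ?_ rfl hj
        rw [ev_comp]; exact ev_clsP k
      exact ev_nthP (e := encBF) (ev_nthP (e := encVec encBF) (w := lab) rfl hcl (cls_lt hj))
        rfl k.2
    · rw [h3, mapFn_inl_free (k := k) lab dum _ fun a ha => h2 a a.2 ((holds_coverP a.2 rfl).2 ha)]
      exact ev_rndP ev_keyIdx (ev_ctxL hC)
  rw [ev_ite_not h1]
  by_cases h2 : isInr.Holds t O z
  · rw [ev_ite_holds h2]
    obtain ⟨i, rfl⟩ := hinr.1 h2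
    rw [oracleOf_apply encMapKey_injective]
    refine ev_mod_cap hC ?_
    rw [mapFn_inr]
    have hlt : (ltP (.comp .snd .snd) dupP).Holds t O z ↔ (i : ℕ) < dupCount x :=
      holds_ltP rfl (ev_dupP _)
    split_ifs with h3
    · rw [ev_ite_holds (hlt.2 h3)]
      exact ev_nthP (e := encBF) (w := dum) rfl rfl i.2
    · rw [ev_ite_not fun h => h3 (hlt.1 h)]
      exact ev_rndP rfl (ev_ctxL hC)
  · rw [ev_ite_not h2, oracleOf_of_ne]; · rfl
    rintro (⟨k, c⟩ | i) rfl
    · exact h1 (hinl.2 ⟨k, c, rfl⟩)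
    · exact h2 (hinr.2 ⟨i, rfl⟩)

end
end Prog

/-! ### Answering queries in the refined filtering -/

open Classical in
/-- The function that is programmed in the refined filtering; if two points have the same
identifier, then the last one is used. -/
noncomputable def filterFn (p : ℝ) {n : ℕ} (w : Fin n → Point P) (ids : Fin n → BF P.ℓ)
    (g : FilterKey P → BF P.ℓ) (y : FilterKey P) : BF P.ℓ :=
  if h : ∃ i, (ids i = y.1 ∧ y.2.2 ∈ nbhd (w i y.2.1)) ∧
      ∀ j, ids j = y.1 ∧ y.2.2 ∈ nbhd (w j y.2.1) → j ≤ i then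
    BF.ofNat P.ℓ (powVal P p ((y.2.2 : ℤ) - ((w h.choose y.2.1 : ℕ) : ℤ)).natAbs)
  else g y

theorem filterFn_last {p : ℝ} {n : ℕ} {w : Fin n → Point P} {ids : Fin n → BF P.ℓ}
    {g : FilterKey P → BF P.ℓ} {y : FilterKey P} {i : Fin n} (h : ids i = y.1)
    (hn : y.2.2 ∈ nbhd (w i y.2.1))
    (hi : ∀ j, ids j = y.1 ∧ y.2.2 ∈ nbhd (w j y.2.1) → j ≤ i) :
    filterFn p w ids g y =
      BF.ofNat P.ℓ (powVal P p ((y.2.2 : ℤ) - ((w i y.2.1 : ℕ) : ℤ)).natAbs) := by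
  have hex : ∃ i, (ids i = y.1 ∧ y.2.2 ∈ nbhd (w i y.2.1)) ∧
      ∀ j, ids j = y.1 ∧ y.2.2 ∈ nbhd (w j y.2.1) → j ≤ i := ⟨i, ⟨h, hn⟩, hi⟩
  have : hex.choose = i := le_antisymm (hi _ hex.choose_spec.1) (hex.choose_spec.2 i ⟨h, hn⟩)
  rw [filterFn, dif_pos hex, this]

theorem filterFn_free {p : ℝ} {n : ℕ} {w : Fin n → Point P} {ids : Fin n → BF P.ℓ}
    {g : FilterKey P → BF P.ℓ} {y : FilterKey P}
    (h : ∀ i, ids i = y.1 → y.2.2 ∉ nbhd (w i y.2.1)) : filterFn p w ids g y = g y :=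
  dif_neg fun ⟨i, ⟨h1, h2⟩, _⟩ => h i h1 h2

/-- The address on the tape of the value of a random function at a key of the filtering. -/
def addrFilter (y : FilterKey P) : ℕ :=
  16 * (y.1.toNat + 2 ^ P.ℓ * (Coord.nat y.2.2 * P.d + y.2.1)) + 2

namespace Prog

/-- The distance of the point `j` from the coordinate in the query, on input `((ctx, y), j)`. -/
abbrev diffP : Prog :=
  addP (subP keyCoord (addP (ctxCoord (.comp .fst .fst) .snd keyDim) (ctxDelta (.comp .fst .fst))))
    (subP (addP (ctxCoord (.comp .fst .fst) .snd keyDim) (ctxDelta (.comp .fst .fst))) keyCoord)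

def filterTest : Prog :=
  andP (eqP (nthP (ctxIds (.comp .fst .fst)) .snd) (.comp .fst (.comp .snd .fst))) coverP

def filterVal : Prog :=
  modP (nthP (pubT (ctxPub (.comp .fst .fst))) diffP) (pubL (ctxPub (.comp .fst .fst)))

def ansFilterKey : Prog :=
  modP (selN (uval (ctxN .fst))
    (rndP 2 (addP (.comp .fst .snd) (mulP (pubL (ctxPub .fst)) keyIdx)) (pubL (ctxPub .fst)))
    filterTest filterVal) (capP .fst)

abbrev isFilterKey : Prog :=
  andP (.comp .isPair .snd) (andP (notP (.comp .isPair (.comp .fst .snd)))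
    (andP (ltP (.comp .fst .snd) (pubL (ctxPub .fst))) (coordKeyP .fst (.comp .snd .snd))))

/-- The answer to the query `y` in the refined filtering, on input `(ctx, y)`. -/
def ansFilter : Prog := .ite isFilterKey ansFilterKey (numP 0)

/-- The answer to a query of the receiver. -/
def ansBoth : Prog :=
  .ite (andP (.comp .isPair .snd) (isNumP (.comp .fst .snd) 0))
    (.comp ansMap (.pair .fst (.comp .snd .snd)))
    (.ite (andP (.comp .isPair .snd) (isNumP (.comp .fst .snd) 1))
      (.comp ansFilter (.pair .fst (.comp .snd .snd))) (numP 0))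

set_option synthInstance.maxSize 4000 in
instance : PT filterTest := by unfold filterTest; infer_instance
set_option synthInstance.maxSize 4000 in
instance : PT filterVal := by unfold filterVal; infer_instance
set_option synthInstance.maxSize 4000 in
instance : PT ansFilterKey := by unfold ansFilterKey; infer_instance
set_option synthInstance.maxSize 4000 in
instance : PT ansFilter := by unfold ansFilter; infer_instance
set_option synthInstance.maxSize 4000 in
instance : PT ansBoth := by unfold ansBoth; infer_instance

theorem ansBoth_size {t : ℕ → ℕ} {O : Data → Data} {ctx y : Data} :
    (ansBoth.ev t O (.pair ctx y)).size ≤ ctx.size + 3 :=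
  ev_ite_cases (p := fun d => d.size ≤ _) ansMap_size
    (ev_ite_cases (p := fun d => d.size ≤ _)
      (ev_ite_cases (p := fun d => d.size ≤ _) (cap_size _) (by simp [Data.size]))
      (by simp [Data.size]))

section
variable {t : ℕ → ℕ} {O : Data → Data} {tb : Data} {n : ℕ}
  {x : Fin n → Point P} {lab : Fin n → Fin P.d → BF P.ℓ} {dum : Fin (padSize P n) → BF P.ℓ}
  {ids : Fin n → BF P.ℓ} {p : ℝ} {τ : Fin (P.δ + 1) → ℕ}

theorem ev_ctxT {C : Prog} {z ids : Data} (hC : C.ev t O z = mapCtx tb x lab dum ids) :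
    (pubT (ctxPub C)).ev t O z = tb := by
  simp only [ev_comp, hC]; rfl

/-- The table matters only modulo `2 ^ ℓ`. The simulator uses the true table, while the reduction
uses its residues, whose size is polynomial without any assumption on `scale`. -/
theorem ev_ansFilter (htb : tb = encVec (fun v : ℕ => .num v) τ)
    (hτ : ∀ i : Fin (P.δ + 1), τ i % 2 ^ P.ℓ = powVal P p i % 2 ^ P.ℓ) (y : Data) :
    ansFilter.ev t O (.pair (mapCtx tb x lab dum (encVec encBF ids)) y) =
      oracleOf encFilterKey (filterFn p x ids fun a => BF.ofNat P.ℓ (t (addrFilter a))) y := by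
  set z : Data := .pair (mapCtx tb x lab dum (encVec encBF ids)) y with hz
  have hC : Prog.fst.ev t O z = mapCtx tb x lab dum (encVec encBF ids) := rfl
  have hN : (uval (ctxN .fst)).ev t O z = .num n := ev_ctxN hC
  have hL : (pubL (ctxPub .fst)).ev t O z = .num (2 ^ P.ℓ) := ev_ctxL hC
  have hkey : isFilterKey.Holds t O z ↔ ∃ a, y = encFilterKey (P := P) a := by
    simp only [isFilterKey]
    rw [holds_andP, holds_andP, holds_andP, holds_isPair, holds_notPair, holds_coordKeyP hC]
    constructor
    · rintro ⟨⟨a, b, h⟩, ⟨i, h1⟩, h3, k, c, h2⟩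
      rw [holds_ltP h1 hL] at h3
      change y = _ at h
      subst h
      change a = _ at h1
      change b = _ at h2
      refine ⟨(BF.ofNat P.ℓ i, k, c), ?_⟩
      rw [h1, h2, encFilterKey, encBF, BF.toNat_ofNat, Nat.mod_eq_of_lt h3]
    · rintro ⟨⟨i, k, c⟩, rfl⟩
      exact ⟨⟨_, _, rfl⟩, ⟨_, rfl⟩, (holds_ltP rfl hL).2 i.toNat_lt, k, c, rfl⟩
  rw [ansFilter]
  by_cases h1 : isFilterKey.Holds t O z
  · rw [ev_ite_holds h1]
    obtain ⟨⟨i, k, c⟩, rfl⟩ := hkey.1 h1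
    rw [oracleOf_apply encFilterKey_injective]
    refine ev_mod_cap hC ?_
    have htest : ∀ j (hj : j < n), filterTest.Holds t O (.pair z (.num j)) ↔
        ids ⟨j, hj⟩ = i ∧ c ∈ nbhd (x ⟨j, hj⟩ k) := by
      intro j hj
      have e1 : (nthP (ctxIds (.comp .fst .fst)) .snd).ev t O (.pair z (.num j)) =
          .num (ids ⟨j, hj⟩).toNat := ev_nthP (e := encBF) (w := ids) rfl rfl hj
      have e2 : (Prog.comp .fst (.comp .snd .fst)).ev t O (.pair z (.num j)) = .num i.toNat := rfl
      rw [filterTest, holds_andP, holds_eqP e1 e2, BF.toNat_injective.eq_iff]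
      exact and_congr_right fun _ => holds_coverP hj rfl
    rcases ev_selN (t := t) (O := O) (i := rndP 2 (addP (.comp .fst .snd)
      (mulP (pubL (ctxPub .fst)) keyIdx)) (pubL (ctxPub .fst))) (g := filterTest)
      (v := filterVal) hN with ⟨j, hj, h2, h4, h3⟩ | ⟨h2, h3⟩
    · obtain ⟨h5, h6⟩ := (htest j hj).1 h2
      rw [h3, filterFn_last (y := (i, k, c)) (i := ⟨j, hj⟩) h5 h6 fun b hb =>
        h4 b b.2 ((htest b b.2).2 hb)]
      set z' : Data := .pair z (.num j)
      have hC' : (Prog.comp .fst .fst).ev t O z' = mapCtx tb x lab dum (encVec encBF ids) := rfl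
      have e1 : (ctxCoord (.comp .fst .fst) .snd keyDim).ev t O z' = .num (x ⟨j, hj⟩ k) := by
        rw [ev_ctxCoord (J := .snd) (K := keyDim) (k := k) hC' rfl rfl hj k.2, coordAt, dif_pos hj]
      have e2 : keyCoord.ev t O z' = .num (Coord.nat c) := rfl
      have e3 := ev_addP e1 (ev_ctxDelta hC')
      -- Of the two truncated differences at least one is zero, so their sum is the distance; the
      -- added `δ` matches the shift in the encoding of coordinates.
      have e4 : diffP.ev t O z' = .num (((c : ℤ) - ((x ⟨j, hj⟩ k : ℕ) : ℤ)).natAbs) := by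
        rw [ev_addP (ev_subP e2 e3) (ev_subP e3 e2)]
        have := Finset.mem_Icc.1 c.2
        congr 1
        unfold Coord.nat; omega
      have hlt : ((c : ℤ) - ((x ⟨j, hj⟩ k : ℕ) : ℤ)).natAbs < P.δ + 1 := by
        have := mem_nbhd.1 h6
        rw [Int.abs_eq_natAbs] at this
        omega
      have e5 : (nthP (pubT (ctxPub (.comp .fst .fst))) diffP).ev t O z' =
          .num (τ ⟨_, hlt⟩) :=
        ev_nthP (e := fun v : ℕ => Data.num v) (w := τ)
          ((ev_ctxT hC').trans htb) e4 hlt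
      have e6 := ev_modP e5 (ev_ctxL hC')
      rw [hτ] at e6
      dsimp only at e6 ⊢
      rw [filterVal, e6, encBF]
      exact congrArg Data.num (BF.toNat_ofNat _ _).symm
    · rw [h3, filterFn_free (y := (i, k, c)) fun b hb hb' => h2 b b.2 ((htest b b.2).2 ⟨hb, hb'⟩)]
      exact ev_rndP (ev_addP (a := i.toNat) rfl (ev_mulP hL ev_keyIdx)) hL
  · rw [ev_ite_not h1, oracleOf_of_ne]; · rfl
    rintro a rfl
    exact h1 (hkey.2 ⟨a, rfl⟩)

/-- The address of a key of one of the two oracles of the receiver. -/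
def _root_.FPSI.addrBoth {n : ℕ} : MapKey P n ⊕ FilterKey P → ℕ := Sum.elim addrMap addrFilter

theorem ev_ansBoth (htb : tb = encVec (fun v : ℕ => .num v) τ)
    (hτ : ∀ i : Fin (P.δ + 1), τ i % 2 ^ P.ℓ = powVal P p i % 2 ^ P.ℓ) (y : Data) :
    ansBoth.ev t O (.pair (mapCtx tb x lab dum (encVec encBF ids)) y) =
      oracleOf encBothKeys (Sum.elim
        (programmed (localList x lab dum) fun a => BF.ofNat P.ℓ (t (addrBoth (.inl a))))
        (filterFn p x ids fun a => BF.ofNat P.ℓ (t (addrBoth (n := n) (.inr a))))) y := by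
  set z : Data := .pair (mapCtx tb x lab dum (encVec encBF ids)) y with hz
  have htest : ∀ v, (andP (.comp .isPair .snd) (isNumP (.comp .fst .snd) v)).Holds t O z ↔
      ∃ y', y = .pair (.num v) y' := by
    intro v
    rw [holds_andP, holds_isPair, holds_isNumP]
    constructor
    · rintro ⟨⟨a, b, h⟩, h1⟩
      change y = _ at h
      subst h
      change a = _ at h1
      exact ⟨b, by rw [h1]⟩
    · rintro ⟨y', rfl⟩
      exact ⟨⟨_, _, rfl⟩, rfl⟩
  have hsplit : ∀ {α β : Type} (e : α → Data) (e' : β → Data) (f : α → BF P.ℓ)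
      (f' : β → BF P.ℓ) (h : Function.Injective (Sum.elim (fun x => Data.pair (.num 0) (e x))
        fun x => Data.pair (.num 1) (e' x))) (y : Data),
      oracleOf (Sum.elim (fun x => Data.pair (.num 0) (e x)) fun x => Data.pair (.num 1) (e' x))
        (Sum.elim f f') (.pair (.num 0) y) = oracleOf e f y ∧
      oracleOf (Sum.elim (fun x => Data.pair (.num 0) (e x)) fun x => Data.pair (.num 1) (e' x))
        (Sum.elim f f') (.pair (.num 1) y) = oracleOf e' f' y := by
    intro α β e e' f f' h y
    have he : Function.Injective e := fun a b hab => Sum.inl_injective (h (by simp [hab]))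
    have he' : Function.Injective e' := fun a b hab => Sum.inr_injective (h (by simp [hab]))
    constructor
    · by_cases hy : ∃ a, e a = y
      · obtain ⟨a, rfl⟩ := hy
        rw [oracleOf_apply he]
        exact oracleOf_apply h _ (.inl a)
      · rw [oracleOf_of_ne fun a ha => hy ⟨a, ha⟩, oracleOf_of_ne]
        rintro (a | a) ha
        · exact hy ⟨a, by simpa using ha⟩
        · simp at ha
    · by_cases hy : ∃ a, e' a = y
      · obtain ⟨a, rfl⟩ := hy
        rw [oracleOf_apply he']
        exact oracleOf_apply h _ (.inr a)
      · rw [oracleOf_of_ne fun a ha => hy ⟨a, ha⟩, oracleOf_of_ne]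
        rintro (a | a) ha
        · simp at ha
        · exact hy ⟨a, by simpa using ha⟩
  rw [ansBoth]
  by_cases h0 : (andP (.comp .isPair .snd) (isNumP (.comp .fst .snd) 0)).Holds t O z
  · rw [ev_ite_holds h0]
    obtain ⟨y', rfl⟩ := (htest 0).1 h0
    exact (ev_ansMap y').trans (hsplit _ _ _ _ encBothKeys_injective y').1.symm
  rw [ev_ite_not h0]
  by_cases h1 : (andP (.comp .isPair .snd) (isNumP (.comp .fst .snd) 1)).Holds t O z
  · rw [ev_ite_holds h1]
    obtain ⟨y', rfl⟩ := (htest 1).1 h1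
    exact (ev_ansFilter htb hτ y').trans (hsplit _ _ _ _ encBothKeys_injective y').2.symm
  · rw [ev_ite_not h1, oracleOf_of_ne]; · rfl
    rintro (a | a) rfl
    · exact h0 ((htest 0).2 ⟨_, rfl⟩)
    · exact h1 ((htest 1).2 ⟨_, rfl⟩)

end
end Prog
end FPSI

/-! ### Resampling, union bounds and random orders. -/

namespace FPSI

open scoped BigOperators
open Finset (expect)
open Prog

/-! ### Indicators, resampling and collisions -/

open Classical in
/-- The indicator of a proposition. -/
noncomputable def ind (p : Prop) : ℝ := if p then 1 else 0

theorem ind_true {p : Prop} (h : p) : ind p = 1 := if_pos h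
theorem ind_false {p : Prop} (h : ¬ p) : ind p = 0 := if_neg h
theorem ind_nonneg (p : Prop) : 0 ≤ ind p := by unfold ind; split_ifs <;> norm_num
theorem ind_mono {p q : Prop} (h : p → q) : ind p ≤ ind q := by
  by_cases hp : p
  · rw [ind_true hp, ind_true (h hp)]
  · rw [ind_false hp]; exact ind_nonneg q

theorem ind_or_le (p q : Prop) : ind (p ∨ q) ≤ ind p + ind q := by
  by_cases hp : p
  · rw [ind_true (.inl hp), ind_true hp]; linarith [ind_nonneg q]
  · rw [ind_false hp, zero_add]; exact ind_mono fun h => h.resolve_left hp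

theorem ind_exists_le {α : Type*} [Fintype α] (p : α → Prop) : ind (∃ a, p a) ≤ ∑ a, ind (p a) := by
  by_cases h : ∃ a, p a
  · obtain ⟨a, ha⟩ := h
    rw [ind_true ⟨a, ha⟩, ← ind_true ha]
    exact Finset.single_le_sum (f := fun a => ind (p a)) (fun b _ => ind_nonneg _)
      (Finset.mem_univ a)
  · rw [ind_false h]; exact Finset.sum_nonneg fun a _ => ind_nonneg _

theorem abs_sub_le_ind {p : Prop} {a b : ℝ} (h : ¬ p → a = b) (h1 : |a - b| ≤ 1) :
    |a - b| ≤ ind p := by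
  by_cases hp : p
  · rwa [ind_true hp]
  · rw [ind_false hp, h hp, sub_self, abs_zero]

/-- Swapping the value at `a` with a fresh sample is an involution of the product space. This
isolates one label or one function value while all others are held fixed. -/
theorem expect_update {K X : Type*} [Fintype K] [DecidableEq K] [Fintype X] [Nonempty X] (a : K)
    (φ : (K → X) → ℝ) : 𝔼 h, φ h = 𝔼 h, 𝔼 v, φ (Function.update h a v) := by
  let e : (K → X) × X ≃ (K → X) × X := ⟨fun x => (Function.update x.1 a x.2, x.1 a),
    fun x => (Function.update x.1 a x.2, x.1 a), fun x => by simp, fun x => by simp⟩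
  rw [← expect_prod fun x : (K → X) × X => φ (Function.update x.1 a x.2)]
  refine Eq.trans ?_ (Fintype.expect_equiv e _ (fun x => φ x.1) fun x => rfl).symm
  rw [expect_prod]
  exact expect_congr' fun h => (Fintype.expect_const (φ h)).symm

theorem expect_ind_eq {X : Type*} [Fintype X] (c : X) :
    𝔼 v : X, ind (v = c) = (Fintype.card X : ℝ)⁻¹ := by
  classical
  rw [Fintype.expect_eq_sum_div_card, div_eq_inv_mul]
  simp [ind]

theorem expect_ind_exists_le {α β : Type*} [Fintype α] [Fintype β] {p : α → β → Prop} {c : ℝ}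
    (h : ∀ b, 𝔼 a, ind (p a b) ≤ c) : 𝔼 a, ind (∃ b, p a b) ≤ Fintype.card β * c := by
  calc 𝔼 a, ind (∃ b, p a b) ≤ 𝔼 a, ∑ b, ind (p a b) :=
        Finset.expect_le_expect fun a _ => ind_exists_le _
    _ = ∑ b, 𝔼 a, ind (p a b) := Finset.expect_sum_comm _ _ _
    _ ≤ ∑ _b : β, c := Finset.sum_le_sum fun b _ => h b
    _ = Fintype.card β * c := by simp

/-- A union bound for collisions. -/
theorem expect_ind_not_injective_le {α X : Type*} [Fintype α] [Nonempty α] {n : ℕ}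
    {f : α → Fin n → X} {c : ℝ} (hc : 0 ≤ c) (h : ∀ i j, i ≠ j → 𝔼 a, ind (f a i = f a j) ≤ c) :
    𝔼 a, ind (¬ Function.Injective (f a)) ≤ n ^ 2 * c := by
  have := expect_ind_exists_le (α := α) (β := Fin n × Fin n)
    (p := fun a x => x.1 ≠ x.2 ∧ f a x.1 = f a x.2) (c := c) fun x => by
      by_cases hx : x.1 = x.2
      · exact expect_le_const fun a => by rw [ind_false (by simp [hx])]; exact hc
      · exact (Finset.expect_le_expect fun a _ => ind_mono And.right).trans (h _ _ hx)
  refine (Finset.expect_le_expect fun a _ => ind_mono fun ha => ?_).trans (this.trans_eq ?_)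
  · simp only [Function.Injective, not_forall] at ha
    obtain ⟨i, j, h1, h2⟩ := ha
    exact ⟨(i, j), h2, h1⟩
  · simp [sq]

/-! ### A random permutation from random numbers -/

/-- The position of `i` when the indices are sorted by the numbers `u`. -/
def rankNat {m : ℕ} (u : Fin m → ℕ) (i : Fin m) : ℕ :=
  (Finset.univ.filter fun j : Fin m => u j < u i ∨ (u j = u i ∧ j < i)).card

theorem rankNat_lt {m : ℕ} (u : Fin m → ℕ) (i : Fin m) : rankNat u i < m := by
  conv_rhs => rw [← Fintype.card_fin m]
  exact Finset.card_lt_card (Finset.filter_ssubset.2 ⟨i, Finset.mem_univ _, by simp⟩)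

theorem rankNat_strict {m : ℕ} (u : Fin m → ℕ) {i j : Fin m} (h : u i < u j ∨ (u i = u j ∧ i < j)) :
    rankNat u i < rankNat u j := by
  refine Finset.card_lt_card ((Finset.ssubset_iff_of_subset fun a ha => ?_).2 ⟨i, ?_, ?_⟩)
  · simp only [Finset.mem_filter, Finset.mem_univ, true_and] at ha ⊢
    rcases ha with h1 | ⟨h1, h2⟩ <;> rcases h with h3 | ⟨h3, h4⟩
    · left; omega
    · left; omega
    · left; omega
    · right; exact ⟨by omega, h2.trans h4⟩
  · simpa using h
  · simp

/-- The permutation that sorts. -/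
noncomputable def rankPerm {m : ℕ} (u : Fin m → ℕ) : Equiv.Perm (Fin m) :=
  Equiv.ofBijective (fun i => ⟨rankNat u i, rankNat_lt u i⟩) <| by
    rw [← Finite.injective_iff_bijective]
    intro i j h
    have h : rankNat u i = rankNat u j := congrArg Fin.val h
    by_contra hij
    rcases lt_trichotomy (u i) (u j) with h1 | h1 | h1
    · exact (rankNat_strict u (.inl h1)).ne h
    · rcases lt_or_gt_of_ne hij with h2 | h2
      · exact (rankNat_strict u (.inr ⟨h1, h2⟩)).ne h
      · exact (rankNat_strict u (.inr ⟨h1.symm, h2⟩)).ne' h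
    · exact (rankNat_strict u (.inl h1)).ne' h

theorem rankPerm_val {m : ℕ} (u : Fin m → ℕ) (i : Fin m) : (rankPerm u i : ℕ) = rankNat u i := rfl

/-- Without ties the rank is determined by the order of the values alone, so sorting commutes with
relabelling the indices. -/
theorem rankPerm_comp {m : ℕ} {u : Fin m → ℕ} (hu : Function.Injective u)
    (π : Equiv.Perm (Fin m)) : rankPerm (fun i => u (π i)) = π.trans (rankPerm u) := by
  have H : ∀ u : Fin m → ℕ, Function.Injective u → ∀ i,
      rankNat u i = (Finset.univ.filter fun j : Fin m => u j < u i).card := by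
    intro u hu i
    rw [rankNat]
    congr 1; ext j
    simp only [Finset.mem_filter, Finset.mem_univ, true_and, or_iff_left_iff_imp]
    rintro ⟨h1, h2⟩
    exact absurd (hu h1) h2.ne
  ext i
  rw [rankPerm_val, Equiv.trans_apply, rankPerm_val, H u hu,
    H (fun i => u (π i)) (hu.comp π.injective)]
  refine Finset.card_bij (fun j _ => π j) (by simp) (fun a _ b _ h => π.injective h)
    fun b hb => ⟨π.symm b, by simpa using hb, by simp⟩

/-- Sorting random numbers gives an almost uniform permutation. -/
theorem abs_expect_rankPerm_sub_le {m N : ℕ} [NeZero N] {f : Equiv.Perm (Fin m) → ℝ}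
    (hf : ∀ σ τ, |f σ - f τ| ≤ 1) :
    |(𝔼 u : Fin m → Fin N, f (rankPerm fun i => u i)) - 𝔼 σ, f σ| ≤ m ^ 2 * (N : ℝ)⁻¹ := by
  -- Both averages are symmetrized by a uniform relabelling `π`. The integrands then agree whenever
  -- `u` has no ties, so only the collision probability of `u` remains.
  have h1 : (𝔼 u : Fin m → Fin N, f (rankPerm fun i => u i)) =
      𝔼 π : Equiv.Perm (Fin m), 𝔼 u : Fin m → Fin N, f (rankPerm fun i => u (π i)) := by
    rw [← Fintype.expect_const (ι := Equiv.Perm (Fin m))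
      (𝔼 u : Fin m → Fin N, f (rankPerm fun i => u i))]
    refine expect_congr' fun π => ?_
    exact (Fintype.expect_equiv (π.arrowCongr (.refl _)) _ _ fun u => by
      congr 2; ext i; simp)
  have h2 : 𝔼 σ, f σ =
      𝔼 π : Equiv.Perm (Fin m), 𝔼 u : Fin m → Fin N, f (π.trans (rankPerm fun i => u i)) := by
    rw [Finset.expect_comm, ← Fintype.expect_const (ι := Fin m → Fin N) (𝔼 σ, f σ)]
    refine expect_congr' fun u => ?_
    exact (Fintype.expect_equiv (Equiv.mulLeft (rankPerm fun i => (u i : ℕ))) _ _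
      fun π => rfl).symm
  rw [h1, h2]
  refine abs_expect_sub_le_const fun π => ?_
  refine (abs_expect_sub_le fun u => abs_sub_le_ind
    (p := ¬ Function.Injective u) (fun hu => ?_) (hf _ _)).trans
    (expect_ind_not_injective_le (f := fun u => u) (by positivity) fun i j hij => ?_)
  · rw [not_not] at hu
    rw [rankPerm_comp (u := fun i => (u i : ℕ)) (Fin.val_injective.comp hu)]
  · rw [expect_update i]
    refine expect_le_const fun u => ?_
    simp only [Function.update_self, Function.update_of_ne hij.symm]
    rw [expect_ind_eq, Fintype.card_fin]

end FPSI

/-! ### Matching identifiers, and exactness of the refined filtering. -/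

namespace FPSI

open scoped BigOperators
open Finset (expect)
open Prog

variable {P : Params} {a b : ℕ}

/-! ### Identifiers -/

/-- The argument of the PRF for a point: the sum of the values of the function of the other party
and of the own labels. -/
noncomputable def mapIn (x : Fin a → Point P) (lab : Fin a → Fin P.d → BF P.ℓ)
    (f : MapKey P b → BF P.ℓ) (i : Fin a) : BF P.ℓ :=
  ∑ k, f (.inl (k, toCoord (x i k))) + pid x lab i

/-- The function that a party programs in fuzzy mapping. -/
noncomputable abbrev mapFn (x : Fin a → Point P) (lab : Fin a → Fin P.d → BF P.ℓ)
    (dum : Fin (padSize P a) → BF P.ℓ) (g : MapKey P a → BF P.ℓ) : MapKey P a → BF P.ℓ :=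
  programmed (localList x lab dum) g

/-- Each point lies in the intervals of the other, so the other party's function returns that
party's own labels there. Both sides are the sum of the two local identifiers, whatever the random
values are. -/
theorem mapIn_eq_of_close {x : Fin a → Point P} {y : Fin b → Point P} {i : Fin a} {j : Fin b}
    (h : ∀ k, |((x i k : ℕ) : ℤ) - ((y j k : ℕ) : ℤ)| ≤ P.δ) (lx dx gx ly dy gy) :
    mapIn x lx (mapFn y ly dy gy) i = mapIn y ly (mapFn x lx dx gx) j := by
  unfold mapIn
  rw [pid_eq, pid_eq, add_comm]
  congr 1
  · refine Finset.sum_congr rfl fun k _ => (mapFn_inl_covered lx dx gx ?_).symm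
    rw [toCoord_mem_nbhd, abs_sub_comm]; exact h k
  · refine Finset.sum_congr rfl fun k _ => mapFn_inl_covered ly dy gy ?_
    rw [toCoord_mem_nbhd]; exact h k

theorem card_BF (ℓ : ℕ) : Fintype.card (BF ℓ) = 2 ^ ℓ := by simp [ZMod.card]

/-- In the dimension `k` where the interval of `i` is isolated, the label sampled for `i` enters the
argument of `i` exactly once and that of `j` not at all. Resampling it makes the difference of the
two arguments uniform. -/
theorem expect_mapIn_collision {x : Fin a → Point P} (hx : DisjointProjection x)
    (f : MapKey P b → BF P.ℓ) {i j : Fin a} (hij : i ≠ j) :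
    𝔼 lab, ind (mapIn x lab f i = mapIn x lab f j) ≤ ((2 : ℝ) ^ P.ℓ)⁻¹ := by
  obtain ⟨k, hk⟩ := hx i
  obtain ⟨h1, h2⟩ := clsFin_isolated hk
  rw [expect_update i]
  refine expect_le_const fun lab => ?_
  rw [expect_update k]
  refine expect_le_const fun r => ?_
  set L : BF P.ℓ → Fin a → Fin P.d → BF P.ℓ :=
    fun v => Function.update lab i (Function.update r k v) with hL
  have hLk : ∀ v c k', (c ≠ i ∨ k' ≠ k) → L v c k' = L 0 c k' := by
    intro v c k' h
    by_cases hc : c = i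
    · subst hc
      have : k' ≠ k := h.resolve_left (by simp)
      simp [hL, this]
    · simp [hL, hc]
  have hi : ∀ v, mapIn x (L v) f i = mapIn x (L 0) f i - L 0 i k + v := by
    intro v
    unfold mapIn
    have hs : ∀ v, ∑ k', L v (clsFin x k' i) k' =
        v + ∑ k' ∈ Finset.univ.erase k, L 0 (clsFin x k' i) k' := by
      intro v
      rw [← Finset.add_sum_erase _ _ (Finset.mem_univ k), h1,
        Finset.sum_congr rfl fun k' hk' => hLk v _ k' (.inr (Finset.ne_of_mem_erase hk'))]
      congr 1
      simp [hL]
    have h0 : L 0 i k = 0 := by simp [hL]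
    rw [pid_eq, pid_eq, hs v, hs 0, h0]; abel
  have hj : ∀ v, mapIn x (L v) f j = mapIn x (L 0) f j := by
    intro v
    unfold mapIn
    rw [pid_eq, pid_eq]
    congr 1
    refine Finset.sum_congr rfl fun k' _ => hLk v _ k' ?_
    by_cases hkk : k' = k
    · subst hkk; exact .inl (h2 j hij.symm)
    · exact .inr hkk
  calc 𝔼 v, ind (mapIn x (L v) f i = mapIn x (L v) f j)
      = 𝔼 v, ind (v = mapIn x (L 0) f j - (mapIn x (L 0) f i - L 0 i k)) :=
        expect_congr' fun v => by rw [hi, hj, eq_sub_iff_add_eq, add_comm]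
    _ ≤ _ := by rw [expect_ind_eq, card_BF]; simp

theorem expect_mapIn_not_injective {x : Fin a → Point P} (hx : DisjointProjection x)
    (f : MapKey P b → BF P.ℓ) :
    𝔼 lab, ind (¬ Function.Injective (mapIn x lab f)) ≤ a ^ 2 * ((2 : ℝ) ^ P.ℓ)⁻¹ :=
  expect_ind_not_injective_le (by positivity) fun _ _ hij => expect_mapIn_collision hx f hij

/-- The values of a random function at distinct points are independent and uniform. -/
theorem abs_expect_random_sub_le {X Y : Type} [Fintype X] [DecidableEq X] [Fintype Y] [Nonempty Y]
    {x : Fin a → X} {f : (Fin a → Y) → ℝ} (hf : ∀ u v, |f u - f v| ≤ 1) :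
    |(𝔼 G : X → Y, f fun i => G (x i)) - 𝔼 ids, f ids| ≤ ind (¬ Function.Injective x) := by
  refine abs_sub_le_ind (fun h => (Balanced.restrict (not_not.1 h)).expect f) ?_
  rw [← Fintype.expect_const (ι := X → Y) (𝔼 ids, f ids)]
  refine abs_expect_sub_le_const fun G => ?_
  rw [← Fintype.expect_const (ι := Fin a → Y) (f fun i => G (x i))]
  exact abs_expect_sub_le_const fun ids => hf _ _

/-! ### Refined filtering -/

variable {p : ℝ}

theorem powVal_mono (hp : 1 ≤ p) {s t : ℕ} (h : s ≤ t) : powVal P p s ≤ powVal P p t := by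
  unfold powVal
  gcongr

theorem mem_filterList {w : Fin P.n → Point P} {ids : Fin P.n → BF P.ℓ} {y : FilterKey P}
    {z : BF P.ℓ} : (y, z) ∈ filterList p w ids ↔ ∃ i, ids i = y.1 ∧ y.2.2 ∈ nbhd (w i y.2.1) ∧
      z = BF.ofNat P.ℓ (powVal P p ((y.2.2 : ℤ) - ((w i y.2.1 : ℕ) : ℤ)).natAbs) := by
  obtain ⟨id, k, c⟩ := y
  simp only [filterList, Finset.mem_biUnion, Finset.mem_univ, true_and, Finset.mem_image,
    Prod.mk.injEq]
  constructor
  · rintro ⟨i, k', c', hc, ⟨h1, rfl, rfl⟩, rfl⟩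
    exact ⟨i, h1, hc, rfl⟩
  · rintro ⟨i, h1, h2, rfl⟩
    exact ⟨i, k, c, h2, ⟨h1, rfl, rfl⟩, rfl⟩

/-- At a key listed with two values `programmed` makes an arbitrary choice, which no program could
follow; `filterFn` takes the last match, as `selN` does. For distinct identifiers there is nothing
to choose. -/
theorem programmed_filterList {w : Fin P.n → Point P} {ids : Fin P.n → BF P.ℓ}
    (h : Function.Injective ids) (g : FilterKey P → BF P.ℓ) :
    programmed (filterList p w ids) g = filterFn p w ids g := by
  ext1 y
  by_cases hy : ∃ i, ids i = y.1 ∧ y.2.2 ∈ nbhd (w i y.2.1)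
  · obtain ⟨i, h1, h2⟩ := hy
    have hi : ∀ j, ids j = y.1 → j = i := fun j hj => h (hj.trans h1.symm)
    rw [filterFn_last h1 h2 fun j hj => (hi j hj.1).le]
    refine programmed_eq (mem_filterList.2 ⟨i, h1, h2, rfl⟩) fun z hz => ?_
    obtain ⟨j, h3, -, rfl⟩ := mem_filterList.1 hz
    rw [hi j h3]
  · rw [filterFn_free fun i h1 h2 => hy ⟨i, h1, h2⟩]
    refine programmed_of_notMem fun z hz => ?_
    obtain ⟨j, h1, h2, -⟩ := mem_filterList.1 hz
    exact hy ⟨j, h1, h2⟩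

theorem distLp_le_iff (hp : 1 ≤ p) {x y : Point P} : distLp p x y ≤ P.δ ↔
    ∑ k, (((((x k : ℕ) : ℤ) - ((y k : ℕ) : ℤ)).natAbs : ℕ) : ℝ) ^ p ≤ (P.δ : ℝ) ^ p := by
  have h : ∀ k, (((((x k : ℕ) : ℤ) - ((y k : ℕ) : ℤ)).natAbs : ℕ) : ℝ) =
      |((x k : ℕ) : ℝ) - ((y k : ℕ) : ℝ)| := by
    intro k
    rw [Nat.cast_natAbs]; push_cast; rfl
  rw [distLp, one_div, Real.rpow_inv_le_iff_of_pos (Finset.sum_nonneg fun k _ => by positivity)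
    (by positivity) (by linarith)]
  simp only [h]

/-- One summand is at most the sum, so the `L_p` ball lies in the `L_∞` ball; hence fuzzy mapping
for `L_∞` misses no match. -/
theorem close_of_distLp_le (hp : 1 ≤ p) {x y : Point P} (h : distLp p x y ≤ P.δ) (k : Fin P.d) :
    |((x k : ℕ) : ℤ) - ((y k : ℕ) : ℤ)| ≤ P.δ := by
  rw [distLp_le_iff hp] at h
  have h1 := (Finset.single_le_sum (f := fun k =>
    (((((x k : ℕ) : ℤ) - ((y k : ℕ) : ℤ)).natAbs : ℕ) : ℝ) ^ p) (fun k _ => by positivity)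
    (Finset.mem_univ k)).trans h
  rw [Real.rpow_le_rpow_iff (by positivity) (by positivity) (by linarith)] at h1
  rw [Int.abs_eq_natAbs]
  exact_mod_cast h1

/-- The sum of the values of a function of the filtering for the coordinates of a point. -/
noncomputable def filterSum (f : FilterKey P → BF P.ℓ) (id : BF P.ℓ) (x : Point P) : ZMod (2 ^ P.ℓ) :=
  ∑ k, ((f (id, k, toCoord (x k))).toNat : ZMod (2 ^ P.ℓ))

/-- The key of dimension `k` is not programmed. -/
def Uncovered (w : Fin a → Point P) (ids : Fin a → BF P.ℓ) (id : BF P.ℓ) (x : Point P)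
    (k : Fin P.d) : Prop := ∀ i, ids i = id → toCoord (x k) ∉ nbhd (w i k)

/-- Distinct identifiers prevent the keys of one query point from being programmed by different
points `w i`. Positivity of `d` supplies the first covered key, which names the point. -/
theorem uncovered_or {w : Fin a → Point P} {ids : Fin a → BF P.ℓ} (h : Function.Injective ids)
    (hd : 0 < P.d) (id : BF P.ℓ) (x : Point P) : (∃ k, Uncovered w ids id x k) ∨
      ∃ i, ids i = id ∧ ∀ k, toCoord (x k) ∈ nbhd (w i k) := by
  by_contra! hc
  obtain ⟨h1, h2⟩ := hc
  simp only [Uncovered, not_forall, not_not] at h1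
  obtain ⟨i, hi, -⟩ := h1 ⟨0, hd⟩
  obtain ⟨k, hk⟩ := h2 i hi
  obtain ⟨j, hj, hj'⟩ := h1 k
  rw [h (hj.trans hi.symm)] at hj'
  exact hk hj'

/-- Every programmed value is at most the threshold, so by `hover` the sum does not wrap around
modulo `2 ^ ℓ`; the comparison is then decided by the precision assumption `hexact`. -/
theorem filterSum_covered (hp : 1 ≤ p) (hover : P.d * powVal P p P.δ < 2 ^ P.ℓ)
    (hexact : ∀ t : Fin P.d → ℕ, (∀ k, t k ≤ P.δ) →
      (∑ k, powVal P p (t k) ≤ powVal P p P.δ ↔ ∑ k, ((t k : ℕ) : ℝ) ^ p ≤ (P.δ : ℝ) ^ p))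
    {w : Fin a → Point P} {ids : Fin a → BF P.ℓ} (h : Function.Injective ids)
    (g : FilterKey P → BF P.ℓ) {i : Fin a} {x : Point P}
    (hx : ∀ k, toCoord (x k) ∈ nbhd (w i k)) :
    (filterSum (filterFn p w ids g) (ids i) x).val ≤ powVal P p P.δ ↔
      distLp p x (w i) ≤ P.δ := by
  set t : Fin P.d → ℕ := fun k => (((x k : ℕ) : ℤ) - ((w i k : ℕ) : ℤ)).natAbs with ht
  have htδ : ∀ k, t k ≤ P.δ := by
    intro k
    have := hx k
    rw [toCoord_mem_nbhd, Int.abs_eq_natAbs] at this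
    exact Nat.cast_le.1 this
  have hle : ∀ k, powVal P p (t k) ≤ powVal P p P.δ := fun k => powVal_mono hp (htδ k)
  have hf : ∀ k, filterFn p w ids g (ids i, k, toCoord (x k)) =
      BF.ofNat P.ℓ (powVal P p (t k)) := fun k =>
    filterFn_last (y := (ids i, k, toCoord (x k))) rfl (hx k) fun j hj => (h hj.1).le
  have hsum : filterSum (filterFn p w ids g) (ids i) x =
      ((∑ k, powVal P p (t k) : ℕ) : ZMod (2 ^ P.ℓ)) := by
    rw [filterSum, Nat.cast_sum]
    refine Finset.sum_congr rfl fun k _ => ?_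
    rw [hf, BF.toNat_ofNat, ZMod.natCast_mod]
  have hlt : ∑ k, powVal P p (t k) < 2 ^ P.ℓ :=
    ((Finset.sum_le_sum fun k _ => hle k).trans (by simp)).trans_lt hover
  rw [hsum, ZMod.val_natCast, Nat.mod_eq_of_lt hlt, hexact t htδ, distLp_le_iff hp]

theorem expect_ind_val_le {ℓ c : ℕ} (u : ZMod (2 ^ ℓ)) :
    𝔼 v : BF ℓ, ind ((((v.toNat : ℕ) : ZMod (2 ^ ℓ)) + u).val ≤ c) ≤
      (c + 1) * ((2 : ℝ) ^ ℓ)⁻¹ := by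
  have hle : ∀ v : BF ℓ, ind ((((v.toNat : ℕ) : ZMod (2 ^ ℓ)) + u).val ≤ c) ≤
      ind (∃ r : Fin (c + 1), v = BF.ofNat ℓ (((r : ℕ) : ZMod (2 ^ ℓ)) - u).val) := by
    refine fun v => ind_mono fun hv => ⟨⟨_, Nat.lt_succ_of_le hv⟩, ?_⟩
    dsimp only
    rw [ZMod.natCast_zmod_val, add_sub_cancel_right, ZMod.val_natCast, BF.ofNat_mod,
      BF.ofNat_toNat]
  refine (Finset.expect_le_expect fun v _ => hle v).trans ((expect_ind_exists_le (α := BF ℓ)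
    (β := Fin (c + 1)) (c := ((2 : ℝ) ^ ℓ)⁻¹) fun r => ?_).trans_eq ?_)
  · rw [expect_ind_eq, card_BF]; simp
  · simp

/-- Resampling the random function at the unprogrammed key shifts the sum by a uniform value and
leaves the other summands alone, so each of the `c + 1` accepted sums has probability at most `2 ^
(-ℓ)`. -/
theorem expect_filterSum_uncovered {w : Fin a → Point P} {ids : Fin a → BF P.ℓ} {id : BF P.ℓ}
    {x : Point P} {k : Fin P.d} (hk : Uncovered w ids id x k) {c : ℕ} :
    𝔼 g, ind ((filterSum (filterFn p w ids g) id x).val ≤ c) ≤ (c + 1) * ((2 : ℝ) ^ P.ℓ)⁻¹ := by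
  rw [expect_update (id, k, toCoord (x k))]
  refine expect_le_const fun g => ?_
  set G : BF P.ℓ → FilterKey P → BF P.ℓ :=
    fun v => Function.update g (id, k, toCoord (x k)) v with hG
  have h1 : ∀ v, filterFn p w ids (G v) (id, k, toCoord (x k)) = v := fun v => by
    rw [filterFn_free (y := (id, k, toCoord (x k))) hk]; simp [hG]
  have h2 : ∀ v k', k' ≠ k → filterFn p w ids (G v) (id, k', toCoord (x k')) =
      filterFn p w ids (G 0) (id, k', toCoord (x k')) := by
    intro v k' hk'
    unfold filterFn
    split_ifs with h
    · rfl
    · simp [hG, hk']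
  refine le_of_eq_of_le (expect_congr' fun v => ?_) (expect_ind_val_le (c := c)
    (∑ k' ∈ Finset.univ.erase k,
      ((filterFn p w ids (G 0) (id, k', toCoord (x k'))).toNat : ZMod (2 ^ P.ℓ))))
  rw [filterSum, ← Finset.add_sum_erase _ _ (Finset.mem_univ k), h1,
    Finset.sum_congr rfl fun k' hk' => by rw [h2 v k' (Finset.ne_of_mem_erase hk')]]

end FPSI

/-! ### The protocol as a deterministic function of uniform choices. -/

namespace FPSI

open scoped BigOperators
open Finset (expect)
open Prog

variable {P : Params}

/-! ### The protocol as a function of its random choices -/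

variable (P) in
abbrev Labels (a : ℕ) := Fin a → Fin P.d → BF P.ℓ
variable (P) in
abbrev Dummies (a : ℕ) := Fin (padSize P a) → BF P.ℓ
variable (P) in
abbrev Shares (a : ℕ) := Fin a × Fin P.d → BF P.ℓ
variable (P) in
abbrev MapFun (a : ℕ) := MapKey P a → BF P.ℓ
variable (P) in
abbrev FilterFun := FilterKey P → BF P.ℓ
variable (P) in
abbrev ArithShares := Fin P.m × Fin P.d → ZMod (2 ^ P.ℓ)

/-- The view of the sender, with the random function of the so-OPPRF. -/
noncomputable def sView (q : Fin P.m → Point P) (σ : Equiv.Perm (Fin P.m)) (g : MapFun P P.m)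
    (lab : Labels P P.m) (dum : Dummies P P.m) (k : BF P.κ) (sO : Shares P P.n)
    (sOwn : Shares P P.m) (ids : Fin P.m → BF P.ℓ) (sh : Shares P P.m) (ar : ArithShares P) :
    SenderView P :=
  ⟨q, σ, ⟨lab, dum, k, mapFn (fun j => q (σ j)) lab dum g, sO, sOwn, ids⟩, sh, ar⟩

/-- The view of the receiver, with the random functions of the so-OPPRFs, if it receives `z`. -/
noncomputable def rView (p : ℝ) (w : Fin P.n → Point P) (g : MapFun P P.n) (gf : FilterFun P)
    (lab : Labels P P.n) (dum : Dummies P P.n) (k : BF P.κ) (sO : Shares P P.m)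
    (sOwn : Shares P P.n) (ids : Fin P.n → BF P.ℓ) (sh : Shares P P.m) (ar : ArithShares P)
    (z : Fin P.m → Option (Point P)) : ReceiverView P :=
  ⟨w, ⟨lab, dum, k, mapFn w lab dum g, sO, sOwn, ids⟩, filterFn p w ids gf, sh, ar,
    fun j => (z j).isSome, z⟩

open Classical in
/-- What the receiver should get for each point of the sender. -/
noncomputable def matched (p : ℝ) (q : Fin P.m → Point P) (w : Fin P.n → Point P) (j : Fin P.m) :
    Option (Point P) := if ∃ i, distLp p (q j) (w i) ≤ P.δ then some (q j) else none

theorem acceptProb_bind_bind {α β : Type} [Fintype α] [Nonempty α] (D : Adversary) (s : ℕ)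
    (f : α → PMF β) (h : β → PMF View) :
    acceptProb D s ((PMF.uniformOfFintype α >>= f) >>= h) = 𝔼 a, acceptProb D s (f a >>= h) := by
  rw [bind_assoc, acceptProb_bind]

theorem acceptProb_soOPPRF {Key ι α : Type} [Fintype Key] [DecidableEq Key] [Fintype ι]
    [DecidableEq ι] {ℓ : ℕ} (L : Finset (Key × BF ℓ)) (X : ι → Key) (D : Adversary) (s : ℕ)
    (f : SoOPPRFOut Key ι ℓ → PMF α) (h : α → PMF View) :
    acceptProb D s ((soOPPRF L X >>= f) >>= h) =
      𝔼 g, 𝔼 y, acceptProb D s (f ⟨programmed L g, y, fun i => programmed L g (X i) - y i⟩ >>= h) := by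
  rw [soOPPRF]
  simp only [bind_assoc, acceptProb_bind, pure_bind]

theorem acceptProb_fuzzyMap {α : Type} (F : BF P.κ → BF P.ℓ → BF P.ℓ) (q : Fin P.m → Point P)
    (w : Fin P.n → Point P) (D : Adversary) (s : ℕ)
    (f : FMapView P P.m P.n × FMapView P P.n P.m → PMF α) (h : α → PMF View) :
    acceptProb D s ((fuzzyMap F q w >>= f) >>= h) =
      𝔼 labS, 𝔼 dumS, 𝔼 labR, 𝔼 dumR, 𝔼 kS, 𝔼 kR, 𝔼 g₁, 𝔼 y₁, 𝔼 g₂, 𝔼 y₂, acceptProb D s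
        (let o₁ := programmed (localList q labS dumS) g₁
        let o₂ := programmed (localList w labR dumR) g₂
        let s₁ := fun ik : Fin P.n × Fin P.d => o₁ (.inl (ik.2, toCoord (w ik.1 ik.2))) - y₁ ik
        let s₂ := fun jk : Fin P.m × Fin P.d => o₂ (.inl (jk.2, toCoord (q jk.1 jk.2))) - y₂ jk
        f (⟨labS, dumS, kS, o₁, y₁, s₂, siOPRF F kR kS (fun j => ∑ k, y₂ (j, k))
            (fun j => (∑ k, s₂ (j, k)) + pid q labS j)⟩,
          ⟨labR, dumR, kR, o₂, y₂, s₁, siOPRF F kS kR (fun i => ∑ k, y₁ (i, k))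
            (fun i => (∑ k, s₁ (i, k)) + pid w labR i)⟩) >>= h) := by
  rw [bind_assoc, fuzzyMap]
  refine (acceptProb_bind_bind _ _ _ _).trans (expect_congr' fun labS => ?_)
  refine (acceptProb_bind_bind _ _ _ _).trans (expect_congr' fun dumS => ?_)
  refine (acceptProb_bind_bind _ _ _ _).trans (expect_congr' fun labR => ?_)
  refine (acceptProb_bind_bind _ _ _ _).trans (expect_congr' fun dumR => ?_)
  refine (acceptProb_bind_bind _ _ _ _).trans (expect_congr' fun kS => ?_)
  refine (acceptProb_bind_bind _ _ _ _).trans (expect_congr' fun kR => ?_)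
  refine (acceptProb_soOPPRF _ _ _ _ _ _).trans (expect_congr' fun g₁ => expect_congr' fun y₁ => ?_)
  refine (acceptProb_soOPPRF _ _ _ _ _ _).trans (expect_congr' fun g₂ => expect_congr' fun y₂ => ?_)
  rw [pure_bind]

section
variable (p : ℝ) (F : BF P.κ → BF P.ℓ → BF P.ℓ) (q₀ : Fin P.m → Point P) (w : Fin P.n → Point P)
  (σ : Equiv.Perm (Fin P.m)) (labS : Labels P P.m) (dumS : Dummies P P.m) (labR : Labels P P.n)
  (dumR : Dummies P P.n) (kS kR : BF P.κ) (g₁ : MapFun P P.m) (y₁ : Shares P P.n)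
  (g₂ : MapFun P P.n) (y₂ : Shares P P.m) (g₃ : FilterFun P) (y₃ : Shares P P.m)
  (a : ArithShares P)

/-- The arguments of the PRF for the points of the receiver. -/
noncomputable abbrev argW : Fin P.n → BF P.ℓ :=
  mapIn w labR (mapFn (fun j => q₀ (σ j)) labS dumS g₁)

/-- The arguments of the PRF for the points of the sender. -/
noncomputable abbrev argQ : Fin P.m → BF P.ℓ :=
  mapIn (fun j => q₀ (σ j)) labS (mapFn w labR dumR g₂)

/-- The queries of fuzzy mapping. -/
noncomputable abbrev mapQuery {n : ℕ} (x : Fin n → Point P) (a : ℕ) (ik : Fin n × Fin P.d) :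
    MapKey P a := .inl (ik.2, toCoord (x ik.1 ik.2))

/-- The views and the output of the receiver, as a function of the random choices. -/
noncomputable def protocolRun : SenderView P × ReceiverView P × Finset (Point P) :=
  let q := fun j => q₀ (σ j)
  let f₁ := mapFn q labS dumS g₁
  let f₂ := mapFn w labR dumR g₂
  let s₁ : Shares P P.n := fun i => f₁ (mapQuery w _ i) - y₁ i
  let s₂ : Shares P P.m := fun i => f₂ (mapQuery q _ i) - y₂ i
  let idW := siOPRF F kS kR (fun i => ∑ k, y₁ (i, k)) (fun i => (∑ k, s₁ (i, k)) + pid w labR i)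
  let idQ := siOPRF F kR kS (fun j => ∑ k, y₂ (j, k)) (fun j => (∑ k, s₂ (j, k)) + pid q labS j)
  let f₃ := programmed (filterList p w idW) g₃
  let s₃ : Shares P P.m := fun jk => f₃ (idQ jk.1, jk.2, toCoord (q jk.1 jk.2)) - y₃ jk
  let a' : ArithShares P := fun i => ((s₃ i + y₃ i).toNat : ZMod (2 ^ P.ℓ)) - a i
  let b := fun j => intervalTest (powVal P p P.δ) (∑ k, a (j, k)) (∑ k, a' (j, k))
  let z := fun j => oblTransfer (none, some (q j)) (b j)
  (⟨q₀, σ, ⟨labS, dumS, kS, f₁, y₁, s₂, idQ⟩, s₃, a⟩,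
    ⟨w, ⟨labR, dumR, kR, f₂, y₂, s₁, idW⟩, f₃, y₃, a', b, z⟩,
    (Finset.univ.filter fun j => b j = true).biUnion fun j => (z j).toFinset)

theorem acceptProb_fpsiExecution (D : Adversary) (s : ℕ) (f : Execution → View) :
    acceptProb D s (f <$> fpsiExecution p F q₀ w) =
      𝔼 σ, 𝔼 labS, 𝔼 dumS, 𝔼 labR, 𝔼 dumR, 𝔼 kS, 𝔼 kR, 𝔼 g₁, 𝔼 y₁, 𝔼 g₂, 𝔼 y₂, 𝔼 g₃, 𝔼 y₃,
        𝔼 a, accept D s (f ((fun r => ⟨r.1.toView, r.2.1.toView, encOut r.2.2⟩)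
          (protocolRun p F q₀ w σ labS dumS labR dumR kS kR g₁ y₁ g₂ y₂ g₃ y₃ a))) := by
  rw [fpsiExecution, Functor.map_map, map_eq_bind_pure_comp]
  refine (acceptProb_bind_bind _ _ _ _).trans (expect_congr' fun σ => ?_)
  refine (acceptProb_fuzzyMap _ _ _ _ _ _ _).trans (expect_congr' fun labS =>
    expect_congr' fun dumS => expect_congr' fun labR => expect_congr' fun dumR =>
    expect_congr' fun kS => expect_congr' fun kR => expect_congr' fun g₁ => expect_congr' fun y₁ =>
    expect_congr' fun g₂ => expect_congr' fun y₂ => ?_)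
  refine (acceptProb_soOPPRF _ _ _ _ _ _).trans (expect_congr' fun g₃ => expect_congr' fun y₃ => ?_)
  rw [b2a, bind_assoc]
  refine (acceptProb_bind_bind _ _ _ _).trans (expect_congr' fun a => ?_)
  rw [pure_bind, pure_bind]
  exact acceptProb_pure _ _ _

/-- The identifiers of the points of the receiver are distinct, and the interval tests give the
right results. -/
def GoodRun : Prop :=
  Function.Injective (fun i => F (kS + kR) (argW q₀ w σ labS dumS labR g₁ i)) ∧
  ∀ j, (filterSum (filterFn p w (fun i => F (kS + kR) (argW q₀ w σ labS dumS labR g₁ i)) g₃)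
      (F (kS + kR) (argQ q₀ w σ labS labR dumR g₂ j)) (q₀ (σ j))).val ≤ powVal P p P.δ ↔
    ∃ i, distLp p (q₀ (σ j)) (w i) ≤ P.δ

/-- The values of the function of the filtering at the queries. -/
noncomputable abbrev filterVals (jk : Fin P.m × Fin P.d) : BF P.ℓ :=
  filterFn p w (fun i => F (kS + kR) (argW q₀ w σ labS dumS labR g₁ i)) g₃
    (F (kS + kR) (argQ q₀ w σ labS labR dumR g₂ jk.1), jk.2, toCoord (q₀ (σ jk.1) jk.2))

/-- The two shares of each so-OPPRF value cancel in the sum, so the identifier does not depend on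
how the value was shared. -/
theorem siOPRF_mapIn {n : ℕ} (x : Fin n → Point P) (lab : Labels P n) {b : ℕ} (f : MapFun P b)
    (y : Shares P n) : siOPRF F kS kR (fun i => ∑ k, y (i, k))
      (fun i => (∑ k, (f (mapQuery x b (i, k)) - y (i, k))) + pid x lab i) =
        fun i => F (kS + kR) (mapIn x lab f i) := by
  ext1 i
  rw [siOPRF, mapIn, Finset.sum_sub_distrib]
  congr 1; abel

/-- In a good run the interval tests are determined by the inputs, so the bits and received points
are those of `matched` and the output is exact; what is left of the randomness appears only in
shares, labels, identifiers and oracles. -/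
theorem protocolRun_of_good
    (h : GoodRun p F q₀ w σ labS dumS labR dumR kS kR g₁ g₂ g₃) :
    protocolRun p F q₀ w σ labS dumS labR dumR kS kR g₁ y₁ g₂ y₂ g₃ y₃ a =
      (sView q₀ σ g₁ labS dumS kS y₁
        (fun i => mapFn w labR dumR g₂ (mapQuery (fun j => q₀ (σ j)) _ i) - y₂ i)
        (fun j => F (kS + kR) (argQ q₀ w σ labS labR dumR g₂ j))
        (fun jk => filterVals p F q₀ w σ labS dumS labR dumR kS kR g₁ g₂ g₃ jk - y₃ jk) a,
      rView p w g₂ g₃ labR dumR kR y₂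
        (fun i => mapFn (fun j => q₀ (σ j)) labS dumS g₁ (mapQuery w _ i) - y₁ i)
        (fun i => F (kS + kR) (argW q₀ w σ labS dumS labR g₁ i)) y₃
        (fun jk => ((filterVals p F q₀ w σ labS dumS labR dumR kS kR g₁ g₂ g₃ jk).toNat :
          ZMod (2 ^ P.ℓ)) - a jk) (fun j => matched p q₀ w (σ j)),
      fuzzyPSI p q₀ w) := by
  obtain ⟨hinj, hbit⟩ := h
  have hQ := siOPRF_mapIn F kR kS (fun j => q₀ (σ j)) labS (mapFn w labR dumR g₂) y₂
  have hW := siOPRF_mapIn F kS kR w labR (mapFn (fun j => q₀ (σ j)) labS dumS g₁) y₁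
  rw [add_comm kR kS] at hQ
  simp only [protocolRun]
  rw [hQ, hW, programmed_filterList hinj]
  -- The Boolean masks `y₃` and the arithmetic masks `a` cancel, and the test is applied to
  -- `filterSum` itself.
  have hb : ∀ j, intervalTest (powVal P p P.δ) (∑ k, a (j, k))
      (∑ k, (((filterVals p F q₀ w σ labS dumS labR dumR kS kR g₁ g₂ g₃ (j, k) - y₃ (j, k) +
        y₃ (j, k)).toNat : ZMod (2 ^ P.ℓ)) - a (j, k))) = (matched p q₀ w (σ j)).isSome := by
    intro j
    rw [intervalTest, Finset.sum_sub_distrib, add_sub_cancel]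
    simp only [sub_add_cancel]
    rw [Bool.eq_iff_iff, decide_eq_true_iff]
    refine (hbit j).trans ?_
    unfold matched
    split_ifs with h1 <;> simp [h1]
  have hz : ∀ j, oblTransfer (none, some (q₀ (σ j))) (matched p q₀ w (σ j)).isSome =
      matched p q₀ w (σ j) := by
    intro j
    unfold matched oblTransfer
    split_ifs <;> simp_all
  have hout : ((Finset.univ.filter fun j => (matched p q₀ w (σ j)).isSome = true).biUnion
      fun j => (matched p q₀ w (σ j)).toFinset) = fuzzyPSI p q₀ w := by
    ext x
    simp only [Finset.mem_biUnion, Finset.mem_filter, Finset.mem_univ, true_and, fuzzyPSI,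
      Finset.mem_image, Option.mem_toFinset, Option.mem_def]
    constructor
    · rintro ⟨j, -, h2⟩
      unfold matched at h2
      split_ifs at h2 with h3
      exact ⟨σ j, h3, by simpa using h2⟩
    · rintro ⟨j, h1, rfl⟩
      refine ⟨σ.symm j, ?_, ?_⟩ <;> simp [matched, h1]
  simp only [filterVals, argQ, sub_add_cancel] at hb
  simp only [sub_add_cancel, hb, hz, hout]
  rfl

end

section
variable {p : ℝ} {F : BF P.κ → BF P.ℓ → BF P.ℓ} {q₀ : Fin P.m → Point P}
  {w : Fin P.n → Point P}

theorem DisjointProjection.comp_perm {m : ℕ} {x : Fin m → Point P} (hx : DisjointProjection x)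
    (σ : Equiv.Perm (Fin m)) : DisjointProjection fun j => x (σ j) := fun i => by
  obtain ⟨k, hk⟩ := hx (σ i)
  exact ⟨k, fun j hj => hk (σ j) fun h => hj (σ.injective h)⟩

/-- For each sender point there are two cases. If some key is unprogrammed, only a false positive
can occur, because a close point would share the identifier and cover every key; its probability is
bounded by resampling. If one point covers all keys, the test is exact, and any other close point
would have the same identifier and hence be the same point. -/
theorem expect_wrong_bit_le (hp : 1 ≤ p) (hq : DisjointProjection q₀)
    (hover : P.d * powVal P p P.δ < 2 ^ P.ℓ)
    (hexact : ∀ t : Fin P.d → ℕ, (∀ k, t k ≤ P.δ) →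
      (∑ k, powVal P p (t k) ≤ powVal P p P.δ ↔ ∑ k, ((t k : ℕ) : ℝ) ^ p ≤ (P.δ : ℝ) ^ p))
    {σ labS dumS labR dumR kS kR g₁ g₂} :
    𝔼 g₃, ind (Function.Injective (fun i => F (kS + kR) (argW q₀ w σ labS dumS labR g₁ i)) ∧
      ¬ GoodRun p F q₀ w σ labS dumS labR dumR kS kR g₁ g₂ g₃) ≤
      P.m * ((powVal P p P.δ + 1) * ((2 : ℝ) ^ P.ℓ)⁻¹) := by
  set idW := fun i => F (kS + kR) (argW q₀ w σ labS dumS labR g₁ i) with hidW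
  set idQ := fun j => F (kS + kR) (argQ q₀ w σ labS labR dumR g₂ j) with hidQ
  have hc : (0 : ℝ) ≤ (powVal P p P.δ + 1) * ((2 : ℝ) ^ P.ℓ)⁻¹ := by positivity
  by_cases hinj : Function.Injective idW
  swap
  · exact expect_le_const fun g => by rw [ind_false fun h => hinj h.1]; positivity
  have := expect_ind_exists_le (α := FilterFun P) (β := Fin P.m)
    (p := fun g₃ j => ¬ ((filterSum (filterFn p w idW g₃) (idQ j) (q₀ (σ j))).val ≤ powVal P p P.δ ↔
      ∃ i, distLp p (q₀ (σ j)) (w i) ≤ P.δ)) (c := (powVal P p P.δ + 1) * ((2 : ℝ) ^ P.ℓ)⁻¹) ?_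
  · rw [Fintype.card_fin] at this
    refine (Finset.expect_le_expect fun g₃ _ => ind_mono fun h => ?_).trans this
    by_contra hne
    simp only [not_exists, not_not] at hne
    exact h.2 ⟨hinj, hne⟩
  intro j
  have hd : 0 < P.d := by obtain ⟨k, -⟩ := hq (σ j); exact k.pos
  rcases uncovered_or (w := w) hinj hd (idQ j) (q₀ (σ j)) with ⟨k, hk⟩ | ⟨i, hi, hcov⟩
  · refine (Finset.expect_le_expect fun g₃ _ => ind_mono fun h => ?_).trans
      (expect_filterSum_uncovered (p := p) (c := powVal P p P.δ) hk)
    by_contra hle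
    refine h ⟨fun h' => absurd h' hle, fun ⟨i, hi⟩ => ?_⟩
    have hclose := close_of_distLp_le hp hi
    have heq : idQ j = idW i := congrArg (F (kS + kR))
      (mapIn_eq_of_close (x := fun j => q₀ (σ j)) (i := j) (j := i) hclose labS dumS g₁ labR dumR g₂)
    exact absurd ((toCoord_mem_nbhd _ _).2 (hclose k)) (hk i heq.symm)
  · refine expect_le_const fun g₃ => ?_
    rw [ind_false]
    · exact hc
    rw [not_not, ← hi, filterSum_covered hp hover hexact hinj g₃ hcov]
    refine ⟨fun h => ⟨i, h⟩, fun ⟨i', hi'⟩ => ?_⟩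
    have hclose := close_of_distLp_le hp hi'
    have heq : idQ j = idW i' := congrArg (F (kS + kR))
      (mapIn_eq_of_close (x := fun j => q₀ (σ j)) (i := j) (j := i') hclose labS dumS g₁ labR dumR
        g₂)
    rwa [← hinj (hi.trans heq)] at hi'

end
end FPSI

/-! ### The probability of a bad run. -/

namespace FPSI

open scoped BigOperators
open Finset (expect)
open Prog

variable {P : Params} {p : ℝ} {F : BF P.κ → BF P.ℓ → BF P.ℓ} {q₀ : Fin P.m → Point P}
  {w : Fin P.n → Point P}

/-! ### Failure of the protocol -/

theorem expect_add_left {A : Type*} [Fintype A] [AddGroup A] (c : A) (f : A → ℝ) :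
    𝔼 y, f (c + y) = 𝔼 y, f y := Fintype.expect_equiv (Equiv.addLeft c) _ _ fun _ => rfl

theorem expect_sub_left {A : Type*} [Fintype A] [AddGroup A] (c : A) (f : A → ℝ) :
    𝔼 y, f (c - y) = 𝔼 y, f y := Fintype.expect_equiv (Equiv.subLeft c) _ _ fun _ => rfl

/-- For fixed `kS` the effective key `kS + kR` is uniform, so the collision bound for a uniform key
applies to each pair of distinct arguments. -/
theorem expect_prf_collision_le {γ : ℝ} (hγ0 : 0 ≤ γ)
    (hγ : ∀ x y, x ≠ y → 𝔼 k, ind (F k x = F k y) ≤ γ) {n : ℕ} (x : Fin n → BF P.ℓ) (kS : BF P.κ) :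
    𝔼 kR, ind (Function.Injective x ∧ ¬ Function.Injective fun i => F (kS + kR) (x i)) ≤
      n ^ 2 * γ := by
  rw [expect_add_left kS fun k =>
    ind (Function.Injective x ∧ ¬ Function.Injective fun i => F k (x i))]
  by_cases hx : Function.Injective x
  · exact (Finset.expect_le_expect fun k _ => ind_mono And.right).trans
      (expect_ind_not_injective_le hγ0 fun i j hij => hγ _ _ fun h => hij (hx h))
  · exact expect_le_const fun k => by rw [ind_false fun h => hx h.1]; positivity

theorem ind_not_le_add_add (A B C : Prop) :
    ind (¬ C) ≤ ind (¬ A) + ind (A ∧ ¬ B) + ind (B ∧ ¬ C) := by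
  have h := (ind_or_le (¬ A ∨ (A ∧ ¬ B)) (B ∧ ¬ C)).trans
    (add_le_add (ind_or_le (¬ A) (A ∧ ¬ B)) le_rfl)
  refine (ind_mono fun hC => ?_).trans h
  by_cases hA : A <;> by_cases hB : B <;> simp [hA, hB, hC]

/-- A bound for the probability that the protocol fails. -/
noncomputable def failBound (p : ℝ) (P : Params) (γ : ℝ) : ℝ :=
  P.n ^ 2 * ((2 : ℝ) ^ P.ℓ)⁻¹ + P.n ^ 2 * γ + P.m * ((powVal P p P.δ + 1) * ((2 : ℝ) ^ P.ℓ)⁻¹)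

/-- A bad run has a first failure: the PRF arguments of the receiver collide, or distinct arguments
have equal PRF values, or the identifiers are distinct and an interval test is wrong. The three
terms of `failBound` bound these events in this order. -/
theorem expect_not_good_le (hp : 1 ≤ p) (hq : DisjointProjection q₀) (hw : DisjointProjection w)
    (hover : P.d * powVal P p P.δ < 2 ^ P.ℓ)
    (hexact : ∀ t : Fin P.d → ℕ, (∀ k, t k ≤ P.δ) →
      (∑ k, powVal P p (t k) ≤ powVal P p P.δ ↔ ∑ k, ((t k : ℕ) : ℝ) ^ p ≤ (P.δ : ℝ) ^ p))
    {γ : ℝ} (hγ0 : 0 ≤ γ) (hγ : ∀ x y, x ≠ y → 𝔼 k, ind (F k x = F k y) ≤ γ) :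
    𝔼 σ, 𝔼 labS, 𝔼 dumS, 𝔼 labR, 𝔼 dumR, 𝔼 kS, 𝔼 kR, 𝔼 g₁, 𝔼 _y₁ : Shares P P.n, 𝔼 g₂,
      𝔼 _y₂ : Shares P P.m, 𝔼 g₃, 𝔼 _y₃ : Shares P P.m, 𝔼 _a : ArithShares P,
        ind (¬ GoodRun p F q₀ w σ labS dumS labR dumR kS kR g₁ g₂ g₃) ≤ failBound p P γ := by
  simp only [Fintype.expect_const]
  refine expect_le_const fun σ => expect_le_const fun labS => expect_le_const fun dumS => ?_
  have hA : 𝔼 labR, 𝔼 g₁, ind (¬ Function.Injective (argW q₀ w σ labS dumS labR g₁)) ≤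
      P.n ^ 2 * ((2 : ℝ) ^ P.ℓ)⁻¹ := by
    rw [Finset.expect_comm]
    exact expect_le_const fun g₁ => expect_mapIn_not_injective hw _
  have hB : 𝔼 labR, 𝔼 kS, 𝔼 kR, 𝔼 g₁, ind (Function.Injective (argW q₀ w σ labS dumS labR g₁) ∧
      ¬ Function.Injective fun i => F (kS + kR) (argW q₀ w σ labS dumS labR g₁ i)) ≤
        P.n ^ 2 * γ := by
    refine expect_le_const fun labR => expect_le_const fun kS => ?_
    rw [Finset.expect_comm]
    exact expect_le_const fun g₁ => expect_prf_collision_le hγ0 hγ _ _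
  have hC : 𝔼 labR, 𝔼 dumR, 𝔼 kS, 𝔼 kR, 𝔼 g₁, 𝔼 g₂, 𝔼 g₃,
      ind (Function.Injective (fun i => F (kS + kR) (argW q₀ w σ labS dumS labR g₁ i)) ∧
        ¬ GoodRun p F q₀ w σ labS dumS labR dumR kS kR g₁ g₂ g₃) ≤
      P.m * ((powVal P p P.δ + 1) * ((2 : ℝ) ^ P.ℓ)⁻¹) :=
    expect_le_const fun labR => expect_le_const fun dumR => expect_le_const fun kS =>
      expect_le_const fun kR => expect_le_const fun g₁ => expect_le_const fun g₂ =>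
        expect_wrong_bit_le hp hq hover hexact
  refine le_trans ?_ (add_le_add (add_le_add hA hB) hC)
  have hS : ∀ labR dumR kS kR g₁ g₂ g₃,
      ind (¬ GoodRun p F q₀ w σ labS dumS labR dumR kS kR g₁ g₂ g₃) ≤
        ind (¬ Function.Injective (argW q₀ w σ labS dumS labR g₁)) +
        ind (Function.Injective (argW q₀ w σ labS dumS labR g₁) ∧
          ¬ Function.Injective fun i => F (kS + kR) (argW q₀ w σ labS dumS labR g₁ i)) +
        ind (Function.Injective (fun i => F (kS + kR) (argW q₀ w σ labS dumS labR g₁ i)) ∧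
          ¬ GoodRun p F q₀ w σ labS dumS labR dumR kS kR g₁ g₂ g₃) := by
    exact fun _ _ _ _ _ _ _ => ind_not_le_add_add _ _ _
  refine (Finset.expect_le_expect fun labR _ => Finset.expect_le_expect fun dumR _ =>
    Finset.expect_le_expect fun kS _ => Finset.expect_le_expect fun kR _ =>
    Finset.expect_le_expect fun g₁ _ => Finset.expect_le_expect fun g₂ _ =>
    Finset.expect_le_expect fun g₃ _ => hS labR dumR kS kR g₁ g₂ g₃).trans_eq ?_
  simp only [Finset.expect_add_distrib, Fintype.expect_const]

/-- Replacing the run of the protocol by its intended outcome. -/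
theorem abs_acceptProb_fpsiExecution_sub_le (D : Adversary) (s : ℕ) (f : Execution → View) :
    |acceptProb D s (f <$> fpsiExecution p F q₀ w) -
      𝔼 σ, 𝔼 labS, 𝔼 dumS, 𝔼 labR, 𝔼 dumR, 𝔼 kS, 𝔼 kR, 𝔼 g₁, 𝔼 y₁, 𝔼 g₂, 𝔼 y₂, 𝔼 g₃, 𝔼 y₃,
        𝔼 a, accept D s (f ⟨(sView q₀ σ g₁ labS dumS kS y₁
          (fun i => mapFn w labR dumR g₂ (mapQuery (fun j => q₀ (σ j)) _ i) - y₂ i)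
          (fun j => F (kS + kR) (argQ q₀ w σ labS labR dumR g₂ j))
          (fun jk => filterVals p F q₀ w σ labS dumS labR dumR kS kR g₁ g₂ g₃ jk - y₃ jk) a).toView,
        (rView p w g₂ g₃ labR dumR kR y₂
          (fun i => mapFn (fun j => q₀ (σ j)) labS dumS g₁ (mapQuery w _ i) - y₁ i)
          (fun i => F (kS + kR) (argW q₀ w σ labS dumS labR g₁ i)) y₃
          (fun jk => ((filterVals p F q₀ w σ labS dumS labR dumR kS kR g₁ g₂ g₃ jk).toNat :
            ZMod (2 ^ P.ℓ)) - a jk) (fun j => matched p q₀ w (σ j))).toView,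
        encOut (fuzzyPSI p q₀ w)⟩)| ≤
      𝔼 σ, 𝔼 labS, 𝔼 dumS, 𝔼 labR, 𝔼 dumR, 𝔼 kS, 𝔼 kR, 𝔼 g₁, 𝔼 _y₁ : Shares P P.n, 𝔼 g₂,
        𝔼 _y₂ : Shares P P.m, 𝔼 g₃, 𝔼 _y₃ : Shares P P.m, 𝔼 _a : ArithShares P,
          ind (¬ GoodRun p F q₀ w σ labS dumS labR dumR kS kR g₁ g₂ g₃) := by
  rw [acceptProb_fpsiExecution]
  refine abs_expect_sub_le fun σ => abs_expect_sub_le fun labS => abs_expect_sub_le fun dumS =>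
    abs_expect_sub_le fun labR => abs_expect_sub_le fun dumR => abs_expect_sub_le fun kS =>
    abs_expect_sub_le fun kR => abs_expect_sub_le fun g₁ => abs_expect_sub_le fun y₁ =>
    abs_expect_sub_le fun g₂ => abs_expect_sub_le fun y₂ => abs_expect_sub_le fun g₃ =>
    abs_expect_sub_le fun y₃ => abs_expect_sub_le fun a =>
    abs_sub_le_ind (fun h => ?_) (abs_accept_sub_le_one _ _ _ _)
  rw [protocolRun_of_good p F q₀ w σ labS dumS labR dumR kS kR g₁ y₁ g₂ y₂ g₃ y₃ a (not_not.1 h)]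

end FPSI

/-! ### Removing the masks: views in terms of PRF values and fresh randomness. -/

namespace FPSI

open scoped BigOperators
open Finset (expect)
open Prog

set_option synthInstance.maxSize 2000

variable {P : Params} {p : ℝ} {F : BF P.κ → BF P.ℓ → BF P.ℓ} {q₀ : Fin P.m → Point P}
  {w : Fin P.n → Point P}

/-! ### From the protocol to random identifiers -/

variable (P) in
/-- The random choices that determine the view of the sender, up to a PRF key and the function in
its so-OPPRF. -/
abbrev RestS := Equiv.Perm (Fin P.m) × Labels P P.m × Dummies P P.m × Labels P P.n × Dummies P P.n ×
  BF P.κ × Shares P P.n × MapFun P P.n × Shares P P.m × Shares P P.m × ArithShares P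

/-- The arguments of the PRF for the points of the sender. -/
noncomputable def RestS.arg (q₀ : Fin P.m → Point P) (w : Fin P.n → Point P) :
    RestS P → Fin P.m → BF P.ℓ :=
  fun (σ, labS, _, labR, dumR, _, _, g₂, _, _, _) => argQ q₀ w σ labS labR dumR g₂

/-- The view of the sender with given identifiers. -/
noncomputable def RestS.view (q₀ : Fin P.m → Point P) (ids : Fin P.m → BF P.ℓ) (g : MapFun P P.m) :
    RestS P → SenderView P :=
  fun (σ, labS, dumS, _, _, kS, y₁, _, y₂, y₃, a) => sView q₀ σ g labS dumS kS y₁ y₂ ids y₃ a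

variable (P) in
/-- The random choices that determine the view of the receiver, up to a PRF key and the functions
in its so-OPPRFs. -/
abbrev RestR := Equiv.Perm (Fin P.m) × Labels P P.m × Dummies P P.m × Labels P P.n × Dummies P P.n ×
  BF P.κ × MapFun P P.m × Shares P P.n × Shares P P.m × Shares P P.m × ArithShares P

/-- The arguments of the PRF for the points of the receiver. -/
noncomputable def RestR.arg (q₀ : Fin P.m → Point P) (w : Fin P.n → Point P) :
    RestR P → Fin P.n → BF P.ℓ :=
  fun (σ, labS, dumS, labR, _, _, g₁, _, _, _, _) => argW q₀ w σ labS dumS labR g₁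

/-- The view of the receiver with given identifiers. -/
noncomputable def RestR.view (p : ℝ) (q₀ : Fin P.m → Point P) (w : Fin P.n → Point P)
    (ids : Fin P.n → BF P.ℓ) (g : MapFun P P.n) (gf : FilterFun P) : RestR P → ReceiverView P :=
  fun (σ, _, _, labR, dumR, kR, _, y₁, y₂, y₃, a) =>
    rView p w g gf labR dumR kR y₂ y₁ ids y₃ a fun j => matched p q₀ w (σ j)

section reorder
variable {A₁ A₂ A₃ A₄ A₅ A₆ A₇ A₈ A₉ : Type*} [Fintype A₁] [Fintype A₂] [Fintype A₃] [Fintype A₄]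
  [Fintype A₅] [Fintype A₆] [Fintype A₇] [Fintype A₈] [Fintype A₉]

theorem expect_reorder₇ (f : A₁ → A₂ → A₃ → A₄ → A₅ → A₆ → A₇ → ℝ) :
    𝔼 a₁, 𝔼 a₂, 𝔼 a₃, 𝔼 a₄, 𝔼 a₅, 𝔼 a₆, 𝔼 a₇, f a₁ a₂ a₃ a₄ a₅ a₆ a₇ =
      𝔼 a₃, 𝔼 a₄, 𝔼 a₅, 𝔼 a₆, 𝔼 a₇, 𝔼 a₁, 𝔼 a₂, f a₁ a₂ a₃ a₄ a₅ a₆ a₇ := by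
  have := Fintype.expect_equiv
    (⟨fun (a₁, a₂, a₃, a₄, a₅, a₆, a₇) => (a₃, a₄, a₅, a₆, a₇, a₁, a₂),
      fun (a₃, a₄, a₅, a₆, a₇, a₁, a₂) => (a₁, a₂, a₃, a₄, a₅, a₆, a₇), fun _ => rfl,
      fun _ => rfl⟩ : A₁ × A₂ × A₃ × A₄ × A₅ × A₆ × A₇ ≃ A₃ × A₄ × A₅ × A₆ × A₇ × A₁ × A₂)
    (fun (a₁, a₂, a₃, a₄, a₅, a₆, a₇) => f a₁ a₂ a₃ a₄ a₅ a₆ a₇)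
    (fun (a₃, a₄, a₅, a₆, a₇, a₁, a₂) => f a₁ a₂ a₃ a₄ a₅ a₆ a₇) fun _ => rfl
  simpa only [expect_prod] using this

theorem expect_reorder₉ (f : A₁ → A₂ → A₃ → A₄ → A₅ → A₆ → A₇ → A₈ → A₉ → ℝ) :
    𝔼 a₁, 𝔼 a₂, 𝔼 a₃, 𝔼 a₄, 𝔼 a₅, 𝔼 a₆, 𝔼 a₇, 𝔼 a₈, 𝔼 a₉, f a₁ a₂ a₃ a₄ a₅ a₆ a₇ a₈ a₉ =
      𝔼 a₂, 𝔼 a₃, 𝔼 a₄, 𝔼 a₆, 𝔼 a₈, 𝔼 a₉, 𝔼 a₁, 𝔼 a₅, 𝔼 a₇, f a₁ a₂ a₃ a₄ a₅ a₆ a₇ a₈ a₉ := by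
  have := Fintype.expect_equiv
    (⟨fun (a₁, a₂, a₃, a₄, a₅, a₆, a₇, a₈, a₉) => (a₂, a₃, a₄, a₆, a₈, a₉, a₁, a₅, a₇),
      fun (a₂, a₃, a₄, a₆, a₈, a₉, a₁, a₅, a₇) => (a₁, a₂, a₃, a₄, a₅, a₆, a₇, a₈, a₉),
      fun _ => rfl, fun _ => rfl⟩ : A₁ × A₂ × A₃ × A₄ × A₅ × A₆ × A₇ × A₈ × A₉ ≃
        A₂ × A₃ × A₄ × A₆ × A₈ × A₉ × A₁ × A₅ × A₇)
    (fun (a₁, a₂, a₃, a₄, a₅, a₆, a₇, a₈, a₉) => f a₁ a₂ a₃ a₄ a₅ a₆ a₇ a₈ a₉)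
    (fun (a₂, a₃, a₄, a₆, a₈, a₉, a₁, a₅, a₇) => f a₁ a₂ a₃ a₄ a₅ a₆ a₇ a₈ a₉) fun _ => rfl
  simpa only [expect_prod] using this

end reorder

/-- For fixed `kS` the substitution `k = kS + kR` frees the PRF key, and reflections of `y₂` and
`y₃` turn masked shares into uniform ones. Then nothing depends on the filtering function `g₃`,
which is averaged away; the receiver's labels and `g₂` survive only in the PRF arguments. -/
theorem expect_sender_eq (f : SenderView P → ℝ) :
    (𝔼 σ, 𝔼 labS, 𝔼 dumS, 𝔼 labR, 𝔼 dumR, 𝔼 kS, 𝔼 kR, 𝔼 g₁, 𝔼 y₁, 𝔼 g₂, 𝔼 y₂ : Shares P P.m, 𝔼 g₃,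
      𝔼 y₃ : Shares P P.m, 𝔼 a, f (sView q₀ σ g₁ labS dumS kS y₁
          (fun i => mapFn w labR dumR g₂ (mapQuery (fun j => q₀ (σ j)) _ i) - y₂ i)
          (fun j => F (kS + kR) (argQ q₀ w σ labS labR dumR g₂ j))
          (fun jk => filterVals p F q₀ w σ labS dumS labR dumR kS kR g₁ g₂ g₃ jk - y₃ jk) a)) =
      𝔼 r : RestS P, 𝔼 k, 𝔼 g, f (r.view q₀ (fun j => F k (r.arg q₀ w j)) g) := by
  rw [expect_prod, expect_congr' fun σ => ?_]
  rw [expect_prod, expect_congr' fun labS => ?_]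
  rw [expect_prod, expect_congr' fun dumS => ?_]
  rw [expect_prod, expect_congr' fun labR => ?_]
  rw [expect_prod, expect_congr' fun dumR => ?_]
  rw [expect_prod, expect_congr' fun kS => ?_]
  simp only [expect_prod, RestS.view, RestS.arg]
  rw [← expect_reorder₇ fun k g₁ y₁ g₂ y₂ y₃ a => f (sView q₀ σ g₁ labS dumS kS y₁ y₂
    (fun j => F k (argQ q₀ w σ labS labR dumR g₂ j)) y₃ a),
    ← expect_add_left kS fun k => 𝔼 g₁, 𝔼 y₁, 𝔼 g₂, 𝔼 y₂, 𝔼 y₃, 𝔼 a, f (sView q₀ σ g₁ labS dumS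
      kS y₁ y₂ (fun j => F k (argQ q₀ w σ labS labR dumR g₂ j)) y₃ a)]
  refine expect_congr' fun kR => expect_congr' fun g₁ => expect_congr' fun y₁ =>
    expect_congr' fun g₂ => ?_
  refine Eq.trans ?_ (expect_sub_left
    (fun i => mapFn w labR dumR g₂ (mapQuery (fun j => q₀ (σ j)) _ i)) fun y₂ => 𝔼 y₃, 𝔼 a,
      f (sView q₀ σ g₁ labS dumS kS y₁ y₂
        (fun j => F (kS + kR) (argQ q₀ w σ labS labR dumR g₂ j)) y₃ a))
  refine expect_congr' fun y₂ => ?_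
  refine Eq.trans (expect_congr' fun g₃ => ?_) (Fintype.expect_const (ι := FilterFun P) _)
  exact expect_sub_left (fun jk => filterVals p F q₀ w σ labS dumS labR dumR kS kR g₁ g₂ g₃ jk)
    fun y₃ => 𝔼 a, f (sView q₀ σ g₁ labS dumS kS y₁ _ _ y₃ a)

/-- Here `kR` is fixed and `kS` frees the key; `y₁` and the sender's arithmetic shares act as masks.
The function `g₃` stays in the view because the receiver has oracle access to it. -/
theorem expect_receiver_eq (f : ReceiverView P → ℝ) :
    (𝔼 σ, 𝔼 labS, 𝔼 dumS, 𝔼 labR, 𝔼 dumR, 𝔼 kS, 𝔼 kR, 𝔼 g₁, 𝔼 y₁ : Shares P P.n, 𝔼 g₂, 𝔼 y₂, 𝔼 g₃,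
      𝔼 y₃, 𝔼 a : ArithShares P, f (rView p w g₂ g₃ labR dumR kR y₂
          (fun i => mapFn (fun j => q₀ (σ j)) labS dumS g₁ (mapQuery w _ i) - y₁ i)
          (fun i => F (kS + kR) (argW q₀ w σ labS dumS labR g₁ i)) y₃
          (fun jk => ((filterVals p F q₀ w σ labS dumS labR dumR kS kR g₁ g₂ g₃ jk).toNat :
            ZMod (2 ^ P.ℓ)) - a jk) (fun j => matched p q₀ w (σ j)))) =
      𝔼 r : RestR P, 𝔼 k, 𝔼 g, 𝔼 gf,
        f (r.view p q₀ w (fun j => F k (r.arg q₀ w j)) g gf) := by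
  rw [expect_prod, expect_congr' fun σ => ?_]
  rw [expect_prod, expect_congr' fun labS => ?_]
  rw [expect_prod, expect_congr' fun dumS => ?_]
  rw [expect_prod, expect_congr' fun labR => ?_]
  rw [expect_prod, expect_congr' fun dumR => ?_]
  simp only [expect_prod, RestR.view, RestR.arg]
  rw [← expect_reorder₉ fun k kR g₁ y₁ g₂ y₂ g₃ y₃ a => f (rView p w g₂ g₃ labR dumR kR y₂ y₁
    (fun j => F k (argW q₀ w σ labS dumS labR g₁ j)) y₃ a fun j => matched p q₀ w (σ j))]
  refine (Finset.expect_comm _ _ _).trans (Eq.trans ?_ (Finset.expect_comm _ _ _))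
  refine expect_congr' fun kR => ?_
  rw [← expect_add_left kR fun k => 𝔼 g₁, 𝔼 y₁, 𝔼 g₂, 𝔼 y₂, 𝔼 g₃, 𝔼 y₃, 𝔼 a, f (rView p w g₂ g₃
    labR dumR kR y₂ y₁ (fun j => F k (argW q₀ w σ labS dumS labR g₁ j)) y₃ a
      fun j => matched p q₀ w (σ j))]
  refine expect_congr' fun kS => expect_congr' fun g₁ => ?_
  rw [add_comm kR kS]
  refine Eq.trans ?_ (expect_sub_left
    (fun i => mapFn (fun j => q₀ (σ j)) labS dumS g₁ (mapQuery w _ i)) fun y₁ => 𝔼 g₂, 𝔼 y₂, 𝔼 g₃,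
      𝔼 y₃, 𝔼 a, f (rView p w g₂ g₃ labR dumR kR y₂ y₁
        (fun j => F (kS + kR) (argW q₀ w σ labS dumS labR g₁ j)) y₃ a
        fun j => matched p q₀ w (σ j)))
  refine expect_congr' fun y₁ => expect_congr' fun g₂ => expect_congr' fun y₂ =>
    expect_congr' fun g₃ => expect_congr' fun y₃ => ?_
  exact expect_sub_left
    (fun jk => ((filterVals p F q₀ w σ labS dumS labR dumR kS kR g₁ g₂ g₃ jk).toNat :
      ZMod (2 ^ P.ℓ))) fun a => f (rView p w g₂ g₃ labR dumR kR y₂ _ _ y₃ a _)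

/-- The interchanges put the average over the sender's labels innermost: the receiver's function is
independent of them, so `expect_mapIn_not_injective` applies with that function fixed. -/
theorem RestS.arg_not_injective_le (hq : DisjointProjection q₀) :
    𝔼 r : RestS P, ind (¬ Function.Injective (r.arg q₀ w)) ≤ P.m ^ 2 * ((2 : ℝ) ^ P.ℓ)⁻¹ := by
  simp only [expect_prod, RestS.arg, Fintype.expect_const]
  refine expect_le_const fun σ => ?_
  rw [Finset.expect_comm]
  refine expect_le_const fun labR => ?_
  rw [Finset.expect_comm]
  refine expect_le_const fun dumR => ?_
  rw [Finset.expect_comm]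
  exact expect_le_const fun g₂ => expect_mapIn_not_injective (hq.comp_perm σ) _

theorem RestR.arg_not_injective_le (hw : DisjointProjection w) :
    𝔼 r : RestR P, ind (¬ Function.Injective (r.arg q₀ w)) ≤ P.n ^ 2 * ((2 : ℝ) ^ P.ℓ)⁻¹ := by
  simp only [expect_prod, RestR.arg, Fintype.expect_const]
  refine expect_le_const fun σ => expect_le_const fun labS => expect_le_const fun dumS => ?_
  rw [Finset.expect_comm]
  exact expect_le_const fun g₁ => expect_mapIn_not_injective hw _

/-- Replacing random functions of distinct arguments by random identifiers. -/
theorem abs_expect_ids_sub_le {R : Type} [Fintype R] {a : ℕ} {X : Type} [Fintype X] [DecidableEq X]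
    (arg : R → Fin a → X) (f : R → (Fin a → X) → ℝ) (hf : ∀ r u v, |f r u - f r v| ≤ 1) {c : ℝ}
    [Nonempty X] (hc : 𝔼 r, ind (¬ Function.Injective (arg r)) ≤ c) :
    |(𝔼 r, 𝔼 G : X → X, f r fun i => G (arg r i)) - 𝔼 r, 𝔼 ids, f r ids| ≤ c :=
  (abs_expect_sub_le fun r => abs_expect_random_sub_le (hf r)).trans hc

end FPSI

/-! ### The simulators as programs. -/

namespace FPSI

open scoped BigOperators
open Finset (expect)
open Prog

variable {P : Params}

/-! ### Parts of a random tape -/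

/-- The `ℓ` low bits of word `i` of the part `tag` of a tape. -/
def tapeBF (ℓ : ℕ) (t : ℕ → ℕ) (tag i : ℕ) : BF ℓ := BF.ofNat ℓ (t (16 * i + tag))

/-- A table of field elements from a tape. -/
def tapeShares (P : Params) (a : ℕ) (t : ℕ → ℕ) (tag : ℕ) (ik : Fin a × Fin P.d) : BF P.ℓ :=
  tapeBF P.ℓ t tag (ik.1 * P.d + ik.2)

/-- Arithmetic shares from a tape. -/
def tapeArith (P : Params) (t : ℕ → ℕ) (jk : Fin P.m × Fin P.d) : ZMod (2 ^ P.ℓ) :=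
  (t (16 * (jk.1 * P.d + jk.2) + 10) : ZMod (2 ^ P.ℓ))

/-- Labels from a tape. -/
def tapeLabels (P : Params) (a : ℕ) (t : ℕ → ℕ) (i : Fin a) (k : Fin P.d) : BF P.ℓ :=
  tapeShares P a t 3 (i, k)

/-- A random function from a tape. -/
def tapeFun {K : Type} (ℓ : ℕ) (addr : K → ℕ) (t : ℕ → ℕ) (y : K) : BF ℓ := BF.ofNat ℓ (t (addr y))

/-- A permutation from a tape. -/
noncomputable def tapePerm (m : ℕ) (t : ℕ → ℕ) : Equiv.Perm (Fin m) :=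
  rankPerm fun j => t (16 * j + 11)

/-! ### Programs that sample the parts of a view -/

namespace Prog

/-- The public parameters in an input `(a, (b, pub))` of the sampling programs. -/
abbrev smpPub (Z : Prog) : Prog := .comp .snd (.comp .snd Z)

/-- A table with `C` rows. -/
def matP (tag : ℕ) (C : Prog) : Prog :=
  tab C (tab (uval (pubD (smpPub .fst)))
    (rndP tag (addP (mulP (.comp .snd .fst) (uval (pubD (smpPub (.comp .fst .fst))))) .snd)
      (pubL (smpPub (.comp .fst .fst)))))

def dummiesP : Prog :=
  tab (mulP (mulP (uval .fst) (uval (pubD (smpPub .id))))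
      (addP (addP (uval (pubDelta (smpPub .id))) (uval (pubDelta (smpPub .id)))) (numP 1)))
    (rndP 4 .snd (pubL (smpPub .fst)))

def idsP : Prog := tab (uval .fst) (rndP 8 .snd (pubL (smpPub .fst)))

/-- A sample of the part of a view that belongs to fuzzy mapping. -/
def fmapP : Prog :=
  .pair (matP 3 (uval .fst)) <| .pair dummiesP <| .pair (rndP 5 (numP 0) (pubK (smpPub .id))) <|
    .pair (matP 6 (uval (.comp .fst .snd))) <| .pair (matP 7 (uval .fst)) idsP

abbrev wordP (J : Prog) : Prog := .comp .rand (addP (mulP (numP 16) J) (numP 11))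

/-- The position of `i` in the sampled order, on input `((a, (b, pub)), i)`. -/
def rankP : Prog :=
  sumN (uval (pubM (smpPub .fst))) (.ite (ltP (wordP .snd) (wordP (.comp .snd .fst))) (numP 1)
    (.ite (andP (eqP (wordP .snd) (wordP (.comp .snd .fst))) (ltP .snd (.comp .snd .fst)))
      (numP 1) (numP 0)))

def orderP : Prog := tab (uval (pubM (smpPub .id))) rankP

/-- The shares from the refined filtering and the arithmetic shares. -/
abbrev sharesP : Prog := matP 9 (uval (pubM (smpPub .id)))
abbrev arithP : Prog := matP 10 (uval (pubM (smpPub .id)))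

set_option synthInstance.maxSize 2000 in
instance (tag : ℕ) (C : Prog) [PT C] [PV C] : PT (matP tag C) := by unfold matP; infer_instance
set_option synthInstance.maxSize 2000 in
instance : PT dummiesP := by unfold dummiesP; infer_instance
set_option synthInstance.maxSize 2000 in
instance : PT idsP := by unfold idsP; infer_instance
set_option synthInstance.maxSize 2000 in
instance : PT fmapP := by unfold fmapP; infer_instance
set_option synthInstance.maxSize 2000 in
instance : PT rankP := by unfold rankP; infer_instance
set_option synthInstance.maxSize 2000 in
instance : PT orderP := by unfold orderP; infer_instance

section
variable {t : ℕ → ℕ} {O : Data → Data} {tb : Data} {a b : ℕ}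

/-- The input of the sampling programs. -/
def _root_.FPSI.smpInput (P : Params) (tb : Data) (a b : ℕ) : Data :=
  .pair (unary a) (.pair (unary b) (pubWith P tb))

theorem ev_entryP (tag : ℕ) (i k : ℕ) :
    (rndP tag (addP (mulP (.comp .snd .fst) (uval (pubD (smpPub (.comp .fst .fst))))) .snd)
      (pubL (smpPub (.comp .fst .fst)))).ev t O
        (.pair (.pair (smpInput P tb a b) (.num i)) (.num k)) =
      encBF (tapeBF P.ℓ t tag (i * P.d + k)) :=
  ev_rndP (ev_addP (ev_mulP (a := i) (b := P.d) rfl (ev_uval rfl)) rfl) rfl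

theorem ev_matP (tag : ℕ) {C : Prog} {n : ℕ} (hC : C.ev t O (smpInput P tb a b) = .num n) :
    (matP tag C).ev t O (smpInput P tb a b) = encShares encBF (tapeShares P n t tag) := by
  refine ev_tab hC fun i => ?_
  exact ev_tab (n := P.d) (ev_uval rfl) fun k => ev_entryP tag i k

theorem ev_labelsP : (matP 3 (uval .fst)).ev t O (smpInput P tb a b) =
    encVec (encVec encBF) (tapeLabels P a t) :=
  ev_tab (n := a) (ev_uval rfl) fun i => ev_tab (n := P.d) (ev_uval rfl) fun k => ev_entryP 3 i k

theorem ev_dummiesP : dummiesP.ev t O (smpInput P tb a b) =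
    encVec encBF fun i : Fin (padSize P a) => tapeBF P.ℓ t 4 i := by
  refine ev_tab ?_ fun _ => ev_rndP (ℓ := P.ℓ) rfl rfl
  have hδ : (addP (uval (pubDelta (smpPub .id))) (uval (pubDelta (smpPub .id)))).ev t O
      (smpInput P tb a b) = .num (2 * P.δ) := by
    rw [two_mul]; exact ev_addP (ev_uval rfl) (ev_uval rfl)
  exact ev_mulP (ev_mulP (a := a) (b := P.d) (ev_uval rfl) (ev_uval rfl)) (ev_addP hδ rfl)

theorem ev_idsP : idsP.ev t O (smpInput P tb a b) =
    encVec encBF fun i : Fin a => tapeBF P.ℓ t 8 i :=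
  ev_tab (n := a) (ev_uval rfl) fun _ => ev_rndP (ℓ := P.ℓ) rfl rfl

theorem ev_fmapP (o : MapFun P a) : fmapP.ev t O (smpInput P tb a b) =
    encFMapView (b := b) ⟨tapeLabels P a t, fun i => tapeBF P.ℓ t 4 i, tapeBF P.κ t 5 0, o,
      tapeShares P b t 6, tapeShares P a t 7, fun i => tapeBF P.ℓ t 8 i⟩ := by
  rw [fmapP, ev_pair, ev_pair, ev_pair, ev_pair, ev_pair, ev_labelsP, ev_dummiesP, ev_idsP,
    ev_matP (n := a) 7 (ev_uval rfl), ev_matP (n := b) 6 (ev_uval rfl),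
    ev_rndP (ℓ := P.κ) (i := 0) rfl rfl]
  rfl

theorem ev_sharesP : sharesP.ev t O (smpInput P tb a b) =
    encShares encBF (tapeShares P P.m t 9) := ev_matP _ (ev_uval rfl)

/-- Bit strings of length `ℓ` and residues modulo `2 ^ ℓ` are encoded by the same numbers, so one
table program samples both kinds of shares. -/
theorem ev_arithP : arithP.ev t O (smpInput P tb a b) = encShares encZMod (tapeArith P t) := by
  refine ev_tab (n := P.m) (ev_uval rfl) fun i => ?_
  refine ev_tab (n := P.d) (ev_uval rfl) fun k => (ev_entryP 10 i k).trans ?_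
  rw [encBF, encZMod, tapeBF, BF.toNat_ofNat, _root_.id, tapeArith, ZMod.val_natCast]

theorem ev_rankP {i : ℕ} (hi : i < P.m) : rankP.ev t O (.pair (smpInput P tb a b) (.num i)) =
    encFin (tapePerm P.m t ⟨i, hi⟩) := by
  rw [rankP, ev_sumN (n := P.m) (w := fun j => if t (16 * j + 11) < t (16 * i + 11) ∨
    (t (16 * j + 11) = t (16 * i + 11) ∧ j < i) then 1 else 0) (ev_uval rfl) fun j _ => ?_]
  · rw [encFin, tapePerm, rankPerm_val, rankNat, Finset.card_filter,
      Finset.sum_range fun j => if t (16 * j + 11) < t (16 * i + 11) ∨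
    (t (16 * j + 11) = t (16 * i + 11) ∧ j < i) then 1 else 0]
    rfl
  · have h1 : (wordP .snd).ev t O (.pair (.pair (smpInput P tb a b) (.num i)) (.num j)) =
      .num (t (16 * j + 11)) := rfl
    have h2 : (wordP (.comp .snd .fst)).ev t O
      (.pair (.pair (smpInput P tb a b) (.num i)) (.num j)) = .num (t (16 * i + 11)) := rfl
    have h3 := holds_ltP h1 h2
    have h4 := holds_eqP h1 h2
    have h5 : (ltP .snd (.comp .snd .fst)).Holds t O
      (.pair (.pair (smpInput P tb a b) (.num i)) (.num j)) ↔ j < i := holds_ltP rfl rfl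
    by_cases hl : t (16 * j + 11) < t (16 * i + 11)
    · rw [ev_ite_holds (h3.2 hl), if_pos (.inl hl)]; rfl
    rw [ev_ite_not fun h => hl (h3.1 h)]
    by_cases he : t (16 * j + 11) = t (16 * i + 11) ∧ j < i
    · rw [ev_ite_holds (holds_andP.2 ⟨h4.2 he.1, h5.2 he.2⟩), if_pos (.inr he)]; rfl
    · rw [ev_ite_not fun h => he ⟨h4.1 (holds_andP.1 h).1, h5.1 (holds_andP.1 h).2⟩,
        if_neg fun h => h.elim hl he]; rfl

theorem ev_orderP : orderP.ev t O (smpInput P tb a b) = encVec encFin (tapePerm P.m t) :=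
  ev_tab (n := P.m) (ev_uval rfl) fun i => ev_rankP i.2

end
end Prog

/-! ### The simulator for the sender -/

namespace Prog

/-- Parts of the input `(1 ^ s, (pub, (input, out)))` of a simulator. -/
abbrev simPub (X : Prog) : Prog := .comp .fst (.comp .snd X)
abbrev simIn (X : Prog) : Prog := .comp .fst (.comp .snd (.comp .snd X))
abbrev simOut (X : Prog) : Prog := .comp .snd (.comp .snd (.comp .snd X))
abbrev smpS (X : Prog) : Prog := .pair (pubM (simPub X)) (.pair (pubN (simPub X)) (simPub X))
abbrev smpR (X : Prog) : Prog := .pair (pubN (simPub X)) (.pair (pubM (simPub X)) (simPub X))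

def viewS : Prog :=
  .pair (simIn .id) <| .pair (.comp orderP (smpS .id)) <| .pair (.comp fmapP (smpS .id)) <|
    .pair (.comp sharesP (smpS .id)) (.comp arithP (smpS .id))

/-- The points of the sender in the sampled order. -/
def pointsS : Prog :=
  tab (uval (pubM (simPub .id))) (nthP (simIn .fst) (.comp rankP (.pair (smpS .fst) .snd)))

def ctxS : Prog :=
  .pair (pubM (simPub .id)) <| .pair (simPub .id) <| .pair pointsS <|
    .pair (.comp (matP 3 (uval .fst)) (smpS .id)) <| .pair (.comp dummiesP (smpS .id)) (numP 0)

def answerS : Prog := .comp ansMap (.pair (.comp ctxS .fst) .snd)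

/-- The point that the receiver gets, if any, on input `(x, i)`: the part of the output from the
position of `i` on. -/
abbrev recvP : Prog := .comp dropP (.pair (simOut .fst) (.comp rankP (.pair (smpR .fst) .snd)))

def viewR : Prog :=
  .pair (simIn .id) <| .pair (.comp fmapP (smpR .id)) <| .pair (.comp sharesP (smpR .id)) <|
    .pair (.comp arithP (smpR .id)) <|
    .pair (tab (uval (pubM (simPub .id))) (.comp .isPair recvP))
      (tab (uval (pubM (simPub .id)))
        (.ite (.comp .isPair recvP) (.pair (numP 1) (.comp .fst recvP)) (numP 0)))

def ctxR : Prog :=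
  .pair (pubN (simPub .id)) <| .pair (simPub .id) <| .pair (simIn .id) <|
    .pair (.comp (matP 3 (uval .fst)) (smpR .id)) <| .pair (.comp dummiesP (smpR .id))
      (.comp idsP (smpR .id))

def answerR : Prog := .comp ansBoth (.pair (.comp ctxR .fst) .snd)

set_option synthInstance.maxSize 4000 in
instance : PT viewS := by unfold viewS; infer_instance
set_option synthInstance.maxSize 4000 in
instance : PT pointsS := by unfold pointsS; infer_instance
set_option synthInstance.maxSize 4000 in
instance : PT ctxS := by unfold ctxS; infer_instance
instance : PT answerS := by unfold answerS; infer_instance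
set_option synthInstance.maxSize 4000 in
instance : PT viewR := by unfold viewR; infer_instance
set_option synthInstance.maxSize 4000 in
instance : PT ctxR := by unfold ctxR; infer_instance
instance : PT answerR := by unfold answerR; infer_instance

section
variable {t : ℕ → ℕ} {O : Data → Data} {tb out : Data} {s : ℕ} {q : Fin P.m → Point P}
  {w : Fin P.n → Point P}

/-- The input of a simulator. -/
def _root_.FPSI.simInput (P : Params) (tb : Data) (s : ℕ) (inp out : Data) : Data :=
  .pair (unary s) (.pair (pubWith P tb) (.pair inp out))

theorem ev_viewS (g : MapFun P P.m) : viewS.ev t O (simInput P tb s (encVec encPoint q) out) =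
    (sView q (tapePerm P.m t) g (tapeLabels P P.m t) (fun i => tapeBF P.ℓ t 4 i)
      (tapeBF P.κ t 5 0) (tapeShares P P.n t 6) (tapeShares P P.m t 7) (fun i => tapeBF P.ℓ t 8 i)
      (tapeShares P P.m t 9) (tapeArith P t)).toView.1 := by
  have hz : (smpS .id).ev t O (simInput P tb s (encVec encPoint q) out) =
    smpInput P tb P.m P.n := rfl
  rw [viewS, ev_pair, ev_pair, ev_pair, ev_pair, ev_comp _ _ _ orderP, ev_comp _ _ _ fmapP,
    ev_comp _ _ _ sharesP, ev_comp _ _ _ arithP, hz, ev_orderP, ev_sharesP, ev_arithP,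
    ev_fmapP (mapFn (fun j => q (tapePerm P.m t j)) (tapeLabels P P.m t)
      (fun i => tapeBF P.ℓ t 4 i) g)]
  rfl

theorem ev_ctxS : ctxS.ev t O (simInput P tb s (encVec encPoint q) out) =
    mapCtx tb (fun j => q (tapePerm P.m t j)) (tapeLabels P P.m t) (fun i => tapeBF P.ℓ t 4 i)
      (.num 0) := by
  have hz : (smpS .id).ev t O (simInput P tb s (encVec encPoint q) out) =
    smpInput P tb P.m P.n := rfl
  have hp : pointsS.ev t O (simInput P tb s (encVec encPoint q) out) =
      encVec encPoint fun j => q (tapePerm P.m t j) := by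
    refine ev_tab (n := P.m) (ev_uval rfl) fun i => ?_
    refine ev_nthP (w := q) (i := tapePerm P.m t i) rfl ?_ (tapePerm P.m t i).2
    rw [ev_comp]
    exact ev_rankP (tb := tb) (a := P.m) (b := P.n) i.2
  rw [ctxS, ev_pair, ev_pair, ev_pair, ev_pair, ev_pair, hp, ev_comp _ _ _ (matP _ _),
    ev_comp _ _ _ dummiesP, hz, ev_labelsP, ev_dummiesP]
  rfl

theorem ev_answerS (y : Data) :
    answerS.ev t O (.pair (simInput P tb s (encVec encPoint q) out) y) =
      oracleOf encMapKey (mapFn (fun j => q (tapePerm P.m t j)) (tapeLabels P P.m t)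
        (fun i => tapeBF P.ℓ t 4 i) (tapeFun P.ℓ addrMap t)) y := by
  rw [answerS, ev_comp, ev_pair, ev_comp _ _ _ ctxS, ev_fst, Data.fst_pair, ev_ctxS]
  exact ev_ansMap y

/-- The simulator scatters the output list over the `m` positions by a sampled permutation: position
`j` receives the item with index `tapePerm P.m t j`, or nothing if the list is too short. -/
theorem ev_viewR {p : ℝ} (g : MapFun P P.n) (gf : FilterFun P) (l : List (Point P)) :
    viewR.ev t O (simInput P tb s (encVec encPoint w) (encList encPoint l)) =
    (rView p w g gf (tapeLabels P P.n t) (fun i => tapeBF P.ℓ t 4 i)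
      (tapeBF P.κ t 5 0) (tapeShares P P.m t 6) (tapeShares P P.n t 7) (fun i => tapeBF P.ℓ t 8 i)
      (tapeShares P P.m t 9) (tapeArith P t) fun j => l[(tapePerm P.m t j : ℕ)]?).toView.1 := by
  set x := simInput P tb s (encVec encPoint w) (encList encPoint l) with hx
  have hz : (smpR .id).ev t O x = smpInput P tb P.n P.m := rfl
  have hrecv : ∀ i : Fin P.m, recvP.ev t O (.pair x (.num i)) =
      encList encPoint (l.drop (tapePerm P.m t i)) := by
    intro i
    have h : (Prog.comp rankP (.pair (smpR .fst) .snd)).ev t O (.pair x (.num i)) =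
        .num (tapePerm P.m t i) := by
      rw [ev_comp]
      exact ev_rankP (tb := tb) (a := P.n) (b := P.m) i.2
    rw [ev_comp, ev_pair, h]
    exact ev_dropP encPoint l t O _
  have hbits : (tab (uval (pubM (simPub .id))) (.comp .isPair recvP)).ev t O x =
      encVec encBool fun j => (l[(tapePerm P.m t j : ℕ)]?).isSome := by
    refine ev_tab (n := P.m) (ev_uval rfl) fun i => ?_
    rw [ev_comp, hrecv, ← List.head?_drop]
    cases l.drop (tapePerm P.m t i) <;> rfl
  have hz' : (tab (uval (pubM (simPub .id)))
        (.ite (.comp .isPair recvP) (.pair (numP 1) (.comp .fst recvP)) (numP 0))).ev t O x =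
      encVec (encOption encPoint) fun j => l[(tapePerm P.m t j : ℕ)]? := by
    refine ev_tab (n := P.m) (ev_uval rfl) fun i => ?_
    rw [ev_ite, ev_comp, ev_pair, ev_comp _ _ _ .fst, hrecv, ← List.head?_drop]
    cases l.drop (tapePerm P.m t i) <;> rfl
  rw [viewR, ev_pair, ev_pair, ev_pair, ev_pair, ev_pair, hbits, hz', ev_comp _ _ _ fmapP,
    ev_comp _ _ _ sharesP, ev_comp _ _ _ arithP, hz, ev_sharesP, ev_arithP,
    ev_fmapP (mapFn w (tapeLabels P P.n t) (fun i => tapeBF P.ℓ t 4 i) g)]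
  rfl

theorem ev_ctxR : ctxR.ev t O (simInput P tb s (encVec encPoint w) out) =
    mapCtx tb w (tapeLabels P P.n t) (fun i => tapeBF P.ℓ t 4 i)
      (encVec encBF fun i : Fin P.n => tapeBF P.ℓ t 8 i) := by
  have hz : (smpR .id).ev t O (simInput P tb s (encVec encPoint w) out) =
    smpInput P tb P.n P.m := rfl
  rw [ctxR, ev_pair, ev_pair, ev_pair, ev_pair, ev_pair, ev_comp _ _ _ (matP _ _),
    ev_comp _ _ _ dummiesP, ev_comp _ _ _ idsP, hz, ev_labelsP, ev_dummiesP, ev_idsP]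
  rfl

theorem ev_answerR {p : ℝ} {τ : Fin (P.δ + 1) → ℕ} (htb : tb = encVec (fun v : ℕ => .num v) τ)
    (hτ : ∀ i : Fin (P.δ + 1), τ i % 2 ^ P.ℓ = powVal P p i % 2 ^ P.ℓ) (y : Data) :
    answerR.ev t O (.pair (simInput P tb s (encVec encPoint w) out) y) =
      oracleOf encBothKeys (Sum.elim
        (mapFn w (tapeLabels P P.n t) (fun i => tapeBF P.ℓ t 4 i) (tapeFun P.ℓ addrMap t))
        (filterFn p w (fun i => tapeBF P.ℓ t 8 i) (tapeFun P.ℓ addrFilter t))) y := by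
  rw [answerR, ev_comp, ev_pair, ev_comp _ _ _ ctxR, ev_fst, Data.fst_pair, ev_ctxR]
  exact ev_ansBoth htb hτ y

end
end Prog
end FPSI

/-! ### Independence and uniformity of the parts of a random tape. -/

namespace FPSI

open scoped BigOperators
open Finset (expect)
open Prog

set_option synthInstance.maxSize 2000

variable {P : Params} {p : ℝ} {q₀ : Fin P.m → Point P} {w : Fin P.n → Point P}

/-! ### The distribution of the parts of a random tape -/

theorem tapeOf_eq {T : ℕ} (ω : Fin (2 ^ T) → Fin (2 ^ T)) {a : ℕ} (h : a < 2 ^ T) :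
    tapeOf ω a = ω ⟨a, h⟩ := dif_pos h

/-- A word of the part `tag` of a tape. -/
theorem tag_lt {T N : ℕ} (hT : 16 * N ≤ 2 ^ T) (tag : Fin 16) (i : Fin N) :
    16 * (i : ℕ) + tag < 2 ^ T := by omega

theorem balanced_tags {T N : ℕ} (hT : 16 * N ≤ 2 ^ T) :
    Balanced fun (ω : Fin (2 ^ T) → Fin (2 ^ T)) (tag : Fin 16) (i : Fin N) =>
      ω ⟨16 * i + tag, tag_lt hT tag i⟩ := by
  have h := Balanced.restrict (X := Fin (2 ^ T)) (e := fun x : Fin 16 × Fin N =>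
    (⟨16 * x.2 + x.1, tag_lt hT x.1 x.2⟩ : Fin (2 ^ T))) fun x y hxy => by
      have : 16 * (x.2 : ℕ) + x.1 = 16 * y.2 + y.1 := congrArg Fin.val hxy
      ext <;> omega
  exact (Balanced.of_equiv (Equiv.curry (Fin 16) (Fin N) (Fin (2 ^ T)))).comp h

theorem balanced_part {K Y : Type} [Finite K] {N T : ℕ} {e : K → ℕ} (he : Function.Injective e)
    (hN : ∀ k, e k < N) {φ : Fin (2 ^ T) → Y} (hφ : Balanced φ) :
    Balanced fun (f : Fin N → Fin (2 ^ T)) k => φ (f ⟨e k, hN k⟩) :=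
  (Balanced.arrow hφ).comp (Balanced.restrict (X := Fin (2 ^ T)) (e := fun k => ⟨e k, hN k⟩)
    fun _ _ h => he (congrArg Fin.val h))

/-- The index of an entry of a table. -/
def tableIdx {a d : ℕ} (ik : Fin a × Fin d) : ℕ := ik.1 * d + ik.2

theorem tableIdx_injective {d : ℕ} {i i' : ℕ} {k k' : Fin d} (h : i * d + k = i' * d + k') :
    i = i' ∧ k = k' := by
  have hd := k.pos
  have h1 : (i * d + k) / d = i := by
    rw [mul_comm, Nat.mul_add_div hd, Nat.div_eq_of_lt k.2, add_zero]
  have h2 : (i' * d + k') / d = i' := by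
    rw [mul_comm, Nat.mul_add_div hd, Nat.div_eq_of_lt k'.2, add_zero]
  have h3 : i = i' := by rw [← h1, ← h2, h]
  subst h3
  exact ⟨rfl, Fin.ext (by omega)⟩

theorem tableIdx_lt {a d : ℕ} {i : ℕ} (hi : i < a) (k : Fin d) : i * d + k < a * d :=
  calc i * d + k < i * d + d := by have := k.2; omega
    _ = (i + 1) * d := by ring
    _ ≤ a * d := Nat.mul_le_mul_right d hi

/-- A bound for the indices of the words that are used. -/
def tapeBound (P : Params) : ℕ :=
  2 ^ P.ℓ * ((P.u + 2 * P.δ) * P.d) + (P.m + P.n) * (P.d * (2 * P.δ + 1)) + P.m + P.n + 1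

theorem addrMap_injective {a : ℕ} : Function.Injective (addrMap (P := P) (n := a)) := by
  rintro (⟨k, c⟩ | i) (⟨k', c'⟩ | i') h <;> simp only [addrMap] at h
  · obtain ⟨h1, rfl⟩ := tableIdx_injective (i := Coord.nat c) (i' := Coord.nat c') (k := k)
      (k' := k') (by omega)
    rw [encCoord_injective (congrArg Data.num h1)]
  · omega
  · omega
  · rw [Fin.ext (show (i : ℕ) = i' by omega)]

theorem addrFilter_injective : Function.Injective (addrFilter (P := P)) := by
  rintro ⟨i, k, c⟩ ⟨i', k', c'⟩ h
  simp only [addrFilter] at h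
  have h0 : i.toNat + 2 ^ P.ℓ * (Coord.nat c * P.d + k) =
    i'.toNat + 2 ^ P.ℓ * (Coord.nat c' * P.d + k') := by omega
  have h1 := congrArg (· % 2 ^ P.ℓ) h0
  simp only [Nat.add_mul_mod_self_left, Nat.mod_eq_of_lt (BF.toNat_lt _)] at h1
  rw [h1] at h0
  have h2 := Nat.eq_of_mul_eq_mul_left (by positivity) (Nat.add_left_cancel h0)
  obtain ⟨h3, rfl⟩ := tableIdx_injective h2
  rw [BF.toNat_injective h1, encCoord_injective (congrArg Data.num h3)]

theorem addrBoth_injective {a : ℕ} : Function.Injective (addrBoth (P := P) (n := a)) := by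
  refine addrMap_injective.sumElim addrFilter_injective fun x y h => ?_
  rcases x with ⟨k, c⟩ | i <;> simp only [addrMap, addrFilter] at h <;> omega

theorem coordIdx_lt (k : Fin P.d) (c : Coord P) : Coord.nat c * P.d + k < tapeBound P := by
  have h1 := tableIdx_lt (Coord.nat_lt c) k
  have h2 : 1 * ((P.u + 2 * P.δ) * P.d) ≤ 2 ^ P.ℓ * ((P.u + 2 * P.δ) * P.d) :=
    Nat.mul_le_mul_right _ (Nat.one_le_two_pow)
  unfold tapeBound; omega

theorem filterIdx_lt (i : BF P.ℓ) (k : Fin P.d) (c : Coord P) :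
    i.toNat + 2 ^ P.ℓ * (Coord.nat c * P.d + k) < tapeBound P := by
  have h1 := tableIdx_lt (Coord.nat_lt c) k
  have h2 := i.toNat_lt
  have h3 : 2 ^ P.ℓ * (Coord.nat c * P.d + k + 1) ≤ 2 ^ P.ℓ * ((P.u + 2 * P.δ) * P.d) :=
    Nat.mul_le_mul_left _ h1
  unfold tapeBound; rw [mul_add, mul_one] at h3; omega

theorem dummyIdx_lt {a : ℕ} (ha : a ≤ P.m + P.n) (i : Fin (padSize P a)) :
    (i : ℕ) < tapeBound P := by
  have h1 : padSize P a ≤ (P.m + P.n) * (P.d * (2 * P.δ + 1)) := by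
    rw [padSize, mul_assoc]; exact Nat.mul_le_mul_right _ ha
  have := i.2
  unfold tapeBound; omega

theorem shareIdx_lt {a : ℕ} (ha : a ≤ P.m + P.n) (ik : Fin a × Fin P.d) :
    tableIdx ik < tapeBound P := by
  have h1 := tableIdx_lt (ik.1.2.trans_le ha) ik.2
  have h2 : (P.m + P.n) * (P.d * 1) ≤ (P.m + P.n) * (P.d * (2 * P.δ + 1)) :=
    Nat.mul_le_mul_left _ (Nat.mul_le_mul_left _ (by omega))
  unfold tapeBound tableIdx; rw [mul_one] at h2; omega

theorem pointIdx_lt {a : ℕ} (ha : a ≤ P.m + P.n) (i : Fin a) : (i : ℕ) < tapeBound P := by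
  have := i.2
  unfold tapeBound; omega

theorem addrBoth_lt {a T : ℕ} (ha : a ≤ P.m + P.n) (hT : 16 * tapeBound P ≤ 2 ^ T)
    (x : MapKey P a ⊕ FilterKey P) : addrBoth x < 2 ^ T := by
  rcases x with (⟨k, c⟩ | i) | ⟨i, k, c⟩
  · have := coordIdx_lt k c; simp only [addrBoth, Sum.elim_inl, addrMap]; omega
  · have := dummyIdx_lt ha i; simp only [addrBoth, Sum.elim_inl, addrMap]; omega
  · have := filterIdx_lt i k c; simp only [addrBoth, Sum.elim_inr, addrFilter]; omega

theorem addrBoth_mod {a : ℕ} (x : MapKey P a ⊕ FilterKey P) : addrBoth x % 16 ≠ 15 := by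
  rcases x with (⟨k, c⟩ | i) | ⟨i, k, c⟩ <;>
    simp only [addrBoth, Sum.elim_inl, Sum.elim_inr, addrMap, addrFilter] <;> omega

/-- The parts of a random tape are independent and uniform. -/
theorem balanced_tape {T a b : ℕ} (ha : a ≤ P.m + P.n) (hb : b ≤ P.m + P.n)
    (hT : 16 * tapeBound P ≤ 2 ^ T) (hℓ : P.ℓ ≤ T) (hκ : P.κ ≤ T) :
    Balanced fun ω : Fin (2 ^ T) → Fin (2 ^ T) =>
      ((fun kc : Fin P.d × Coord P => tapeFun P.ℓ (addrMap (n := a)) (tapeOf ω) (.inl kc),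
        fun i : Fin (padSize P a) => tapeFun P.ℓ addrMap (tapeOf ω) (.inr i),
        fun y : FilterKey P => tapeFun P.ℓ addrFilter (tapeOf ω) y,
        tapeLabels P a (tapeOf ω), fun i : Fin (padSize P a) => tapeBF P.ℓ (tapeOf ω) 4 i,
        tapeBF P.κ (tapeOf ω) 5 0, tapeShares P b (tapeOf ω) 6, tapeShares P a (tapeOf ω) 7,
        fun i : Fin a => tapeBF P.ℓ (tapeOf ω) 8 i, tapeShares P P.m (tapeOf ω) 9,
        tapeArith P (tapeOf ω),
        fun j : Fin P.m => ω ⟨16 * j + 11, tag_lt hT 11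
          ⟨j, pointIdx_lt (Nat.le_add_right _ _) j⟩⟩, ()) :
        ((Fin P.d × Coord P) → BF P.ℓ) × Dummies P a × FilterFun P × Labels P a × Dummies P a ×
          BF P.κ × Shares P b × Shares P a × (Fin a → BF P.ℓ) × Shares P P.m × ArithShares P ×
          (Fin P.m → Fin (2 ^ T)) × Unit) := by
  have hm : P.m ≤ P.m + P.n := Nat.le_add_right _ _
  have hB := balanced_ofNat hℓ
  have hinj : ∀ c : ℕ, Function.Injective (tableIdx : Fin c × Fin P.d → ℕ) := by
    intro c x y h
    obtain ⟨h1, h2⟩ := tableIdx_injective h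
    exact Prod.ext (Fin.ext h1) h2
  have h0 := balanced_part (K := Fin P.d × Coord P) (e := fun kc => Coord.nat kc.2 * P.d + kc.1)
    (fun x y h => by
      obtain ⟨h1, h2⟩ := tableIdx_injective h
      exact Prod.ext h2 (encCoord_injective (congrArg Data.num h1)))
    (fun kc => coordIdx_lt kc.1 kc.2) hB
  have h1 := balanced_part (K := Fin (padSize P a)) Fin.val_injective (dummyIdx_lt ha) hB
  have h2 := balanced_part (K := FilterKey P)
    (e := fun y => y.1.toNat + 2 ^ P.ℓ * (Coord.nat y.2.2 * P.d + y.2.1))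
    (fun x y h => addrFilter_injective (by unfold addrFilter; dsimp only at h; rw [h]))
    (fun y => filterIdx_lt y.1 y.2.1 y.2.2) hB
  have h3 := (Balanced.of_equiv (Equiv.curry (Fin a) (Fin P.d) (BF P.ℓ))).comp
    (balanced_part (K := Fin a × Fin P.d) (hinj _) (shareIdx_lt ha) hB)
  have h5 := (Balanced.of_equiv (Equiv.funUnique Unit (BF P.κ))).comp
    (balanced_part (K := Unit) (e := fun _ => 0) (fun _ _ _ => rfl)
      (fun _ => show 0 < tapeBound P by unfold tapeBound; omega) (balanced_ofNat hκ))
  have h6 := balanced_part (K := Fin b × Fin P.d) (hinj _) (shareIdx_lt hb) hB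
  have h7 := balanced_part (K := Fin a × Fin P.d) (hinj _) (shareIdx_lt ha) hB
  have h8 := balanced_part (K := Fin a) Fin.val_injective (pointIdx_lt ha) hB
  have h9 := balanced_part (K := Fin P.m × Fin P.d) (hinj _) (shareIdx_lt hm) hB
  have h10 := balanced_part (K := Fin P.m × Fin P.d) (hinj _) (shareIdx_lt hm) (balanced_zmod hℓ)
  have h11 := balanced_part (K := Fin P.m) Fin.val_injective (pointIdx_lt hm)
    (Balanced.of_equiv (Equiv.refl (Fin (2 ^ T))))
  have hN : Nonempty (Fin (tapeBound P)) := ⟨0, by unfold tapeBound; omega⟩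
  -- The residues 0 to 11 modulo 16 carry the twelve parts, in this order; the four remaining
  -- residues are mapped to `Unit` and averaged out.
  have H := (h0.cons <| h1.cons <| h2.cons <| h3.cons <| h1.cons <| h5.cons <| h6.cons <|
    h7.cons <| h8.cons <| h9.cons <| h10.cons <| h11.cons <|
    Balanced.unit (X := Fin 4 → Fin (tapeBound P) → Fin (2 ^ T))).comp (balanced_tags hT)
  have ht : ∀ (ω : Fin (2 ^ T) → Fin (2 ^ T)) (a : ℕ) (h : a < 2 ^ T),
      (ω ⟨a, h⟩ : ℕ) = tapeOf ω a := fun ω a h => (tapeOf_eq ω h).symm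
  refine (congrArg Balanced (funext fun ω => ?_)).mp H
  have hB : ∀ {K : Type} {e : K → ℕ} (h : ∀ k, e k < 2 ^ T),
      (fun k => BF.ofNat P.ℓ (ω ⟨e k, h k⟩)) = fun k => BF.ofNat P.ℓ (tapeOf ω (e k)) :=
    fun h => funext fun k => congrArg (BF.ofNat P.ℓ) (ht ω _ _)
  refine congrArg₂ Prod.mk (hB _) <| congrArg₂ Prod.mk (hB _) <| congrArg₂ Prod.mk (hB _) <|
    congrArg₂ Prod.mk (funext fun i => funext fun k => congrArg (BF.ofNat P.ℓ) (ht ω _ _)) <| congrArg₂ Prod.mk (hB _) <|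
    congrArg₂ Prod.mk (congrArg (BF.ofNat P.κ) (ht ω _ _)) <| congrArg₂ Prod.mk (hB _) <|
    congrArg₂ Prod.mk (hB _) <| congrArg₂ Prod.mk (hB _) <| congrArg₂ Prod.mk (hB _) <|
    congrArg₂ Prod.mk (funext fun k => congrArg (Nat.cast (R := ZMod (2 ^ P.ℓ))) (ht ω _ _)) rfl

end FPSI

/-! ### The laws of the simulated views. -/

namespace FPSI

open scoped BigOperators
open Finset (expect)
open Prog

set_option synthInstance.maxSize 2000

variable {P : Params} {p : ℝ} {q₀ : Fin P.m → Point P} {w : Fin P.n → Point P}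

/-! ### Simulated views as averages over independent uniform choices -/

theorem expect_sumElim {A B C : Type} [Fintype A] [Fintype B] [Fintype C] [DecidableEq A]
    [DecidableEq B] (f : (A ⊕ B → C) → ℝ) : 𝔼 g, 𝔼 g', f (Sum.elim g g') = 𝔼 g, f g := by
  rw [← expect_prod fun x : (A → C) × (B → C) => f (Sum.elim x.1 x.2)]
  exact (Fintype.expect_equiv (Equiv.sumArrowEquivProdArrow A B C) _ _ fun g => by
    simp [Equiv.sumArrowEquivProdArrow]).symm

section reorder
variable {A₁ A₂ A₃ A₄ A₅ A₆ A₇ A₈ A₉ A₁₀ A₁₁ : Type*} [Fintype A₁] [Fintype A₂] [Fintype A₃]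
  [Fintype A₄] [Fintype A₅] [Fintype A₆] [Fintype A₇] [Fintype A₈] [Fintype A₉] [Fintype A₁₀]
  [Fintype A₁₁]

theorem expect_reorder₁₁ (f : A₁ → A₂ → A₃ → A₄ → A₅ → A₆ → A₇ → A₈ → A₉ → A₁₀ → A₁₁ → ℝ) :
    𝔼 a₁, 𝔼 a₂, 𝔼 a₃, 𝔼 a₄, 𝔼 a₅, 𝔼 a₆, 𝔼 a₇, 𝔼 a₈, 𝔼 a₉, 𝔼 a₁₀, 𝔼 a₁₁,
      f a₁ a₂ a₃ a₄ a₅ a₆ a₇ a₈ a₉ a₁₀ a₁₁ =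
    𝔼 a₁₁, 𝔼 a₃, 𝔼 a₄, 𝔼 a₅, 𝔼 a₆, 𝔼 a₇, 𝔼 a₉, 𝔼 a₁₀, 𝔼 a₈, 𝔼 a₁, 𝔼 a₂,
      f a₁ a₂ a₃ a₄ a₅ a₆ a₇ a₈ a₉ a₁₀ a₁₁ := by
  have := Fintype.expect_equiv
    (⟨fun (a₁, a₂, a₃, a₄, a₅, a₆, a₇, a₈, a₉, a₁₀, a₁₁) =>
        (a₁₁, a₃, a₄, a₅, a₆, a₇, a₉, a₁₀, a₈, a₁, a₂),
      fun (a₁₁, a₃, a₄, a₅, a₆, a₇, a₉, a₁₀, a₈, a₁, a₂) =>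
        (a₁, a₂, a₃, a₄, a₅, a₆, a₇, a₈, a₉, a₁₀, a₁₁), fun _ => rfl, fun _ => rfl⟩ :
      A₁ × A₂ × A₃ × A₄ × A₅ × A₆ × A₇ × A₈ × A₉ × A₁₀ × A₁₁ ≃
        A₁₁ × A₃ × A₄ × A₅ × A₆ × A₇ × A₉ × A₁₀ × A₈ × A₁ × A₂)
    (fun (a₁, a₂, a₃, a₄, a₅, a₆, a₇, a₈, a₉, a₁₀, a₁₁) => f a₁ a₂ a₃ a₄ a₅ a₆ a₇ a₈ a₉ a₁₀ a₁₁)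
    (fun (a₁₁, a₃, a₄, a₅, a₆, a₇, a₉, a₁₀, a₈, a₁, a₂) => f a₁ a₂ a₃ a₄ a₅ a₆ a₇ a₈ a₉ a₁₀ a₁₁)
    fun _ => rfl
  simpa only [expect_prod] using this

end reorder

/-- Choices from a random tape are close to independent uniform choices. -/
theorem abs_expect_tape_sub_le {T a b : ℕ} (ha : a ≤ P.m + P.n) (hb : b ≤ P.m + P.n)
    (hT : 16 * tapeBound P ≤ 2 ^ T) (hℓ : P.ℓ ≤ T) (hκ : P.κ ≤ T)
    (h : Equiv.Perm (Fin P.m) → Labels P a → Dummies P a → BF P.κ → Shares P b → Shares P a →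
      Shares P P.m → ArithShares P → (Fin a → BF P.ℓ) → MapFun P a → FilterFun P → ℝ)
    (hh : ∀ σ τ lab dum k sO sOwn sh ar ids g gf,
      |h σ lab dum k sO sOwn sh ar ids g gf - h τ lab dum k sO sOwn sh ar ids g gf| ≤ 1) :
    |(𝔼 ω : Fin (2 ^ T) → Fin (2 ^ T), h (tapePerm P.m (tapeOf ω)) (tapeLabels P a (tapeOf ω))
        (fun i => tapeBF P.ℓ (tapeOf ω) 4 i) (tapeBF P.κ (tapeOf ω) 5 0)
        (tapeShares P b (tapeOf ω) 6) (tapeShares P a (tapeOf ω) 7)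
        (tapeShares P P.m (tapeOf ω) 9) (tapeArith P (tapeOf ω))
        (fun i => tapeBF P.ℓ (tapeOf ω) 8 i) (tapeFun P.ℓ addrMap (tapeOf ω))
        (tapeFun P.ℓ addrFilter (tapeOf ω))) -
      𝔼 σ, 𝔼 lab, 𝔼 dum, 𝔼 k, 𝔼 sO, 𝔼 sOwn, 𝔼 sh, 𝔼 ar, 𝔼 ids, 𝔼 g, 𝔼 gf,
        h σ lab dum k sO sOwn sh ar ids g gf| ≤ P.m ^ 2 * ((2 : ℝ) ^ T)⁻¹ := by
  have H := (balanced_tape ha hb hT hℓ hκ).expect fun x =>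
    h (rankPerm fun j => x.2.2.2.2.2.2.2.2.2.2.2.1 j) x.2.2.2.1 x.2.2.2.2.1 x.2.2.2.2.2.1
      x.2.2.2.2.2.2.1 x.2.2.2.2.2.2.2.1 x.2.2.2.2.2.2.2.2.2.1 x.2.2.2.2.2.2.2.2.2.2.1
      x.2.2.2.2.2.2.2.2.1 (Sum.elim x.1 x.2.1) x.2.2.1
  have hL : ∀ ω : Fin (2 ^ T) → Fin (2 ^ T),
      (rankPerm fun j : Fin P.m => (ω ⟨16 * j + 11, tag_lt hT 11
        ⟨j, pointIdx_lt (Nat.le_add_right _ _) j⟩⟩ : ℕ)) = tapePerm P.m (tapeOf ω) ∧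
      (Sum.elim (fun kc : Fin P.d × Coord P => tapeFun P.ℓ (addrMap (n := a)) (tapeOf ω) (.inl kc))
        fun i : Fin (padSize P a) => tapeFun P.ℓ addrMap (tapeOf ω) (.inr i)) =
      tapeFun P.ℓ addrMap (tapeOf ω) := fun ω =>
    ⟨congrArg rankPerm (funext fun j => (tapeOf_eq ω _).symm),
      funext fun x => by rcases x with x | x <;> rfl⟩
  simp only [hL] at H
  rw [H]
  simp only [expect_prod, Fintype.expect_const]
  -- Every choice except the permutation is exactly uniform. With the permutation innermost and all
  -- else fixed, the error is the one of `abs_expect_rankPerm_sub_le`.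
  rw [← expect_reorder₁₁ fun g gf lab dum k sO sOwn ids sh ar σ =>
    h σ lab dum k sO sOwn sh ar ids g gf,
    expect_sumElim fun g => 𝔼 gf, 𝔼 lab, 𝔼 dum, 𝔼 k, 𝔼 sO, 𝔼 sOwn, 𝔼 ids, 𝔼 sh, 𝔼 ar,
      𝔼 u : Fin P.m → Fin (2 ^ T), h (rankPerm fun j => u j) lab dum k sO sOwn sh ar ids g gf]
  refine abs_expect_sub_le_const fun g => abs_expect_sub_le_const fun gf =>
    abs_expect_sub_le_const fun lab => abs_expect_sub_le_const fun dum =>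
    abs_expect_sub_le_const fun k => abs_expect_sub_le_const fun sO =>
    abs_expect_sub_le_const fun sOwn => abs_expect_sub_le_const fun ids =>
    abs_expect_sub_le_const fun sh => abs_expect_sub_le_const fun ar => ?_
  have := abs_expect_rankPerm_sub_le (N := 2 ^ T)
    (f := fun σ => h σ lab dum k sO sOwn sh ar ids g gf) fun σ τ => hh σ τ _ _ _ _ _ _ _ _ _ _
  exact_mod_cast this

theorem abs_expect_sender_tape_sub_le {T : ℕ} (hT : 16 * tapeBound P ≤ 2 ^ T) (hℓ : P.ℓ ≤ T)
    (hκ : P.κ ≤ T) (f : SenderView P → ℝ) (hf : ∀ v v', |f v - f v'| ≤ 1) :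
    |(𝔼 ω : Fin (2 ^ T) → Fin (2 ^ T), f (sView q₀ (tapePerm P.m (tapeOf ω))
        (tapeFun P.ℓ addrMap (tapeOf ω)) (tapeLabels P P.m (tapeOf ω))
        (fun i => tapeBF P.ℓ (tapeOf ω) 4 i) (tapeBF P.κ (tapeOf ω) 5 0)
        (tapeShares P P.n (tapeOf ω) 6) (tapeShares P P.m (tapeOf ω) 7)
        (fun i => tapeBF P.ℓ (tapeOf ω) 8 i) (tapeShares P P.m (tapeOf ω) 9)
        (tapeArith P (tapeOf ω)))) -
      𝔼 r : RestS P, 𝔼 ids, 𝔼 g, f (r.view q₀ ids g)| ≤ P.m ^ 2 * ((2 : ℝ) ^ T)⁻¹ := by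
  refine le_of_eq_of_le ?_ (abs_expect_tape_sub_le (a := P.m) (b := P.n) (by omega) (by omega)
    hT hℓ hκ (fun σ lab dum k sO sOwn sh ar ids g _ =>
      f (sView q₀ σ g lab dum k sO sOwn ids sh ar)) fun _ _ _ _ _ _ _ _ _ _ _ _ => hf _ _)
  simp only [expect_prod, RestS.view, Fintype.expect_const]

theorem matched_isSome {j : Fin P.m} : (matched p q₀ w j).isSome ↔
    ∃ i, distLp p (q₀ j) (w i) ≤ P.δ := by
  unfold matched; split_ifs with h <;> simp [h]

theorem matched_eq {j : Fin P.m} : matched p q₀ w j = some (q₀ j) ∨ matched p q₀ w j = none := by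
  unfold matched; split_ifs <;> simp

theorem DisjointProjection.injective {a : ℕ} {x : Fin a → Point P} (hx : DisjointProjection x) :
    Function.Injective x := by
  intro i j hij
  by_contra hne
  obtain ⟨k, hk⟩ := hx i
  have := hk j (Ne.symm hne)
  rw [hij, Set.inter_self, Set.Icc_eq_empty_iff] at this
  omega

/-- The points that are matched, as entries of a list without repetitions. -/
theorem exists_perm_getElem?_eq_matched (hq : Function.Injective q₀) {l : List (Point P)}
    (hl : l.Nodup) (hmem : ∀ x, x ∈ l ↔ x ∈ fuzzyPSI p q₀ w) :
    ∃ π : Equiv.Perm (Fin P.m), ∀ i : Fin P.m, l[(i : ℕ)]? = matched p q₀ w (π i) := by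
  have hmem' : ∀ x, x ∈ l ↔ ∃ j, (matched p q₀ w j).isSome ∧ q₀ j = x := by
    intro x
    rw [hmem, fuzzyPSI]
    simp only [Finset.mem_image, Finset.mem_filter, Finset.mem_univ, true_and, matched_isSome]
  have hlen : l.length ≤ P.m := by
    classical
    rw [← List.toFinset_card_of_nodup hl]
    calc l.toFinset.card ≤ (Finset.univ.image q₀).card := Finset.card_le_card fun x hx => by
          obtain ⟨j, -, rfl⟩ := (hmem' x).1 (List.mem_toFinset.1 hx)
          exact Finset.mem_image_of_mem _ (Finset.mem_univ j)
      _ ≤ P.m := Finset.card_image_le.trans (Finset.card_fin _).le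
  choose φ hφ hφq using fun i : {i : Fin P.m // (i : ℕ) < l.length} =>
    (hmem' _).1 (l.getElem_mem i.2)
  -- Positions in `l` correspond bijectively to matched indices. A bijection between subsets of a
  -- finite set extends to a permutation, which then sends positions past the end of `l` to
  -- unmatched indices.
  let e : {i : Fin P.m // (i : ℕ) < l.length} ≃ {j : Fin P.m // (matched p q₀ w j).isSome} :=
    Equiv.ofBijective (fun i => ⟨φ i, hφ i⟩) ⟨fun i i' h => by
      have h1 := congrArg q₀ (congrArg Subtype.val h)
      simp only [hφq] at h1
      exact Subtype.ext (Fin.ext ((hl.getElem_inj_iff).1 h1)), fun j => by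
      obtain ⟨i, hi, hij⟩ := List.getElem_of_mem ((hmem' (q₀ j)).2 ⟨j, j.2, rfl⟩)
      exact ⟨⟨⟨i, hi.trans_le hlen⟩, hi⟩, Subtype.ext (hq ((hφq _).trans hij))⟩⟩
  refine ⟨e.extendSubtype, fun i => ?_⟩
  by_cases hi : (i : ℕ) < l.length
  · rw [e.extendSubtype_apply_of_mem i hi, List.getElem?_eq_getElem hi]
    have h1 : q₀ (e ⟨i, hi⟩) = l[(i : ℕ)] := hφq ⟨i, hi⟩
    rcases matched_eq (p := p) (q₀ := q₀) (w := w) (j := e ⟨i, hi⟩) with h | h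
    · rw [h, h1]
    · have := (e ⟨i, hi⟩).2; rw [h] at this; cases this
  · have h1 := e.extendSubtype_not_mem i hi
    rw [List.getElem?_eq_none (not_lt.1 hi)]
    rcases h2 : matched p q₀ w (e.extendSubtype i) with _ | _
    · rfl
    · rw [h2] at h1; exact absurd rfl h1

/-- This is where the sender's random order is needed: composing a uniform permutation with `π`
changes nothing, so the matched points in random order have the same law as the output list in
random positions, and the list is all that the simulator knows. -/
theorem abs_expect_receiver_tape_sub_le {T : ℕ} (hT : 16 * tapeBound P ≤ 2 ^ T) (hℓ : P.ℓ ≤ T)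
    (hκ : P.κ ≤ T) (hq : Function.Injective q₀) {l : List (Point P)} (hl : l.Nodup)
    (hmem : ∀ x, x ∈ l ↔ x ∈ fuzzyPSI p q₀ w)
    (f : ReceiverView P → ℝ) (hf : ∀ v v', |f v - f v'| ≤ 1) :
    |(𝔼 ω : Fin (2 ^ T) → Fin (2 ^ T), f (rView p w (tapeFun P.ℓ addrMap (tapeOf ω))
        (tapeFun P.ℓ addrFilter (tapeOf ω)) (tapeLabels P P.n (tapeOf ω))
        (fun i => tapeBF P.ℓ (tapeOf ω) 4 i) (tapeBF P.κ (tapeOf ω) 5 0)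
        (tapeShares P P.m (tapeOf ω) 6) (tapeShares P P.n (tapeOf ω) 7)
        (fun i => tapeBF P.ℓ (tapeOf ω) 8 i) (tapeShares P P.m (tapeOf ω) 9)
        (tapeArith P (tapeOf ω)) fun j => l[(tapePerm P.m (tapeOf ω) j : ℕ)]?)) -
      𝔼 r : RestR P, 𝔼 ids, 𝔼 g, 𝔼 gf, f (r.view p q₀ w ids g gf)| ≤
        P.m ^ 2 * ((2 : ℝ) ^ T)⁻¹ := by
  refine le_of_eq_of_le ?_ (abs_expect_tape_sub_le (a := P.n) (b := P.m) (by omega) (by omega)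
    hT hℓ hκ (fun σ lab dum k sO sOwn sh ar ids g gf =>
      f (rView p w g gf lab dum k sO sOwn ids sh ar fun j => l[(σ j : ℕ)]?))
      fun _ _ _ _ _ _ _ _ _ _ _ _ => hf _ _)
  obtain ⟨π, hπ⟩ := exists_perm_getElem?_eq_matched hq hl hmem
  have key (X : (Fin P.m → Option (Point P)) → ℝ) :
      𝔼 σ : Equiv.Perm (Fin P.m), X (fun j => matched p q₀ w (σ j)) =
        𝔼 σ : Equiv.Perm (Fin P.m), X fun j => l[(σ j : ℕ)]? := by
    simp only [hπ]
    exact (Fintype.expect_equiv (Equiv.mulLeft π) _ (fun σ => X fun j => matched p q₀ w (σ j))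
      fun σ => rfl).symm
  simp only [expect_prod, RestR.view, Fintype.expect_const]
  rw [key fun z => 𝔼 lab, 𝔼 dum, 𝔼 k, 𝔼 sOwn, 𝔼 sO, 𝔼 sh, 𝔼 ar, 𝔼 ids, 𝔼 g, 𝔼 gf,
    f (rView p w g gf lab dum k sO sOwn ids sh ar z)]
  refine congrArg abs (congrArg₂ HSub.hSub rfl ?_)
  exact expect_congr' fun σ => expect_congr' fun lab => expect_congr' fun dum =>
    expect_congr' fun k => Finset.expect_comm _ _ _

end FPSI

/-! ### Polynomial bounds for sizes of views and lengths of tapes. -/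

namespace FPSI

open scoped BigOperators
open Finset (expect)
open Prog

set_option synthInstance.maxSize 2000

variable {P : Params} {p : ℝ} {q₀ : Fin P.m → Point P} {w : Fin P.n → Point P} {L : ℕ}

/-! ### Bounds for the sizes of views -/

/-- The sum of the parameters that are polynomially bounded. -/
def Params.total (P : Params) : ℕ := P.m + P.n + P.d + P.δ + Nat.size P.u + P.ℓ + P.κ + 1

theorem Admissible.poly_total {P : ℕ → Params} (hP : Admissible p P) :
    PolyBounded fun s => (P s).total :=
  ((((((hP.poly_m.add hP.poly_n).add hP.poly_d).add hP.poly_δ).add hP.poly_u).add hP.poly_ℓ).add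
    hP.poly_κ).add (.const 1)

/-- A bound for the size of a vector of length at most `L` with entries of size at most `B`. -/
def vecBound (L B : ℕ) : ℕ := L * (B + 1) + 1

theorem size_encVec_le {α : Type} {n B : ℕ} {e : α → Data} {v : Fin n → α} (hn : n ≤ L)
    (h : ∀ i, (e (v i)).size ≤ B) : (encVec e v).size ≤ vecBound L B :=
  (encVec_size_le h).trans (Nat.add_le_add_right (Nat.mul_le_mul_right _ hn) _)

theorem PolyBounded.vecBound {f g : ℕ → ℕ} (hf : PolyBounded f) (hg : PolyBounded g) :
    PolyBounded fun s => vecBound (f s) (g s) := (hf.mul (hg.add (.const 1))).add (.const 1)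

theorem encPoint_size (x : Point P) : (encPoint x).size ≤ vecBound P.total P.total := by
  refine size_encVec_le (by unfold Params.total; omega) fun k => ?_
  have := Nat.size_le_size (x k).2.le
  simp only [encFin, Data.size, Params.total]; omega

theorem encBF_size_total (x : BF P.ℓ) : (encBF x).size ≤ P.total :=
  (encBF_size x).trans (by unfold Params.total; omega)

theorem encPoints_size {a : ℕ} (ha : a ≤ P.total) (x : Fin a → Point P) :
    (encVec encPoint x).size ≤ vecBound P.total (vecBound P.total P.total) :=
  size_encVec_le ha fun i => encPoint_size (x i)

theorem encLabels_size {a : ℕ} (ha : a ≤ P.total) (x : Labels P a) :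
    (encVec (encVec encBF) x).size ≤ vecBound P.total (vecBound P.total P.total) :=
  size_encVec_le ha fun _ => size_encVec_le (by unfold Params.total; omega) fun _ =>
    encBF_size_total _

theorem encShares_size {a : ℕ} {α : Type} {e : α → Data} (he : ∀ x, (e x).size ≤ P.total)
    (ha : a ≤ P.total) (x : Fin a × Fin P.d → α) :
    (encShares e x).size ≤ vecBound P.total (vecBound P.total P.total) :=
  size_encVec_le ha fun _ => size_encVec_le (by unfold Params.total; omega) fun _ => he _

theorem encZMod_size (x : ZMod (2 ^ P.ℓ)) : (encZMod x).size ≤ P.total :=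
  (size_num_of_lt (ZMod.val_lt x)).trans (by unfold Params.total; omega)

theorem encDummies_size {a : ℕ} (ha : a ≤ P.total) (x : Dummies P a) :
    (encVec encBF x).size ≤ vecBound (P.total * P.total * (2 * P.total + 1)) P.total := by
  refine size_encVec_le ?_ fun i => encBF_size_total (x i)
  have h1 : P.d ≤ P.total := by unfold Params.total; omega
  have h2 : P.δ ≤ P.total := by unfold Params.total; omega
  unfold padSize; gcongr

theorem encPointSet_size (Z : Finset (Point P)) (hZ : Z.card ≤ P.total) :
    (encPointSet Z).size ≤ vecBound P.total (vecBound P.total P.total) := by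
  have h : encPointSet Z = encVec (fun x : Lex (Point P) => encPoint (ofLex x))
      ((Z.map toLex.toEmbedding).sort (· ≤ ·)).get := by
    rw [encVec, List.ofFn_get]; rfl
  rw [h]
  refine size_encVec_le ?_ fun i => encPoint_size _
  rw [Finset.length_sort, Finset.card_map]
  exact hZ

theorem card_fuzzyPSI_le : (fuzzyPSI p q₀ w).card ≤ P.total := by
  refine Finset.card_image_le.trans ((Finset.card_filter_le _ _).trans ?_)
  rw [Finset.card_fin]; unfold Params.total; omega

/-- A bound for the parts of views. -/
def partBound (L : ℕ) : ℕ :=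
  vecBound L (vecBound L L) + vecBound (L * L * (2 * L + 1)) L + L + 10

theorem PolyBounded.partBound {f : ℕ → ℕ} (hf : PolyBounded f) :
    PolyBounded fun s => partBound (f s) :=
  (((hf.vecBound (hf.vecBound hf)).add
    (((hf.mul hf).mul (((PolyBounded.const 2).mul hf).add (.const 1))).vecBound hf)).add hf).add
      (.const 10)

theorem le_vecBound {B : ℕ} (hL : 0 < L) : B ≤ vecBound L B := by
  unfold vecBound; nlinarith

theorem encFMapView_size {a b : ℕ} (ha : a ≤ P.total) (hb : b ≤ P.total) (v : FMapView P a b) :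
    (encFMapView v).size ≤ 6 * partBound P.total := by
  have h1 := encLabels_size ha v.labels
  have h2 := encDummies_size ha v.dummies
  have h3 : (encBF v.keyShare).size ≤ P.total :=
    (encBF_size _).trans (by unfold Params.total; omega)
  have h4 := encShares_size encBF_size_total hb v.sharesOther
  have h5 := encShares_size encBF_size_total ha v.sharesOwn
  have h6 : (encVec encBF v.ids).size ≤ vecBound P.total P.total :=
    size_encVec_le ha fun _ => encBF_size_total _
  have h7 := le_vecBound (L := P.total) (B := vecBound P.total P.total) (Nat.succ_pos _)
  unfold encFMapView partBound; simp only [Data.size]; omega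

theorem SenderView.toView_size (v : SenderView P) : v.toView.1.size ≤ 10 * partBound P.total := by
  have hm : P.m ≤ P.total := by unfold Params.total; omega
  have hn : P.n ≤ P.total := by unfold Params.total; omega
  have h1 := encPoints_size hm v.input
  have h2 : (encVec encFin v.order).size ≤ vecBound P.total (vecBound P.total P.total) := by
    refine size_encVec_le hm fun i => le_trans ?_ (le_vecBound (Nat.succ_pos _))
    exact (Nat.add_le_add_right (Nat.size_le.2 ((v.order i).2.trans P.m.lt_two_pow_self)) 1).trans
      (by unfold Params.total; omega)
  have h3 := encFMapView_size hm hn v.fmap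
  have h4 := encShares_size encBF_size_total hm v.shares
  have h5 := encShares_size encZMod_size hm v.arithShares
  have h6 : vecBound P.total (vecBound P.total P.total) + 10 ≤ partBound P.total := by
    unfold partBound; omega
  simp only [SenderView.toView, Data.size]; omega

theorem ReceiverView.toView_size (v : ReceiverView P) :
    v.toView.1.size ≤ 14 * partBound P.total := by
  have hm : P.m ≤ P.total := by unfold Params.total; omega
  have hn : P.n ≤ P.total := by unfold Params.total; omega
  have h1 := encPoints_size hn v.input
  have h3 := encFMapView_size hn hm v.fmap
  have h4 := encShares_size encBF_size_total hm v.shares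
  have h5 := encShares_size encZMod_size hm v.arithShares
  have h2 : (encVec encBool v.bits).size ≤ vecBound P.total 2 :=
    size_encVec_le hm fun i => by cases v.bits i <;> simp [encBool, Data.size]
  have h7 : (encVec (encOption encPoint) v.received).size ≤
      vecBound P.total (vecBound P.total P.total + 3) := by
    refine size_encVec_le hm fun i => ?_
    rcases v.received i with _ | x
    · simp [encOption, Data.size]
    · have := encPoint_size x
      simp only [encOption, Data.size]; norm_num; omega
  have h6 : vecBound P.total (vecBound P.total P.total) + P.total + 10 ≤ partBound P.total := by
    unfold partBound; omega
  have h8 : vecBound P.total 2 ≤ 3 * P.total + 1 := by unfold vecBound; omega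
  have h9 : vecBound P.total (vecBound P.total P.total + 3) =
    vecBound P.total (vecBound P.total P.total) + 3 * P.total := by
    unfold vecBound; ring
  simp only [ReceiverView.toView, Data.size]; omega

theorem encOut_size : (Data.pair (encOut (fuzzyPSI p q₀ w)).1 (encOut (fuzzyPSI p q₀ w)).2).size ≤
    partBound P.total := by
  have := encPointSet_size _ (card_fuzzyPSI_le (p := p) (q₀ := q₀) (w := w))
  unfold partBound
  simp only [encOut, Data.size]; norm_num; omega

theorem mapCtx_size {a : ℕ} (ha : a ≤ P.total) {tb ids : Data} {x : Fin a → Point P}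
    {lab : Labels P a} {dum : Dummies P a} (htb : tb.size ≤ partBound P.total)
    (hids : ids.size ≤ partBound P.total) :
    (mapCtx tb x lab dum ids).size ≤ 16 * partBound P.total := by
  have h1 := encPoints_size ha x
  have h2 := encLabels_size ha lab
  have h3 := encDummies_size ha dum
  have h4 : P.total + 10 + vecBound P.total (vecBound P.total P.total) +
    vecBound (P.total * P.total * (2 * P.total + 1)) P.total ≤ partBound P.total := by
    unfold partBound; omega
  have h5 : P.m + P.n + P.d + P.δ + Nat.size P.u + P.ℓ + P.κ + 1 = P.total := rfl
  simp only [mapCtx, pubWith, encList, _root_.id, Data.size, unary_size]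
  simp only [Nat.size_zero]
  omega

/-- A length of random tapes that is sufficient for the simulators. -/
theorem tapeBound_le {T : ℕ} (h : 3 * P.total + 8 ≤ T) : 16 * tapeBound P ≤ 2 ^ T := by
  have hle : ∀ a, a ≤ P.total → a ≤ 2 ^ P.total := fun a ha => ha.trans P.total.lt_two_pow_self.le
  have hm := hle P.m (by unfold Params.total; omega)
  have hn := hle P.n (by unfold Params.total; omega)
  have hd := hle P.d (by unfold Params.total; omega)
  have hδ := hle P.δ (by unfold Params.total; omega)
  have hu : P.u ≤ 2 ^ P.total := (Nat.lt_size_self P.u).le.trans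
    (Nat.pow_le_pow_right two_pos (by unfold Params.total; omega))
  have hℓ : 2 ^ P.ℓ ≤ 2 ^ P.total := Nat.pow_le_pow_right two_pos (by unfold Params.total; omega)
  have h1 : 1 ≤ 2 ^ P.total := Nat.one_le_two_pow
  -- With `X = 2 ^ P.total`, the bound is at most `12 * X ^ 3`, and `16 * 12 ≤ 2 ^ 8`.
  refine le_trans ?_ (Nat.pow_le_pow_right two_pos h)
  rw [pow_add, mul_comm 3, pow_mul]
  generalize 2 ^ P.total = X at *
  have h2 : 2 ^ P.ℓ * ((P.u + 2 * P.δ) * P.d) ≤ X * ((X + 2 * X) * X) := by gcongr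
  have h3 : (P.m + P.n) * (P.d * (2 * P.δ + 1)) ≤ (X + X) * (X * (2 * X + X)) := by gcongr
  have h4 : X ≤ X ^ 3 := by nlinarith [Nat.mul_le_mul h1 h1]
  have h5 : X * ((X + 2 * X) * X) = 3 * X ^ 3 := by ring
  have h6 : (X + X) * (X * (2 * X + X)) = 6 * X ^ 3 := by ring
  unfold tapeBound; omega

end FPSI

/-! ### The PRF hybrid for both views. -/

namespace FPSI

open scoped BigOperators
open Finset (expect)
open Prog

set_option synthInstance.maxSize 2000

variable {p : ℝ} {P : ℕ → Params}

/-! ### Replacing the PRF by a random function -/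

namespace Prog

/-- Set the identifiers in the part of a view that belongs to fuzzy mapping. -/
abbrev setIds (X I : Prog) : Prog :=
  .pair (.comp .fst X) <| .pair (.comp .fst (.comp .snd X)) <|
    .pair (.comp .fst (.comp .snd (.comp .snd X))) <|
    .pair (.comp .fst (.comp .snd (.comp .snd (.comp .snd X)))) <|
    .pair (.comp .fst (.comp .snd (.comp .snd (.comp .snd (.comp .snd X))))) I

/-- Set the identifiers in a view of the sender with outputs, and keep the context. -/
def plugS : Prog :=
  .pair (.comp .fst .fst) <| .pair
    (.pair (.comp .fst (.comp .fst (.comp .snd .fst))) <|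
      .pair (.comp .fst (.comp .snd (.comp .fst (.comp .snd .fst)))) <|
      .pair (setIds (.comp .fst (.comp .snd (.comp .snd (.comp .fst (.comp .snd .fst))))) .snd)
        (.comp .snd (.comp .snd (.comp .snd (.comp .fst (.comp .snd .fst))))))
    (.comp .snd (.comp .snd .fst))

/-- Set the identifiers in a context. -/
abbrev setCtxIds (C I : Prog) : Prog :=
  .pair (.comp .fst C) <| .pair (.comp .fst (.comp .snd C)) <|
    .pair (.comp .fst (.comp .snd (.comp .snd C))) <|
    .pair (.comp .fst (.comp .snd (.comp .snd (.comp .snd C)))) <|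
    .pair (.comp .fst (.comp .snd (.comp .snd (.comp .snd (.comp .snd C))))) I

/-- Set the identifiers in a context and in a view of the receiver with outputs. -/
def plugR : Prog :=
  .pair (setCtxIds (.comp .fst .fst) .snd) <| .pair
    (.pair (.comp .fst (.comp .fst (.comp .snd .fst))) <|
      .pair (setIds (.comp .fst (.comp .snd (.comp .fst (.comp .snd .fst)))) .snd)
        (.comp .snd (.comp .snd (.comp .fst (.comp .snd .fst)))))
    (.comp .snd (.comp .snd .fst))

set_option synthInstance.maxSize 4000 in
instance : PT plugS := by unfold plugS; infer_instance
set_option synthInstance.maxSize 4000 in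
instance : PT plugR := by unfold plugR; infer_instance

end Prog

/-- A view of the sender with outputs and placeholders for the identifiers, and the context of the
function in its so-OPPRF. -/
noncomputable def tmplS {P : Params} (p : ℝ) (q₀ : Fin P.m → Point P) (w : Fin P.n → Point P)
    (r : RestS P) : Data :=
  .pair (mapCtx (.num 0) (fun j => q₀ (r.1 j)) r.2.1 r.2.2.1 (.num 0))
    ((r.view q₀ (fun _ => 0) 0).toView.withOutput (encOut (fuzzyPSI p q₀ w))).1

theorem tmplS_size {P : Params} {q₀ : Fin P.m → Point P} {w : Fin P.n → Point P} (r : RestS P) :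
    (tmplS p q₀ w r).size ≤ 28 * partBound P.total := by
  have h1 := (r.view q₀ (fun _ => 0) 0).toView_size
  have h2 := encOut_size (p := p) (q₀ := q₀) (w := w)
  have h3 := mapCtx_size (a := P.m) (tb := .num 0) (ids := .num 0)
    (x := fun j => q₀ (r.1 j)) (lab := r.2.1) (dum := r.2.2.1)
    (by unfold Params.total; omega) (by unfold partBound; simp [Data.size])
    (by unfold partBound; simp [Data.size])
  have h4 : 10 ≤ partBound P.total := by unfold partBound; omega
  simp only [tmplS, View.withOutput, Data.size] at h2 ⊢
  omega

theorem prf_sender (hP : Admissible p P) {F : ∀ s, BF (P s).κ → BF (P s).ℓ → BF (P s).ℓ}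
    (hF : Pseudorandom F) (D : Adversary) :
    ∃ μ, Negligible μ ∧ ∀ s (q₀ : Fin (P s).m → Point (P s)) (w : Fin (P s).n → Point (P s)),
      |(𝔼 r : RestS (P s), 𝔼 k, 𝔼 g, accept D s ((r.view q₀ (fun j => F s k (r.arg q₀ w j))
          g).toView.withOutput (encOut (fuzzyPSI p q₀ w)))) -
        𝔼 r : RestS (P s), 𝔼 G : BF (P s).ℓ → BF (P s).ℓ, 𝔼 g, accept D s
          ((r.view q₀ (fun j => G (r.arg q₀ w j)) g).toView.withOutput
            (encOut (fuzzyPSI p q₀ w)))| ≤ μ s := by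
  obtain ⟨μ, hμ, h⟩ := prf_views hF hP.poly_ℓ hP.poly_m (plug := plugS) (A := ansMap)
    ⟨_, MonoPoly.self.add (.const 3), fun t O s ctx y _ hs =>
      ansMap_size.trans (Nat.add_le_add_right hs 3)⟩
    (Key := fun s => MapKey (P s) (P s).m) (addr := fun s => addrMap) (fun s => addrMap_injective)
    (fun s k => addrBoth_mod (.inl k))
    ⟨fun s => 3 * (P s).total + 8, ((PolyBounded.const 3).mul hP.poly_total).add (.const 8),
      fun s k => addrBoth_lt (by omega) (tapeBound_le le_rfl) (.inl k)⟩
    -- The remaining random choices `r` are part of the index. The bound then holds for each `r`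
    -- separately and survives averaging, and the reduction need not sample `r`.
    (ι := fun s => (Fin (P s).m → Point (P s)) × (Fin (P s).n → Point (P s)) × RestS (P s))
    (xs := fun s i => i.2.2.arg i.1 i.2.1) (tmpl := fun s i => tmplS p i.1 i.2.1 i.2.2)
    ⟨fun s => 28 * partBound (P s).total, (PolyBounded.const 28).mul hP.poly_total.partBound,
      fun s i => tmplS_size i.2.2⟩
    (vd := fun s i ids => ((i.2.2.view i.1 ids 0).toView.withOutput
        (encOut (fuzzyPSI p i.1 i.2.1))).1)
    (orc := fun s i _ g => oracleOf encMapKey (mapFn (fun j => i.1 (i.2.2.1 j)) i.2.2.2.1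
      i.2.2.2.2.1 g))
    (fun s i ids t O => ⟨_, rfl, fun t O y => ev_ansMap y⟩) D
  exact ⟨μ, hμ, fun s q₀ w => abs_expect_sub_le_const fun r => h s (q₀, w, r)⟩

/-- A view of the receiver with outputs and placeholders for the identifiers, and the context of the
functions in its so-OPPRFs. -/
noncomputable def tmplR {P : Params} (p : ℝ) (q₀ : Fin P.m → Point P) (w : Fin P.n → Point P)
    (r : RestR P) : Data :=
  .pair (mapCtx (encVec (fun v : ℕ => .num v) fun t : Fin (P.δ + 1) => powVal P p t % 2 ^ P.ℓ)
      w r.2.2.2.1 r.2.2.2.2.1 (.num 0))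
    ((r.view p q₀ w (fun _ => 0) 0 0).toView.withOutput (encOut (fuzzyPSI p q₀ w))).1

theorem tmplR_size {P : Params} {q₀ : Fin P.m → Point P} {w : Fin P.n → Point P} (r : RestR P) :
    (tmplR p q₀ w r).size ≤ 32 * partBound P.total := by
  have h1 := (r.view p q₀ w (fun _ => 0) 0 0).toView_size
  have h2 := encOut_size (p := p) (q₀ := q₀) (w := w)
  have h5 : (encVec (fun v : ℕ => Data.num v) fun t : Fin (P.δ + 1) =>
      powVal P p t % 2 ^ P.ℓ).size ≤ partBound P.total := by
    refine (size_encVec_le (L := P.total) (B := P.total) (by unfold Params.total; omega)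
      fun t => (size_num_of_lt (Nat.mod_lt _ (by positivity))).trans
        (by unfold Params.total; omega)).trans ?_
    have h7 := le_vecBound (L := P.total) (B := vecBound P.total P.total) (Nat.succ_pos _)
    unfold partBound; omega
  have h3 := mapCtx_size (a := P.n) (ids := .num 0)
    (x := w) (lab := r.2.2.2.1) (dum := r.2.2.2.2.1)
    (by unfold Params.total; omega) h5 (by unfold partBound; simp [Data.size])
  have h4 : 10 ≤ partBound P.total := by unfold partBound; omega
  simp only [tmplR, View.withOutput, Data.size] at h2 ⊢
  omega

/-- `prf_views` allows a single random function, so the two functions behind the receiver's oracles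
are merged into one on the disjoint union of their keys. -/
theorem expect_receiver_sum {P : Params} {q₀ : Fin P.m → Point P} {w : Fin P.n → Point P}
    (r : RestR P) (ids : Fin P.n → BF P.ℓ) (D : Adversary) (s : ℕ) (out : Data × Data) :
    𝔼 g, 𝔼 gf, accept D s ((r.view p q₀ w ids g gf).toView.withOutput out) =
      𝔼 g : MapKey P P.n ⊕ FilterKey P → BF P.ℓ,
        accept D s (((r.view p q₀ w ids 0 0).toView.withOutput out).1, oracleOf encBothKeys
          (Sum.elim (mapFn w r.2.2.2.1 r.2.2.2.2.1 fun x => g (.inl x))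
            (filterFn p w ids fun x => g (.inr x)))) := by
  rw [← expect_sumElim fun g : MapKey P P.n ⊕ FilterKey P → BF P.ℓ =>
    accept D s (((r.view p q₀ w ids 0 0).toView.withOutput out).1, oracleOf encBothKeys
      (Sum.elim (mapFn w r.2.2.2.1 r.2.2.2.2.1 fun x => g (.inl x))
        (filterFn p w ids fun x => g (.inr x))))]
  rfl

theorem prf_receiver (hP : Admissible p P) {F : ∀ s, BF (P s).κ → BF (P s).ℓ → BF (P s).ℓ}
    (hF : Pseudorandom F) (D : Adversary) :
    ∃ μ, Negligible μ ∧ ∀ s (q₀ : Fin (P s).m → Point (P s)) (w : Fin (P s).n → Point (P s)),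
      |(𝔼 r : RestR (P s), 𝔼 k, 𝔼 g, 𝔼 gf, accept D s ((r.view p q₀ w
          (fun j => F s k (r.arg q₀ w j)) g gf).toView.withOutput (encOut (fuzzyPSI p q₀ w)))) -
        𝔼 r : RestR (P s), 𝔼 G : BF (P s).ℓ → BF (P s).ℓ, 𝔼 g, 𝔼 gf, accept D s
          ((r.view p q₀ w (fun j => G (r.arg q₀ w j)) g gf).toView.withOutput
            (encOut (fuzzyPSI p q₀ w)))| ≤ μ s := by
  obtain ⟨μ, hμ, h⟩ := prf_views hF hP.poly_ℓ hP.poly_n (plug := plugR) (A := ansBoth)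
    ⟨_, MonoPoly.self.add (.const 3), fun t O s ctx y _ hs =>
      ansBoth_size.trans (Nat.add_le_add_right hs 3)⟩
    (Key := fun s => MapKey (P s) (P s).n ⊕ FilterKey (P s)) (addr := fun s => addrBoth)
    (fun s => addrBoth_injective) (fun s k => addrBoth_mod k)
    ⟨fun s => 3 * (P s).total + 8, ((PolyBounded.const 3).mul hP.poly_total).add (.const 8),
      fun s k => addrBoth_lt (by omega) (tapeBound_le le_rfl) k⟩
    (ι := fun s => (Fin (P s).m → Point (P s)) × (Fin (P s).n → Point (P s)) × RestR (P s))
    (xs := fun s i => i.2.2.arg i.1 i.2.1) (tmpl := fun s i => tmplR p i.1 i.2.1 i.2.2)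
    ⟨fun s => 32 * partBound (P s).total, (PolyBounded.const 32).mul hP.poly_total.partBound,
      fun s i => tmplR_size i.2.2⟩
    (vd := fun s i ids => ((i.2.2.view p i.1 i.2.1 ids 0 0).toView.withOutput
        (encOut (fuzzyPSI p i.1 i.2.1))).1)
    (orc := fun s i ids g => oracleOf encBothKeys (Sum.elim
      (mapFn i.2.1 i.2.2.2.2.2.1 i.2.2.2.2.2.2.1 fun x => g (.inl x))
      (filterFn p i.2.1 ids fun x => g (.inr x))))
    (fun s i ids t O => ⟨_, rfl, fun t O y => ev_ansBoth rfl (fun i => Nat.mod_mod _ _) y⟩) D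
  refine ⟨μ, hμ, fun s q₀ w => abs_expect_sub_le_const fun r => ?_⟩
  simp only [expect_receiver_sum]
  exact h s (q₀, w, r)

end FPSI

/-! ### Collecting the errors. -/

namespace FPSI

open scoped BigOperators
open Finset (expect)
open Prog

set_option synthInstance.maxSize 2000

variable {p : ℝ} {P : ℕ → Params}

/-! ### Error bounds -/

theorem mul_inv_two_pow_le {a ℓ s : ℕ} (h : a * 2 ^ s ≤ 2 ^ ℓ) :
    (a : ℝ) * ((2 : ℝ) ^ ℓ)⁻¹ ≤ ((2 : ℝ) ^ s)⁻¹ := by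
  rw [← div_eq_mul_inv, div_le_iff₀ (by positivity), ← div_eq_inv_mul, le_div_iff₀ (by positivity)]
  exact_mod_cast h

/-- The factor 4 counts the terms bounded by the size of the field: colliding arguments, collisions
of a random function, and the two parts of `m * (c_δ + 1)`. -/
theorem Admissible.failBound_le (hP : Admissible p P) (s : ℕ) (c : ℝ) :
    failBound p (P s) (c + ((2 : ℝ) ^ (P s).ℓ)⁻¹) ≤
      4 * ((2 : ℝ) ^ s)⁻¹ + ((P s).n ^ 2 : ℕ) * c := by
  have h1 := mul_inv_two_pow_le (hP.field_n s)
  have h2 := mul_inv_two_pow_le (hP.field_δ s)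
  have h3 : ((P s).m : ℝ) * ((2 : ℝ) ^ (P s).ℓ)⁻¹ ≤ ((2 : ℝ) ^ s)⁻¹ :=
    mul_inv_two_pow_le ((Nat.mul_le_mul_right _ (Nat.le_self_pow two_ne_zero _)).trans
      (hP.field_m s))
  push_cast at h1 h2 ⊢
  unfold failBound
  nlinarith

/-- The probability that a run of the protocol is not good is negligible. -/
theorem exists_failure_bound (hp : 1 ≤ p) (hP : Admissible p P)
    {F : ∀ s, BF (P s).κ → BF (P s).ℓ → BF (P s).ℓ} (hF : Pseudorandom F) :
    ∃ μ, Negligible μ ∧ ∀ s (q₀ : Fin (P s).m → Point (P s)) (w : Fin (P s).n → Point (P s)),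
      DisjointProjection q₀ → DisjointProjection w →
      𝔼 σ, 𝔼 labS, 𝔼 dumS, 𝔼 labR, 𝔼 dumR, 𝔼 kS, 𝔼 kR, 𝔼 g₁, 𝔼 _y₁ : Shares (P s) (P s).n, 𝔼 g₂,
        𝔼 _y₂ : Shares (P s) (P s).m, 𝔼 g₃, 𝔼 _y₃ : Shares (P s) (P s).m, 𝔼 _a : ArithShares (P s),
          ind (¬ GoodRun p (F s) q₀ w σ labS dumS labR dumR kS kR g₁ g₂ g₃) ≤ μ s := by
  obtain ⟨μ, hμ, hcol⟩ := prf_collision hF hP.poly_ℓ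
  refine ⟨fun s => ((4 : ℕ) : ℝ) * ((2 : ℝ) ^ s)⁻¹ + ((P s).n ^ 2 : ℕ) * |μ s|,
    (Negligible.two_pow.const_mul 4).add (Negligible.poly_mul (hμ.mono fun s => (abs_abs _).le)
      ((hP.poly_n.mul hP.poly_n).mono fun s => (sq _).le)), fun s q₀ w hq hw => ?_⟩
  refine (expect_not_good_le hp hq hw (hP.no_overflow s) (hP.exact_repr s)
    (γ := |μ s| + ((2 : ℝ) ^ (P s).ℓ)⁻¹) (by positivity) fun x y hxy => ?_).trans
      (hP.failBound_le s _)
  refine le_trans (le_of_eq (expect_congr' fun k => ?_))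
    ((hcol s x y hxy).trans (add_le_add_left (le_abs_self _) _))
  by_cases h : F s k x = F s k y
  · rw [ind_true h, if_pos h]
  · rw [ind_false h, if_neg h]

theorem abs_sub_le_add {a b c x y : ℝ} (h1 : |a - b| ≤ x) (h2 : |b - c| ≤ y) : |a - c| ≤ x + y :=
  (abs_sub_le a b c).trans (add_le_add h1 h2)

/-- Three errors add up: bad runs, the PRF hybrid, and colliding arguments when random function
values become independent identifiers. In the final average the receiver's set enters only through
the output. -/
theorem real_sender (hp : 1 ≤ p) (hP : Admissible p P)
    {F : ∀ s, BF (P s).κ → BF (P s).ℓ → BF (P s).ℓ} (hF : Pseudorandom F) (D : Adversary) :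
    ∃ μ, Negligible μ ∧ ∀ s (q₀ : Fin (P s).m → Point (P s)) (w : Fin (P s).n → Point (P s)),
      DisjointProjection q₀ → DisjointProjection w →
      |acceptProb D s ((fun e => e.viewS.withOutput e.out) <$> fpsiExecution p (F s) q₀ w) -
        𝔼 r : RestS (P s), 𝔼 ids, 𝔼 g, accept D s ((r.view q₀ ids g).toView.withOutput
          (encOut (fuzzyPSI p q₀ w)))| ≤ μ s := by
  obtain ⟨μ₁, hμ₁, h₁⟩ := exists_failure_bound hp hP hF
  obtain ⟨μ₂, hμ₂, h₂⟩ := prf_sender hP hF D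
  refine ⟨fun s => μ₁ s + μ₂ s + ((2 : ℝ) ^ s)⁻¹, (hμ₁.add hμ₂).add Negligible.two_pow,
    fun s q₀ w hq hw => abs_sub_le_add (abs_sub_le_add ?_ (h₂ s q₀ w)) ?_⟩
  · rw [← expect_sender_eq fun v => accept D s (v.toView.withOutput (encOut (fuzzyPSI p q₀ w)))]
    exact (abs_acceptProb_fpsiExecution_sub_le D s _).trans (h₁ s q₀ w hq hw)
  · refine abs_expect_ids_sub_le (fun r : RestS (P s) => r.arg q₀ w) (fun r ids => 𝔼 g, accept D s
      ((r.view q₀ ids g).toView.withOutput (encOut (fuzzyPSI p q₀ w))))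
      (fun r u v => abs_expect_sub_le_const fun g => abs_accept_sub_le_one _ _ _ _)
      ((RestS.arg_not_injective_le hq).trans ?_)
    exact_mod_cast mul_inv_two_pow_le (hP.field_m s)

/-- The same three hybrids as for the sender; at the end the sender's set enters only through the
output and the matched points. -/
theorem real_receiver (hp : 1 ≤ p) (hP : Admissible p P)
    {F : ∀ s, BF (P s).κ → BF (P s).ℓ → BF (P s).ℓ} (hF : Pseudorandom F) (D : Adversary) :
    ∃ μ, Negligible μ ∧ ∀ s (q₀ : Fin (P s).m → Point (P s)) (w : Fin (P s).n → Point (P s)),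
      DisjointProjection q₀ → DisjointProjection w →
      |acceptProb D s ((fun e => e.viewR.withOutput e.out) <$> fpsiExecution p (F s) q₀ w) -
        𝔼 r : RestR (P s), 𝔼 ids, 𝔼 g, 𝔼 gf, accept D s ((r.view p q₀ w ids g gf).toView.withOutput
          (encOut (fuzzyPSI p q₀ w)))| ≤ μ s := by
  obtain ⟨μ₁, hμ₁, h₁⟩ := exists_failure_bound hp hP hF
  obtain ⟨μ₂, hμ₂, h₂⟩ := prf_receiver hP hF D
  refine ⟨fun s => μ₁ s + μ₂ s + ((2 : ℝ) ^ s)⁻¹, (hμ₁.add hμ₂).add Negligible.two_pow,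
    fun s q₀ w hq hw => abs_sub_le_add (abs_sub_le_add ?_ (h₂ s q₀ w)) ?_⟩
  · rw [← expect_receiver_eq fun v => accept D s (v.toView.withOutput (encOut (fuzzyPSI p q₀ w)))]
    exact (abs_acceptProb_fpsiExecution_sub_le D s _).trans (h₁ s q₀ w hq hw)
  · refine abs_expect_ids_sub_le (fun r : RestR (P s) => r.arg q₀ w) (fun r ids => 𝔼 g, 𝔼 gf,
      accept D s ((r.view p q₀ w ids g gf).toView.withOutput (encOut (fuzzyPSI p q₀ w))))
      (fun r u v => abs_expect_sub_le_const fun g => abs_expect_sub_le_const fun gf =>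
        abs_accept_sub_le_one _ _ _ _) ((RestR.arg_not_injective_le hw).trans ?_)
    exact_mod_cast mul_inv_two_pow_le (hP.field_n s)

/-! ### The simulators -/

theorem acceptProb_sample (S : Simulator) (D : Adversary) (s : ℕ) (x : Data) (f : View → View) :
    acceptProb D s (f <$> S.sample s x) =
      𝔼 ω : Fin (2 ^ S.tapeLen.eval s) → Fin (2 ^ S.tapeLen.eval s),
        accept D s (f (S.view.ev (tapeOf ω) (fun _ => .num 0) x,
          fun y => S.answer.ev (tapeOf ω) (fun _ => .num 0) (.pair x y))) := by
  rw [Simulator.sample, map_eq_bind_pure_comp, bind_assoc, acceptProb_bind]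
  refine expect_congr' fun ω => ?_
  rw [pure_bind]
  exact acceptProb_pure D s _

/-- The simulator for the corrupted sender. -/
def simS (T : Polynomial ℕ) : Simulator := ⟨viewS, PT.out, answerS, PT.out, T⟩

/-- The simulator for the corrupted receiver. -/
def simR (T : Polynomial ℕ) : Simulator := ⟨viewR, PT.out, answerR, PT.out, T⟩

variable {P : Params} {q₀ : Fin P.m → Point P} {w : Fin P.n → Point P}

theorem encParams_eq (p : ℝ) : encParams P p =
    pubWith P (encVec (fun v : ℕ => .num v) fun t : Fin (P.δ + 1) => powVal P p t) := by
  have h : encVec (fun t : Fin (P.δ + 1) => Data.num (powVal P p t)) _root_.id =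
      encVec (fun v : ℕ => .num v) fun t : Fin (P.δ + 1) => powVal P p t := by
    rw [encVec, encVec, ← encList_map (fun v : ℕ => Data.num v) fun t : Fin (P.δ + 1) =>
      powVal P p t, List.map_ofFn]
    rfl
  rw [encParams, h]; rfl

theorem ideal_sender {T : Polynomial ℕ} {s : ℕ} (hT : 3 * P.total + 8 ≤ T.eval s)
    (D : Adversary) (out : Data) (o : Data × Data) :
    |acceptProb D s ((fun v => View.withOutput v o) <$> (simS T).sample s
        (.pair (unary s) (.pair (encParams P p) (.pair (encVec encPoint q₀) out)))) -
      𝔼 r : RestS P, 𝔼 ids, 𝔼 g, accept D s ((r.view q₀ ids g).toView.withOutput o)| ≤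
        P.m ^ 2 * ((2 : ℝ) ^ T.eval s)⁻¹ := by
  refine le_of_eq_of_le (congrArg abs (congrArg₂ HSub.hSub ?_ rfl))
    (abs_expect_sender_tape_sub_le (tapeBound_le hT) (by unfold Params.total at hT; omega)
      (by unfold Params.total at hT; omega) (fun v => accept D s (v.toView.withOutput o))
      fun _ _ => abs_accept_sub_le_one _ _ _ _)
  rw [acceptProb_sample, encParams_eq]
  refine expect_congr' fun ω => congrArg (accept D s) (congrArg (View.withOutput · o) ?_)
  exact Prod.ext (ev_viewS _) (funext fun y => ev_answerS y)

theorem ideal_receiver {T : Polynomial ℕ} {s : ℕ} (hT : 3 * P.total + 8 ≤ T.eval s)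
    (hq : DisjointProjection q₀) (D : Adversary) (o : Data × Data) :
    |acceptProb D s ((fun v => View.withOutput v o) <$> (simR T).sample s
        (.pair (unary s) (.pair (encParams P p) (.pair (encVec encPoint w)
          (encOut (fuzzyPSI p q₀ w)).2)))) -
      𝔼 r : RestR P, 𝔼 ids, 𝔼 g, 𝔼 gf,
        accept D s ((r.view p q₀ w ids g gf).toView.withOutput o)| ≤
        P.m ^ 2 * ((2 : ℝ) ^ T.eval s)⁻¹ := by
  -- The output reaches the simulator as a sorted list. Only absence of repetitions and the set of
  -- its members matter, because the positions are randomized.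
  have hl : ∃ l : List (Point P), l.Nodup ∧ (∀ x, x ∈ l ↔ x ∈ fuzzyPSI p q₀ w) ∧
      encPointSet (fuzzyPSI p q₀ w) = encList encPoint l :=
    ⟨(((fuzzyPSI p q₀ w).map toLex.toEmbedding).sort (· ≤ ·)).map ofLex,
      (Finset.sort_nodup _ _).map ofLex.injective, fun x => by
        simp only [List.mem_map, Finset.mem_sort, Finset.mem_map_equiv]
        exact ⟨fun ⟨y, hy, h⟩ => h ▸ hy, fun h => ⟨toLex x, h, rfl⟩⟩, (encList_map _ _ _).symm⟩
  obtain ⟨l, hl, hmem, hout⟩ := hl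
  refine le_of_eq_of_le (congrArg abs (congrArg₂ HSub.hSub ?_ rfl))
    (abs_expect_receiver_tape_sub_le (tapeBound_le hT) (by unfold Params.total at hT; omega)
      (by unfold Params.total at hT; omega) hq.injective hl hmem
      (fun v => accept D s (v.toView.withOutput o)) fun _ _ => abs_accept_sub_le_one _ _ _ _)
  rw [acceptProb_sample, encParams_eq, encOut, hout]
  refine expect_congr' fun ω => congrArg (accept D s) (congrArg (View.withOutput · o) ?_)
  exact Prod.ext (ev_viewR _ _ l) (funext fun y => ev_answerR rfl (fun _ => rfl) y)

theorem fpsi_secure {P : ℕ → Params} (hp : 1 ≤ p) (hP : Admissible p P)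
    {F : ∀ s, BF (P s).κ → BF (P s).ℓ → BF (P s).ℓ} (hF : Pseudorandom F) :
    SecurelyComputes (X := fun s => Fin (P s).m → Point (P s))
      (Y := fun s => Fin (P s).n → Point (P s)) (fun _ => encVec encPoint)
      (fun _ => encVec encPoint) (fun s => encParams (P s) p)
      (fun _ q w => DisjointProjection q ∧ DisjointProjection w)
      (fun _ q w => encOut (fuzzyPSI p q w)) (fun s q w => fpsiExecution p (F s) q w) := by
  obtain ⟨L, hL⟩ := hP.poly_total
  have hT : ∀ s, 3 * (P s).total + 8 ≤ (3 * L + 8 : Polynomial ℕ).eval s := fun s => by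
    have : (P s).total ≤ L.eval s := hL s
    simp only [Polynomial.eval_add, Polynomial.eval_mul, Polynomial.eval_ofNat]; omega
  -- Tape words have at least `ℓ` bits, so `field_m` also controls the probability of ties in the
  -- sampled order.
  have hm : ∀ s, ((P s).m ^ 2 : ℝ) * ((2 : ℝ) ^ (3 * L + 8 : Polynomial ℕ).eval s)⁻¹ ≤
      ((2 : ℝ) ^ s)⁻¹ := fun s => by
    have h : (P s).ℓ ≤ (3 * L + 8 : Polynomial ℕ).eval s := by
      have := hT s; unfold Params.total at this; omega
    exact_mod_cast mul_inv_two_pow_le ((hP.field_m s).trans (Nat.pow_le_pow_right two_pos h))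
  refine ⟨simS (3 * L + 8), simR (3 * L + 8), fun D => ?_, fun D => ?_⟩
  · obtain ⟨μ, hμ, h⟩ := real_sender hp hP hF D
    refine ⟨fun s => μ s + ((2 : ℝ) ^ s)⁻¹, hμ.add Negligible.two_pow, fun s i =>
      abs_sub_le_add (h s i.1.1 i.1.2 i.2.1 i.2.2) ?_⟩
    rw [abs_sub_comm]
    exact (ideal_sender (hT s) D _ _).trans (hm s)
  · obtain ⟨μ, hμ, h⟩ := real_receiver hp hP hF D
    refine ⟨fun s => μ s + ((2 : ℝ) ^ s)⁻¹, hμ.add Negligible.two_pow, fun s i =>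
      abs_sub_le_add (h s i.1.1 i.1.2 i.2.1 i.2.2) ?_⟩
    rw [abs_sub_comm]
    exact (ideal_receiver (hT s) i.2.1 D _).trans (hm s)

end FPSI

theorem mainTheorem4 (p : ℝ) (hp : 1 ≤ p) (P : ℕ → FPSI.Params) (hP : FPSI.Admissible p P)
    (F : ∀ s, FPSI.BF (P s).κ → FPSI.BF (P s).ℓ → FPSI.BF (P s).ℓ)
    (hF : FPSI.Pseudorandom F) :
    FPSI.SecurelyComputes
      (X := fun s => Fin (P s).m → FPSI.Point (P s))
      (Y := fun s => Fin (P s).n → FPSI.Point (P s))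
      (fun _ => FPSI.encVec FPSI.encPoint) (fun _ => FPSI.encVec FPSI.encPoint)
      (fun s => FPSI.encParams (P s) p)
      (fun _ q w => FPSI.DisjointProjection q ∧ FPSI.DisjointProjection w)
      (fun _ q w => FPSI.encOut (FPSI.fuzzyPSI p q w))
      (fun s q w => FPSI.fpsiExecution p (F s) q w) :=
  FPSI.fpsi_secure hp hP hF
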